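/- Let $k$ be a field of characteristic $0$; complexes are cochain complexes of $k$-vector spaces. **Cubical Feynman categories.** Let $\mathbb F_1,\mathbb F_2$ be small, strict and skeletal cubical Feynman categories. So $\mathbb F$ is given by a set of vertices and sets of generating morphisms $(v_1,\dots,v_n)\to v_0$ forming a coloured symmetric operad. Isomorphic vertices are equal, automorphism groups of vertices are finite, and the objects of $\mathbb F$ are the finite families (tensor products) of vertices. There is an $\mathbb N$-valued degree of morphisms, additive for $\circ$ and $\otimes$, such that morphisms of degree $0$ are isomorphisms, only finitely many generating morphisms of degree $1$ have a given target, and every morphism of degree $n$ is a composite of $n$ morphisms of degree $1$ in exactly $n!$ ways up to isomorphism. Precisely: there are free $S_n$-actions on the sets $C^n(A,B)$ of sequences of $n$ composable degree $1$ morphisms from $A$ to $B$ modulo isomorphisms of the intermediate objects, compatible with concatenation, and the orbits are the fibres of composition. $\mathbb V$ denotes the groupoid of vertices. **Operads.** A $\mathbb V$-module is a functor from $\mathbb V$ to complexes. For $\epsilon=+$, an $\mathbb F^{\epsilon}$-op is a symmetric monoidal functor from $\mathbb F$ to complexes. For $\epsilon=-$ it is the skew-invariant version: a sequence in $C^n(A,B)$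 acts by a map of degree $n$, and permuting the sequence by $\sigma\in S_n$ multiplies its action by $\operatorname{sgn}\sigma$. $F_\epsilon(E)$ is the free $\mathbb F^\epsilon$-op on a $\mathbb V$-module $E$, $F_\epsilon(E)^1$ is its weight $1$ part (generated by the generating morphisms of degree $1$), and $\langle S\rangle$ is the ideal generated by $S$. An $\mathbb F^\epsilon$-op is quadratic if it is isomorphic to $F_\epsilon(E)/\langle S\rangle$ for a $\mathbb V$-module $E$ and a sub-$\mathbb V$-module (in complexes) $S\subset F_\epsilon(E)^1$. Its dual, with respect to this presentation, is $(F_\epsilon(E)/\langle S\rangle)^!=F_{-\epsilon}(E^\ast)/\langle S^\perp\rangle$, where $E^\ast$ is the linear dual and $S^\perp\subset F_{-\epsilon}(E^\ast)^1$ consists of the elements that vanish on $S$ under the canonical pairing. $E$ is of finite type if each component $E(v)_m$ is finite-dimensional and if, for every source $(v_1,\dots,v_n)$ of a generating morphism of degree $1$, $E(v_1)\otimes\cdots\otimes E(v_n)$ is finite-dimensional in each degree. **Morphisms.** Let $\phi\colon\mathbb F_1\to\mathbb F_2$ be a degree preserving morphism, given by a map of vertices with finite fibres and a map of generating morphisms,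 which is admissible: it is faithful; if $\phi(g)=f\circ\phi(l)$ with $g\colon A\to C$, $l\colon A\to B$, then $f=\phi(f')$ for some $f'\colon B\to C$; and if $\phi(g)=f\circ h$ then $g=g_1\circ g_2$ with $f=\phi(g_1)\circ\sigma^{-1}$, $h=\sigma\circ\phi(g_2)$ for an isomorphism $\sigma$ of the middle objects. $R\colon\mathbb F_2^\epsilon\text{-}Ops\to\mathbb F_1^\epsilon\text{-}Ops$ and $r$ (on $\mathbb V$-modules) denote restriction along $\phi$. $L^!\colon\mathbb F_1^\epsilon\text{-}Ops\to\mathbb F_2^\epsilon\text{-}Ops$ is given by $$L^!(\mathcal P)(v)=\bigoplus_{\phi(w)=v}\mathcal P(w)\otimes_{\mathrm{Aut}(w)}k[\mathrm{Aut}(v)],$$ where $f\colon(v_1,\dots,v_n)\to v_0$ sends $[p_1\otimes\sigma_1]\otimes\cdots\otimes[p_n\otimes\sigma_n]$ to $[\mathcal P(g)(p_1\otimes\cdots\otimes p_n)\otimes\sigma_0]$ if $f\circ(\sigma_1\otimes\cdots\otimes\sigma_n)=\sigma_0\circ\phi(g)$ for some $g$ and $\sigma_0$, and to $0$ otherwise.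 $R^!$ denotes a left adjoint of $L^!$. Finally, $\phi$ is quadratic preserving if, for both parities and all $\mathbb V_2$-modules $E$, the natural map $\beta_E\colon F_1(rE)\to R\,F_2(E)$ (with $F_i$ the free $\mathbb F_i^{\epsilon}$-op) is surjective at each vertex and its kernel is generated, as an ideal, by its weight $1$ part. **Theorem.** Let $\phi$ be as above and quadratic preserving. For both parities $\epsilon$ the functor $L^!$ has a left adjoint $R^!$. Let $\mathcal O\cong F_\epsilon(E)/\langle S\rangle$ be a quadratic $\mathbb F_2^\epsilon$-op with $E$ of finite type. Then: 1. The map $\pi_1\colon F_{-\epsilon}(rE^\ast)\to R(\mathcal O^!)$, the composite of $\beta_{E^\ast}$ and $R$ of the projection $F_{-\epsilon}(E^\ast)\to\mathcal O^!$, is surjective at each vertex, and its kernel is the ideal $\langle K\rangle$ generated by $K:=\ker(\pi_1)\cap F_{-\epsilon}(rE^\ast)^1$. So $R(\mathcal O^!)$ is quadratic, with generators $rE^\ast$ and relations $K$. 2. $R^!(\mathcal O)\cong R(\mathcal O^!)^!$ as $\mathbb F_1^\epsilon$-ops, where the outer dual is formed with this presentation, i.e. $R(\mathcal O^!)^!=F_\epsilon((rE^\ast)^\ast)/\langle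 K^\perp\rangle$. -/

import Mathlib

open CategoryTheory

universe u

/-- Relabelling of families of one-element sets. -/
def sigmaOne (J : Type) : (Σ _ : J, Fin 1) ≃ J where
  toFun s := s.1
  invFun j := ⟨j, 0⟩
  left_inv := fun ⟨_, i⟩ => by rw [Subsingleton.elim i 0]
  right_inv _ := rfl

/-- Relabelling of a one-element family. -/
def oneSigma (I : Type) : (Σ _ : Fin 1, I) ≃ I where
  toFun s := s.2
  invFun i := ⟨0, i⟩
  left_inv := fun ⟨j, _⟩ => by rw [Subsingleton.elim j 0]
  right_inv _ := rfl

/-- A coloured symmetric operad in sets, in coordinate-free form. `V` is the set of colours (the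
vertices); `Op X v` is the set of generating morphisms `X → v`, where the source `X` is a family of
colours indexed by a finite type; `reindex` is the symmetric group action in the form of relabelling of
the inputs; `comp b a` is the total composition of `b` with a family `a` of operations. -/
structure ColOperad where
  V : Type u
  Op : {I : Type} → [Finite I] → (I → V) → V → Type u
  one : ∀ v : V, Op (fun _ : Fin 1 => v) v
  comp : ∀ {J : Type} [Finite J] {I : J → Type} [∀ j, Finite (I j)] {X : ∀ j, I j → V}
    {Y : J → V} {v : V}, Op Y v → (∀ j, Op (X j) (Y j)) →
      Op (fun s : Σ j, I j => X s.1 s.2) v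
  reindex : ∀ {I K : Type} [Finite I] [Finite K] (ρ : I ≃ K) {X : K → V} {v : V},
    Op (fun i => X (ρ i)) v → Op X v
  reindex_refl : ∀ {I : Type} [Finite I] {X : I → V} {v : V} (a : Op X v),
    reindex (Equiv.refl I) a = a
  reindex_trans : ∀ {I K L : Type} [Finite I] [Finite K] [Finite L] (ρ : I ≃ K) (τ : K ≃ L)
    {X : L → V} {v : V} (a : Op (fun i => X (τ (ρ i))) v),
    reindex τ (reindex ρ (X := fun k => X (τ k)) a) = reindex (ρ.trans τ) (X := X) a
  comp_reindex_right : ∀ {J : Type} [Finite J] {I K : J → Type} [∀ j, Finite (I j)]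
    [∀ j, Finite (K j)] (ρ : ∀ j, I j ≃ K j) {X : ∀ j, K j → V} {Y : J → V} {v : V}
    (b : Op Y v) (a : ∀ j, Op (fun i => X j (ρ j i)) (Y j)),
    comp b (fun j => reindex (ρ j) (X := X j) (a j)) =
      reindex (Equiv.sigmaCongrRight ρ) (X := fun s : Σ j, K j => X s.1 s.2) (comp b a)
  comp_reindex_left : ∀ {J J' : Type} [Finite J] [Finite J'] (ρ : J ≃ J') {I : J' → Type}
    [∀ j, Finite (I j)] {X : ∀ j, I j → V} {Y : J' → V} {v : V}
    (b : Op (fun j => Y (ρ j)) v) (a : ∀ j, Op (X j) (Y j)),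
    comp (reindex ρ (X := Y) b) a =
      reindex (Equiv.sigmaCongrLeft ρ) (X := fun s : Σ j, I j => X s.1 s.2)
        (comp b (fun j => a (ρ j)))
  comp_one : ∀ {J : Type} [Finite J] {Y : J → V} {v : V} (b : Op Y v),
    reindex (sigmaOne J) (X := Y) (comp b (fun j => one (Y j))) = b
  one_comp : ∀ {I : Type} [Finite I] {X : I → V} {v : V} (a : Op X v),
    reindex (oneSigma I) (X := X) (comp (one v) (fun _ => a)) = a
  assoc : ∀ {K : Type} [Finite K] {J : K → Type} [∀ k, Finite (J k)] {I : ∀ k, J k → Type}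
    [∀ k j, Finite (I k j)] {X : ∀ k j, I k j → V} {Y : ∀ k, J k → V} {Z : K → V} {v : V}
    (c : Op Z v) (b : ∀ k, Op (Y k) (Z k)) (a : ∀ k j, Op (X k j) (Y k j)),
    reindex (Equiv.sigmaAssoc I)
        (X := fun s : Σ k, Σ j, I k j => X s.1 s.2.1 s.2.2)
        (comp (comp c b) (fun s : Σ k, J k => a s.1 s.2)) =
      comp c (fun k => comp (b k) (a k))

namespace ColOperad

variable (F : ColOperad.{u})

/-- A morphism of the associated strict symmetric monoidal category: a map of index sets together
with an operation for each fibre. -/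
@[ext]
structure Mor {I J : Type} [Finite I] [Finite J] (X : I → F.V) (Y : J → F.V) where
  idx : I → J
  op : ∀ j, F.Op (fun i : {i // idx i = j} => X i.1) (Y j)

variable {F}
variable {I J K L : Type} [Finite I] [Finite J] [Finite K] [Finite L]
  {X : I → F.V} {Y : J → F.V} {Z : K → F.V} {W : L → F.V} {v : F.V}

/-- The composite of an operation with a morphism into its source. -/
def precomp (b : F.Op Y v) (h : F.Mor X Y) : F.Op X v :=
  F.reindex (Equiv.sigmaFiberEquiv h.idx) (X := X) (F.comp b h.op)

/-- The fibre of the identity. -/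
def fiberOne (j : J) : Fin 1 ≃ {i : J // i = j} where
  toFun _ := ⟨j, rfl⟩
  invFun _ := 0
  left_inv i := (Subsingleton.elim i 0).symm
  right_inv := fun ⟨_, h⟩ => by subst h; rfl

variable (X) in
/-- The identity morphism. -/
def Mor.id : F.Mor X X where
  idx i := i
  op j := F.reindex (fiberOne j) (X := fun i : {i // i = j} => X i.1) (F.one (X j))

/-- Fibres of a restricted map of index sets. -/
def fiberRestrict (f : I → J) (p : J → Prop) (j : {j // p j}) :
    {i // f i = j.1} ≃ {i : {i // p (f i)} // (⟨f i.1, i.2⟩ : {j // p j}) = j} where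
  toFun i := ⟨⟨i.1, by rw [i.2]; exact j.2⟩, Subtype.ext i.2⟩
  invFun i := ⟨i.1.1, congrArg Subtype.val i.2⟩
  left_inv _ := rfl
  right_inv _ := rfl

/-- The part of a morphism that lies over a subset of the target index set. -/
def Mor.restrict (f : F.Mor X Y) (p : J → Prop) :
    F.Mor (fun i : {i // p (f.idx i)} => X i.1) (fun j : {j // p j} => Y j.1) where
  idx i := ⟨f.idx i.1, i.2⟩
  op j := F.reindex (fiberRestrict f.idx p j)
    (X := fun i : {i : {i // p (f.idx i)} // (⟨f.idx i.1, i.2⟩ : {j // p j}) = j} => X i.1.1)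
    (f.op j.1)

/-- Composition of morphisms. -/
def Mor.comp (f : F.Mor X Y) (g : F.Mor Y Z) : F.Mor X Z where
  idx i := g.idx (f.idx i)
  op k := precomp (g.op k) (f.restrict (fun j => g.idx j = k))

theorem reindex_congr {I K : Type} [Finite I] [Finite K] {ρ ρ' : I ≃ K} {X : K → F.V} {v : F.V}
    {Z : I → F.V}
    (h : ∀ i, ρ i = ρ' i) (a : F.Op Z v) (h1 : Z = fun i => X (ρ i)) (h2 : Z = fun i => X (ρ' i)) :
    F.reindex ρ (X := X) (h1 ▸ a) = F.reindex ρ' (X := X) (h2 ▸ a) := by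
  have : ρ = ρ' := Equiv.ext h
  subst this; rfl

theorem precomp_id (b : F.Op Y v) : precomp b (Mor.id Y) = b := by
  conv_rhs => rw [← F.comp_one b]
  refine Eq.trans (congrArg (F.reindex _ (X := Y)) (F.comp_reindex_right
    (fun j => fiberOne j) (X := fun j i => Y i.1) b (fun j => F.one (Y j)))) ?_
  refine (F.reindex_trans _ _ (X := Y) _).trans ?_
  exact reindex_congr (X := Y) (fun i => rfl) _ rfl rfl

theorem precomp_precomp (c : F.Op Z v) (g : F.Mor Y Z) (f : F.Mor X Y) :
    precomp (precomp c g) f = precomp c (f.comp g) := by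
  have h1 := F.comp_reindex_left (Equiv.sigmaFiberEquiv g.idx) (Y := Y)
    (X := fun j (i : {i // f.idx i = j}) => X i.1) (F.comp c g.op) f.op
  refine Eq.trans (congrArg (F.reindex (Equiv.sigmaFiberEquiv f.idx) (X := X)) h1) ?_
  refine (F.reindex_trans _ _ (X := X) _).trans ?_
  have h2 : ∀ k, (f.comp g).op k =
      F.reindex ((Equiv.sigmaCongrRight (fiberRestrict f.idx (fun j => g.idx j = k))).trans
        (Equiv.sigmaFiberEquiv (f.restrict (fun j => g.idx j = k)).idx))
        (X := fun i : {i // g.idx (f.idx i) = k} => X i.1)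
        (F.comp (g.op k) (fun j => f.op j.1)) := by
    intro k
    refine Eq.trans (congrArg (F.reindex _
      (X := fun i : {i // g.idx (f.idx i) = k} => X i.1)) (F.comp_reindex_right
      (fun j => fiberRestrict f.idx (fun j => g.idx j = k) j)
      (X := fun j i => X i.1.1) (g.op k) (fun j => f.op j.1))) ?_
    exact F.reindex_trans _ _ (X := fun i : {i // g.idx (f.idx i) = k} => X i.1) _
  have h3 : precomp c (f.comp g) = F.reindex (Equiv.sigmaFiberEquiv (f.comp g).idx) (X := X)
      (F.comp c (fun k => (f.comp g).op k)) := rfl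
  rw [h3, funext h2]
  symm
  refine Eq.trans (congrArg (F.reindex _ (X := X)) (F.comp_reindex_right
    (fun k => (Equiv.sigmaCongrRight (fiberRestrict f.idx (fun j => g.idx j = k))).trans
        (Equiv.sigmaFiberEquiv (f.restrict (fun j => g.idx j = k)).idx))
      (X := fun k i => X i.1) c (fun k => F.comp (g.op k) (fun j => f.op j.1)))) ?_
  refine (F.reindex_trans _ _ (X := X) _).trans ?_
  have h4 := F.assoc c g.op (fun k j => f.op j.1)
  refine Eq.trans (congrArg (F.reindex _ (X := X)) h4.symm) ?_
  refine (F.reindex_trans _ _ (X := X) _).trans ?_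
  exact reindex_congr (X := X) (fun i => rfl) _ rfl rfl

theorem comp_op (f : F.Mor X Y) (g : F.Mor Y Z) (k : K) : (f.comp g).op k =
      F.reindex ((Equiv.sigmaCongrRight (fiberRestrict f.idx (fun j => g.idx j = k))).trans
        (Equiv.sigmaFiberEquiv (f.restrict (fun j => g.idx j = k)).idx))
        (X := fun i : {i // g.idx (f.idx i) = k} => X i.1)
        (F.comp (g.op k) (fun j => f.op j.1)) := by
  refine Eq.trans (congrArg (F.reindex _
      (X := fun i : {i // g.idx (f.idx i) = k} => X i.1)) (F.comp_reindex_right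
      (fun j => fiberRestrict f.idx (fun j => g.idx j = k) j)
      (X := fun j i => X i.1.1) (g.op k) (fun j => f.op j.1))) ?_
  exact F.reindex_trans _ _ (X := fun i : {i // g.idx (f.idx i) = k} => X i.1) _

theorem restrict_comp (f : F.Mor X Y) (g : F.Mor Y Z) (p : K → Prop) :
    (f.comp g).restrict p = (f.restrict (fun j => p (g.idx j))).comp (g.restrict p) := by
  refine Mor.ext rfl (heq_of_eq (funext fun k => ?_))
  refine Eq.trans (congrArg (F.reindex (fiberRestrict (f.comp g).idx p k)
    (X := fun i : {i : {i // p (g.idx (f.idx i))} //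
    (⟨g.idx (f.idx i.1), i.2⟩ : {j // p j}) = k} => X i.1.1)) (comp_op f g k.1 :)) ?_
  refine (F.reindex_trans _ _ (X := fun i : {i : {i // p (g.idx (f.idx i))} //
    (⟨g.idx (f.idx i.1), i.2⟩ : {j // p j}) = k} => X i.1.1) _).trans ?_
  refine Eq.trans ?_ (comp_op (f.restrict (fun j => p (g.idx j))) (g.restrict p) k).symm
  have h1 := F.comp_reindex_right (J := {j : {j // p (g.idx j)} //
      (⟨g.idx j.1, j.2⟩ : {j // p j}) = k})
    (fun j => fiberRestrict f.idx (fun j => p (g.idx j)) j.1)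
    (X := fun j i => X i.1.1) ((g.restrict p).op k) (fun j => f.op j.1.1)
  have h2 := F.comp_reindex_left (fiberRestrict g.idx p k) (Y := fun j => Y j.1.1)
    (X := fun j (i : {i // f.idx i = j.1.1}) => X i.1) (g.op k.1) (fun j => f.op j.1.1)
  symm
  refine Eq.trans (congrArg (F.reindex _ (X := fun i : {i : {i // p (g.idx (f.idx i))} //
    (⟨g.idx (f.idx i.1), i.2⟩ : {j // p j}) = k} => X i.1.1)) h1) ?_
  refine (F.reindex_trans _ _ (X := fun i : {i : {i // p (g.idx (f.idx i))} //
    (⟨g.idx (f.idx i.1), i.2⟩ : {j // p j}) = k} => X i.1.1) _).trans ?_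
  refine Eq.trans (congrArg (F.reindex _ (X := fun i : {i : {i // p (g.idx (f.idx i))} //
    (⟨g.idx (f.idx i.1), i.2⟩ : {j // p j}) = k} => X i.1.1)) h2) ?_
  refine (F.reindex_trans _ _ (X := fun i : {i : {i // p (g.idx (f.idx i))} //
    (⟨g.idx (f.idx i.1), i.2⟩ : {j // p j}) = k} => X i.1.1) _).trans ?_
  exact reindex_congr (X := fun i : {i : {i // p (g.idx (f.idx i))} //
    (⟨g.idx (f.idx i.1), i.2⟩ : {j // p j}) = k} => X i.1.1) (fun i => rfl) _ rfl rfl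

theorem Mor.assoc (f : F.Mor X Y) (g : F.Mor Y Z) (h : F.Mor Z W) :
    (f.comp g).comp h = f.comp (g.comp h) := by
  refine Mor.ext rfl (heq_of_eq (funext fun l => ?_))
  exact (congrArg (precomp (h.op l)) (restrict_comp f g (fun k => h.idx k = l))).trans
    (precomp_precomp _ _ _).symm

theorem Mor.id_comp (f : F.Mor X Y) : (Mor.id X).comp f = f := by
  refine Mor.ext rfl (heq_of_eq (funext fun j => ?_))
  have : (Mor.id X).restrict (fun i => f.idx i = j) =
      Mor.id (fun i : {i // f.idx i = j} => X i.1) := by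
    refine Mor.ext rfl (heq_of_eq (funext fun i => ?_))
    refine (F.reindex_trans _ _
      (X := fun i' : {i' : {i // f.idx i = j} // i' = i} => X i'.1.1) _).trans ?_
    exact reindex_congr (X := fun i' : {i' : {i // f.idx i = j} // i' = i} => X i'.1.1)
      (fun i => rfl) _ rfl rfl
  exact (congrArg (precomp (f.op j)) this).trans (precomp_id _)

theorem Mor.comp_id (f : F.Mor X Y) : f.comp (Mor.id Y) = f := by
  refine Mor.ext rfl (heq_of_eq (funext fun j => ?_))
  refine (comp_op f (Mor.id Y) j).trans ?_
  have h2 := F.comp_reindex_left (fiberOne j) (Y := fun j' : {j' : J // j' = j} => Y j'.1)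
    (I := fun j' => {i // f.idx i = j'.1})
    (X := fun j' i => X i.1) (F.one (Y j)) (fun j' => f.op j'.1)
  refine Eq.trans (congrArg (F.reindex _ (X := fun i : {i // f.idx i = j} => X i.1)) h2) ?_
  refine (F.reindex_trans _ _ (X := fun i : {i // f.idx i = j} => X i.1) _).trans ?_
  refine Eq.trans ?_ (F.one_comp (f.op j))
  exact reindex_congr (I := Σ _ : Fin 1, {i // f.idx i = j})
    
    (ρ := ((fiberOne j).sigmaCongrLeft.trans
        ((Equiv.sigmaCongrRight (fiberRestrict f.idx fun j' => (id Y).idx j' = j)).trans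
          (Equiv.sigmaFiberEquiv (f.restrict fun j' => (id Y).idx j' = j).idx))))
    (ρ' := oneSigma _) (X := fun i : {i // f.idx i = j} => X i.1) (fun i => rfl)
    (F.comp (F.one (Y j)) (fun _ => f.op j)) rfl rfl

/-- Objects of the symmetric monoidal category: finite families of vertices. -/
structure Obj (F : ColOperad.{u}) where
  I : Type
  [fin : Finite I]
  X : I → F.V

attribute [instance] Obj.fin

instance : Category (Obj F) where
  Hom A B := F.Mor A.X B.X
  id A := Mor.id A.X
  comp f g := f.comp g
  id_comp := Mor.id_comp
  comp_id := Mor.comp_id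
  assoc := Mor.assoc
end ColOperad

namespace ColOperad

variable {F : ColOperad.{u}}

/-- The object given by one vertex. -/
def single {F : ColOperad.{u}} (v : F.V) : Obj F := ⟨Fin 1, fun _ => v⟩

/-- The object given by a tuple of vertices. -/
abbrev fam {n : ℕ} (X : Fin n → F.V) : Obj F := ⟨Fin n, X⟩

/-- A morphism into a single vertex, as an operation. -/
def toOp {A : Obj F} {v : F.V} (f : A ⟶ single v) : F.Op A.X v :=
  precomp (F.one v) f

/-- The composite `b ∘ (a_1 ⊗ ⋯ ⊗ a_m)`, with the `N` inputs of the composite labelled through the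
bijection `e`. -/
def compTo {m N : ℕ} {n : Fin m → ℕ} (e : (Σ j, Fin (n j)) ≃ Fin N) {X : Fin N → F.V}
    {Y : Fin m → F.V} {v : F.V} (b : F.Op Y v) (a : ∀ j, F.Op (fun i => X (e ⟨j, i⟩)) (Y j)) :
    F.Op X v :=
  F.reindex e (X := X) (F.comp b a)

/-- The fibre over `j` of the projection to block numbers. -/
def fiberEquiv {m N : ℕ} {n : Fin m → ℕ} (e : (Σ j, Fin (n j)) ≃ Fin N) (j : Fin m) :
    Fin (n j) ≃ {t : Fin N // (e.symm t).1 = j} where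
  toFun i := ⟨e ⟨j, i⟩, by rw [e.symm_apply_apply]⟩
  invFun t := t.2 ▸ (e.symm t.1).2
  left_inv i := by
    have : ∀ (s : Σ j, Fin (n j)) (h : s = ⟨j, i⟩) (h' : s.1 = j), (h' ▸ s.2 : Fin (n j)) = i := by
      intro s h h'; subst h; rfl
    exact this _ (e.symm_apply_apply _) _
  right_inv t := by
    obtain ⟨t, rfl⟩ := t
    exact Subtype.ext (e.apply_symm_apply t)

/-- The morphism `a_1 ⊗ ⋯ ⊗ a_m`, with the inputs labelled through `e`. -/
def ofFin {m N : ℕ} {n : Fin m → ℕ} (e : (Σ j, Fin (n j)) ≃ Fin N) {X : Fin N → F.V}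
    {Y : Fin m → F.V} (a : ∀ j, F.Op (fun i => X (e ⟨j, i⟩)) (Y j)) : fam X ⟶ fam Y where
  idx t := (e.symm t).1
  op j := F.reindex (fiberEquiv e j)
    (X := fun t : {t : Fin N // (e.symm t).1 = j} => X t.1) (a j)

/-- Two factorizations `b ∘ (⊗ a_j)` and `b' ∘ (⊗ a'_j)` through tuples `Y` and `Y'` agree up to an
isomorphism of the middle object. -/
def ChainEquiv {N m m' : ℕ} {n : Fin m → ℕ} {n' : Fin m' → ℕ} {X : Fin N → F.V}
    {Y : Fin m → F.V} {Y' : Fin m' → F.V} {v : F.V}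
    (e : (Σ j, Fin (n j)) ≃ Fin N) (b : F.Op Y v) (a : ∀ j, F.Op (fun i => X (e ⟨j, i⟩)) (Y j))
    (e' : (Σ j, Fin (n' j)) ≃ Fin N) (b' : F.Op Y' v)
    (a' : ∀ j, F.Op (fun i => X (e' ⟨j, i⟩)) (Y' j)) : Prop :=
  ∃ σ : fam Y ≅ fam Y', ofFin e a ≫ σ.hom = ofFin e' a' ∧ precomp b' σ.hom = b

/-- A degree function on generating morphisms which is additive under composition. -/
structure DegreeFunction (F : ColOperad.{u}) where
  deg : ∀ {I : Type} [Finite I] {X : I → F.V} {v : F.V}, F.Op X v → ℕ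
  deg_comp : ∀ {J : Type} [Finite J] {I : J → Type} [∀ j, Finite (I j)] {X : ∀ j, I j → F.V}
    {Y : J → F.V} {v : F.V} (b : F.Op Y v) (a : ∀ j, F.Op (X j) (Y j)),
    deg (F.comp b a) = deg b + ∑ᶠ j, deg (a j)
  deg_reindex : ∀ {I K : Type} [Finite I] [Finite K] (ρ : I ≃ K) {X : K → F.V} {v : F.V}
    (a : F.Op (fun i => X (ρ i)) v), deg (F.reindex ρ (X := X) a) = deg a

namespace DegreeFunction
variable (D : DegreeFunction F)

/-- The degree of a morphism: the sum of the degrees of its tensor factors. -/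
noncomputable def mdeg {A B : Obj F} (f : A ⟶ B) : ℕ := ∑ᶠ j, D.deg (Mor.op f j)

theorem deg_one (v : F.V) : D.deg (F.one v) = 0 := by
  have h := congrArg D.deg (F.comp_one (F.one v))
  rw [D.deg_reindex, D.deg_comp, finsum_eq_sum_of_fintype] at h
  simpa using h

theorem deg_precomp {I J : Type} [Finite I] [Finite J] {X : I → F.V} {Y : J → F.V} {v : F.V}
    (b : F.Op Y v) (f : F.Mor X Y) : D.deg (precomp b f) = D.deg b + ∑ᶠ j, D.deg (f.op j) :=
  (D.deg_reindex (Equiv.sigmaFiberEquiv f.idx) (X := X) (F.comp b f.op)).trans (D.deg_comp _ _)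

theorem mdeg_id (A : Obj F) : D.mdeg (𝟙 A) = 0 := by
  have : ∀ j, D.deg (Mor.op (𝟙 A) j) = 0 := fun j =>
    (D.deg_reindex (fiberOne j) (X := fun i : {i // i = j} => A.X i.1) (F.one (A.X j))).trans
      (D.deg_one _)
  simp [mdeg, this]

theorem mdeg_comp {A B C : Obj F} (f : A ⟶ B) (g : B ⟶ C) :
    D.mdeg (f ≫ g) = D.mdeg f + D.mdeg g := by
  classical
  have := Fintype.ofFinite B.I
  have := Fintype.ofFinite C.I
  have h : ∀ k, D.deg (Mor.op (f ≫ g) k) =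
      D.deg (Mor.op g k) + ∑ j : {j // Mor.idx g j = k}, D.deg (Mor.op f j.1) := by
    intro k
    refine (congrArg D.deg (comp_op (F := F) f g k)).trans ?_
    refine (D.deg_reindex _ (X := fun i : {i // Mor.idx g (Mor.idx f i) = k} => A.X i.1) _).trans ?_
    refine (D.deg_comp _ _).trans ?_
    rw [finsum_eq_sum_of_fintype]
  have h2 : ∑ j, D.deg (Mor.op f j) =
      ∑ s : (Σ k, {j // Mor.idx g j = k}), D.deg (Mor.op f s.2.1) :=
    (Equiv.sum_comp (Equiv.sigmaFiberEquiv (Mor.idx g)) (fun j => D.deg (Mor.op f j))).symm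
  simp only [mdeg, finsum_eq_sum_of_fintype, h, Finset.sum_add_distrib]
  rw [h2, Fintype.sum_sigma, add_comm]

theorem mdeg_iso {A B : Obj F} (θ : A ≅ B) : D.mdeg θ.hom = 0 := by
  have h := D.mdeg_comp θ.hom θ.inv
  rw [θ.hom_inv_id, mdeg_id] at h
  omega

theorem deg_toOp {A : Obj F} {v : F.V} (f : A ⟶ single v) : D.deg (toOp f) = D.mdeg f := by
  refine (D.deg_precomp (F.one v) f).trans ?_
  rw [deg_one, zero_add]; rfl

theorem deg_toOp_iso {v w : F.V} (θ : single v ≅ single w) : D.deg (toOp θ.hom) = 0 :=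
  (D.deg_toOp _).trans (D.mdeg_iso θ)

theorem deg_compTo {m N : ℕ} {n : Fin m → ℕ} (e : (Σ j, Fin (n j)) ≃ Fin N) {X : Fin N → F.V}
    {Y : Fin m → F.V} {v : F.V} (b : F.Op Y v) (a : ∀ j, F.Op (fun i => X (e ⟨j, i⟩)) (Y j)) :
    D.deg (compTo e b a) = D.deg b + ∑ j, D.deg (a j) := by
  rw [compTo, D.deg_reindex, D.deg_comp, finsum_eq_sum_of_fintype]

/-- A sequence of `n` composable morphisms of degree one, followed by an isomorphism. -/
inductive Chain : ℕ → Obj F → Obj F → Type (max 1 u)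
  | last {A B : Obj F} (θ : A ≅ B) : Chain 0 A B
  | step {n : ℕ} {A Z B : Obj F} (h : A ⟶ Z) (hd : D.mdeg h = 1) (c : Chain n Z B) :
      Chain (n + 1) A B

variable {D}

namespace Chain

/-- The composite of a sequence. -/
def composite {n : ℕ} {A B : Obj F} : D.Chain n A B → (A ⟶ B)
  | last θ => θ.hom
  | step h _ c => h ≫ c.composite

/-- Composing the first morphism of a sequence with an isomorphism. -/
def isoComp {n : ℕ} {A A' B : Obj F} (θ : A' ≅ A) : D.Chain n A B → D.Chain n A' B
  | last θ' => last (θ ≪≫ θ')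
  | step h hd c => step (θ.hom ≫ h) (by rw [mdeg_comp, mdeg_iso, hd]) c

/-- Concatenation of sequences. -/
def append {p q : ℕ} {A B C : Obj F} : D.Chain p A B → D.Chain q B C → D.Chain (q + p) A C
  | last θ, c' => c'.isoComp θ
  | step h hd c, c' => step h hd (c.append c')

/-- Sequences are identified when isomorphisms are moved from one morphism of the sequence to the
next. -/
inductive Rel : ∀ {n : ℕ} {A B : Obj F}, D.Chain n A B → D.Chain n A B → Prop
  | slide {n : ℕ} {A Z Z' B : Obj F} (h : A ⟶ Z) (hd : D.mdeg h = 1) (θ : Z ≅ Z')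
      (hd' : D.mdeg (h ≫ θ.hom) = 1) (c : D.Chain n Z' B) :
      Rel (step (h ≫ θ.hom) hd' c) (step h hd (c.isoComp θ))
  | step {n : ℕ} {A Z B : Obj F} (h : A ⟶ Z) (hd : D.mdeg h = 1) {c c' : D.Chain n Z B} :
      Rel c c' → Rel (step h hd c) (step h hd c')

end Chain

variable (D) in
/-- The set `C^n(A, B)` of sequences modulo composition of isomorphisms. -/
def ChainClass (n : ℕ) (A B : Obj F) : Type (max 1 u) :=
  Quot (Chain.Rel (D := D) (n := n) (A := A) (B := B))

/-- The block sum of two permutations, in the order that matches concatenation. -/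
def blockPerm {p q : ℕ} (σ : Equiv.Perm (Fin p)) (τ : Equiv.Perm (Fin q)) :
    Equiv.Perm (Fin (q + p)) :=
  finSumFinEquiv.permCongr (Equiv.sumCongr τ σ)

variable (D) in
/-- Cubicality: morphisms of degree zero are isomorphisms; a morphism of degree `n` is a composite of
`n` morphisms of degree one (and an isomorphism); the symmetric groups act freely on the sets
`C^n(A, B)`, compatibly with concatenation, and the orbits are the fibres of composition; and only
finitely many generating morphisms of degree one have a given target. -/
structure IsCubical : Prop where
  isIso_of_deg : ∀ {A B : Obj F} (f : A ⟶ B), D.mdeg f = 0 → IsIso f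
  factor : ∀ {A B : Obj F} (f : A ⟶ B), ∃ c : D.Chain (D.mdeg f) A B, c.composite = f
  action : ∃ act : ∀ (n : ℕ) (A B : Obj F), Equiv.Perm (Fin n) → D.ChainClass n A B →
      D.ChainClass n A B,
    (∀ n A B c, act n A B 1 c = c) ∧
    (∀ n A B σ τ c, act n A B (σ * τ) c = act n A B σ (act n A B τ c)) ∧
    (∀ n A B σ c, act n A B σ c = c → σ = 1) ∧
    (∀ n A B (c c' : D.Chain n A B),
      c.composite = c'.composite ↔ ∃ σ, act n A B σ (Quot.mk _ c) = Quot.mk _ c') ∧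
    (∀ p q A B C σ τ (c d : D.Chain p A B) (c' d' : D.Chain q B C),
      act p A B σ (Quot.mk _ c) = Quot.mk _ d → act q B C τ (Quot.mk _ c') = Quot.mk _ d' →
        act (q + p) A C (blockPerm σ τ) (Quot.mk _ (c.append c')) = Quot.mk _ (d.append d'))
  finite_deg_one : ∀ v : F.V,
    Finite (Σ n : ℕ, Σ X : Fin n → F.V, {a : F.Op X v // D.deg a = 1})

end DegreeFunction
end ColOperad

/-- A cubical Feynman category, in strict and skeletal form, given by its operad of generating morphisms:
isomorphic vertices are equal, vertices have finite automorphism groups, and there is an additive degree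
function for which the category is cubical. -/
structure CubicalFeynmanCat extends ColOperad.{u} where
  eq_of_iso : ∀ {v w : V}, Nonempty (ColOperad.single (F := toColOperad) v ≅ ColOperad.single (F := toColOperad) w) → v = w
  finite_aut : ∀ v : V, Finite (ColOperad.single (F := toColOperad) v ≅ ColOperad.single (F := toColOperad) v)
  degree : toColOperad.DegreeFunction
  cubical : degree.IsCubical

namespace CubicalFeynmanCat

variable (F : CubicalFeynmanCat.{u})

/-- The degree of a generating morphism. -/
abbrev deg {F : CubicalFeynmanCat.{u}} {I : Type} [Finite I] {X : I → F.V} {v : F.V}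
    (a : F.Op X v) : ℕ := F.degree.deg a

/-- The underlying symmetric monoidal category. -/
abbrev Cat : Type (max 1 u) := F.toColOperad.Obj

/-- The groupoid of vertices: its morphisms are the isomorphisms of the underlying category. -/
structure Vert where
  of : F.V

instance : Category F.Vert where
  Hom v w := (ColOperad.single v.of : F.Cat) ≅ ColOperad.single w.of
  id v := Iso.refl _
  comp f g := f ≪≫ g

instance : Groupoid F.Vert where
  inv f := Iso.symm f
  inv_comp f := Iso.symm_self_id f
  comp_inv f := Iso.self_symm_id f

variable {F}

/-- An isomorphism of vertices as a unary operation. -/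
def vop {v w : F.Vert} (θ : v ⟶ w) : F.Op (fun _ : Fin 1 => v.of) w.of :=
  ColOperad.toOp (Iso.hom (show (ColOperad.single v.of : F.Cat) ≅ ColOperad.single w.of from θ))

theorem deg_vop {v w : F.Vert} (θ : v ⟶ w) : deg (vop θ) = 0 :=
  F.degree.deg_toOp_iso _

end CubicalFeynmanCat

/-- A degree preserving morphism of cubical Feynman categories, given on vertices and on generating
morphisms; each vertex has finitely many preimages. -/
structure CubicalMorphism (F₁ F₂ : CubicalFeynmanCat.{u}) where
  obj : F₁.V → F₂.V
  map : ∀ {I : Type} [Finite I] {X : I → F₁.V} {v : F₁.V},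
    F₁.Op X v → F₂.Op (fun i => obj (X i)) (obj v)
  map_one : ∀ v, map (F₁.one v) = F₂.one (obj v)
  map_comp : ∀ {J : Type} [Finite J] {I : J → Type} [∀ j, Finite (I j)] {X : ∀ j, I j → F₁.V}
    {Y : J → F₁.V} {v : F₁.V} (b : F₁.Op Y v) (a : ∀ j, F₁.Op (X j) (Y j)),
    map (F₁.comp b a) = F₂.comp (map b) (fun j => map (a j))
  map_reindex : ∀ {I K : Type} [Finite I] [Finite K] (ρ : I ≃ K) {X : K → F₁.V} {v : F₁.V}
    (a : F₁.Op (fun i => X (ρ i)) v),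
    map (F₁.reindex ρ (X := X) a) = F₂.reindex ρ (X := fun k => obj (X k)) (map a)
  deg_map : ∀ {I : Type} [Finite I] {X : I → F₁.V} {v : F₁.V} (a : F₁.Op X v),
    CubicalFeynmanCat.deg (map a) = CubicalFeynmanCat.deg a
  finite_fiber : ∀ v : F₂.V, Finite {w : F₁.V // obj w = v}

namespace CubicalMorphism

open ColOperad

variable {F₁ F₂ : CubicalFeynmanCat.{u}} (φ : CubicalMorphism F₁ F₂)

/-- The action on objects. -/
def mobj (A : F₁.Cat) : F₂.Cat := ⟨A.I, fun i => φ.obj (A.X i)⟩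

/-- The action on morphisms. -/
def mmap {A B : F₁.Cat} (f : A ⟶ B) : φ.mobj A ⟶ φ.mobj B where
  idx := Mor.idx f
  op j := φ.map (Mor.op f j)

theorem map_precomp {I J : Type} [Finite I] [Finite J] {X : I → F₁.V} {Y : J → F₁.V} {v : F₁.V}
    (b : F₁.Op Y v) (h : F₁.Mor X Y) :
    φ.map (precomp b h) = precomp (F := F₂.toColOperad) (φ.map b)
      (⟨h.idx, fun j => φ.map (h.op j)⟩ : F₂.Mor (fun i => φ.obj (X i)) (fun j => φ.obj (Y j))) :=
  (φ.map_reindex (Equiv.sigmaFiberEquiv h.idx) (X := X) (F₁.comp b h.op)).trans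
    (congrArg (F₂.reindex (Equiv.sigmaFiberEquiv h.idx) (X := fun i => φ.obj (X i)))
      (φ.map_comp b h.op))

/-- The associated functor. -/
def functor : F₁.Cat ⥤ F₂.Cat where
  obj := φ.mobj
  map f := φ.mmap f
  map_id A := Mor.ext rfl (heq_of_eq (funext fun j =>
    (φ.map_reindex (fiberOne j) (X := fun i : {i // i = j} => A.X i.1) (F₁.one (A.X j))).trans
      (congrArg (F₂.reindex (fiberOne j) (X := fun i : {i // i = j} => φ.obj (A.X i.1)))
        (φ.map_one _))))
  map_comp {A B C} f g := by
    refine Mor.ext rfl (heq_of_eq (funext fun k => ?_))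
    refine (φ.map_precomp (Mor.op g k) (Mor.restrict f _)).trans ?_
    refine congrArg (precomp (φ.map (Mor.op g k))) ?_
    exact Mor.ext rfl (heq_of_eq (funext fun j => φ.map_reindex _
      (X := fun i : {i : {i // Mor.idx g (Mor.idx f i) = k} //
        (⟨Mor.idx f i.1, i.2⟩ : {j // Mor.idx g j = k}) = j} => A.X i.1.1) _))

theorem map_toOp {A : F₁.Cat} {v : F₁.V} (f : A ⟶ single v) :
    φ.map (toOp f) = toOp (A := φ.mobj A) (v := φ.obj v) (φ.functor.map f) :=
  (φ.map_precomp (F₁.one v) f).trans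
    (congrArg (fun b => precomp b _) (φ.map_one v))

theorem map_compTo {m N : ℕ} {n : Fin m → ℕ} (e : (Σ j, Fin (n j)) ≃ Fin N) {X : Fin N → F₁.V}
    {Y : Fin m → F₁.V} {v : F₁.V} (b : F₁.Op Y v) (a : ∀ j, F₁.Op (fun i => X (e ⟨j, i⟩)) (Y j)) :
    φ.map (compTo e b a) = compTo (F := F₂.toColOperad) (X := fun t => φ.obj (X t)) e (φ.map b)
      (fun j => φ.map (a j)) :=
  (φ.map_reindex e (X := X) _).trans
    (congrArg (F₂.reindex e (X := fun i => φ.obj (X i))) (φ.map_comp b a))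

theorem functor_map_ofFin {m N : ℕ} {n : Fin m → ℕ} (e : (Σ j, Fin (n j)) ≃ Fin N)
    {X : Fin N → F₁.V} {Y : Fin m → F₁.V} (a : ∀ j, F₁.Op (fun i => X (e ⟨j, i⟩)) (Y j)) :
    φ.functor.map (ofFin e a) = ofFin (F := F₂.toColOperad) (X := fun t => φ.obj (X t))
      (Y := fun j => φ.obj (Y j)) e (fun j => φ.map (a j)) :=
  Mor.ext rfl (heq_of_eq (funext fun j => φ.map_reindex _
    (X := fun t : {t : Fin N // (e.symm t).1 = j} => X t.1) _))

/-- The restriction to the groupoids of vertices. -/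
def vert : F₁.Vert ⥤ F₂.Vert where
  obj v := ⟨φ.obj v.of⟩
  map θ := φ.functor.mapIso θ
  map_id _ := Iso.ext (φ.functor.map_id _)
  map_comp _ _ := Iso.ext (φ.functor.map_comp _ _)

theorem map_vop {v w : F₁.Vert} (θ : v ⟶ w) :
    φ.map (CubicalFeynmanCat.vop θ) = CubicalFeynmanCat.vop (φ.vert.map θ) :=
  φ.map_toOp _

/-- Admissibility: the functor is faithful, and satisfies two factorization axioms. First, if
`φ(g) = f ∘ φ(l)` then `f` is in the image of `φ` (on morphisms between the given objects). Second, if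
`φ(g) = f ∘ h` then `g = g₁ ∘ g₂`, with `f` and `h` equal to `φ(g₁)` and `φ(g₂)` up to an isomorphism of
the middle object. -/
structure Admissible : Prop where
  faithful : φ.functor.Faithful
  factor₁ : ∀ {A B C : F₁.Cat} (g : A ⟶ C) (l : A ⟶ B) (f : φ.functor.obj B ⟶ φ.functor.obj C),
    φ.functor.map g = φ.functor.map l ≫ f → ∃ f' : B ⟶ C, φ.functor.map f' = f
  factor₂ : ∀ {A C : F₁.Cat} {Y : F₂.Cat} (g : A ⟶ C) (h : φ.functor.obj A ⟶ Y)
    (f : Y ⟶ φ.functor.obj C), φ.functor.map g = h ≫ f →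
      ∃ (B : F₁.Cat) (g₂ : A ⟶ B) (g₁ : B ⟶ C) (σ : φ.functor.obj B ≅ Y),
        g = g₂ ≫ g₁ ∧ f = σ.inv ≫ φ.functor.map g₁ ∧ h = φ.functor.map g₂ ≫ σ.hom

end CubicalMorphism

section Operads

/-- `V`-modules: functors from the groupoid of vertices to complexes of `k`-vector spaces (graded
by the integers, with differential of degree one). -/
abbrev VMod (F : CubicalFeynmanCat.{u}) (k : Type u) [Field k] :=
  F.Vert ⥤ CochainComplex (ModuleCat.{u} k) ℤ

/-- The parity of an operad. -/
inductive Parity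
  | even
  | odd

namespace Parity

/-- The opposite parity. -/
def flip : Parity → Parity
  | even => odd
  | odd => even

/-- The degree of the structure map of an operation of degree `n`: zero or `n`. -/
def shift : Parity → ℕ → ℤ
  | even, _ => 0
  | odd, n => n

@[simp] theorem shift_zero (ε : Parity) : ε.shift 0 = 0 := by cases ε <;> rfl

end Parity

section
variable (k : Type u) [Field k]

/-- The sign `(-1)^n`. -/
def sgn (n : ℤ) : k := ((n.negOnePow : ℤ) : k)

/-- The sign of a transposition: trivial or alternating. -/
def Parity.swapSign : Parity → k
  | even => 1
  | odd => -1

end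

/-- The exponent of the Koszul sign in `(a_1 ⊗ ⋯ ⊗ a_m)(x_1 ⊗ ⋯ ⊗ x_N)`, where `p t` is the degree of
`x_t` and `d j` that of `a_j`: the first sum comes from sorting the arguments into blocks, the second
from moving each `a_j` past the arguments of the previous blocks. -/
def koszul {m N : ℕ} {n : Fin m → ℕ} (e : (Σ j, Fin (n j)) ≃ Fin N) (p : Fin N → ℤ)
    (d : Fin m → ℤ) : ℤ :=
  (∑ s : Σ j, Fin (n j), ∑ t : Σ j, Fin (n j),
    if (s.1 < t.1 ∨ (s.1 = t.1 ∧ s.2.val < t.2.val)) ∧ e t < e s then p (e s) * p (e t) else 0) +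
  ∑ s : Σ j, Fin (n j), ∑ j : Fin m, if s.1 < j then d j * p (e s) else 0

variable {k : Type u} [Field k]

/-- The degrees after the `i`-th entry has been differentiated. -/
def bump {n : ℕ} (p : Fin n → ℤ) (i j : Fin n) : ℤ := if j = i then p j + 1 else p j

/-- A tuple of homogeneous elements with the `i`-th entry replaced by its differential. -/
noncomputable def dAt {n : ℕ} (C : Fin n → CochainComplex (ModuleCat.{u} k) ℤ) {p : Fin n → ℤ}
    (x : ∀ j, (C j).X (p j)) (i j : Fin n) : (C j).X (bump p i j) :=
  if h : j = i then ((C j).d (p j) (bump p i j)).hom (x j)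
  else ((C j).XIsoOfEq (show p j = bump p i j by simp [bump, h])).hom.hom (x j)

open CubicalFeynmanCat ColOperad

/-- A family of complexes with structure maps for the generating morphisms of degree zero and one,
which are multilinear maps between homogeneous components; in odd parity an operation of degree one
has a structure map of degree one. -/
structure RawOp (F : CubicalFeynmanCat.{u}) (k : Type u) [Field k] (ε : Parity) where
  obj : F.V → CochainComplex (ModuleCat.{u} k) ℤ
  act : ∀ {n : ℕ} {X : Fin n → F.V} {v : F.V} (a : F.Op X v) (_ : deg a ≤ 1)
    (p : Fin n → ℤ) (m : ℤ) (_ : ∑ i, p i + ε.shift (deg a) = m),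
    MultilinearMap k (fun i => (obj (X i)).X (p i)) ((obj v).X m)

namespace RawOp

variable {F : CubicalFeynmanCat.{u}} {ε : Parity}

/-- The composite of structure maps, with its Koszul sign. -/
noncomputable def act₂ (P : RawOp F k ε) {m N : ℕ} {n : Fin m → ℕ} (e : (Σ j, Fin (n j)) ≃ Fin N)
    {X : Fin N → F.V} {Y : Fin m → F.V} {v : F.V} (b : F.Op Y v)
    (a : ∀ j, F.Op (fun i => X (e ⟨j, i⟩)) (Y j)) (hb : deg b ≤ 1) (ha : ∀ j, deg (a j) ≤ 1)
    (p : Fin N → ℤ) (q : Fin m → ℤ) (r : ℤ)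
    (hq : ∀ j, ∑ i, p (e ⟨j, i⟩) + ε.shift (deg (a j)) = q j)
    (hr : ∑ j, q j + ε.shift (deg b) = r) (x : ∀ t, (P.obj (X t)).X (p t)) : (P.obj v).X r :=
  sgn k (koszul e p (fun j => ε.shift (deg (a j)))) •
    P.act b hb q r hr (fun j =>
      P.act (a j) (ha j) (fun i => p (e ⟨j, i⟩)) (q j) (hq j) (fun i => x (e ⟨j, i⟩)))

/-- The axioms of an operad over the cubical Feynman category (even parity), respectively of an odd
one. As every morphism is a composite of morphisms of degree one, and all factorizations of a morphism are
related by permutations, such an operad is determined by the structure maps of degree at most one. They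
have to be unital, associative and equivariant (`act_one`, `act_comp`), compatible with the differentials
(`d_act`), and (skew) invariant: the two different factorizations of a morphism of degree two into
morphisms of degree one act in the same way, respectively with opposite signs (`act_swap`). -/
structure IsOp (P : RawOp F k ε) : Prop where
  act_one : ∀ (v : F.V) (h1 : deg (F.one v) ≤ 1) (m : ℤ)
    (h : ∑ _i : Fin 1, m + ε.shift (deg (F.one v)) = m)
    (x : ∀ _i : Fin 1, (P.obj v).X m), P.act (F.one v) h1 (fun _ => m) m h x = x 0
  act_comp : ∀ {m N : ℕ} {n : Fin m → ℕ} (e : (Σ j, Fin (n j)) ≃ Fin N)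
    {X : Fin N → F.V} {Y : Fin m → F.V} {v : F.V} (b : F.Op Y v)
    (a : ∀ j, F.Op (fun i => X (e ⟨j, i⟩)) (Y j)) (hb : deg b ≤ 1) (ha : ∀ j, deg (a j) ≤ 1)
    (hc : deg (compTo e b a) ≤ 1) (p : Fin N → ℤ) (q : Fin m → ℤ) (r : ℤ)
    (hq : ∀ j, ∑ i, p (e ⟨j, i⟩) + ε.shift (deg (a j)) = q j)
    (hr : ∑ j, q j + ε.shift (deg b) = r)
    (hp : ∑ t, p t + ε.shift (deg (compTo e b a)) = r) (x : ∀ t, (P.obj (X t)).X (p t)),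
    P.act (compTo e b a) hc p r hp x = P.act₂ e b a hb ha p q r hq hr x
  act_swap : ∀ {N m m' : ℕ} {n : Fin m → ℕ} {n' : Fin m' → ℕ} {X : Fin N → F.V}
    {Y : Fin m → F.V} {Y' : Fin m' → F.V} {v : F.V}
    (e : (Σ j, Fin (n j)) ≃ Fin N) (b : F.Op Y v) (a : ∀ j, F.Op (fun i => X (e ⟨j, i⟩)) (Y j))
    (e' : (Σ j, Fin (n' j)) ≃ Fin N) (b' : F.Op Y' v)
    (a' : ∀ j, F.Op (fun i => X (e' ⟨j, i⟩)) (Y' j))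
    (hb : deg b = 1) (_ : ∑ j, deg (a j) = 1) (hb' : deg b' = 1) (_ : ∑ j, deg (a' j) = 1)
    (ha₁ : ∀ j, deg (a j) ≤ 1) (ha₁' : ∀ j, deg (a' j) ≤ 1)
    (_ : compTo e b a = compTo e' b' a') (_ : ¬ ChainEquiv e b a e' b' a')
    (p : Fin N → ℤ) (q : Fin m → ℤ) (q' : Fin m' → ℤ) (r : ℤ)
    (hq : ∀ j, ∑ i, p (e ⟨j, i⟩) + ε.shift (deg (a j)) = q j)
    (hr : ∑ j, q j + ε.shift (deg b) = r)
    (hq' : ∀ j, ∑ i, p (e' ⟨j, i⟩) + ε.shift (deg (a' j)) = q' j)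
    (hr' : ∑ j, q' j + ε.shift (deg b') = r) (x : ∀ t, (P.obj (X t)).X (p t)),
    P.act₂ e b a hb.le ha₁ p q r hq hr x =
      ε.swapSign k • P.act₂ e' b' a' hb'.le ha₁' p q' r hq' hr' x
  d_act : ∀ {n : ℕ} {X : Fin n → F.V} {v : F.V} (a : F.Op X v) (ha : deg a ≤ 1)
    (p : Fin n → ℤ) (m m' : ℤ) (_ : m + 1 = m') (h : ∑ i, p i + ε.shift (deg a) = m)
    (h' : ∀ i, ∑ j, bump p i j + ε.shift (deg a) = m')
    (x : ∀ i, (P.obj (X i)).X (p i)),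
    ((P.obj v).d m m').hom (P.act a ha p m h x) = sgn k (ε.shift (deg a)) •
      ∑ i, sgn k (∑ j, if j < i then p j else 0) •
        P.act a ha (bump p i) m' (h' i) (fun j => dAt (fun j => P.obj (X j)) x i j)

/-- Morphisms: chain maps that commute with the structure maps. -/
@[ext]
structure Hom (P Q : RawOp F k ε) where
  app : ∀ v, P.obj v ⟶ Q.obj v
  map_act : ∀ {n : ℕ} {X : Fin n → F.V} {v : F.V} (a : F.Op X v) (ha : deg a ≤ 1)
    (p : Fin n → ℤ) (m : ℤ) (h : ∑ i, p i + ε.shift (deg a) = m)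
    (x : ∀ i, (P.obj (X i)).X (p i)),
    ((app v).f m).hom (P.act a ha p m h x) =
      Q.act a ha p m h (fun i => ((app (X i)).f (p i)).hom (x i))

end RawOp

/-- The operads of parity `ε` over `F`, in complexes of `k`-vector spaces. -/
structure Ops (F : CubicalFeynmanCat.{u}) (k : Type u) [Field k] (ε : Parity)
    extends RawOp F k ε where
  isOp : toRawOp.IsOp

namespace Ops

variable {F : CubicalFeynmanCat.{u}} {ε : Parity}

instance : Category (Ops F k ε) where
  Hom P Q := RawOp.Hom P.toRawOp Q.toRawOp
  id P := ⟨fun _ => 𝟙 _, fun _ _ _ _ _ _ => rfl⟩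
  comp f g := ⟨fun v => f.app v ≫ g.app v, fun a ha p m h x =>
    (congrArg _ (f.map_act a ha p m h x)).trans (g.map_act a ha p m h _)⟩

@[simp] theorem id_app (P : Ops F k ε) (v : F.V) : RawOp.Hom.app (𝟙 P) v = 𝟙 _ := rfl
@[simp] theorem comp_app {P Q R : Ops F k ε} (f : P ⟶ Q) (g : Q ⟶ R) (v : F.V) :
    RawOp.Hom.app (f ≫ g) v = RawOp.Hom.app f v ≫ RawOp.Hom.app g v := rfl

end Ops

namespace ColOperad

variable {F : ColOperad.{u}}

theorem precomp_ofFin {m N : ℕ} {n : Fin m → ℕ} (e : (Σ j, Fin (n j)) ≃ Fin N) {X : Fin N → F.V}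
    {Y : Fin m → F.V} {v : F.V} (b : F.Op Y v) (a : ∀ j, F.Op (fun i => X (e ⟨j, i⟩)) (Y j)) :
    precomp b (ofFin e a) = compTo e b a := by
  refine Eq.trans (congrArg (F.reindex _ (X := X)) (F.comp_reindex_right (fiberEquiv e)
    (X := fun j t => X t.1) b a)) ?_
  refine (F.reindex_trans _ _ (X := X) _).trans ?_
  exact reindex_congr (ρ := (Equiv.sigmaCongrRight (fiberEquiv e)).trans
    (Equiv.sigmaFiberEquiv (Mor.idx (ofFin (Y := Y) e a)))) (ρ' := e) (X := X)
    (fun i => rfl) (F.comp b a) rfl rfl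

theorem precomp_single {A : Obj F} {v w : F.V} (b : F.Op (fun _ : Fin 1 => v) w)
    (f : A ⟶ single v) :
    precomp b f = F.reindex (oneSigma A.I) (X := A.X) (F.comp b (fun _ => toOp f)) := by
  let ρ : (Σ _ : Fin 1, Fin 1) ≃ Fin 1 := oneSigma (Fin 1)
  have hb : b = F.reindex ρ (X := fun _ => v) (F.comp b (fun _ => F.one v)) := by
    conv_lhs => rw [← F.comp_one b]
    exact reindex_congr (X := fun _ => v) (fun i => Subsingleton.elim _ _)
      (F.comp b (fun _ => F.one v)) rfl rfl
  have h0 := F.comp_reindex_left ρ (Y := fun _ => v) (X := fun j (i : {i // Mor.idx f i = j}) => A.X i.1)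
    (F.comp b (fun _ => F.one v)) (Mor.op f)
  have h1 := F.assoc (K := Fin 1) (J := fun _ => Fin 1) (I := fun _ j => {i // Mor.idx f i = j})
    (X := fun _ j i => A.X i.1) b (fun _ => F.one v) (fun _ j => Mor.op f j)
  have h2 := F.comp_reindex_right (J := Fin 1) (fun _ => Equiv.sigmaFiberEquiv (Mor.idx f))
    (X := fun _ => A.X) b (fun _ => F.comp (F.one v) (Mor.op f))
  symm
  refine Eq.trans (congrArg (F.reindex (oneSigma A.I) (X := A.X)) h2) ?_
  refine (F.reindex_trans _ _ (X := A.X) _).trans ?_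
  refine Eq.trans (congrArg (F.reindex _ (X := A.X)) h1.symm) ?_
  refine (F.reindex_trans _ _ (X := A.X) _).trans ?_
  symm
  refine Eq.trans (b := F.reindex (Equiv.sigmaFiberEquiv (Mor.idx f)) (X := A.X) (F.comp b (Mor.op f)))
    rfl ?_
  conv_lhs => rw [hb]
  refine Eq.trans (congrArg (F.reindex _ (X := A.X)) h0) ?_
  refine (F.reindex_trans _ _ (X := A.X) _).trans ?_
  exact reindex_congr (X := A.X) (fun i => rfl) _ rfl rfl

end ColOperad

theorem sgn_zero : sgn k 0 = 1 := by simp [sgn]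

theorem koszul_oneSigma {n : ℕ} (p : Fin n → ℤ) (d : Fin 1 → ℤ) :
    koszul (n := fun _ => n) (oneSigma (Fin n)) p d = 0 := by
  have h1 : ∀ s t : (Σ _ : Fin 1, Fin n),
      ¬ ((s.1 < t.1 ∨ (s.1 = t.1 ∧ s.2.val < t.2.val)) ∧ oneSigma (Fin n) t < oneSigma (Fin n) s) := by
    rintro ⟨s, i⟩ ⟨t, j⟩ ⟨h, h'⟩
    have : s = t := Subsingleton.elim _ _
    subst this
    have h'' : j < i := h'
    simp at h
    omega
  have h2 : ∀ (s : (Σ _ : Fin 1, Fin n)) (j : Fin 1), ¬ s.1 < j := by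
    intro s j
    rw [Subsingleton.elim s.1 j]; exact lt_irrefl _
  unfold koszul
  rw [Finset.sum_eq_zero fun s _ => Finset.sum_eq_zero fun t _ => if_neg (h1 s t),
    Finset.sum_eq_zero fun s _ => Finset.sum_eq_zero fun j _ => if_neg (h2 s j), add_zero]

namespace Ops

variable {F : CubicalFeynmanCat.{u}} {ε : Parity}

/-- The action of an isomorphism of vertices. -/
noncomputable def vmap (P : Ops F k ε) {v w : F.Vert} (θ : v ⟶ w) (m : ℤ) :
    (P.obj v.of).X m →ₗ[k] (P.obj w.of).X m :=
  (MultilinearMap.ofSubsingleton k _ _ (0 : Fin 1)).symm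
    (P.act (vop θ) (by rw [deg_vop]; exact Nat.zero_le 1) (fun _ => m) m (by simp [deg_vop]))

theorem vmap_apply (P : Ops F k ε) {v w : F.Vert} (θ : v ⟶ w) (m : ℤ) (x : (P.obj v.of).X m) :
    P.vmap θ m x = P.act (vop θ) (by rw [deg_vop]; exact Nat.zero_le 1) (fun _ => m) m
      (by simp [deg_vop]) (fun _ => x) := rfl

theorem act_congr (P : Ops F k ε) {n : ℕ} {X : Fin n → F.V} {v : F.V} {a b : F.Op X v}
    (hab : a = b) (ha : deg a ≤ 1) (hb : deg b ≤ 1) (p : Fin n → ℤ) (m : ℤ)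
    (h : ∑ i, p i + ε.shift (deg a) = m) (h' : ∑ i, p i + ε.shift (deg b) = m)
    (x : ∀ i, (P.obj (X i)).X (p i)) : P.act a ha p m h x = P.act b hb p m h' x := by
  subst hab; rfl

theorem vop_id (v : F.Vert) : vop (𝟙 v) = F.one v.of := precomp_id _

theorem vop_comp {v w z : F.Vert} (θ : v ⟶ w) (θ' : w ⟶ z) :
    vop (θ ≫ θ') = compTo (n := fun _ : Fin 1 => 1) (X := fun _ : Fin 1 => v.of)
      (Y := fun _ : Fin 1 => w.of)
      (oneSigma (Fin 1)) (vop θ') (fun _ => vop θ) :=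
  (precomp_precomp _ _ _).symm.trans (precomp_single (vop θ') (Iso.hom θ))

theorem vmap_id (P : Ops F k ε) (v : F.Vert) (m : ℤ) (x : (P.obj v.of).X m) :
    P.vmap (𝟙 v) m x = x :=
  (P.act_congr (vop_id v) _ ((F.degree.deg_one _).le.trans (Nat.zero_le 1)) _ _ _
    (by rw [show deg (F.one v.of) = 0 from F.degree.deg_one _]; simp) _).trans (P.isOp.act_one _ _ _ _ _)

theorem vmap_comp (P : Ops F k ε) {v w z : F.Vert} (θ : v ⟶ w) (θ' : w ⟶ z) (m : ℤ)
    (x : (P.obj v.of).X m) : P.vmap (θ ≫ θ') m x = P.vmap θ' m (P.vmap θ m x) := by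
  have hd : deg (vop (θ ≫ θ')) = 0 := deg_vop _
  rw [vop_comp] at hd
  refine (P.act_congr (vop_comp θ θ') _ (by rw [hd]; exact Nat.zero_le 1) _ _ _
    (by simp [hd]) _).trans ?_
  refine (P.isOp.act_comp (n := fun _ : Fin 1 => 1) (X := fun _ : Fin 1 => v.of)
    (Y := fun _ : Fin 1 => w.of) (oneSigma (Fin 1)) (vop θ') (fun _ => vop θ)
    (by rw [deg_vop]; exact Nat.zero_le 1) (fun _ => by rw [deg_vop]; exact Nat.zero_le 1)
    _ (fun _ => m) (fun _ => m) m (by simp [deg_vop]) (by simp [deg_vop]) _ _).trans ?_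
  rw [RawOp.act₂, koszul_oneSigma, sgn_zero, one_smul]
  rfl

theorem vmap_d (P : Ops F k ε) {v w : F.Vert} (θ : v ⟶ w) (m m' : ℤ) (hm : m + 1 = m')
    (x : (P.obj v.of).X m) :
    ((P.obj w.of).d m m').hom (P.vmap θ m x) = P.vmap θ m' (((P.obj v.of).d m m').hom x) := by
  subst hm
  refine (P.isOp.d_act (vop θ) _ (fun _ => m) m (m + 1) rfl _ (by simp [deg_vop, bump]) _).trans ?_
  have h0 : sgn k (ε.shift (deg (vop θ))) = 1 := by
    rw [deg_vop, Parity.shift_zero, sgn_zero]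
  rw [h0, one_smul, Fintype.sum_unique]
  have h1 : sgn k (∑ j : Fin 1, if j < default then (fun _ => m) j else 0) = 1 := by
    simp [sgn_zero]
  rw [h1, one_smul]
  have h2 : ∀ (q : Fin 1 → ℤ) (hq : ∀ j, q j = m + 1) (h : ∑ i, q i + ε.shift (deg (vop θ)) = m + 1)
      (y : ∀ j, (P.obj v.of).X (q j)) (z : (P.obj v.of).X (m + 1))
      (_ : ((P.obj v.of).XIsoOfEq (hq 0)).hom.hom (y 0) = z)
      (ha : deg (vop θ) ≤ 1), P.act (vop θ) ha q (m + 1) h y = P.vmap θ (m + 1) z := by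
    intro q hq h y z hy ha
    have : q = fun _ => m + 1 := funext hq
    subst this
    rw [vmap_apply]
    congr 1
    funext j
    rw [← hy, Subsingleton.elim j 0]
    simp [HomologicalComplex.XIsoOfEq]
  refine h2 _ (fun j => ?_) _ _ _ ?_ _
  · rw [Subsingleton.elim j default]; simp [bump]
  · have h3 : ∀ (r : ℤ) (hr : r = m + 1), ((P.obj v.of).XIsoOfEq hr).hom.hom
        (((P.obj v.of).d m r).hom x) = ((P.obj v.of).d m (m + 1)).hom x := by
      intro r hr; subst hr; simp [HomologicalComplex.XIsoOfEq]
    exact h3 _ _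

/-- The underlying `V`-module of an operad. -/
noncomputable def under (P : Ops F k ε) : VMod F k where
  obj v := P.obj v.of
  map θ :=
    { f := fun m => ModuleCat.ofHom (P.vmap θ m)
      comm' := fun m m' h => by
        ext x
        exact (P.vmap_d θ m m' h x) }
  map_id v := by
    ext m x
    exact P.vmap_id v m x
  map_comp θ θ' := by
    ext m x
    exact P.vmap_comp θ θ' m x

end Ops

section Free

variable {F : CubicalFeynmanCat.{u}}

/-- Formal expressions in generators from the `V`-module `E`, linear combinations, differentials and
structure maps. -/
inductive OpTerm (E : VMod F k) (ε : Parity) : F.V → ℤ → Type u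
  | gen {v : F.V} {m : ℤ} (x : (E.obj ⟨v⟩).X m) : OpTerm E ε v m
  | zero {v : F.V} {m : ℤ} : OpTerm E ε v m
  | add {v : F.V} {m : ℤ} (s t : OpTerm E ε v m) : OpTerm E ε v m
  | smul {v : F.V} {m : ℤ} (c : k) (t : OpTerm E ε v m) : OpTerm E ε v m
  | d {v : F.V} {m m' : ℤ} (h : m + 1 = m') (t : OpTerm E ε v m) : OpTerm E ε v m'
  | node {n : ℕ} {X : Fin n → F.V} {v : F.V} (a : F.Op X v) (ha : deg a ≤ 1)
      (p : Fin n → ℤ) (m : ℤ) (h : ∑ i, p i + ε.shift (deg a) = m)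
      (x : ∀ i, OpTerm E ε (X i) (p i)) : OpTerm E ε v m

namespace OpTerm

variable {E : VMod F k} {ε : Parity}

/-- A finite sum of expressions. -/
def sum {v : F.V} {m : ℤ} {n : ℕ} (t : Fin n → OpTerm E ε v m) : OpTerm E ε v m :=
  (List.ofFn t).foldr add zero

/-- A tuple of expressions with the `i`-th one differentiated. -/
def dAt {n : ℕ} {X : Fin n → F.V} {p : Fin n → ℤ} (x : ∀ j, OpTerm E ε (X j) (p j))
    (i j : Fin n) : OpTerm E ε (X j) (bump p i j) :=
  if h : j = i then d (show p j + 1 = bump p i j by simp [bump, h]) (x j)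
  else (show p j = bump p i j by simp [bump, h]) ▸ x j

/-- The composite of structure maps, as an expression. -/
def node₂ {m N : ℕ} {n : Fin m → ℕ} (e : (Σ j, Fin (n j)) ≃ Fin N)
    {X : Fin N → F.V} {Y : Fin m → F.V} {v : F.V} (b : F.Op Y v)
    (a : ∀ j, F.Op (fun i => X (e ⟨j, i⟩)) (Y j)) (hb : deg b ≤ 1) (ha : ∀ j, deg (a j) ≤ 1)
    (p : Fin N → ℤ) (q : Fin m → ℤ) (r : ℤ)
    (hq : ∀ j, ∑ i, p (e ⟨j, i⟩) + ε.shift (deg (a j)) = q j)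
    (hr : ∑ j, q j + ε.shift (deg b) = r) (x : ∀ t, OpTerm E ε (X t) (p t)) : OpTerm E ε v r :=
  smul (sgn k (koszul e p (fun j => ε.shift (deg (a j)))))
    (node b hb q r hr (fun j =>
      node (a j) (ha j) (fun i => p (e ⟨j, i⟩)) (q j) (hq j) (fun i => x (e ⟨j, i⟩))))

/-- The congruence generated by the laws of vector spaces and complexes, the relations of `E`, and
the axioms of operads. -/
inductive Rel : ∀ {v : F.V} {m : ℤ}, OpTerm E ε v m → OpTerm E ε v m → Prop
  | refl {v : F.V} {m : ℤ} (t : OpTerm E ε v m) : Rel t t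
  | symm {v : F.V} {m : ℤ} {s t : OpTerm E ε v m} : Rel s t → Rel t s
  | trans {v : F.V} {m : ℤ} {s t r : OpTerm E ε v m} : Rel s t → Rel t r → Rel s r
  | add_congr {v : F.V} {m : ℤ} {s s' t t' : OpTerm E ε v m} :
      Rel s s' → Rel t t' → Rel (add s t) (add s' t')
  | smul_congr {v : F.V} {m : ℤ} (c : k) {t t' : OpTerm E ε v m} :
      Rel t t' → Rel (smul c t) (smul c t')
  | d_congr {v : F.V} {m m' : ℤ} (h : m + 1 = m') {t t' : OpTerm E ε v m} :
      Rel t t' → Rel (d h t) (d h t')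
  | node_congr {n : ℕ} {X : Fin n → F.V} {v : F.V} (a : F.Op X v) (ha : deg a ≤ 1)
      (p : Fin n → ℤ) (m : ℤ) (h : ∑ i, p i + ε.shift (deg a) = m)
      {x y : ∀ i, OpTerm E ε (X i) (p i)} :
      (∀ i, Rel (x i) (y i)) → Rel (node a ha p m h x) (node a ha p m h y)
  | add_assoc {v : F.V} {m : ℤ} (s t r : OpTerm E ε v m) :
      Rel (add (add s t) r) (add s (add t r))
  | add_comm {v : F.V} {m : ℤ} (s t : OpTerm E ε v m) : Rel (add s t) (add t s)
  | zero_add {v : F.V} {m : ℤ} (t : OpTerm E ε v m) : Rel (add zero t) t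
  | neg_add {v : F.V} {m : ℤ} (t : OpTerm E ε v m) : Rel (add (smul (-1) t) t) zero
  | smul_add {v : F.V} {m : ℤ} (c : k) (s t : OpTerm E ε v m) :
      Rel (smul c (add s t)) (add (smul c s) (smul c t))
  | add_smul {v : F.V} {m : ℤ} (c c' : k) (t : OpTerm E ε v m) :
      Rel (smul (c + c') t) (add (smul c t) (smul c' t))
  | mul_smul {v : F.V} {m : ℤ} (c c' : k) (t : OpTerm E ε v m) :
      Rel (smul (c * c') t) (smul c (smul c' t))
  | one_smul {v : F.V} {m : ℤ} (t : OpTerm E ε v m) : Rel (smul 1 t) t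
  | d_add {v : F.V} {m m' : ℤ} (h : m + 1 = m') (s t : OpTerm E ε v m) :
      Rel (d h (add s t)) (add (d h s) (d h t))
  | d_smul {v : F.V} {m m' : ℤ} (h : m + 1 = m') (c : k) (t : OpTerm E ε v m) :
      Rel (d h (smul c t)) (smul c (d h t))
  | d_d {v : F.V} {m m' m'' : ℤ} (h : m + 1 = m') (h' : m' + 1 = m'') (t : OpTerm E ε v m) :
      Rel (d h' (d h t)) zero
  | gen_add {v : F.V} {m : ℤ} (x y : (E.obj ⟨v⟩).X m) : Rel (gen (x + y)) (add (gen x) (gen y))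
  | gen_smul {v : F.V} {m : ℤ} (c : k) (x : (E.obj ⟨v⟩).X m) : Rel (gen (c • x)) (smul c (gen x))
  | gen_d {v : F.V} {m m' : ℤ} (h : m + 1 = m') (x : (E.obj ⟨v⟩).X m) :
      Rel (gen (((E.obj ⟨v⟩).d m m').hom x)) (d h (gen x))
  | gen_map {v w : F.Vert} (θ : v ⟶ w) {m : ℤ} (ha : deg (vop θ) ≤ 1)
      (h : ∑ _i : Fin 1, m + ε.shift (deg (vop θ)) = m) (x : (E.obj v).X m) :
      Rel (gen (((E.map θ).f m).hom x)) (node (vop θ) ha (fun _ => m) m h (fun _ => gen x))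
  | node_add {n : ℕ} {X : Fin n → F.V} {v : F.V} (a : F.Op X v) (ha : deg a ≤ 1)
      (p : Fin n → ℤ) (m : ℤ) (h : ∑ i, p i + ε.shift (deg a) = m)
      (x : ∀ i, OpTerm E ε (X i) (p i)) (i : Fin n) (s t : OpTerm E ε (X i) (p i)) :
      Rel (node a ha p m h (Function.update x i (add s t)))
        (add (node a ha p m h (Function.update x i s)) (node a ha p m h (Function.update x i t)))
  | node_smul {n : ℕ} {X : Fin n → F.V} {v : F.V} (a : F.Op X v) (ha : deg a ≤ 1)
      (p : Fin n → ℤ) (m : ℤ) (h : ∑ i, p i + ε.shift (deg a) = m)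
      (x : ∀ i, OpTerm E ε (X i) (p i)) (i : Fin n) (c : k) (t : OpTerm E ε (X i) (p i)) :
      Rel (node a ha p m h (Function.update x i (smul c t)))
        (smul c (node a ha p m h (Function.update x i t)))
  | node_one (v : F.V) (h1 : deg (F.one v) ≤ 1) (m : ℤ)
      (h : ∑ _i : Fin 1, m + ε.shift (deg (F.one v)) = m) (x : ∀ _i : Fin 1, OpTerm E ε v m) :
      Rel (node (F.one v) h1 (fun _ => m) m h x) (x 0)
  | node_comp {m N : ℕ} {n : Fin m → ℕ} (e : (Σ j, Fin (n j)) ≃ Fin N)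
      {X : Fin N → F.V} {Y : Fin m → F.V} {v : F.V} (b : F.Op Y v)
      (a : ∀ j, F.Op (fun i => X (e ⟨j, i⟩)) (Y j)) (hb : deg b ≤ 1) (ha : ∀ j, deg (a j) ≤ 1)
      (hc : deg (compTo e b a) ≤ 1) (p : Fin N → ℤ) (q : Fin m → ℤ) (r : ℤ)
      (hq : ∀ j, ∑ i, p (e ⟨j, i⟩) + ε.shift (deg (a j)) = q j)
      (hr : ∑ j, q j + ε.shift (deg b) = r)
      (hp : ∑ t, p t + ε.shift (deg (compTo e b a)) = r) (x : ∀ t, OpTerm E ε (X t) (p t)) :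
      Rel (node (compTo e b a) hc p r hp x) (node₂ e b a hb ha p q r hq hr x)
  | node_swap {N m m' : ℕ} {n : Fin m → ℕ} {n' : Fin m' → ℕ} {X : Fin N → F.V}
      {Y : Fin m → F.V} {Y' : Fin m' → F.V} {v : F.V}
      (e : (Σ j, Fin (n j)) ≃ Fin N) (b : F.Op Y v) (a : ∀ j, F.Op (fun i => X (e ⟨j, i⟩)) (Y j))
      (e' : (Σ j, Fin (n' j)) ≃ Fin N) (b' : F.Op Y' v)
      (a' : ∀ j, F.Op (fun i => X (e' ⟨j, i⟩)) (Y' j))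
      (hb : deg b = 1) (_ : ∑ j, deg (a j) = 1) (hb' : deg b' = 1) (_ : ∑ j, deg (a' j) = 1)
      (ha₁ : ∀ j, deg (a j) ≤ 1) (ha₁' : ∀ j, deg (a' j) ≤ 1)
      (hc : compTo e b a = compTo e' b' a') (hs : ¬ ChainEquiv e b a e' b' a')
      (p : Fin N → ℤ) (q : Fin m → ℤ) (q' : Fin m' → ℤ) (r : ℤ)
      (hq : ∀ j, ∑ i, p (e ⟨j, i⟩) + ε.shift (deg (a j)) = q j)
      (hr : ∑ j, q j + ε.shift (deg b) = r)
      (hq' : ∀ j, ∑ i, p (e' ⟨j, i⟩) + ε.shift (deg (a' j)) = q' j)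
      (hr' : ∑ j, q' j + ε.shift (deg b') = r) (x : ∀ t, OpTerm E ε (X t) (p t)) :
      Rel (node₂ e b a hb.le ha₁ p q r hq hr x)
        (smul (ε.swapSign k) (node₂ e' b' a' hb'.le ha₁' p q' r hq' hr' x))
  | d_node {n : ℕ} {X : Fin n → F.V} {v : F.V} (a : F.Op X v) (ha : deg a ≤ 1)
      (p : Fin n → ℤ) (m m' : ℤ) (hm : m + 1 = m') (h : ∑ i, p i + ε.shift (deg a) = m)
      (h' : ∀ i, ∑ j, bump p i j + ε.shift (deg a) = m')
      (x : ∀ i, OpTerm E ε (X i) (p i)) :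
      Rel (d hm (node a ha p m h x)) (smul (sgn k (ε.shift (deg a)))
        (sum fun i => smul (sgn k (∑ j, if j < i then p j else 0))
          (node a ha (bump p i) m' (h' i) (fun j => dAt x i j))))

end OpTerm

variable (E : VMod F k) (ε : Parity)

/-- The homogeneous components of the free operad. -/
def FreeMod (v : F.V) (m : ℤ) : Type u := Quot (OpTerm.Rel (E := E) (ε := ε) (v := v) (m := m))

namespace FreeMod

variable {E ε}

/-- The class of an expression. -/
def mk {v : F.V} {m : ℤ} (t : OpTerm E ε v m) : FreeMod E ε v m := Quot.mk _ t

theorem mk_eq {v : F.V} {m : ℤ} {s t : OpTerm E ε v m} : mk s = mk t ↔ s.Rel t :=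
  Equivalence.quot_mk_eq_iff ⟨.refl, .symm, .trans⟩ s t

theorem mk_surjective {v : F.V} {m : ℤ} :
    Function.Surjective (mk : OpTerm E ε v m → FreeMod E ε v m) := Quot.exists_rep

variable {v : F.V} {m : ℤ}

instance : Zero (FreeMod E ε v m) := ⟨mk .zero⟩
instance : Add (FreeMod E ε v m) :=
  ⟨Quot.map₂ .add (fun _ _ _ h => .add_congr (.refl _) h) (fun _ _ _ h => .add_congr h (.refl _))⟩
instance : SMul k (FreeMod E ε v m) := ⟨fun c => Quot.map (.smul c) (fun _ _ h => .smul_congr c h)⟩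
instance : Neg (FreeMod E ε v m) := ⟨fun x => (-1 : k) • x⟩

instance : AddCommGroup (FreeMod E ε v m) :=
  { AddGroup.ofLeftAxioms (G := FreeMod E ε v m)
      (by rintro ⟨s⟩ ⟨t⟩ ⟨r⟩; exact mk_eq.2 (.add_assoc s t r))
      (by rintro ⟨t⟩; exact mk_eq.2 (.zero_add t))
      (by rintro ⟨t⟩; exact mk_eq.2 (.neg_add t)) with
    add_comm := by rintro ⟨s⟩ ⟨t⟩; exact mk_eq.2 (.add_comm s t) }

instance : Module k (FreeMod E ε v m) :=
  Module.ofMinimalAxioms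
    (by rintro c ⟨s⟩ ⟨t⟩; exact mk_eq.2 (.smul_add c s t))
    (by rintro c c' ⟨t⟩; exact mk_eq.2 (.add_smul c c' t))
    (by rintro c c' ⟨t⟩; exact mk_eq.2 (.mul_smul c c' t))
    (by rintro ⟨t⟩; exact mk_eq.2 (.one_smul t))

theorem mk_add (s t : OpTerm E ε v m) : mk (s.add t) = mk s + mk t := rfl
theorem mk_smul (c : k) (t : OpTerm E ε v m) : mk (t.smul c) = c • mk t := rfl
theorem mk_zero : mk (OpTerm.zero : OpTerm E ε v m) = 0 := rfl

theorem mk_sum {n : ℕ} (t : Fin n → OpTerm E ε v m) : mk (OpTerm.sum t) = ∑ i, mk (t i) := by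
  have : ∀ l : List (OpTerm E ε v m), mk (l.foldr OpTerm.add OpTerm.zero) = (l.map mk).sum := by
    intro l
    induction l with
    | nil => rfl
    | cons a l ih => rw [List.foldr_cons, mk_add, ih, List.map_cons, List.sum_cons]
  rw [OpTerm.sum, this, List.map_ofFn, List.sum_ofFn]
  rfl

/-- The differential. -/
def dLin {m m' : ℤ} (h : m + 1 = m') : FreeMod E ε v m →ₗ[k] FreeMod E ε v m' where
  toFun := Quot.map (.d h) (fun _ _ => .d_congr h)
  map_add' := by rintro ⟨s⟩ ⟨t⟩; exact mk_eq.2 (.d_add h s t)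
  map_smul' := by rintro c ⟨t⟩; exact mk_eq.2 (.d_smul h c t)

variable (E ε v) in
/-- The complex of the free operad at a vertex. -/
noncomputable def complex : CochainComplex (ModuleCat.{u} k) ℤ where
  X m := ModuleCat.of k (FreeMod E ε v m)
  d m m' := if h : m + 1 = m' then ModuleCat.ofHom (dLin h) else 0
  shape m m' h := dif_neg h
  d_comp_d' i j l hij hjl := by
    have hij' : i + 1 = j := hij
    have hjl' : j + 1 = l := hjl
    rw [dif_pos hij', dif_pos hjl']
    ext x
    obtain ⟨t, rfl⟩ := mk_surjective x
    exact mk_eq.2 (.d_d hij' hjl' t)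

theorem complex_d {m' : ℤ} (h : m + 1 = m') (t : OpTerm E ε v m) :
    ((complex E ε v).d m m').hom (mk t) = mk (t.d h) := by
  simp only [complex, dif_pos h]
  rfl

/-- The structure maps of the free operad. -/
noncomputable def actLin {n : ℕ} {X : Fin n → F.V} {v : F.V} (a : F.Op X v) (ha : deg a ≤ 1)
    (p : Fin n → ℤ) (m : ℤ) (h : ∑ i, p i + ε.shift (deg a) = m) :
    MultilinearMap k (fun i => FreeMod E ε (X i) (p i)) (FreeMod E ε v m) :=
  have key : ∀ (x : ∀ i, OpTerm E ε (X i) (p i)),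
      mk (.node a ha p m h fun j => (mk (x j)).out) = mk (.node a ha p m h x) := fun x =>
    mk_eq.2 (.node_congr a ha p m h fun _ => mk_eq.1 (Quot.out_eq _))
  MultilinearMap.mk' (fun x => mk (.node a ha p m h fun i => (x i).out))
    (by
      intro x i s t
      obtain ⟨x, rfl⟩ : ∃ y : ∀ i, OpTerm E ε (X i) (p i), x = fun i => mk (y i) :=
        ⟨fun i => (x i).out, funext fun _ => (Quot.out_eq _).symm⟩
      obtain ⟨s, rfl⟩ := mk_surjective s
      obtain ⟨t, rfl⟩ := mk_surjective t
      have hu : ∀ r : OpTerm E ε (X i) (p i), Function.update (fun i => mk (x i)) i (mk r) =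
          fun j => mk (Function.update x i r j) := by
        intro r; funext j
        by_cases hj : j = i
        · subst hj; simp
        · simp [hj]
      rw [← mk_add, hu, hu, hu, key, key, key]
      exact mk_eq.2 (.node_add a ha p m h x i s t))
    (by
      intro x i c t
      obtain ⟨x, rfl⟩ : ∃ y : ∀ i, OpTerm E ε (X i) (p i), x = fun i => mk (y i) :=
        ⟨fun i => (x i).out, funext fun _ => (Quot.out_eq _).symm⟩
      obtain ⟨t, rfl⟩ := mk_surjective t
      have hu : ∀ r : OpTerm E ε (X i) (p i), Function.update (fun i => mk (x i)) i (mk r) =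
          fun j => mk (Function.update x i r j) := by
        intro r; funext j
        by_cases hj : j = i
        · subst hj; simp
        · simp [hj]
      rw [← mk_smul, hu, hu, key, key]
      exact mk_eq.2 (.node_smul a ha p m h x i c t))

theorem actLin_mk {n : ℕ} {X : Fin n → F.V} {v : F.V} (a : F.Op X v) (ha : deg a ≤ 1)
    (p : Fin n → ℤ) (m : ℤ) (h : ∑ i, p i + ε.shift (deg a) = m)
    (x : ∀ i, OpTerm E ε (X i) (p i)) :
    actLin a ha p m h (fun i => mk (x i)) = mk (.node a ha p m h x) :=
  mk_eq.2 (.node_congr a ha p m h fun _ => mk_eq.1 (Quot.out_eq _))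

theorem exists_mk {n : ℕ} {X : Fin n → F.V} {p : Fin n → ℤ}
    (x : ∀ i, FreeMod E ε (X i) (p i)) :
    ∃ y : ∀ i, OpTerm E ε (X i) (p i), x = fun i => mk (y i) :=
  ⟨fun i => (x i).out, funext fun _ => (Quot.out_eq _).symm⟩

end FreeMod

/-- The free operad, without its axioms. -/
noncomputable def freeRaw : RawOp F k ε where
  obj := FreeMod.complex E ε
  act a ha p m h := FreeMod.actLin a ha p m h

variable {E ε}

theorem freeRaw_act {n : ℕ} {X : Fin n → F.V} {v : F.V} (a : F.Op X v) (ha : deg a ≤ 1)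
    (p : Fin n → ℤ) (m : ℤ) (h : ∑ i, p i + ε.shift (deg a) = m)
    (x : ∀ i, OpTerm E ε (X i) (p i)) :
    (freeRaw E ε).act a ha p m h (fun i => FreeMod.mk (x i)) = FreeMod.mk (.node a ha p m h x) :=
  FreeMod.actLin_mk a ha p m h x

theorem freeRaw_act₂ {m N : ℕ} {n : Fin m → ℕ} (e : (Σ j, Fin (n j)) ≃ Fin N)
    {X : Fin N → F.V} {Y : Fin m → F.V} {v : F.V} (b : F.Op Y v)
    (a : ∀ j, F.Op (fun i => X (e ⟨j, i⟩)) (Y j)) (hb : deg b ≤ 1) (ha : ∀ j, deg (a j) ≤ 1)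
    (p : Fin N → ℤ) (q : Fin m → ℤ) (r : ℤ)
    (hq : ∀ j, ∑ i, p (e ⟨j, i⟩) + ε.shift (deg (a j)) = q j)
    (hr : ∑ j, q j + ε.shift (deg b) = r) (x : ∀ t, OpTerm E ε (X t) (p t)) :
    (freeRaw E ε).act₂ e b a hb ha p q r hq hr (fun t => FreeMod.mk (x t)) =
      FreeMod.mk (.node₂ e b a hb ha p q r hq hr x) := by
  have h := Eq.trans (congrArg ((freeRaw E ε).act b hb q r hr)
    (funext fun j => freeRaw_act (a j) (ha j) (fun i => p (e ⟨j, i⟩)) (q j) (hq j)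
      (fun i => x (e ⟨j, i⟩)))) (freeRaw_act b hb q r hr _)
  exact congrArg (fun z : FreeMod E ε v r =>
    sgn k (koszul e p (fun j => ε.shift (deg (a j)))) • z) h

theorem freeRaw_dAt {n : ℕ} {X : Fin n → F.V} {p : Fin n → ℤ} (x : ∀ j, OpTerm E ε (X j) (p j))
    (i j : Fin n) : dAt (fun j => (freeRaw E ε).obj (X j)) (fun j => FreeMod.mk (x j)) i j =
      FreeMod.mk (OpTerm.dAt x i j) := by
  unfold dAt OpTerm.dAt
  split_ifs with h
  · exact FreeMod.complex_d _ _
  · have : ∀ (r : ℤ) (hr : p j = r), (((freeRaw E ε).obj (X j)).XIsoOfEq hr).hom.hom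
        (FreeMod.mk (x j)) = FreeMod.mk (hr ▸ x j) := by
      intro r hr; subst hr; simp [HomologicalComplex.XIsoOfEq]; rfl
    exact this _ _

theorem freeRaw_isOp : (freeRaw E ε).IsOp where
  act_one v h1 m h x := by
    obtain ⟨x, rfl⟩ := FreeMod.exists_mk x
    exact (freeRaw_act _ _ _ _ _ _).trans (FreeMod.mk_eq.2 (.node_one v h1 m h x))
  act_comp := by
    intro m N n e X Y v b a hb ha hc p q r hq hr hp x
    obtain ⟨x, rfl⟩ := FreeMod.exists_mk x
    refine (freeRaw_act _ _ _ _ _ _).trans (Eq.trans ?_ (freeRaw_act₂ _ _ _ _ _ _ _ _ _ _ _).symm)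
    exact FreeMod.mk_eq.2 (.node_comp e b a hb ha hc p q r hq hr hp x)
  act_swap := by
    intro N m m' n n' X Y Y' v e b a e' b' a' hb ha hb' ha' ha₁ ha₁' hc hs p q q' r hq hr hq' hr' x
    obtain ⟨x, rfl⟩ := FreeMod.exists_mk x
    refine (freeRaw_act₂ _ _ _ _ _ _ _ _ _ _ _).trans (Eq.trans ?_
      (congrArg (fun z : FreeMod E ε v r => ε.swapSign k • z) (freeRaw_act₂ _ _ _ _ _ _ _ _ _ _ _).symm))
    exact FreeMod.mk_eq.2
      (.node_swap e b a e' b' a' hb ha hb' ha' ha₁ ha₁' hc hs p q q' r hq hr hq' hr' x)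
  d_act := by
    intro n X v a ha p m m' hm h h' x
    obtain ⟨x, rfl⟩ := FreeMod.exists_mk x
    refine Eq.trans (congrArg _ (freeRaw_act a ha p m h x)) ?_
    refine (FreeMod.complex_d hm _).trans ?_
    refine (FreeMod.mk_eq.2 (.d_node a ha p m m' hm h h' x)).trans ?_
    rw [FreeMod.mk_smul, FreeMod.mk_sum]
    refine congrArg (fun z : FreeMod E ε v m' => sgn k (ε.shift (deg a)) • z) (Finset.sum_congr rfl fun i _ => ?_)
    have h2 := (freeRaw_act a ha (bump p i) m' (h' i) (fun j => OpTerm.dAt x i j)).symm.trans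
      (congrArg _ (funext fun j => (freeRaw_dAt x i j).symm))
    exact congrArg (fun z : FreeMod E ε v m' => sgn k (∑ j, if j < i then p j else 0) • z) h2

variable (E ε) in
/-- The free operad `F_ε(E)` generated by a `V`-module `E`. -/
noncomputable def Ops.free : Ops F k ε := ⟨freeRaw E ε, freeRaw_isOp⟩

namespace Ops

/-- The inclusion of generators. -/
noncomputable def unit : E ⟶ (free E ε).under where
  app v :=
    { f := fun m => ModuleCat.ofHom (X := (E.obj v).X m)
        (Y := ((free E ε).obj v.of).X m)
        { toFun := fun x => FreeMod.mk (.gen (v := v.of) x)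
          map_add' := fun x y => FreeMod.mk_eq.2 (.gen_add x y)
          map_smul' := fun c x => FreeMod.mk_eq.2 (.gen_smul c x) }
      comm' := fun m m' h => by
        ext x
        exact (FreeMod.complex_d h (.gen (v := v.of) x)).trans
          (FreeMod.mk_eq.2 (.symm (.gen_d h x))) }
  naturality v w θ := by
    ext m x
    refine (FreeMod.mk_eq.2 (.gen_map (ε := ε) θ _ _ x)).trans
      (freeRaw_act (vop θ) ((deg_vop θ).le.trans (Nat.zero_le 1)) (fun _ => m) m (by simp [deg_vop])
        (fun _ => .gen (v := v.of) x)).symm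

section lift

variable {P : Ops F k ε} (f : E ⟶ P.under)

/-- The value of an expression in an operad `P`. -/
noncomputable def eval : ∀ {v : F.V} {m : ℤ}, OpTerm E ε v m → (P.obj v).X m
  | v, m, .gen x => ((f.app ⟨v⟩).f m).hom x
  | _, _, .zero => 0
  | _, _, .add s t => eval s + eval t
  | _, _, .smul c t => c • eval t
  | v, m', .d (m := m) _ t => ((P.obj v).d m m').hom (eval t)
  | _, m, .node a ha p _ h x => P.act a ha p m h (fun i => eval (x i))

theorem eval_sum {v : F.V} {m : ℤ} {n : ℕ} (t : Fin n → OpTerm E ε v m) :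
    eval f (OpTerm.sum t) = ∑ i, eval f (t i) := by
  have : ∀ l : List (OpTerm E ε v m), eval f (l.foldr OpTerm.add OpTerm.zero) =
      (l.map (eval f)).sum := by
    intro l
    induction l with
    | nil => rfl
    | cons a l ih => rw [List.foldr_cons, List.map_cons, List.sum_cons, ← ih]; rfl
  rw [OpTerm.sum, this, List.map_ofFn, List.sum_ofFn]
  rfl

theorem eval_node₂ {m N : ℕ} {n : Fin m → ℕ} (e : (Σ j, Fin (n j)) ≃ Fin N)
    {X : Fin N → F.V} {Y : Fin m → F.V} {v : F.V} (b : F.Op Y v)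
    (a : ∀ j, F.Op (fun i => X (e ⟨j, i⟩)) (Y j)) (hb : deg b ≤ 1) (ha : ∀ j, deg (a j) ≤ 1)
    (p : Fin N → ℤ) (q : Fin m → ℤ) (r : ℤ)
    (hq : ∀ j, ∑ i, p (e ⟨j, i⟩) + ε.shift (deg (a j)) = q j)
    (hr : ∑ j, q j + ε.shift (deg b) = r) (x : ∀ t, OpTerm E ε (X t) (p t)) :
    eval f (.node₂ e b a hb ha p q r hq hr x) =
      P.act₂ e b a hb ha p q r hq hr (fun t => eval f (x t)) := rfl

theorem eval_dAt {n : ℕ} {X : Fin n → F.V} {p : Fin n → ℤ} (x : ∀ j, OpTerm E ε (X j) (p j))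
    (i j : Fin n) : eval f (OpTerm.dAt x i j) =
      dAt (fun j => P.obj (X j)) (fun j => eval f (x j)) i j := by
  unfold dAt OpTerm.dAt
  split_ifs with h
  · rfl
  · have : ∀ (r : ℤ) (hr : p j = r), eval f (hr ▸ x j) =
        ((P.obj (X j)).XIsoOfEq hr).hom.hom (eval f (x j)) := by
      intro r hr; subst hr; simp [HomologicalComplex.XIsoOfEq]
    exact this _ _

theorem eval_update {n : ℕ} {X : Fin n → F.V} {p : Fin n → ℤ} (x : ∀ j, OpTerm E ε (X j) (p j))
    (i : Fin n) (t : OpTerm E ε (X i) (p i)) :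
    (fun j => eval f (Function.update x i t j)) =
      Function.update (fun j => eval f (x j)) i (eval f t) := by
  funext j
  by_cases hj : j = i
  · subst hj; simp
  · simp [hj]

theorem eval_rel {v : F.V} {m : ℤ} {s t : OpTerm E ε v m} (h : s.Rel t) : eval f s = eval f t := by
  induction h with
  | refl => rfl
  | symm _ ih => exact ih.symm
  | trans _ _ ih ih' => exact ih.trans ih'
  | add_congr _ _ ih ih' => exact congrArg₂ (· + ·) ih ih'
  | smul_congr c _ ih => exact congrArg (c • ·) ih
  | @d_congr v m m' h t t' _ ih => exact congrArg ((P.obj v).d m m').hom ih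
  | node_congr a ha p m h _ ih => exact congrArg (P.act a ha p m h) (funext ih)
  | add_assoc => exact add_assoc _ _ _
  | add_comm => exact add_comm _ _
  | zero_add => exact zero_add _
  | neg_add t => exact (congrArg (· + eval f t) (neg_one_smul k (eval f t))).trans (neg_add_cancel _)
  | smul_add => exact smul_add _ _ _
  | add_smul => exact add_smul _ _ _
  | mul_smul => exact mul_smul _ _ _
  | one_smul => exact one_smul _ _
  | d_add => exact map_add _ _ _
  | d_smul => exact map_smul _ _ _
  | @d_d v m m' m'' h h' t =>
      exact congrArg (fun g : (P.obj v).X m ⟶ (P.obj v).X m'' => g.hom (eval f t))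
        ((P.obj v).d_comp_d m m' m'')
  | gen_add => exact map_add _ _ _
  | gen_smul => exact map_smul _ _ _
  | @gen_d v m m' h x =>
      exact congrArg (fun g : (E.obj ⟨v⟩).X m ⟶ (P.obj v).X m' => g.hom x)
        ((f.app ⟨v⟩).comm m m').symm
  | @gen_map v w θ m ha h x =>
      exact congrArg (fun g : E.obj v ⟶ P.under.obj w => (g.f m).hom x) (f.naturality θ)
  | node_add a ha p m h x i s t =>
      change P.act a ha p m h (fun j => eval f (Function.update x i (OpTerm.add s t) j)) =
        P.act a ha p m h (fun j => eval f (Function.update x i s j)) +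
        P.act a ha p m h (fun j => eval f (Function.update x i t j))
      rw [eval_update, eval_update, eval_update]
      exact MultilinearMap.map_update_add _ _ _ _ _
  | node_smul a ha p m h x i c t =>
      change P.act a ha p m h (fun j => eval f (Function.update x i (OpTerm.smul c t) j)) =
        c • P.act a ha p m h (fun j => eval f (Function.update x i t j))
      rw [eval_update, eval_update]
      exact MultilinearMap.map_update_smul _ _ _ _ _
  | node_one v h1 m h x => exact P.isOp.act_one v h1 m h _
  | node_comp e b a hb ha hc p q r hq hr hp x =>
      exact P.isOp.act_comp e b a hb ha hc p q r hq hr hp _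
  | node_swap e b a e' b' a' hb ha hb' ha' ha₁ ha₁' hc hs p q q' r hq hr hq' hr' x =>
      exact P.isOp.act_swap e b a e' b' a' hb ha hb' ha' ha₁ ha₁' hc hs p q q' r hq hr hq' hr'
        (fun t => eval f (x t))
  | @d_node n X v a ha p m m' hm h h' x =>
      refine (P.isOp.d_act a ha p m m' hm h h' _).trans ?_
      refine congrArg (sgn k (ε.shift (deg a)) • ·) ((eval_sum f _).trans ?_).symm
      refine Finset.sum_congr rfl fun i _ => ?_
      refine congrArg (sgn k (∑ j, if j < i then p j else 0) • ·) ?_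
      exact congrArg _ (funext fun j => eval_dAt f x i j)

/-- The morphism of operads induced by a morphism of `V`-modules. -/
noncomputable def lift : free E ε ⟶ P where
  app v :=
    { f := fun m => ModuleCat.ofHom (X := ((free E ε).obj v).X m)
        { toFun := fun x => Quot.lift (eval f) (fun _ _ => eval_rel f) x
          map_add' := by rintro ⟨s⟩ ⟨t⟩; rfl
          map_smul' := by rintro c ⟨s⟩; rfl }
      comm' := by
        intro m m' h
        ext x
        obtain ⟨x, rfl⟩ := FreeMod.mk_surjective x
        exact (congrArg (Quot.lift (eval f) (fun _ _ => eval_rel f))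
          (FreeMod.complex_d h x)).symm }
  map_act := by
    intro n X v a ha p m h x
    obtain ⟨x, rfl⟩ := FreeMod.exists_mk x
    exact congrArg (Quot.lift (eval f) (fun _ _ => eval_rel f)) (freeRaw_act a ha p m h x)

theorem lift_mk {v : F.V} {m : ℤ} (t : OpTerm E ε v m) :
    (((lift f).app v).f m).hom (FreeMod.mk t) = eval f t := rfl

end lift

end Ops

end Free

section Ideals

theorem multilinear_congr {n : ℕ} {M : Fin n → Type u} [∀ i, AddCommGroup (M i)]
    [∀ i, Module k (M i)] {N : Type u} [AddCommGroup N] [Module k N] (I : ∀ i, Submodule k (M i))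
    (g : MultilinearMap k M N) (hg : ∀ x i, x i ∈ I i → g x = 0) (x y : ∀ i, M i)
    (h : ∀ i, x i - y i ∈ I i) : g x = g y := by
  have : ∀ s : Finset (Fin n), g (s.piecewise x y) = g y := by
    intro s
    induction s using Finset.induction_on with
    | empty => simp
    | insert a s ha ih =>
      rw [← ih, Finset.piecewise_insert, ← sub_eq_zero]
      conv_lhs => rw [← Function.update_eq_self a (s.piecewise x y), Function.update_idem,
        ← MultilinearMap.map_update_sub]
      refine hg _ a ?_
      rw [Function.update_self, Finset.piecewise_eq_of_notMem _ _ _ ha]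
      exact h a
  simpa using this Finset.univ

variable {F : CubicalFeynmanCat.{u}} {ε : Parity}

/-- Ideals of an operad: subspaces closed under the differential, such that a structure map sends a
tuple with at least one entry in the ideal to the ideal. -/
@[ext]
structure OpIdeal (P : Ops F k ε) where
  carrier : ∀ (v : F.V) (m : ℤ), Submodule k ((P.obj v).X m)
  d_mem : ∀ {v : F.V} {m m' : ℤ} {x : (P.obj v).X m}, x ∈ carrier v m →
    ((P.obj v).d m m').hom x ∈ carrier v m'
  act_mem : ∀ {n : ℕ} {X : Fin n → F.V} {v : F.V} (a : F.Op X v) (ha : deg a ≤ 1)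
    (p : Fin n → ℤ) (m : ℤ) (h : ∑ i, p i + ε.shift (deg a) = m)
    (x : ∀ i, (P.obj (X i)).X (p i)) (i : Fin n), x i ∈ carrier (X i) (p i) →
      P.act a ha p m h x ∈ carrier v m

namespace OpIdeal

variable {P Q : Ops F k ε}

/-- The ideal generated by a family of subspaces. -/
def span (S : ∀ (v : F.V) (m : ℤ), Submodule k ((P.obj v).X m)) : OpIdeal P where
  carrier v m :=
    { carrier := {x | ∀ I : OpIdeal P, (∀ w n, S w n ≤ I.carrier w n) → x ∈ I.carrier v m}
      add_mem' := fun hx hy I hI => add_mem (hx I hI) (hy I hI)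
      zero_mem' := fun _ _ => zero_mem _
      smul_mem' := fun c _ hx I hI => Submodule.smul_mem _ c (hx I hI) }
  d_mem hx I hI := I.d_mem (hx I hI)
  act_mem a ha p m h x i hx I hI := I.act_mem a ha p m h x i (hx I hI)

/-- The kernel of a morphism of operads. -/
def ker (f : P ⟶ Q) : OpIdeal P where
  carrier v m := LinearMap.ker ((RawOp.Hom.app f v).f m).hom
  d_mem {v m m' x} hx := by
    have := congrArg (fun g : (P.obj v).X m ⟶ (Q.obj v).X m' => g.hom x)
      ((RawOp.Hom.app f v).comm m m')
    have hx' : ((RawOp.Hom.app f v).f m).hom x = 0 := hx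
    refine LinearMap.mem_ker.2 (this.symm.trans ?_)
    exact (congrArg ((Q.obj v).d m m').hom hx').trans (map_zero _)
  act_mem a ha p m h x i hx :=
    (RawOp.Hom.map_act f a ha p m h x).trans (MultilinearMap.map_coord_zero _ i hx)

variable (I : OpIdeal P)

/-- The quotient complexes. -/
noncomputable def complex (v : F.V) : CochainComplex (ModuleCat.{u} k) ℤ where
  X m := ModuleCat.of k ((P.obj v).X m ⧸ I.carrier v m)
  d m m' := ModuleCat.ofHom
    (Submodule.mapQ _ _ ((P.obj v).d m m').hom (fun _ hx => I.d_mem hx))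
  shape m m' h := by
    have h0 := (P.obj v).shape m m' h
    ext x
    exact congrArg (fun g : (P.obj v).X m ⟶ (P.obj v).X m' =>
      (Submodule.Quotient.mk (g.hom x) : (P.obj v).X m' ⧸ I.carrier v m')) h0
  d_comp_d' i j l hij hjl := by
    ext x
    exact congrArg (fun g : (P.obj v).X i ⟶ (P.obj v).X l =>
      (Submodule.Quotient.mk (g.hom x) : (P.obj v).X l ⧸ I.carrier v l))
        ((P.obj v).d_comp_d i j l)

/-- The projection to the quotient. -/
def proj (v : F.V) (m : ℤ) : (P.obj v).X m →ₗ[k] (I.complex v).X m := (I.carrier v m).mkQ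

theorem proj_surjective (v : F.V) (m : ℤ) : Function.Surjective (I.proj v m) :=
  Submodule.mkQ_surjective _

theorem proj_act {n : ℕ} {X : Fin n → F.V} {v : F.V} (a : F.Op X v) (ha : deg a ≤ 1)
    (p : Fin n → ℤ) (m : ℤ) (h : ∑ i, p i + ε.shift (deg a) = m)
    (x y : ∀ i, (P.obj (X i)).X (p i)) (hxy : ∀ i, I.proj (X i) (p i) (x i) = I.proj _ _ (y i)) :
    I.proj v m (P.act a ha p m h x) = I.proj v m (P.act a ha p m h y) :=
  multilinear_congr (fun i => I.carrier (X i) (p i))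
    ((I.proj v m).compMultilinearMap (P.act a ha p m h))
    (fun x i hx => (Submodule.Quotient.mk_eq_zero _).2 (I.act_mem a ha p m h x i hx)) x y
    (fun i => (Submodule.Quotient.eq _).1 (hxy i))

/-- Representatives. -/
noncomputable def rep {n : ℕ} {X : Fin n → F.V} {p : Fin n → ℤ}
    (x : ∀ i, (I.complex (X i)).X (p i)) (i : Fin n) : (P.obj (X i)).X (p i) :=
  (I.proj_surjective (X i) (p i) (x i)).choose

theorem proj_rep {n : ℕ} {X : Fin n → F.V} {p : Fin n → ℤ}
    (x : ∀ i, (I.complex (X i)).X (p i)) (i : Fin n) : I.proj _ _ (I.rep x i) = x i :=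
  (I.proj_surjective (X i) (p i) (x i)).choose_spec

theorem exists_rep {n : ℕ} {X : Fin n → F.V} {p : Fin n → ℤ}
    (x : ∀ i, (I.complex (X i)).X (p i)) :
    ∃ y : ∀ i, (P.obj (X i)).X (p i), x = fun i => I.proj _ _ (y i) :=
  ⟨I.rep x, funext fun i => (I.proj_rep x i).symm⟩

theorem proj_update {n : ℕ} {X : Fin n → F.V} {p : Fin n → ℤ}
    (x : ∀ i, (P.obj (X i)).X (p i)) (i : Fin n) (t : (P.obj (X i)).X (p i)) :
    Function.update (fun j => I.proj _ _ (x j)) i (I.proj _ _ t) =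
      fun j => I.proj _ _ (Function.update x i t j) := by
  funext j
  by_cases hj : j = i
  · subst hj; simp
  · simp [hj]

/-- The quotient operad, without its axioms. -/
noncomputable def quotRaw : RawOp F k ε where
  obj := I.complex
  act {n X v} a ha p m h :=
    have key : ∀ x : ∀ i, (P.obj (X i)).X (p i),
        I.proj v m (P.act a ha p m h (I.rep fun i => I.proj _ _ (x i))) =
          I.proj v m (P.act a ha p m h x) := fun x =>
      I.proj_act a ha p m h _ _ fun i => I.proj_rep (fun i => I.proj _ _ (x i)) i
    MultilinearMap.mk' (fun x => I.proj v m (P.act a ha p m h (I.rep x)))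
      (by
        intro x i s t
        obtain ⟨x, rfl⟩ := I.exists_rep x
        obtain ⟨s, rfl⟩ := I.proj_surjective _ _ s
        obtain ⟨t, rfl⟩ := I.proj_surjective _ _ t
        rw [← map_add, proj_update, proj_update, proj_update, key, key, key, ← map_add,
          MultilinearMap.map_update_add])
      (by
        intro x i c t
        obtain ⟨x, rfl⟩ := I.exists_rep x
        obtain ⟨t, rfl⟩ := I.proj_surjective _ _ t
        rw [← map_smul, proj_update, proj_update, key, key, ← map_smul,
          MultilinearMap.map_update_smul])

theorem quotRaw_act {n : ℕ} {X : Fin n → F.V} {v : F.V} (a : F.Op X v) (ha : deg a ≤ 1)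
    (p : Fin n → ℤ) (m : ℤ) (h : ∑ i, p i + ε.shift (deg a) = m)
    (x : ∀ i, (P.obj (X i)).X (p i)) :
    I.quotRaw.act a ha p m h (fun i => I.proj _ _ (x i)) = I.proj v m (P.act a ha p m h x) :=
  I.proj_act a ha p m h _ _ fun i => I.proj_rep (fun i => I.proj _ _ (x i)) i

theorem quotRaw_act₂ {m N : ℕ} {n : Fin m → ℕ} (e : (Σ j, Fin (n j)) ≃ Fin N)
    {X : Fin N → F.V} {Y : Fin m → F.V} {v : F.V} (b : F.Op Y v)
    (a : ∀ j, F.Op (fun i => X (e ⟨j, i⟩)) (Y j)) (hb : deg b ≤ 1) (ha : ∀ j, deg (a j) ≤ 1)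
    (p : Fin N → ℤ) (q : Fin m → ℤ) (r : ℤ)
    (hq : ∀ j, ∑ i, p (e ⟨j, i⟩) + ε.shift (deg (a j)) = q j)
    (hr : ∑ j, q j + ε.shift (deg b) = r) (x : ∀ t, (P.obj (X t)).X (p t)) :
    I.quotRaw.act₂ e b a hb ha p q r hq hr (fun t => I.proj _ _ (x t)) =
      I.proj v r (P.act₂ e b a hb ha p q r hq hr x) := by
  have h := Eq.trans (congrArg (I.quotRaw.act b hb q r hr)
    (funext fun j => I.quotRaw_act (a j) (ha j) (fun i => p (e ⟨j, i⟩)) (q j) (hq j)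
      (fun i => x (e ⟨j, i⟩)))) (I.quotRaw_act b hb q r hr _)
  exact (congrArg (fun z : (I.complex v).X r =>
    sgn k (koszul e p (fun j => ε.shift (deg (a j)))) • z) h).trans (map_smul _ _ _).symm

theorem proj_d {v : F.V} {m m' : ℤ} (x : (P.obj v).X m) :
    ((I.complex v).d m m').hom (I.proj v m x) = I.proj v m' (((P.obj v).d m m').hom x) := rfl

theorem quotRaw_dAt {n : ℕ} {X : Fin n → F.V} {p : Fin n → ℤ} (x : ∀ j, (P.obj (X j)).X (p j))
    (i j : Fin n) : dAt (fun j => I.complex (X j)) (fun j => I.proj _ _ (x j)) i j =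
      I.proj _ _ (dAt (fun j => P.obj (X j)) x i j) := by
  unfold dAt
  split_ifs with h
  · rfl
  · have : ∀ (r : ℤ) (hr : p j = r), ((I.complex (X j)).XIsoOfEq hr).hom.hom
        (I.proj _ _ (x j)) = I.proj _ _ (((P.obj (X j)).XIsoOfEq hr).hom.hom (x j)) := by
      intro r hr; subst hr; simp [HomologicalComplex.XIsoOfEq]
    exact this _ _

theorem quotRaw_isOp : I.quotRaw.IsOp where
  act_one v h1 m h x := by
    obtain ⟨x, rfl⟩ := I.exists_rep x
    exact (I.quotRaw_act _ _ _ _ _ _).trans (congrArg _ (P.isOp.act_one v h1 m h x))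
  act_comp := by
    intro m N n e X Y v b a hb ha hc p q r hq hr hp x
    obtain ⟨x, rfl⟩ := I.exists_rep x
    refine (I.quotRaw_act _ _ _ _ _ _).trans (Eq.trans ?_
      (I.quotRaw_act₂ _ _ _ _ _ _ _ _ _ _ _).symm)
    exact congrArg _ (P.isOp.act_comp e b a hb ha hc p q r hq hr hp x)
  act_swap := by
    intro N m m' n n' X Y Y' v e b a e' b' a' hb ha hb' ha' ha₁ ha₁' hc hs p q q' r hq hr hq' hr' x
    obtain ⟨x, rfl⟩ := I.exists_rep x
    refine (I.quotRaw_act₂ _ _ _ _ _ _ _ _ _ _ _).trans (Eq.trans ?_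
      (congrArg (fun z : (I.complex v).X r => ε.swapSign k • z)
        (I.quotRaw_act₂ _ _ _ _ _ _ _ _ _ _ _).symm))
    exact (congrArg _ (P.isOp.act_swap e b a e' b' a' hb ha hb' ha' ha₁ ha₁' hc hs p q q' r hq hr
      hq' hr' x)).trans (map_smul _ _ _)
  d_act := by
    intro n X v a ha p m m' hm h h' x
    obtain ⟨x, rfl⟩ := I.exists_rep x
    refine Eq.trans (congrArg _ (I.quotRaw_act a ha p m h x)) ?_
    refine (I.proj_d _).trans ?_
    refine (congrArg _ (P.isOp.d_act a ha p m m' hm h h' x)).trans ?_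
    rw [map_smul, map_sum]
    refine congrArg (fun z : (I.complex v).X m' => sgn k (ε.shift (deg a)) • z)
      (Finset.sum_congr rfl fun i _ => ?_)
    have h2 := (I.quotRaw_act a ha (bump p i) m' (h' i)
      (fun j => dAt (fun j => P.obj (X j)) x i j)).symm.trans
      (congrArg _ (funext fun j => (I.quotRaw_dAt x i j).symm))
    exact (map_smul _ _ _).trans (congrArg (fun z : (I.complex v).X m' =>
      sgn k (∑ j, if j < i then p j else 0) • z) h2)

/-- The quotient operad. -/
noncomputable def quot : Ops F k ε := ⟨I.quotRaw, I.quotRaw_isOp⟩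

/-- The projection to the quotient operad. -/
noncomputable def π : P ⟶ I.quot where
  app v := { f := fun m => ModuleCat.ofHom (I.proj v m) }
  map_act a ha p m h x := (I.quotRaw_act a ha p m h x).symm

end OpIdeal

end Ideals

namespace ColOperad

theorem toOp_ofFin {F : ColOperad.{u}} {n : ℕ} {X : Fin n → F.V} {v : F.V} (b : F.Op X v) :
    toOp (v := v) (ofFin (m := 1) (n := fun _ => n) (oneSigma (Fin n)) (X := X)
      (Y := fun _ => v) (fun _ => b)) = b :=
  (precomp_ofFin (m := 1) (n := fun _ => n) (oneSigma (Fin n)) (X := X) (Y := fun _ => v)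
    (F.one v) (fun _ => b)).trans (F.one_comp b)

end ColOperad

namespace CubicalMorphism

variable {F₁ F₂ : CubicalFeynmanCat.{u}} {φ : CubicalMorphism F₁ F₂}

theorem Admissible.map_injective (hφ : φ.Admissible) {n : ℕ} {X : Fin n → F₁.V} {v : F₁.V}
    {a b : F₁.Op X v} (h : φ.map a = φ.map b) : a = b := by
  have := hφ.faithful
  rw [← toOp_ofFin a, ← toOp_ofFin b]
  refine congrArg toOp (φ.functor.map_injective ?_)
  refine (φ.functor_map_ofFin _ _).trans (Eq.trans ?_ (φ.functor_map_ofFin _ _).symm)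
  exact congrArg (ofFin _) (funext fun _ => h)

theorem Admissible.chainEquiv (hφ : φ.Admissible) {N m m' : ℕ} {n : Fin m → ℕ} {n' : Fin m' → ℕ}
    {X : Fin N → F₁.V} {Y : Fin m → F₁.V} {Y' : Fin m' → F₁.V} {v : F₁.V}
    {e : (Σ j, Fin (n j)) ≃ Fin N} {b : F₁.Op Y v} {a : ∀ j, F₁.Op (fun i => X (e ⟨j, i⟩)) (Y j)}
    {e' : (Σ j, Fin (n' j)) ≃ Fin N} {b' : F₁.Op Y' v}
    {a' : ∀ j, F₁.Op (fun i => X (e' ⟨j, i⟩)) (Y' j)}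
    (h : ChainEquiv (F := F₂.toColOperad) (X := fun t => φ.obj (X t)) e (φ.map b)
      (fun j => φ.map (a j)) e' (φ.map b') (fun j => φ.map (a' j))) : ChainEquiv e b a e' b' a' := by
  have := hφ.faithful
  obtain ⟨σ₀, h1, h2⟩ := h
  let σ : φ.functor.obj (fam Y) ≅ φ.functor.obj (fam Y') := σ₀
  have h1' : φ.functor.map (ofFin e a) ≫ σ.hom = φ.functor.map (ofFin e' a') :=
    (congrArg (· ≫ σ.hom) (φ.functor_map_ofFin e a)).trans (h1.trans (φ.functor_map_ofFin e' a').symm)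
  have h1'' : φ.functor.map (ofFin e a) = φ.functor.map (ofFin e' a') ≫ σ.inv := by
    rw [← h1', Category.assoc, σ.hom_inv_id, Category.comp_id]
  obtain ⟨f, hf⟩ := hφ.factor₁ (ofFin e' a') (ofFin e a) σ.hom h1'.symm
  obtain ⟨g, hg⟩ := hφ.factor₁ (ofFin e a) (ofFin e' a') σ.inv h1''
  refine ⟨⟨f, g, φ.functor.map_injective ?_, φ.functor.map_injective ?_⟩,
    φ.functor.map_injective ?_, hφ.map_injective ?_⟩
  · rw [φ.functor.map_comp, hf, hg, φ.functor.map_id]; exact σ.hom_inv_id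
  · rw [φ.functor.map_comp, hf, hg, φ.functor.map_id]; exact σ.inv_hom_id
  · rw [φ.functor.map_comp, hf]; exact h1'
  · exact (φ.map_precomp b' f).trans ((congrArg (precomp (φ.map b')) hf).trans h2)

end CubicalMorphism

namespace Ops

variable {F₁ F₂ : CubicalFeynmanCat.{u}} {φ : CubicalMorphism F₁ F₂} {ε : Parity}

variable (φ) in
/-- Restriction of an operad along `φ`, without its axioms. -/
def resRaw (P : RawOp F₂ k ε) : RawOp F₁ k ε where
  obj v := P.obj (φ.obj v)
  act a ha p m h := P.act (φ.map a) ((φ.deg_map a).le.trans ha) p m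
    (by rw [φ.deg_map a]; exact h)

theorem resRaw_act₂ (P : RawOp F₂ k ε) {m N : ℕ} {n : Fin m → ℕ} (e : (Σ j, Fin (n j)) ≃ Fin N)
    {X : Fin N → F₁.V} {Y : Fin m → F₁.V} {v : F₁.V} (b : F₁.Op Y v)
    (a : ∀ j, F₁.Op (fun i => X (e ⟨j, i⟩)) (Y j)) (hb : deg b ≤ 1) (ha : ∀ j, deg (a j) ≤ 1)
    (p : Fin N → ℤ) (q : Fin m → ℤ) (r : ℤ)
    (hq : ∀ j, ∑ i, p (e ⟨j, i⟩) + ε.shift (deg (a j)) = q j)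
    (hr : ∑ j, q j + ε.shift (deg b) = r) (x : ∀ t, (P.obj (φ.obj (X t))).X (p t)) :
    (resRaw φ P).act₂ e b a hb ha p q r hq hr x =
      P.act₂ (X := fun t => φ.obj (X t)) e (φ.map b) (fun j => φ.map (a j))
        ((φ.deg_map b).le.trans hb) (fun j => (φ.deg_map (a j)).le.trans (ha j)) p q r
        (fun j => by rw [φ.deg_map (a j)]; exact hq j) (by rw [φ.deg_map b]; exact hr) x := by
  refine congrArg (fun c : Fin m → ℤ => sgn k (koszul e p c) • _) ?_
  exact funext fun j => congrArg ε.shift (φ.deg_map (a j)).symm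

theorem resRaw_isOp (hφ : φ.Admissible) (P : Ops F₂ k ε) : (resRaw φ P.toRawOp).IsOp where
  act_one v h1 m h x := by
    have hd : deg (F₂.one (φ.obj v)) = 0 := F₂.degree.deg_one _
    exact (P.act_congr (φ.map_one v) _ (hd.le.trans (Nat.zero_le 1)) _ _ _
      (by rw [hd]; simp) _).trans (P.isOp.act_one _ _ _ _ _)
  act_comp := by
    intro m N n e X Y v b a hb ha hc p q r hq hr hp x
    have hd : deg (φ.map (compTo e b a)) = deg (compTo e b a) := φ.deg_map _
    have hd' := hd
    rw [φ.map_compTo] at hd'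
    refine Eq.trans (P.act_congr (φ.map_compTo e b a) _ (hd'.le.trans hc) _ _ _
      (by rw [hd']; exact hp) _) ?_
    refine Eq.trans ?_ (resRaw_act₂ P.toRawOp e b a hb ha p q r hq hr x).symm
    exact P.isOp.act_comp _ _ _ _ _ _ _ _ _ _ _ _ _
  act_swap := by
    intro N m m' n n' X Y Y' v e b a e' b' a' hb ha hb' ha' ha₁ ha₁' hc hs p q q' r hq hr hq' hr' x
    refine (resRaw_act₂ P.toRawOp e b a hb.le ha₁ p q r hq hr x).trans ?_
    refine Eq.trans ?_ (congrArg (ε.swapSign k • ·)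
      (resRaw_act₂ P.toRawOp e' b' a' hb'.le ha₁' p q' r hq' hr' x).symm)
    refine P.isOp.act_swap (X := fun t => φ.obj (X t)) e (φ.map b) (fun j => φ.map (a j)) e'
      (φ.map b') (fun j => φ.map (a' j)) ((φ.deg_map b).trans hb)
      ((Finset.sum_congr rfl fun j _ => φ.deg_map (a j)).trans ha) ((φ.deg_map b').trans hb')
      ((Finset.sum_congr rfl fun j _ => φ.deg_map (a' j)).trans ha')
      (fun j => (φ.deg_map (a j)).le.trans (ha₁ j)) (fun j => (φ.deg_map (a' j)).le.trans (ha₁' j))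
      ?_ (fun h => hs (hφ.chainEquiv h)) p q q' r _ _ _ _ x
    exact (φ.map_compTo e b a).symm.trans ((congrArg φ.map hc).trans (φ.map_compTo e' b' a'))
  d_act := by
    intro n X v a ha p m m' hm h h' x
    refine (P.isOp.d_act (φ.map a) ((φ.deg_map a).le.trans ha) p m m' hm
      (by rw [φ.deg_map a]; exact h) (fun i => by rw [φ.deg_map a]; exact h' i) x).trans ?_
    exact congrArg (fun c : ℕ => sgn k (ε.shift c) • _) (φ.deg_map a)

/-- The restriction functor `R`. -/
def res (hφ : φ.Admissible) : Ops F₂ k ε ⥤ Ops F₁ k ε where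
  obj P := ⟨resRaw φ P.toRawOp, resRaw_isOp hφ P⟩
  map f := ⟨fun v => f.app (φ.obj v), fun a ha p m h x =>
    f.map_act (φ.map a) ((φ.deg_map a).le.trans ha) p m (by rw [φ.deg_map a]; exact h) x⟩

variable (φ) in
/-- The restriction `r` of `V`-modules. -/
abbrev resV (E : VMod F₂ k) : VMod F₁ k := φ.vert ⋙ E

/-- Restriction commutes with passing to underlying `V`-modules. -/
noncomputable def resUnder (hφ : φ.Admissible) (P : Ops F₂ k ε) :
    resV φ P.under ⟶ ((res hφ).obj P).under where
  app v := 𝟙 (P.obj (φ.obj v.of))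
  naturality v w θ := by
    refine (Category.comp_id _).trans (Eq.trans ?_ (Category.id_comp _).symm)
    ext m x
    have hd := deg_vop (φ.vert.map θ)
    have hs : ε.shift (deg (vop (φ.vert.map θ))) = 0 := (congrArg ε.shift hd).trans ε.shift_zero
    exact (P.act_congr (φ.map_vop θ) _ (hd.le.trans (Nat.zero_le 1)) _ _ _
      (by simp only [Finset.sum_const, Finset.card_univ, Fintype.card_fin, one_smul]; exact (congrArg (m + ·) hs).trans (add_zero m)) _).symm

/-- The natural transformation `F₁ r ⇒ R F₂`, adjoint to `r` of the inclusion of generators. -/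
noncomputable def beta (hφ : φ.Admissible) (E : VMod F₂ k) (ε : Parity) :
    free (resV φ E) ε ⟶ (res hφ).obj (free E ε) :=
  lift (Functor.whiskerLeft φ.vert unit ≫ resUnder hφ (free E ε))

end Ops

namespace ColOperad

section
variable {F : ColOperad.{u}} {I J : Type} [Finite I] [Finite J]

theorem reindex_injective {I K : Type} [Finite I] [Finite K] (ρ : I ≃ K) {X : K → F.V} {v : F.V} :
    Function.Injective (F.reindex ρ (X := X) (v := v)) := by
  obtain ⟨Z, rfl⟩ : ∃ Z : I → F.V, X = fun k => Z (ρ.symm k) :=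
    ⟨fun i => X (ρ i), by funext k; simp⟩
  have h0 : ∀ σ : I ≃ I, σ = Equiv.refl I →
      Function.Injective (F.reindex σ (X := Z) (v := v)) := by
    rintro σ rfl a b h
    exact (F.reindex_refl (X := Z) a).symm.trans (h.trans (F.reindex_refl (X := Z) b))
  intro a b h
  refine h0 (ρ.trans ρ.symm) (by simp) ?_
  exact (F.reindex_trans ρ ρ.symm (X := Z) a).symm.trans
    ((congrArg (F.reindex ρ.symm (X := Z)) h).trans (F.reindex_trans ρ ρ.symm (X := Z) b))

theorem reindex_surjective {I K : Type} [Finite I] [Finite K] (ρ : I ≃ K) {X : K → F.V} {v : F.V} :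
    Function.Surjective (F.reindex ρ (X := X) (v := v)) := by
  intro a
  have h0 : ∀ σ : K ≃ K, σ = Equiv.refl K →
      Function.Surjective (F.reindex σ (X := X) (v := v)) := by
    rintro σ rfl a
    exact ⟨a, F.reindex_refl a⟩
  obtain ⟨b, hb⟩ := h0 (ρ.symm.trans ρ) (by simp) a
  exact ⟨F.reindex ρ.symm (X := fun i => X (ρ i)) b,
    (F.reindex_trans ρ.symm ρ (X := X) b).trans hb⟩

/-- The fibre of a constant map. -/
def constFiber (I : Type) (f : I → Fin 1) (j : Fin 1) : I ≃ {i : I // f i = j} where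
  toFun i := ⟨i, Subsingleton.elim _ _⟩
  invFun i := i.1
  left_inv _ := rfl
  right_inv _ := rfl

/-- An operation as a morphism. -/
def arrow {X : I → F.V} {v : F.V} (f : F.Op X v) : (⟨I, X⟩ : Obj F) ⟶ single v where
  idx _ := (0 : Fin 1)
  op j := F.reindex (constFiber I (fun _ => 0) j)
    (X := fun i : {_i : I // (0 : Fin 1) = j} => X i.1) f

theorem toOp_arrow {X : I → F.V} {v : F.V} (f : F.Op X v) : toOp (arrow f) = f := by
  refine Eq.trans ?_ (F.one_comp f)
  refine Eq.trans (congrArg (F.reindex (Equiv.sigmaFiberEquiv (fun _ : I => (0 : Fin 1))) (X := X))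
    (F.comp_reindex_right (J := Fin 1) (constFiber I (fun _ => 0))
    (X := fun j i => X i.1) (F.one v) (fun _ => f))) ?_
  refine (F.reindex_trans _ _ (X := X) _).trans ?_
  exact reindex_congr (ρ := (Equiv.sigmaCongrRight (constFiber I (fun _ => 0))).trans
    (Equiv.sigmaFiberEquiv (fun _ : I => (0 : Fin 1)))) (ρ' := oneSigma I) (X := X)
    (fun i => rfl) (F.comp (F.one v) (fun _ => f)) rfl rfl

theorem arrow_toOp {X : I → F.V} {v : F.V} (h : (⟨I, X⟩ : Obj F) ⟶ single v) :
    arrow (toOp h) = h := by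
  obtain ⟨f, g⟩ := h
  have hf : f = fun _ => (0 : Fin 1) := funext fun _ => Subsingleton.elim (α := Fin 1) _ _
  subst hf
  have hg : ∃ a : F.Op X v, g = fun j => F.reindex (constFiber I (fun _ => 0) j)
      (X := fun i : {_i : I // (0 : Fin 1) = j} => X i.1) a := by
    obtain ⟨a, ha⟩ := reindex_surjective (constFiber I (fun _ => 0) 0)
      (X := fun i : {_i : I // (0 : Fin 1) = 0} => X i.1) (g (0 : Fin 1))
    refine ⟨a, funext fun j => ?_⟩
    obtain rfl : j = (0 : Fin 1) := Subsingleton.elim (α := Fin 1) _ _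
    exact ha.symm
  obtain ⟨a, rfl⟩ := hg
  exact congrArg arrow (toOp_arrow a)

theorem arrow_precomp {X : I → F.V} {Y : J → F.V} {v : F.V} (b : F.Op Y v)
    (h : (⟨I, X⟩ : Obj F) ⟶ ⟨J, Y⟩) : arrow (precomp b h) = h ≫ arrow b := by
  rw [← arrow_toOp (h ≫ arrow b)]
  refine congrArg arrow ?_
  exact (congrArg (fun c => precomp c h) (toOp_arrow b).symm).trans
    (precomp_precomp (F.one v) (arrow b) h)

theorem arrow_injective {X : I → F.V} {v : F.V} :
    Function.Injective (arrow : F.Op X v → _) := fun a b h => by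
  rw [← toOp_arrow a, ← toOp_arrow b, h]

theorem arrow_compTo {m N : ℕ} {n : Fin m → ℕ} (e : (Σ j, Fin (n j)) ≃ Fin N) {X : Fin N → F.V}
    {Y : Fin m → F.V} {v : F.V} (b : F.Op Y v) (a : ∀ j, F.Op (fun i => X (e ⟨j, i⟩)) (Y j)) :
    arrow (compTo e b a) = (ofFin e a ≫ arrow b : fam X ⟶ single v) := by
  rw [← precomp_ofFin]; exact arrow_precomp b (ofFin e a)

theorem ofFin_injective {m N : ℕ} {n : Fin m → ℕ} (e : (Σ j, Fin (n j)) ≃ Fin N) {X : Fin N → F.V}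
    {Y : Fin m → F.V} {a b : ∀ j, F.Op (fun i => X (e ⟨j, i⟩)) (Y j)} (h : ofFin e a = ofFin e b) :
    a = b := by
  funext j
  have h1 := congrFun (eq_of_heq (Mor.mk.inj h).2) j
  exact reindex_injective _ (X := fun t : {t : Fin N // (e.symm t).1 = j} => X t.1) h1

theorem exists_ofFin {m N : ℕ} {n : Fin m → ℕ} (e : (Σ j, Fin (n j)) ≃ Fin N) {X : Fin N → F.V}
    {Y : Fin m → F.V} (h : fam X ⟶ fam Y) (hi : Mor.idx h = fun t => (e.symm t).1) :
    ∃ a, h = ofFin e a := by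
  obtain ⟨f, g⟩ := h
  change f = _ at hi
  subst hi
  have : ∀ j : Fin m, ∃ a : F.Op (fun i => X (e ⟨j, i⟩)) (Y j), g j =
      F.reindex (fiberEquiv e j) (X := fun t : {t : Fin N // (e.symm t).1 = j} => X t.1) a :=
    fun j => (reindex_surjective (fiberEquiv e j)
      (X := fun t : {t : Fin N // (e.symm t).1 = j} => X t.1) (g j)).imp fun _ h => h.symm
  choose a ha using this
  exact ⟨a, Mor.ext rfl (heq_of_eq (funext ha))⟩

theorem Mor.idx_comp {A B C : Obj F} (f : A ⟶ B) (g : B ⟶ C) (i : A.I) :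
    Mor.idx (f ≫ g) i = Mor.idx g (Mor.idx f i) := rfl

theorem Mor.idx_id {A : Obj F} (i : A.I) : Mor.idx (𝟙 A) i = i := rfl

end

end ColOperad

namespace CubicalFeynmanCat

variable {F : CubicalFeynmanCat.{u}} {I : Type} [Finite I]

theorem deg_arrow {X : I → F.V} {v : F.V} (f : F.Op X v) : F.degree.mdeg (arrow f) = deg f := by
  rw [← F.degree.deg_toOp, toOp_arrow]

theorem vop_injective {v w : F.Vert} : Function.Injective (vop : (v ⟶ w) → _) := by
  intro θ θ' h
  have h1 := congrArg arrow h
  exact Iso.ext ((arrow_toOp (Iso.hom θ)).symm.trans (h1.trans (arrow_toOp (Iso.hom θ'))))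

theorem exists_vop {v w : F.V} (f : F.Op (fun _ : Fin 1 => v) w) (hf : deg f = 0) :
    ∃ θ : (⟨v⟩ : F.Vert) ⟶ ⟨w⟩, f = vop θ := by
  have := F.cubical.isIso_of_deg (arrow f) ((deg_arrow f).trans hf)
  let θ : (single v : F.Cat) ≅ single w := @asIso _ _ (single v : F.Cat) (single w) (arrow f) this
  exact ⟨θ, (toOp_arrow f).symm⟩

/-- A tensor product of isomorphisms of vertices. -/
def vhom {X Y : I → F.V} (u : ∀ i, (⟨X i⟩ : F.Vert) ⟶ ⟨Y i⟩) : (⟨I, X⟩ : F.Cat) ⟶ ⟨I, Y⟩ where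
  idx i := i
  op j := F.reindex (fiberOne j) (X := fun i : {i // i = j} => X i.1) (vop (u j))

theorem vhom_id {X : I → F.V} : vhom (fun i => 𝟙 (⟨X i⟩ : F.Vert)) = 𝟙 (⟨I, X⟩ : F.Cat) :=
  Mor.ext rfl (heq_of_eq (funext fun j => congrArg (F.reindex (fiberOne j)
    (X := fun i : {i // i = j} => X i.1)) (Ops.vop_id ⟨X j⟩)))

theorem vhom_comp {X Y Z : I → F.V} (u : ∀ i, (⟨X i⟩ : F.Vert) ⟶ ⟨Y i⟩)
    (u' : ∀ i, (⟨Y i⟩ : F.Vert) ⟶ ⟨Z i⟩) : vhom u ≫ vhom u' = vhom (fun i => u i ≫ u' i) := by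
  refine Mor.ext rfl (heq_of_eq (funext fun j => ?_))
  refine (comp_op (vhom u) (vhom u') j).trans ?_
  refine Eq.trans (congrArg (F.reindex _ (X := fun i : {i // i = j} => X i.1))
    (F.comp_reindex_left (fiberOne j) (Y := fun j' : {j' : I // j' = j} => Y j'.1)
      (I := fun j' => {i // i = j'.1}) (X := fun j' i => X i.1) (vop (u' j))
      (fun j' => Mor.op (vhom u) j'.1))) ?_
  refine (F.reindex_trans _ _ (X := fun i : {i // i = j} => X i.1) _).trans ?_
  refine Eq.trans (congrArg (F.reindex _ (X := fun i : {i // i = j} => X i.1))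
    (F.comp_reindex_right (J := Fin 1) (fun _ => fiberOne j) (X := fun _ i => X i.1) (vop (u' j))
      (fun _ => vop (u j)))) ?_
  refine (F.reindex_trans _ _ (X := fun i : {i // i = j} => X i.1) _).trans ?_
  refine Eq.trans ?_ (congrArg (F.reindex (fiberOne j) (X := fun i : {i // i = j} => X i.1))
    (Ops.vop_comp (u j) (u' j)).symm)
  refine Eq.trans ?_ (F.reindex_trans (oneSigma (Fin 1)) (fiberOne j)
    (X := fun i : {i // i = j} => X i.1) _).symm
  exact reindex_congr (X := fun i : {i // i = j} => X i.1)
    (ρ' := (oneSigma (Fin 1)).trans (fiberOne j))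
    (fun i => rfl) (F.comp (vop (u' j)) (fun _ => vop (u j))) rfl rfl

/-- A tensor product of isomorphisms of vertices, as an isomorphism. -/
def vhomIso {X Y : I → F.V} (u : ∀ i, (⟨X i⟩ : F.Vert) ⟶ ⟨Y i⟩) :
    (⟨I, X⟩ : F.Cat) ≅ ⟨I, Y⟩ where
  hom := vhom u
  inv := vhom fun i => Groupoid.inv (u i)
  hom_inv_id := by rw [vhom_comp]; simp only [Groupoid.comp_inv]; exact vhom_id
  inv_hom_id := by rw [vhom_comp]; simp only [Groupoid.inv_comp]; exact vhom_id

theorem vhom_injective {X Y : I → F.V} {u u' : ∀ i, (⟨X i⟩ : F.Vert) ⟶ ⟨Y i⟩}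
    (h : vhom u = vhom u') : u = u' := by
  funext j
  have h1 := congrFun (eq_of_heq (Mor.mk.inj h).2) j
  exact vop_injective (reindex_injective _ (X := fun i : {i // i = j} => X i.1) h1)

theorem exists_vhom {X Y : I → F.V} (h : (⟨I, X⟩ : F.Cat) ⟶ ⟨I, Y⟩) (hi : ∀ i, Mor.idx h i = i)
    (hd : F.degree.mdeg h = 0) : ∃ u, h = vhom u := by
  obtain ⟨f, g⟩ := h
  obtain rfl : f = fun i => i := funext hi
  have := Fintype.ofFinite I
  have hd' : ∀ j, deg (g j) = 0 := by
    intro j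
    have : ∑ᶠ j, deg (g j) = 0 := hd
    rw [finsum_eq_sum_of_fintype, Finset.sum_eq_zero_iff] at this
    exact this j (Finset.mem_univ _)
  have : ∀ j : I, ∃ u : (⟨X j⟩ : F.Vert) ⟶ ⟨Y j⟩, g j =
      F.reindex (fiberOne j) (X := fun i : {i // i = j} => X i.1) (vop u) := by
    intro j
    obtain ⟨a, ha⟩ := reindex_surjective (fiberOne j)
      (X := fun i : {i // i = j} => X i.1) (g j)
    have hda : deg a = 0 := by
      rw [← hd' j, ← ha]
      exact (F.degree.deg_reindex (fiberOne j) (X := fun i : {i // i = j} => X i.1) a).symm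
    obtain ⟨θ, rfl⟩ := exists_vop (v := X j) a hda
    exact ⟨θ, ha.symm⟩
  choose u hu using this
  exact ⟨u, Mor.ext rfl (heq_of_eq (funext hu))⟩

/-- The fibres of a bijection. -/
def singleFiber {K I : Type} (i : K ≃ I) (a : I) : Fin 1 ≃ {t : K // i t = a} where
  toFun _ := ⟨i.symm a, by simp⟩
  invFun _ := 0
  left_inv _ := Subsingleton.elim _ _
  right_inv := fun ⟨t, ht⟩ => by subst ht; simp

/-- Relabelling of an object, as a morphism. -/
def relabel {K : Type} [Finite K] (i : K ≃ I) (X : I → F.V) :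
    (⟨K, fun t => X (i t)⟩ : F.Cat) ⟶ ⟨I, X⟩ where
  idx := i
  op a := F.reindex (singleFiber i a) (X := fun t : {t : K // i t = a} => X (i t.1))
    ((funext fun _ => congrArg X (by simp [singleFiber]) :
      (fun _ : Fin 1 => X a) = fun j => X (i (singleFiber i a j).1)) ▸ F.one (X a))

theorem deg_relabel {K : Type} [Finite K] (i : K ≃ I) (X : I → F.V) :
    F.degree.mdeg (relabel i X) = 0 := by
  have : ∀ a, deg (Mor.op (relabel i X) a) = 0 := by
    intro a
    refine (F.degree.deg_reindex (singleFiber i a)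
      (X := fun t : {t : K // i t = a} => X (i t.1)) _).trans ?_
    have : ∀ (Z : Fin 1 → F.V) (h : (fun _ : Fin 1 => X a) = Z), deg (h ▸ F.one (X a)) = 0 := by
      rintro Z rfl
      exact F.degree.deg_one _
    exact this _ _
  refine finsum_eq_zero_of_forall_eq_zero this

end CubicalFeynmanCat

namespace CubicalMorphism

variable {F₁ F₂ : CubicalFeynmanCat.{u}} (φ : CubicalMorphism F₁ F₂)

/-- Vertices of the source with an isomorphism from their image to `v`. -/
structure Lift (v : F₂.V) where
  w : F₁.V
  σ : φ.vert.obj ⟨w⟩ ⟶ ⟨v⟩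

variable {φ} in
/-- Isomorphism of such pairs. -/
def Lift.Equiv {v : F₂.V} (l l' : φ.Lift v) : Prop :=
  ∃ θ : (⟨l.w⟩ : F₁.Vert) ⟶ ⟨l'.w⟩, φ.vert.map θ ≫ l'.σ = l.σ

instance liftSetoid (v : F₂.V) : Setoid (φ.Lift v) where
  r := Lift.Equiv
  iseqv :=
    { refl := fun l => ⟨𝟙 _, by rw [φ.vert.map_id]; exact Category.id_comp _⟩
      symm := by
        rintro l l' ⟨θ, h⟩
        refine ⟨Groupoid.inv θ, ?_⟩
        rw [← h, ← Category.assoc, ← φ.vert.map_comp, Groupoid.inv_comp, φ.vert.map_id]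
        exact Category.id_comp _
      trans := by
        rintro l l' l'' ⟨θ, h⟩ ⟨θ', h'⟩
        exact ⟨θ ≫ θ', by rw [φ.vert.map_comp, Category.assoc, h', h]⟩ }

/-- Isomorphism classes of pairs `(w, σ : φ(w) ≅ v)`. As `φ` is faithful, such pairs have no
non-trivial automorphisms. -/
def Cell (v : F₂.V) : Type u := Quotient (φ.liftSetoid v)

instance (v : F₂.V) : Finite (φ.Cell v) := by
  have : Finite (φ.Lift v) := by
    have := φ.finite_fiber v
    have : ∀ w : {w : F₁.V // φ.obj w = v}, Finite ((⟨φ.obj w.1⟩ : F₂.Vert) ⟶ ⟨v⟩) := by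
      rintro ⟨w, rfl⟩
      exact F₂.finite_aut (φ.obj w)
    refine Finite.of_surjective
      (fun s : Σ w : {w : F₁.V // φ.obj w = v}, ((⟨φ.obj w.1⟩ : F₂.Vert) ⟶ ⟨v⟩) =>
        (⟨s.1.1, s.2⟩ : φ.Lift v)) ?_
    rintro ⟨w, σ⟩
    exact ⟨⟨⟨w, F₂.eq_of_iso ⟨σ⟩⟩, σ⟩, rfl⟩
  exact Quotient.finite _

noncomputable instance (v : F₂.V) : Fintype (φ.Cell v) := Fintype.ofFinite _

variable {φ}

/-- The vertex of a chosen representative of a class. -/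
noncomputable def Cell.w {v : F₂.V} (c : φ.Cell v) : F₁.V := (Quotient.out c).w
/-- The isomorphism of a chosen representative of a class. -/
noncomputable def Cell.σ {v : F₂.V} (c : φ.Cell v) : φ.vert.obj ⟨c.w⟩ ⟶ ⟨v⟩ :=
  (Quotient.out c).σ

theorem Cell.eq_of_hom {v : F₂.V} {c c' : φ.Cell v} (θ : (⟨c.w⟩ : F₁.Vert) ⟶ ⟨c'.w⟩)
    (h : φ.vert.map θ ≫ c'.σ = c.σ) : c = c' := by
  rw [← Quotient.out_eq c, ← Quotient.out_eq c']
  exact Quotient.sound ⟨θ, h⟩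

theorem Cell.exists_hom {v : F₂.V} (l : φ.Lift v) : ∃ (c : φ.Cell v)
    (θ : (⟨l.w⟩ : F₁.Vert) ⟶ ⟨c.w⟩), φ.vert.map θ ≫ c.σ = l.σ :=
  ⟨Quotient.mk _ l, Setoid.symm (Quotient.mk_out l)⟩

/-- The isomorphism of a representative, in the category of objects. -/
noncomputable def Cell.iso {v : F₂.V} (c : φ.Cell v) : φ.functor.obj (single c.w) ≅ single v := c.σ

/-- The tensor product of the isomorphisms of representatives. -/
noncomputable def cellIso {I : Type} [Finite I] {X : I → F₂.V} (c : ∀ i, φ.Cell (X i)) :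
    φ.functor.obj ⟨I, fun i => (c i).w⟩ ≅ ⟨I, X⟩ :=
  vhomIso (X := fun i => φ.obj (c i).w) fun i => (c i).σ

/-- The operation `g` lies over `f`: `σ₀ ∘ φ(g) = f ∘ (σ_1 ⊗ ⋯ ⊗ σ_n)`. -/
def IsOver {n : ℕ} {X : Fin n → F₂.V} {v : F₂.V} (f : F₂.Op X v) (c : ∀ i, φ.Cell (X i))
    (c₀ : φ.Cell v) (g : F₁.Op (fun i => (c i).w) c₀.w) : Prop :=
  φ.functor.map (arrow g) ≫ c₀.iso.hom = (cellIso c).hom ≫ arrow f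

theorem map_arrow {I : Type} [Finite I] {X : I → F₁.V} {v : F₁.V} (g : F₁.Op X v) :
    φ.functor.map (arrow g) = arrow (F := F₂.toColOperad) (φ.map g) :=
  Mor.ext rfl (heq_of_eq (funext fun (j : Fin 1) => φ.map_reindex (constFiber I (fun _ => 0) j)
    (X := fun i : {_i : I // (0 : Fin 1) = j} => X i.1) g))

theorem map_vhom {I : Type} [Finite I] {X Y : I → F₁.V}
    (u : ∀ i, (⟨X i⟩ : F₁.Vert) ⟶ ⟨Y i⟩) :
    φ.functor.map (vhom u) = vhom (fun i => φ.vert.map (u i)) :=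
  Mor.ext rfl (heq_of_eq (funext fun j => (φ.map_reindex (fiberOne j)
    (X := fun i : {i : I // i = j} => X i.1) (vop (u j))).trans
      (congrArg (F₂.reindex (fiberOne j) (X := fun i : {i : I // i = j} => φ.obj (X i.1)))
        (φ.map_vop (u j)))))

theorem mdeg_map {A B : F₁.Cat} (f : A ⟶ B) :
    F₂.degree.mdeg (φ.functor.map f) = F₁.degree.mdeg f :=
  finsum_congr fun j => φ.deg_map (Mor.op f j)

section

variable {n : ℕ} {X : Fin n → F₂.V} {v : F₂.V} {f : F₂.Op X v} {c : ∀ i, φ.Cell (X i)}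
    {c₀ : φ.Cell v} {g : F₁.Op (fun i => (c i).w) c₀.w}

theorem IsOver.deg_eq (h : IsOver f c c₀ g) : deg g = deg f := by
  have h1 := congrArg F₂.degree.mdeg h
  rw [F₂.degree.mdeg_comp, F₂.degree.mdeg_comp, F₂.degree.mdeg_iso, F₂.degree.mdeg_iso,
    mdeg_map, deg_arrow, deg_arrow, zero_add, add_zero] at h1
  exact h1

theorem IsOver.unique (hφ : φ.Admissible) (h : IsOver f c c₀ g)
    {g' : F₁.Op (fun i => (c i).w) c₀.w} (h' : IsOver f c c₀ g') : g = g' := by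
  have := hφ.faithful
  refine arrow_injective (φ.functor.map_injective ?_)
  exact (cancel_mono c₀.iso.hom).1 (h.trans h'.symm)

end

section

variable {m N : ℕ} {n : Fin m → ℕ} {e : (Σ j, Fin (n j)) ≃ Fin N} {X : Fin N → F₂.V}
    {Y : Fin m → F₂.V} {v : F₂.V} {b : F₂.Op Y v} {a : ∀ j, F₂.Op (fun i => X (e ⟨j, i⟩)) (Y j)}
    {C : ∀ t, φ.Cell (X t)} {D : ∀ j, φ.Cell (Y j)} {c₀ : φ.Cell v}

theorem ofFin_comp_vhom {F : CubicalFeynmanCat.{u}} {X : Fin N → F.V} {Y Y' : Fin m → F.V}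
    (s : ∀ j, (⟨Y j⟩ : F.Vert) ⟶ ⟨Y' j⟩) (b : ∀ j, F.Op (fun i => X (e ⟨j, i⟩)) (Y j)) :
    (ofFin e b ≫ vhom s : fam X ⟶ fam Y') =
      ofFin e (fun j => toOp (arrow (b j) ≫ Iso.hom (s j))) := by
  refine Mor.ext rfl (heq_of_eq (funext fun j => ?_))
  have h0 : toOp (arrow (b j) ≫ Iso.hom (s j)) =
      F.reindex (oneSigma (Fin (n j))) (X := fun i => X (e ⟨j, i⟩))
        (F.comp (vop (s j)) (fun _ => b j)) := by
    refine (precomp_precomp (F.one (Y' j)) (Iso.hom (s j)) (arrow (b j))).symm.trans ?_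
    refine (precomp_single (vop (s j)) (arrow (b j))).trans ?_
    exact congrArg (fun z => F.reindex (oneSigma (Fin (n j))) (X := fun i => X (e ⟨j, i⟩))
      (F.comp (vop (s j)) (fun _ => z))) (toOp_arrow (b j))
  refine (comp_op (ofFin e b) (vhom s) j).trans ?_
  refine Eq.trans (congrArg (F.reindex _ (X := fun t : {t : Fin N // (e.symm t).1 = j} => X t.1))
    (F.comp_reindex_left (fiberOne j) (Y := fun j' : {j' : Fin m // j' = j} => Y j'.1)
      (I := fun j' => {t : Fin N // (e.symm t).1 = j'.1}) (X := fun j' i => X i.1) (vop (s j))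
      (fun j' => Mor.op (ofFin e b) j'.1))) ?_
  refine (F.reindex_trans _ _
    (X := fun t : {t : Fin N // (e.symm t).1 = j} => X t.1) _).trans ?_
  refine Eq.trans (congrArg (F.reindex _ (X := fun t : {t : Fin N // (e.symm t).1 = j} => X t.1))
    (F.comp_reindex_right (J := Fin 1) (fun _ => fiberEquiv e j) (X := fun _ t => X t.1) (vop (s j))
      (fun _ => b j))) ?_
  refine (F.reindex_trans _ _
    (X := fun t : {t : Fin N // (e.symm t).1 = j} => X t.1) _).trans ?_
  refine Eq.trans ?_ (congrArg (F.reindex (fiberEquiv e j)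
    (X := fun t : {t : Fin N // (e.symm t).1 = j} => X t.1)) h0.symm)
  refine Eq.trans ?_ (F.reindex_trans (oneSigma (Fin (n j))) (fiberEquiv e j)
    (X := fun t : {t : Fin N // (e.symm t).1 = j} => X t.1) _).symm
  exact reindex_congr (X := fun t : {t : Fin N // (e.symm t).1 = j} => X t.1)
    (ρ := (Equiv.sigmaCongrRight fun _ : Fin 1 => fiberEquiv e j).trans
      ((fiberOne j).sigmaCongrLeft.trans ((Equiv.sigmaCongrRight
        (fiberRestrict (Mor.idx (ofFin e b)) fun j' => Mor.idx (vhom s) j' = j)).trans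
        (Equiv.sigmaFiberEquiv
          (Mor.restrict (ofFin e b) fun j' => Mor.idx (vhom s) j' = j).idx))))
    (ρ' := (oneSigma (Fin (n j))).trans (fiberEquiv e j))
    (fun i => rfl) (F.comp (vop (s j)) (fun _ => b j)) rfl rfl

theorem vhom_comp_ofFin {F : CubicalFeynmanCat.{u}} {X X' : Fin N → F.V} {Y : Fin m → F.V}
    (s : ∀ t, (⟨X t⟩ : F.Vert) ⟶ ⟨X' t⟩) (a : ∀ j, F.Op (fun i => X' (e ⟨j, i⟩)) (Y j)) :
    ((vhom s : fam X ⟶ fam X') ≫ ofFin e a : fam X ⟶ fam Y) =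
      ofFin e (fun j => precomp (a j) (vhom (fun i => s (e ⟨j, i⟩)))) := by
  refine Mor.ext rfl (heq_of_eq (funext fun j => ?_))
  have h0 : precomp (a j) (vhom (fun i => s (e ⟨j, i⟩))) =
      F.reindex (sigmaOne (Fin (n j))) (X := fun i => X (e ⟨j, i⟩))
        (F.comp (a j) (fun i => vop (s (e ⟨j, i⟩)))) := by
    refine Eq.trans (congrArg (F.reindex _ (X := fun i => X (e ⟨j, i⟩))) (F.comp_reindex_right
      (fun i => fiberOne i) (X := fun i i' => X (e ⟨j, i'.1⟩)) (a j)
        (fun i => vop (s (e ⟨j, i⟩))))) ?_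
    refine (F.reindex_trans _ _ (X := fun i => X (e ⟨j, i⟩)) _).trans ?_
    exact reindex_congr (X := fun i => X (e ⟨j, i⟩)) (ρ' := sigmaOne (Fin (n j)))
      (fun i => rfl) (F.comp (a j) (fun i => vop (s (e ⟨j, i⟩)))) rfl rfl
  refine (comp_op (vhom s) (ofFin e a) j).trans ?_
  refine Eq.trans (congrArg (F.reindex _ (X := fun t : {t : Fin N // (e.symm t).1 = j} => X t.1))
    (F.comp_reindex_left (fiberEquiv e j) (Y := fun t : {t : Fin N // (e.symm t).1 = j} => X' t.1)
      (I := fun t => {t' : Fin N // t' = t.1}) (X := fun t i => X i.1) (a j)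
      (fun t => Mor.op (vhom s) t.1))) ?_
  refine (F.reindex_trans _ _
    (X := fun t : {t : Fin N // (e.symm t).1 = j} => X t.1) _).trans ?_
  refine Eq.trans (congrArg (F.reindex _ (X := fun t : {t : Fin N // (e.symm t).1 = j} => X t.1))
    (F.comp_reindex_right (fun i => fiberOne (e ⟨j, i⟩)) (X := fun _ t => X t.1) (a j)
      (fun i => vop (s (e ⟨j, i⟩))))) ?_
  refine (F.reindex_trans _ _
    (X := fun t : {t : Fin N // (e.symm t).1 = j} => X t.1) _).trans ?_
  refine Eq.trans ?_ (congrArg (F.reindex (fiberEquiv e j)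
    (X := fun t : {t : Fin N // (e.symm t).1 = j} => X t.1)) h0.symm)
  refine Eq.trans ?_ (F.reindex_trans (sigmaOne (Fin (n j))) (fiberEquiv e j)
    (X := fun t : {t : Fin N // (e.symm t).1 = j} => X t.1) _).symm
  exact reindex_congr (X := fun t : {t : Fin N // (e.symm t).1 = j} => X t.1)
    (ρ' := (sigmaOne (Fin (n j))).trans (fiberEquiv e j))
    (fun i => rfl) (F.comp (a j) (fun i => vop (s (e ⟨j, i⟩)))) rfl rfl

theorem ofFin_vhom {F : CubicalFeynmanCat.{u}} {X X' : Fin N → F.V} {Y Y' : Fin m → F.V}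
    (s : ∀ t, (⟨X t⟩ : F.Vert) ⟶ ⟨X' t⟩) (s' : ∀ j, (⟨Y j⟩ : F.Vert) ⟶ ⟨Y' j⟩)
    (a : ∀ j, F.Op (fun i => X' (e ⟨j, i⟩)) (Y' j))
    (b : ∀ j, F.Op (fun i => X (e ⟨j, i⟩)) (Y j)) :
    (ofFin e b ≫ vhom s' : fam X ⟶ fam Y') = (vhom s : fam X ⟶ fam X') ≫ ofFin e a ↔
      ∀ j, arrow (b j) ≫ Iso.hom (s' j) = vhom (fun i => s (e ⟨j, i⟩)) ≫ arrow (a j) := by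
  rw [ofFin_comp_vhom, vhom_comp_ofFin]
  have h1 : ∀ j, arrow (precomp (a j) (vhom (fun i => s (e ⟨j, i⟩)))) =
      vhom (fun i => s (e ⟨j, i⟩)) ≫ arrow (a j) := fun j => arrow_precomp _ _
  constructor
  · intro h j
    rw [← h1, ← congrFun (ofFin_injective e h) j, arrow_toOp]
  · intro h
    refine congrArg (ofFin e) (funext fun j => arrow_injective ?_)
    rw [h1, arrow_toOp, h]

end

end CubicalMorphism

namespace CubicalMorphism

variable {F₁ F₂ : CubicalFeynmanCat.{u}} {φ : CubicalMorphism F₁ F₂}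
    {m N : ℕ} {n : Fin m → ℕ} {e : (Σ j, Fin (n j)) ≃ Fin N} {X : Fin N → F₂.V}
    {Y : Fin m → F₂.V} {v : F₂.V} {b : F₂.Op Y v} {a : ∀ j, F₂.Op (fun i => X (e ⟨j, i⟩)) (Y j)}
    {C : ∀ t, φ.Cell (X t)} {D D' : ∀ j, φ.Cell (Y j)} {c₀ : φ.Cell v}

theorem isOver_iff {g' : ∀ j, F₁.Op (fun i => (C (e ⟨j, i⟩)).w) (D j).w} :
    (∀ j, IsOver (a j) (fun i => C (e ⟨j, i⟩)) (D j) (g' j)) ↔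
      φ.functor.map (ofFin (X := fun t => (C t).w) (Y := fun j => (D j).w) e g') ≫
        (cellIso D).hom = ((cellIso C).hom ≫ ofFin e a : _ ⟶ fam Y) := by
  have h := ofFin_vhom (e := e) (X := fun t => φ.obj (C t).w) (Y := fun j => φ.obj (D j).w)
    (fun t => (C t).σ) (fun j => (D j).σ) a (fun j => φ.map (g' j))
  refine Iff.trans ?_ (h.symm.trans ?_)
  · refine forall_congr' fun j => ?_
    unfold IsOver
    rw [map_arrow]
    rfl
  · refine Eq.congr ?_ rfl
    exact congrArg (· ≫ (cellIso D).hom) (φ.functor_map_ofFin (X := fun t => (C t).w)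
      (Y := fun j => (D j).w) e g').symm

theorem IsOver.comp {g : F₁.Op (fun j => (D j).w) c₀.w}
    {g' : ∀ j, F₁.Op (fun i => (C (e ⟨j, i⟩)).w) (D j).w} (hb : IsOver b D c₀ g)
    (ha : ∀ j, IsOver (a j) (fun i => C (e ⟨j, i⟩)) (D j) (g' j)) :
    IsOver (compTo e b a) C c₀ (compTo (X := fun t => (C t).w) e g g') := by
  have ha' := isOver_iff.1 ha
  unfold IsOver at hb ⊢
  rw [arrow_compTo, arrow_compTo]
  refine Eq.trans (congrArg (· ≫ c₀.iso.hom) (φ.functor.map_comp _ _)) ?_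
  refine (Category.assoc _ _ _).trans ?_
  refine Eq.trans (congrArg (_ ≫ ·) hb) ?_
  refine (Category.assoc _ _ _).symm.trans ?_
  refine Eq.trans (congrArg (· ≫ arrow b) ha') ?_
  exact Category.assoc _ _ _

theorem IsOver.cell_unique (hφ : φ.Admissible)
    {g : ∀ j, F₁.Op (fun i => (C (e ⟨j, i⟩)).w) (D j).w}
    {g' : ∀ j, F₁.Op (fun i => (C (e ⟨j, i⟩)).w) (D' j).w}
    (h : ∀ j, IsOver (a j) (fun i => C (e ⟨j, i⟩)) (D j) (g j))
    (h' : ∀ j, IsOver (a j) (fun i => C (e ⟨j, i⟩)) (D' j) (g' j)) : D = D' := by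
  have hf := hφ.faithful
  have h1 := isOver_iff.1 h
  have h1' := isOver_iff.1 h'
  let ψ := cellIso D ≪≫ (cellIso D').symm
  have h2 : φ.functor.map (ofFin (X := fun t => (C t).w) (Y := fun j => (D' j).w) e g') =
      φ.functor.map (ofFin (X := fun t => (C t).w) (Y := fun j => (D j).w) e g) ≫ ψ.hom := by
    rw [← cancel_mono (cellIso D').hom]
    refine h1'.trans (h1.symm.trans ?_)
    simp [ψ]
  obtain ⟨f, hf⟩ := hφ.factor₁ _ _ _ h2
  have hi : ∀ j, Mor.idx f j = j := by
    intro j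
    have := congrArg (fun g => Mor.idx g j) hf
    exact this
  have hd : F₁.degree.mdeg f = 0 := by
    rw [← mdeg_map (φ := φ), hf]
    exact F₂.degree.mdeg_iso ψ
  obtain ⟨θ, rfl⟩ := exists_vhom (X := fun j => (D j).w) (Y := fun j => (D' j).w) f hi hd
  have h3 : vhom (fun j => φ.vert.map (θ j)) ≫ (cellIso D').hom = (cellIso D).hom := by
    refine Eq.trans (congrArg (· ≫ (cellIso D').hom) (map_vhom θ).symm) ?_
    rw [hf]
    exact (Category.assoc _ _ _).trans
      ((congrArg ((cellIso D).hom ≫ ·) (cellIso D').inv_hom_id).trans (Category.comp_id _))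
  have h4 := vhom_injective ((vhom_comp (F := F₂) (fun j => φ.vert.map (θ j))
    (fun j => (D' j).σ)).symm.trans h3)
  exact funext fun j => Cell.eq_of_hom (θ j) (congrFun h4 j)

theorem exists_iso_cell {B : F₁.Cat} (σ : φ.functor.obj B ≅ fam Y) :
    ∃ (D : ∀ j, φ.Cell (Y j)) (ψ : B ≅ fam (fun j => (D j).w)),
      φ.functor.map ψ.hom ≫ (cellIso D).hom = σ.hom := by
  let i : Fin m ≃ B.I :=
    { toFun := Mor.idx σ.inv
      invFun := Mor.idx σ.hom
      left_inv := fun j => congrArg (fun g => Mor.idx g j) σ.inv_hom_id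
      right_inv := fun j => congrArg (fun g => Mor.idx g j) σ.hom_inv_id }
  have hr := F₁.cubical.isIso_of_deg (relabel i B.X) (deg_relabel i B.X)
  let ρ := asIso (relabel i B.X)
  let σ' := φ.functor.mapIso ρ ≪≫ σ
  obtain ⟨u, hu⟩ := exists_vhom (X := fun j => φ.obj (B.X (i j))) (Y := Y) σ'.hom
    (fun j => i.left_inv j) (F₂.degree.mdeg_iso σ')
  have hc := fun j => Cell.exists_hom (φ := φ) ⟨B.X (i j), u j⟩
  choose D θ hθ using hc
  refine ⟨D, ρ.symm ≪≫ vhomIso θ, ?_⟩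
  rw [← cancel_epi (φ.functor.map ρ.hom), ← Category.assoc, ← φ.functor.map_comp]
  have h1 : ρ.hom ≫ (ρ.symm ≪≫ vhomIso θ).hom = vhom θ := by simp [vhomIso]
  refine Eq.trans (congrArg (fun z => φ.functor.map z ≫ (cellIso D).hom) h1) ?_
  refine Eq.trans (congrArg (· ≫ (cellIso D).hom) (map_vhom θ)) ?_
  refine (vhom_comp (F := F₂) (fun j => φ.vert.map (θ j)) (fun j => (D j).σ)).trans ?_
  exact (congrArg vhom (funext hθ)).trans hu.symm

theorem IsOver.exists_factor (hφ : φ.Admissible) {G : F₁.Op (fun t => (C t).w) c₀.w}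
    (h : IsOver (compTo e b a) C c₀ G) : ∃ (D : ∀ j, φ.Cell (Y j))
      (g : F₁.Op (fun j => (D j).w) c₀.w)
      (g' : ∀ j, F₁.Op (fun i => (C (e ⟨j, i⟩)).w) (D j).w), IsOver b D c₀ g ∧
      ∀ j, IsOver (a j) (fun i => C (e ⟨j, i⟩)) (D j) (g' j) := by
  unfold IsOver at h
  rw [arrow_compTo] at h
  have h1 : φ.functor.map (arrow G) =
      ((cellIso C).hom ≫ ofFin e a : _ ⟶ fam Y) ≫ (arrow b ≫ c₀.iso.inv) := by
    rw [← cancel_mono c₀.iso.hom, h]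
    refine Eq.symm ((Category.assoc _ _ _).trans ?_)
    refine Eq.trans (congrArg (_ ≫ ·) ?_) (Category.assoc _ _ _)
    exact (Category.assoc _ _ _).trans
      ((congrArg (arrow b ≫ ·) c₀.iso.inv_hom_id).trans (Category.comp_id _))
  obtain ⟨B, g₂, g₁, σ, -, hg₁, hg₂⟩ := hφ.factor₂ (arrow G) _ _ h1
  obtain ⟨D, ψ, hψ⟩ := exists_iso_cell σ
  have h2 : φ.functor.map (g₂ ≫ ψ.hom) ≫ (cellIso D).hom =
      ((cellIso C).hom ≫ ofFin e a : _ ⟶ fam Y) := by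
    rw [φ.functor.map_comp, Category.assoc, hψ, hg₂]
  have hi : Mor.idx (g₂ ≫ ψ.hom) = fun t => (e.symm t).1 := by
    funext t
    exact congrArg (fun g => Mor.idx g t) h2
  obtain ⟨g', hg'⟩ := exists_ofFin (X := fun t => (C t).w) (Y := fun j => (D j).w) e _ hi
  refine ⟨D, toOp (A := fam fun j => (D j).w) (ψ.inv ≫ g₁), g', ?_,
    isOver_iff.2 ((congrArg (fun z => φ.functor.map z ≫ (cellIso D).hom) hg'.symm).trans h2)⟩
  unfold IsOver
  rw [arrow_toOp]
  have h3 : φ.functor.map g₁ = σ.hom ≫ arrow b ≫ c₀.iso.inv := by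
    rw [hg₁, σ.hom_inv_id_assoc]
  rw [φ.functor.map_comp, h3, ← hψ]
  have h4 : φ.functor.map ψ.inv ≫ φ.functor.map ψ.hom = 𝟙 _ := by
    rw [← φ.functor.map_comp, ψ.inv_hom_id, φ.functor.map_id]
  refine (Category.assoc _ _ _).trans ?_
  refine Eq.trans (congrArg (φ.functor.map ψ.inv ≫ ·) ((Category.assoc _ _ _).trans
    (congrArg ((φ.functor.map ψ.hom ≫ (cellIso D).hom) ≫ ·) ((Category.assoc _ _ _).trans
      ((congrArg (arrow b ≫ ·) c₀.iso.inv_hom_id).trans (Category.comp_id _)))))) ?_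
  refine (Category.assoc _ _ _).symm.trans (congrArg (· ≫ arrow b) ?_)
  exact (Category.assoc _ _ _).symm.trans ((congrArg (· ≫ (cellIso D).hom) h4).trans
    (Category.id_comp _))

end CubicalMorphism

namespace CubicalMorphism

variable {F₁ F₂ : CubicalFeynmanCat.{u}} {φ : CubicalMorphism F₁ F₂}

theorem IsOver.chainEquiv {N m m' : ℕ} {n : Fin m → ℕ} {n' : Fin m' → ℕ}
    {X : Fin N → F₂.V} {Y : Fin m → F₂.V} {Y' : Fin m' → F₂.V} {v : F₂.V}
    {e : (Σ j, Fin (n j)) ≃ Fin N} {b : F₂.Op Y v} {a : ∀ j, F₂.Op (fun i => X (e ⟨j, i⟩)) (Y j)}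
    {e' : (Σ j, Fin (n' j)) ≃ Fin N} {b' : F₂.Op Y' v}
    {a' : ∀ j, F₂.Op (fun i => X (e' ⟨j, i⟩)) (Y' j)}
    {C : ∀ t, φ.Cell (X t)} {D : ∀ j, φ.Cell (Y j)} {D' : ∀ j, φ.Cell (Y' j)} {c₀ : φ.Cell v}
    {h : F₁.Op (fun j => (D j).w) c₀.w} {g : ∀ j, F₁.Op (fun i => (C (e ⟨j, i⟩)).w) (D j).w}
    {h' : F₁.Op (fun j => (D' j).w) c₀.w} {g' : ∀ j, F₁.Op (fun i => (C (e' ⟨j, i⟩)).w) (D' j).w}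
    (hb : IsOver b D c₀ h) (ha : ∀ j, IsOver (a j) (fun i => C (e ⟨j, i⟩)) (D j) (g j))
    (hb' : IsOver b' D' c₀ h') (ha' : ∀ j, IsOver (a' j) (fun i => C (e' ⟨j, i⟩)) (D' j) (g' j))
    (hs : ChainEquiv (X := fun t => (C t).w) e h g e' h' g') : ChainEquiv e b a e' b' a' := by
  obtain ⟨ψ, h1, h2⟩ := hs
  have ha := isOver_iff.1 ha
  have ha' := isOver_iff.1 ha'
  let σ : fam Y ≅ fam Y' := (cellIso D).symm ≪≫ φ.functor.mapIso ψ ≪≫ cellIso D'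
  refine ⟨σ, ?_, ?_⟩
  · rw [← cancel_epi (cellIso C).hom]
    refine Eq.trans ?_ ha'
    rw [← h1, φ.functor.map_comp]
    refine (Category.assoc _ _ _).symm.trans ?_
    refine Eq.trans (congrArg (· ≫ σ.hom) ha.symm) ?_
    refine (Category.assoc _ _ _).trans ((congrArg (_ ≫ ·) ?_).trans (Category.assoc _ _ _).symm)
    exact (cellIso D).hom_inv_id_assoc _
  · refine arrow_injective ((arrow_precomp b' σ.hom).trans ?_)
    rw [← cancel_epi (cellIso D).hom]
    refine Eq.trans ?_ hb
    have h3 : arrow h = ψ.hom ≫ arrow h' := by rw [← h2]; exact arrow_precomp h' ψ.hom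
    rw [h3, φ.functor.map_comp]
    refine Eq.trans ?_ ((congrArg (φ.functor.map ψ.hom ≫ ·) hb'.symm).trans
      (Category.assoc _ _ _).symm)
    refine (Category.assoc _ _ _).symm.trans ((congrArg (· ≫ arrow b') ?_).trans
      (Category.assoc _ _ _))
    exact (cellIso D).hom_inv_id_assoc _

end CubicalMorphism

namespace Ops

open CubicalMorphism

variable {F₁ F₂ : CubicalFeynmanCat.{u}} {φ : CubicalMorphism F₁ F₂} {ε : Parity}

section
variable (P : RawOp F₁ k ε)

open Classical in
/-- The structure map of the operation that lies over `f`, and zero if there is none. -/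
noncomputable def coef {n : ℕ} {X : Fin n → F₂.V} {v : F₂.V} (f : F₂.Op X v) (hf : deg f ≤ 1)
    (p : Fin n → ℤ) (m : ℤ) (h : ∑ i, p i + ε.shift (deg f) = m) (c : ∀ i, φ.Cell (X i))
    (c₀ : φ.Cell v) :
    MultilinearMap k (fun i => (P.obj (c i).w).X (p i)) ((P.obj c₀.w).X m) :=
  if hg : ∃ g, IsOver f c c₀ g then
    P.act hg.choose (hg.choose_spec.deg_eq.le.trans hf) p m (by rw [hg.choose_spec.deg_eq]; exact h)
  else 0

variable (φ) in
/-- The complex `L^!(P)(v)`, the sum of `P(w) ⊗_{Aut(w)} k[Aut(v)]` over the `w` with `φ(w) = v`. In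
terms of the classes of pairs `(w, σ)`, whose elements are the `[p ⊗ σ]`, it is the (finite) direct sum
of one copy of `P(w)` for each class. -/
noncomputable def lComplex (v : F₂.V) : CochainComplex (ModuleCat.{u} k) ℤ where
  X m := ModuleCat.of k (∀ c : φ.Cell v, (P.obj c.w).X m)
  d m m' := ModuleCat.ofHom
    (LinearMap.pi fun c => ((P.obj c.w).d m m').hom ∘ₗ LinearMap.proj c)
  shape m m' h := by
    ext x c
    exact congrArg (fun g : (P.obj c.w).X m ⟶ (P.obj c.w).X m' => g.hom (x c))
      ((P.obj c.w).shape m m' h)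
  d_comp_d' i j l _ _ := by
    ext x c
    exact congrArg (fun g : (P.obj c.w).X i ⟶ (P.obj c.w).X l => g.hom (x c))
      ((P.obj c.w).d_comp_d i j l)

variable (φ) in
/-- The operad `L^!(P)`, without its axioms. For a generating morphism `f : (v_1, …, v_n) → v_0`, the
structure map sends `[p_1 ⊗ σ_1] ⊗ ⋯ ⊗ [p_n ⊗ σ_n]` to `[P(g)(p_1 ⊗ ⋯ ⊗ p_n) ⊗ σ_0]` if there is `g` with
`f ∘ (σ_1 ⊗ ⋯ ⊗ σ_n) = σ_0 ∘ φ(g)`, and to zero if there is none. -/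
noncomputable def lRaw : RawOp F₂ k ε where
  obj := lComplex φ P
  act f hf p m h := MultilinearMap.pi fun c₀ =>
    ∑ c, (coef (φ := φ) P f hf p m h c c₀).compLinearMap fun i => LinearMap.proj (c i)

theorem lRaw_act {n : ℕ} {X : Fin n → F₂.V} {v : F₂.V} (f : F₂.Op X v) (hf : deg f ≤ 1)
    (p : Fin n → ℤ) (m : ℤ) (h : ∑ i, p i + ε.shift (deg f) = m)
    (x : ∀ i, (lComplex φ P (X i)).X (p i)) (c₀ : φ.Cell v) :
    ((lRaw φ P).act f hf p m h x : ∀ c : φ.Cell v, (P.obj c.w).X m) c₀ =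
      ∑ c, coef P f hf p m h c c₀ (fun i => (x i : ∀ c : φ.Cell (X i), (P.obj c.w).X (p i)) (c i)) := by
  exact sum_apply (F := MultilinearMap k (fun i => (lComplex φ P (X i)).X (p i))
    ((P.obj c₀.w).X m)) Finset.univ
    (fun c : (∀ i, φ.Cell (X i)) => (coef P f hf p m h c c₀).compLinearMap
      fun i => LinearMap.proj (φ := fun c : φ.Cell (X i) => (P.obj c.w).X (p i)) (c i)) x

end

end Ops

namespace Ops

open CubicalMorphism

variable {F₁ F₂ : CubicalFeynmanCat.{u}} {φ : CubicalMorphism F₁ F₂} {ε : Parity}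

section
variable (P : RawOp F₁ k ε)

theorem rawAct_congr {F : CubicalFeynmanCat.{u}} (P : RawOp F k ε) {n : ℕ} {X : Fin n → F.V}
    {v : F.V} {a b : F.Op X v}
    (hab : a = b) (ha : deg a ≤ 1) (hb : deg b ≤ 1) (p : Fin n → ℤ) (m : ℤ)
    (h : ∑ i, p i + ε.shift (deg a) = m) (h' : ∑ i, p i + ε.shift (deg b) = m) :
    P.act a ha p m h = P.act b hb p m h' := by
  subst hab; rfl

theorem coef_eq (hφ : φ.Admissible) {n : ℕ} {X : Fin n → F₂.V} {v : F₂.V} {f : F₂.Op X v}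
    (hf : deg f ≤ 1) (p : Fin n → ℤ) (m : ℤ) (h : ∑ i, p i + ε.shift (deg f) = m)
    {c : ∀ i, φ.Cell (X i)} {c₀ : φ.Cell v} {g : F₁.Op (fun i => (c i).w) c₀.w}
    (hg : IsOver f c c₀ g) (hg₁ : deg g ≤ 1) (hg₂ : ∑ i, p i + ε.shift (deg g) = m) :
    coef P f hf p m h c c₀ = P.act g hg₁ p m hg₂ := by
  have H : ∃ g, IsOver f c c₀ g := ⟨g, hg⟩
  unfold coef
  rw [dif_pos H]
  exact rawAct_congr P (H.choose_spec.unique hφ hg) _ _ _ _ _ _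

theorem coef_zero {n : ℕ} {X : Fin n → F₂.V} {v : F₂.V} {f : F₂.Op X v}
    (hf : deg f ≤ 1) (p : Fin n → ℤ) (m : ℤ) (h : ∑ i, p i + ε.shift (deg f) = m)
    {c : ∀ i, φ.Cell (X i)} {c₀ : φ.Cell v} (hg : ¬ ∃ g, IsOver f c c₀ g) :
    coef P f hf p m h c c₀ = 0 := dif_neg hg

/-- Families of classes, sorted into blocks. -/
def cellEquiv {m N : ℕ} {n : Fin m → ℕ} (e : (Σ j, Fin (n j)) ≃ Fin N) (X : Fin N → F₂.V) :
    (∀ t, φ.Cell (X t)) ≃ (∀ j, ∀ i : Fin (n j), φ.Cell (X (e ⟨j, i⟩))) :=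
  (Equiv.piCongrLeft (fun t => φ.Cell (X t)) e).symm.trans
    (Equiv.piCurry (fun j i => φ.Cell (X (e ⟨j, i⟩))))

variable {m N : ℕ} {n : Fin m → ℕ} (e : (Σ j, Fin (n j)) ≃ Fin N)
    {X : Fin N → F₂.V} {Y : Fin m → F₂.V} {v : F₂.V} (b : F₂.Op Y v)
    (a : ∀ j, F₂.Op (fun i => X (e ⟨j, i⟩)) (Y j)) (hb : deg b ≤ 1) (ha : ∀ j, deg (a j) ≤ 1)
    (p : Fin N → ℤ) (q : Fin m → ℤ) (r : ℤ)
    (hq : ∀ j, ∑ i, p (e ⟨j, i⟩) + ε.shift (deg (a j)) = q j)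
    (hr : ∑ j, q j + ε.shift (deg b) = r)

/-- Composites of coefficients. -/
noncomputable def coef₂ (C : ∀ t, φ.Cell (X t)) (c₀ : φ.Cell v)
    (x : ∀ t, (P.obj (C t).w).X (p t)) : (P.obj c₀.w).X r :=
  sgn k (koszul e p (fun j => ε.shift (deg (a j)))) •
    ∑ D, coef P b hb q r hr D c₀ (fun j => coef P (a j) (ha j) (fun i => p (e ⟨j, i⟩)) (q j) (hq j)
      (fun i => C (e ⟨j, i⟩)) (D j) (fun i => x (e ⟨j, i⟩)))

theorem lRaw_act₂ (x : ∀ t, (lComplex φ P (X t)).X (p t)) (c₀ : φ.Cell v) :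
    ((lRaw φ P).act₂ e b a hb ha p q r hq hr x : ∀ c : φ.Cell v, (P.obj c.w).X r) c₀ =
      ∑ C, coef₂ P e b a hb ha p q r hq hr C c₀
        (fun t => (x t : ∀ c : φ.Cell (X t), (P.obj c.w).X (p t)) (C t)) := by
  unfold coef₂
  rw [← Finset.smul_sum, Finset.sum_comm]
  refine congrArg (fun z : (P.obj c₀.w).X r =>
    sgn k (koszul e p (fun j => ε.shift (deg (a j)))) • z) ?_
  refine (lRaw_act P b hb q r hr _ c₀).trans (Finset.sum_congr rfl fun D _ => ?_)
  refine Eq.trans (congrArg (coef P b hb q r hr D c₀) (funext fun j =>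
    lRaw_act P (a j) (ha j) (fun i => p (e ⟨j, i⟩)) (q j) (hq j) (fun i => x (e ⟨j, i⟩)) (D j))) ?_
  refine (MultilinearMap.map_sum (coef P b hb q r hr D c₀) _).trans ?_
  exact (Equiv.sum_comp (cellEquiv (φ := φ) e X) _).symm

variable {e b a hb ha p q r hq hr}

theorem coef₂_eq (hφ : φ.Admissible) {C : ∀ t, φ.Cell (X t)} {D : ∀ j, φ.Cell (Y j)}
    {c₀ : φ.Cell v} {g : F₁.Op (fun j => (D j).w) c₀.w}
    {g' : ∀ j, F₁.Op (fun i => (C (e ⟨j, i⟩)).w) (D j).w} (hg : IsOver b D c₀ g)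
    (hg' : ∀ j, IsOver (a j) (fun i => C (e ⟨j, i⟩)) (D j) (g' j))
    (x : ∀ t, (P.obj (C t).w).X (p t)) :
    coef₂ P e b a hb ha p q r hq hr C c₀ x =
      P.act₂ (X := fun t => (C t).w) e g g' (hg.deg_eq.le.trans hb)
        (fun j => (hg' j).deg_eq.le.trans (ha j)) p q r
        (fun j => by rw [(hg' j).deg_eq]; exact hq j) (by rw [hg.deg_eq]; exact hr) x := by
  unfold coef₂ RawOp.act₂
  have hd : (fun j => ε.shift (deg (a j))) = fun j => ε.shift (deg (g' j)) :=
    funext fun j => by rw [(hg' j).deg_eq]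
  rw [hd]
  refine congrArg (sgn k (koszul e p (fun j => ε.shift (deg (g' j)))) • ·) ?_
  refine (Finset.sum_eq_single D ?_ (fun h => (h (Finset.mem_univ _)).elim)).trans ?_
  · intro D' _ hD
    by_cases h : ∀ j, ∃ g'', IsOver (a j) (fun i => C (e ⟨j, i⟩)) (D' j) g''
    · choose g'' hg'' using h
      exact (hD (IsOver.cell_unique hφ hg'' hg')).elim
    · push Not at h
      obtain ⟨j, hj⟩ := h
      refine MultilinearMap.map_coord_zero _ j ?_
      rw [coef_zero P _ _ _ _ (not_exists.2 hj)]
      rfl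
  · rw [coef_eq P hφ hb q r hr hg]
    refine congrArg _ (funext fun j => ?_)
    rw [coef_eq P hφ (ha j) _ _ _ (hg' j)]

theorem coef₂_zero {C : ∀ t, φ.Cell (X t)} {c₀ : φ.Cell v}
    (hn : ¬ ∃ G, IsOver (compTo e b a) C c₀ G) (x : ∀ t, (P.obj (C t).w).X (p t)) :
    coef₂ P e b a hb ha p q r hq hr C c₀ x = 0 := by
  unfold coef₂
  refine (congrArg (sgn k (koszul e p (fun j => ε.shift (deg (a j)))) • ·)
    (Finset.sum_eq_zero fun D _ => ?_)).trans (smul_zero _)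
  by_cases h : ∀ j, ∃ g'', IsOver (a j) (fun i => C (e ⟨j, i⟩)) (D j) g''
  · choose g'' hg'' using h
    have : ¬ ∃ g, IsOver b D c₀ g := fun ⟨g, hg⟩ => hn ⟨_, hg.comp hg''⟩
    rw [coef_zero P _ _ _ _ this]
    rfl
  · push Not at h
    obtain ⟨j, hj⟩ := h
    refine MultilinearMap.map_coord_zero _ j ?_
    rw [coef_zero P _ _ _ _ (not_exists.2 hj)]
    rfl

end

theorem vhom_single {F : CubicalFeynmanCat.{u}} {v w : F.Vert} (θ : v ⟶ w) :
    vhom (I := Fin 1) (X := fun _ => v.of) (Y := fun _ => w.of) (fun _ => θ) = Iso.hom θ := by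
  have h : toOp (v := w.of) (vhom (I := Fin 1) (X := fun _ => v.of) (Y := fun _ => w.of)
      (fun _ => θ)) = vop θ := by
    refine Eq.trans ?_ (F.one_comp (vop θ))
    refine Eq.trans (congrArg (F.reindex _ (X := fun _ => v.of)) (F.comp_reindex_right
      (fun j : Fin 1 => fiberOne j) (X := fun _ _ => v.of) (F.one w.of) (fun _ => vop θ))) ?_
    refine (F.reindex_trans _ _ (X := fun _ => v.of) _).trans ?_
    exact reindex_congr (X := fun _ => v.of) (ρ' := oneSigma (Fin 1))
      (fun i => Subsingleton.elim (α := Fin 1) _ _) (F.comp (F.one w.of) (fun _ => vop θ)) rfl rfl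
  refine (arrow_toOp (X := fun _ : Fin 1 => v.of) _).symm.trans ((congrArg arrow h).trans ?_)
  exact arrow_toOp (X := fun _ : Fin 1 => v.of) (Iso.hom θ)

theorem arrow_one {F : CubicalFeynmanCat.{u}} (v : F.V) :
    arrow (F.one v) = 𝟙 (single v : F.Cat) :=
  (congrArg arrow (vop_id ⟨v⟩).symm).trans
    (arrow_toOp (X := fun _ : Fin 1 => v) (𝟙 (single v : F.Cat)))

theorem cellIso_single {v : F₂.V} (c : φ.Cell v) :
    (cellIso (fun _ : Fin 1 => c)).hom = c.iso.hom :=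
  vhom_single (v := φ.vert.obj ⟨c.w⟩) (w := ⟨v⟩) c.σ

theorem isOver_one {v : F₂.V} (c : φ.Cell v) :
    IsOver (F₂.one v) (fun _ : Fin 1 => c) c (F₁.one c.w) := by
  unfold IsOver
  rw [arrow_one, arrow_one, cellIso_single]
  exact (congrArg (· ≫ c.iso.hom) (φ.functor.map_id _)).trans
    ((Category.id_comp _).trans (Category.comp_id _).symm)

theorem cell_eq_of_isOver_one {v : F₂.V} {c c₀ : φ.Cell v}
    {g : F₁.Op (fun _ : Fin 1 => c.w) c₀.w} (h : IsOver (F₂.one v) (fun _ => c) c₀ g) : c = c₀ := by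
  have hd : deg g = 0 := h.deg_eq.trans (F₂.degree.deg_one v)
  obtain ⟨θ, rfl⟩ := exists_vop g hd
  unfold IsOver at h
  rw [arrow_one, cellIso_single] at h
  have h1 : arrow (vop θ) = Iso.hom θ := arrow_toOp (X := fun _ : Fin 1 => c.w) (Iso.hom θ)
  refine Cell.eq_of_hom θ (Iso.ext ?_)
  refine Eq.trans ?_ (h.trans (Category.comp_id _))
  exact congrArg (fun z => φ.functor.map z ≫ c₀.iso.hom) h1.symm

theorem lRaw_dAt (P : RawOp F₁ k ε) {n : ℕ} {X : Fin n → F₂.V} {p : Fin n → ℤ}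
    (x : ∀ j, (lComplex φ P (X j)).X (p j)) (i j : Fin n) (c : φ.Cell (X j)) :
    (dAt (fun j => lComplex φ P (X j)) x i j : ∀ c : φ.Cell (X j), (P.obj c.w).X (bump p i j)) c =
      if h : j = i then ((P.obj c.w).d (p j) (bump p i j)).hom
        ((x j : ∀ c : φ.Cell (X j), (P.obj c.w).X (p j)) c)
      else ((P.obj c.w).XIsoOfEq (show p j = bump p i j by simp [bump, h])).hom.hom
        ((x j : ∀ c : φ.Cell (X j), (P.obj c.w).X (p j)) c) := by
  unfold dAt
  split_ifs with h
  · rfl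
  · have : ∀ (r : ℤ) (hr : p j = r), (((lComplex φ P (X j)).XIsoOfEq hr).hom.hom (x j) :
        ∀ c : φ.Cell (X j), (P.obj c.w).X r) c =
        ((P.obj c.w).XIsoOfEq hr).hom.hom ((x j : ∀ c : φ.Cell (X j), (P.obj c.w).X (p j)) c) := by
      intro r hr; subst hr; simp [HomologicalComplex.XIsoOfEq]
    exact this _ _

theorem lRaw_isOp (hφ : φ.Admissible) (P : Ops F₁ k ε) : (lRaw φ P.toRawOp).IsOp where
  act_one v h1 m h x := by
    funext c₀
    refine (lRaw_act P.toRawOp _ h1 _ m h x c₀).trans ?_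
    refine (Finset.sum_eq_single (fun _ => c₀) ?_ (fun h => (h (Finset.mem_univ _)).elim)).trans ?_
    · intro c _ hc
      obtain ⟨c, rfl⟩ : ∃ c', c = fun _ => c' :=
        ⟨c 0, funext fun i => congrArg c (Subsingleton.elim _ _)⟩
      rw [coef_zero]
      · rfl
      · rintro ⟨g, hg⟩
        exact hc (funext fun _ => cell_eq_of_isOver_one hg)
    · have hd : deg (F₁.one c₀.w) = 0 := F₁.degree.deg_one _
      rw [coef_eq P.toRawOp hφ h1 _ m h (isOver_one c₀) (hd.le.trans (Nat.zero_le 1))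
        (by rw [hd]; simp)]
      exact P.isOp.act_one _ _ _ _ _
  act_comp := by
    intro m N n e X Y v b a hb ha hc p q r hq hr hp x
    funext c₀
    refine (lRaw_act P.toRawOp _ hc p r hp x c₀).trans
      ((Finset.sum_congr rfl fun C _ => ?_).trans
        (lRaw_act₂ P.toRawOp e b a hb ha p q r hq hr x c₀).symm)
    by_cases h : ∃ G, IsOver (compTo e b a) C c₀ G
    · obtain ⟨G, hG⟩ := h
      obtain ⟨D, g, g', hg, hg'⟩ := hG.exists_factor hφ
      have hcomp := hg.comp hg'
      rw [coef₂_eq P.toRawOp hφ hg hg', coef_eq P.toRawOp hφ hc p r hp hcomp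
        (hcomp.deg_eq.le.trans hc) (by rw [hcomp.deg_eq]; exact hp)]
      exact P.isOp.act_comp _ _ _ _ _ _ _ _ _ _ _ _ _
    · rw [coef₂_zero P.toRawOp h, coef_zero P.toRawOp _ _ _ _ h]
      rfl
  act_swap := by
    intro N m m' n n' X Y Y' v e b a e' b' a' hb ha hb' ha' ha₁ ha₁' hc hs p q q' r hq hr hq' hr' x
    funext c₀
    refine (lRaw_act₂ P.toRawOp e b a hb.le ha₁ p q r hq hr x c₀).trans ?_
    refine Eq.trans ?_ (congrArg (fun z : (P.obj c₀.w).X r => ε.swapSign k • z)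
      (lRaw_act₂ P.toRawOp e' b' a' hb'.le ha₁' p q' r hq' hr' x c₀).symm)
    rw [Finset.smul_sum]
    refine Finset.sum_congr rfl fun C _ => ?_
    by_cases h : ∃ G, IsOver (compTo e b a) C c₀ G
    · obtain ⟨G, hG⟩ := h
      obtain ⟨D, g, g', hg, hg'⟩ := hG.exists_factor hφ
      have hG₂ : IsOver (compTo e' b' a') C c₀ G := hc ▸ hG
      obtain ⟨D₂, g₂, g₂', hg₂, hg₂'⟩ := hG₂.exists_factor hφ
      rw [coef₂_eq P.toRawOp hφ hg hg', coef₂_eq P.toRawOp hφ hg₂ hg₂']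
      refine P.isOp.act_swap (X := fun t => (C t).w) e g g' e' g₂ g₂' (hg.deg_eq.trans hb)
        ((Finset.sum_congr rfl fun j _ => (hg' j).deg_eq).trans ha) (hg₂.deg_eq.trans hb')
        ((Finset.sum_congr rfl fun j _ => (hg₂' j).deg_eq).trans ha') _ _ ?_
        (fun h => hs (hg.chainEquiv hg' hg₂ hg₂' h)) p q q' r _ _ _ _ _
      exact ((hg.comp hg').unique hφ hG).trans ((hg₂.comp hg₂').unique hφ hG₂).symm
    · rw [coef₂_zero P.toRawOp h, coef₂_zero P.toRawOp (hc ▸ h), smul_zero]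
  d_act := by
    intro n X v a ha p m m' hm h h' x
    funext c₀
    have h1 : ∀ c, ((P.obj c₀.w).d m m').hom (coef P.toRawOp a ha p m h c c₀
        (fun i => (x i : ∀ c : φ.Cell (X i), (P.obj c.w).X (p i)) (c i))) =
        sgn k (ε.shift (deg a)) • ∑ i, sgn k (∑ j, if j < i then p j else 0) •
          coef P.toRawOp a ha (bump p i) m' (h' i) c c₀ (fun j =>
            (dAt (fun j => lComplex φ P.toRawOp (X j)) x i j :
              ∀ c : φ.Cell (X j), (P.obj c.w).X (bump p i j)) (c j)) := by
      intro c
      by_cases hg : ∃ g, IsOver a c c₀ g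
      · obtain ⟨g, hg⟩ := hg
        rw [coef_eq P.toRawOp hφ ha p m h hg (hg.deg_eq.le.trans ha) (by rw [hg.deg_eq]; exact h)]
        refine (P.isOp.d_act g _ p m m' hm _ (fun i => by rw [hg.deg_eq]; exact h' i) _).trans ?_
        have hsg : sgn k (ε.shift (deg g)) = sgn k (ε.shift (deg a)) := by rw [hg.deg_eq]
        rw [hsg]
        refine congrArg (fun z : (P.obj c₀.w).X m' => sgn k (ε.shift (deg a)) • z)
          (Finset.sum_congr rfl fun i _ => ?_)
        rw [coef_eq P.toRawOp hφ ha (bump p i) m' (h' i) hg (hg.deg_eq.le.trans ha)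
          (by rw [hg.deg_eq]; exact h' i)]
        refine congrArg (fun z : (P.obj c₀.w).X m' => sgn k (∑ j, if j < i then p j else 0) • z) ?_
        exact congrArg _ (funext fun j => (lRaw_dAt P.toRawOp x i j (c j)).symm)
      · rw [coef_zero P.toRawOp _ _ _ _ hg]
        simp only [coef_zero P.toRawOp _ _ _ _ hg]
        simp
    refine Eq.trans (congrArg ((P.obj c₀.w).d m m').hom (lRaw_act P.toRawOp a ha p m h x c₀)) ?_
    rw [map_sum, Finset.sum_congr rfl fun c _ => h1 c, ← Finset.smul_sum, Finset.sum_comm]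
    refine congrArg (fun z : (P.obj c₀.w).X m' => sgn k (ε.shift (deg a)) • z) ?_
    have h2 : ∀ (y : Fin n → ∀ c : φ.Cell v, (P.obj c.w).X m'),
        (∑ i, y i) c₀ = ∑ i, y i c₀ := fun y => Finset.sum_apply _ _ _
    refine Eq.trans (Finset.sum_congr rfl fun i _ => ?_) (h2 _).symm
    rw [← Finset.smul_sum]
    exact congrArg (fun z : (P.obj c₀.w).X m' => sgn k (∑ j, if j < i then p j else 0) • z)
      (lRaw_act P.toRawOp a ha (bump p i) m' (h' i) _ c₀).symm

/-- The exceptional push-forward `L^!`. -/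
noncomputable def lShriek (hφ : φ.Admissible) : Ops F₁ k ε ⥤ Ops F₂ k ε where
  obj P := ⟨lRaw φ P.toRawOp, lRaw_isOp hφ P⟩
  map {P Q} f :=
    { app := fun v =>
        { f := fun m => ModuleCat.ofHom (X := (lComplex φ P.toRawOp v).X m)
            (Y := (lComplex φ Q.toRawOp v).X m)
            (LinearMap.pi fun c => ((RawOp.Hom.app f c.w).f m).hom ∘ₗ LinearMap.proj c)
          comm' := by
            intro m m' _
            ext x
            refine funext fun c : φ.Cell v => ?_
            exact congrArg (fun g : (P.obj c.w).X m ⟶ (Q.obj c.w).X m' => g.hom (x c))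
              ((RawOp.Hom.app f c.w).comm m m') }
      map_act := by
        intro n X v a ha p m h x
        funext c₀
        refine Eq.trans (congrArg ((RawOp.Hom.app f c₀.w).f m).hom
          (lRaw_act P.toRawOp a ha p m h x c₀)) ?_
        refine Eq.trans ?_ (lRaw_act Q.toRawOp a ha p m h _ c₀).symm
        rw [map_sum]
        refine Finset.sum_congr rfl fun c _ => ?_
        by_cases hg : ∃ g, IsOver a c c₀ g
        · obtain ⟨g, hg⟩ := hg
          rw [coef_eq P.toRawOp hφ ha p m h hg (hg.deg_eq.le.trans ha) (by rw [hg.deg_eq]; exact h),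
            coef_eq Q.toRawOp hφ ha p m h hg (hg.deg_eq.le.trans ha) (by rw [hg.deg_eq]; exact h)]
          exact RawOp.Hom.map_act f g _ p m _ _
        · rw [coef_zero P.toRawOp _ _ _ _ hg, coef_zero Q.toRawOp _ _ _ _ hg]
          exact map_zero _ }

end Ops

section Quadratic

variable {F : CubicalFeynmanCat.{u}}

/-- A formal generator of the weight one part of the free operad: a generating morphism of degree one
and elements of `E` at its inputs. -/
structure WGen (E : VMod F k) (ε : Parity) (v : F.V) (m : ℤ) where
  n : ℕ
  X : Fin n → F.V
  op : F.Op X v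
  deg_op : deg op = 1
  p : Fin n → ℤ
  h : ∑ i, p i + ε.shift (deg op) = m
  x : ∀ i, (E.obj ⟨X i⟩).X (p i)

variable {E : VMod F k} {ε : Parity}

/-- The element of the free operad given by a generator of weight one. -/
noncomputable def WGen.eval {v : F.V} {m : ℤ} (t : WGen E ε v m) : ((Ops.free E ε).obj v).X m :=
  (Ops.free E ε).act t.op t.deg_op.le t.p m t.h
    (fun i => (((Ops.unit (E := E) (ε := ε)).app ⟨t.X i⟩).f (t.p i)).hom (t.x i))

/-- The same for linear combinations. -/
noncomputable def evalLin (E : VMod F k) (ε : Parity) (v : F.V) (m : ℤ) :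
    (WGen E ε v m →₀ k) →ₗ[k] ((Ops.free E ε).obj v).X m :=
  Finsupp.linearCombination k WGen.eval

/-- The weight one part of the free operad. -/
noncomputable def weightOne (E : VMod F k) (ε : Parity) (v : F.V) (m : ℤ) :
    Submodule k (((Ops.free E ε).obj v).X m) :=
  LinearMap.range (evalLin E ε v m)

/-- The linear dual of a complex: the dual of the component of degree `-q` in degree `q`, with the
transposed differential. -/
noncomputable def dualComplex (C : CochainComplex (ModuleCat.{u} k) ℤ) :
    CochainComplex (ModuleCat.{u} k) ℤ where
  X q := ModuleCat.of k (Module.Dual k (C.X (-q)))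
  d i j := ModuleCat.ofHom ((C.d (-j) (-i)).hom.dualMap)
  shape i j h := by
    have h0 : C.d (-j) (-i) = 0 := C.shape _ _ (by
      change ¬ (-j + 1 = -i)
      change ¬ (i + 1 = j) at h
      omega)
    rw [h0]
    ext x y
    exact map_zero x
  d_comp_d' i j l _ _ := by
    ext x y
    refine Eq.trans ?_ (map_zero x)
    exact congrArg (fun g : C.X (-l) ⟶ C.X (-i) => x (g.hom y)) (C.d_comp_d (-l) (-j) (-i))

/-- The transpose of a chain map. -/
noncomputable def dualMor {C D : CochainComplex (ModuleCat.{u} k) ℤ} (f : C ⟶ D) :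
    dualComplex D ⟶ dualComplex C where
  f q := ModuleCat.ofHom (X := Module.Dual k (D.X (-q))) (Y := Module.Dual k (C.X (-q)))
    (f.f (-q)).hom.dualMap
  comm' i j _ := by
    ext x
    refine LinearMap.ext fun y => ?_
    exact congrArg (fun g : C.X (-j) ⟶ D.X (-i) => (show Module.Dual k (D.X (-i)) from x) (g.hom y))
      (f.comm (-j) (-i)).symm

/-- The linear dual of a `V`-module. -/
noncomputable def dualModule (E : VMod F k) : VMod F k where
  obj v := dualComplex (E.obj v)
  map θ := dualMor (E.map (Groupoid.inv θ))
  map_id v := by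
    have : Groupoid.inv (𝟙 v) = 𝟙 v := by simp
    rw [this, E.map_id]
    rfl
  map_comp θ θ' := by
    have : Groupoid.inv (θ ≫ θ') = Groupoid.inv θ' ≫ Groupoid.inv θ := by simp
    rw [this, E.map_comp]
    rfl

/-- The evaluation of a functional on an element; zero unless the degrees are opposite. -/
noncomputable def dualEval (C : CochainComplex (ModuleCat.{u} k) ℤ) {q p : ℤ}
    (η : (dualComplex C).X q) (x : C.X p) : k :=
  if h : p = -q then (show Module.Dual k (C.X (-q)) from η) ((C.XIsoOfEq h).hom.hom x) else 0

/-- The ways to write `a = b ∘ (u_1 ⊗ ⋯ ⊗ u_n)`, where the `u_j` are isomorphisms of vertices (and the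
inputs are permuted by `π`). -/
structure IsoMatch {n n' : ℕ} {X : Fin n → F.V} {Y : Fin n' → F.V} {v : F.V} (b : F.Op Y v)
    (a : F.Op X v) where
  π : Fin n' ≃ Fin n
  u : ∀ j, (⟨X (π j)⟩ : F.Vert) ⟶ ⟨Y j⟩
  comp : compTo ((sigmaOne (Fin n')).trans π) b (fun j => vop (u j)) = a

/-- The pairing of generators of weight one of the free operads on the linear dual of `E` and on `E`:
`⟨(b, η), (a, x)⟩` is the sum, over the ways to write `a` as the composite of `b` with an isomorphism, of the
values of `η` on the image of `x` under this isomorphism. -/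
noncomputable def weightPair {δ : Parity} {v : F.V} {m m' : ℤ} (s : WGen (dualModule E) δ v m')
    (t : WGen E ε v m) : k :=
  ∑ᶠ l : IsoMatch s.op t.op,
    sgn k (koszul ((sigmaOne (Fin s.n)).trans l.π) t.p (fun _ => 0)) *
      ∏ j, dualEval (E.obj ⟨s.X j⟩) (s.x j) (((E.map (l.u j)).f (t.p (l.π j))).hom (t.x (l.π j)))

/-- The pairing of linear combinations. -/
noncomputable def weightPairLin (E : VMod F k) (ε δ : Parity) (v : F.V) (m m' : ℤ) :
    (WGen (dualModule E) δ v m' →₀ k) →ₗ[k] (WGen E ε v m →₀ k) →ₗ[k] k :=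
  Finsupp.linearCombination k fun s => Finsupp.linearCombination k fun t => weightPair s t

/-- The functionals vanishing on `S`, as subspaces of the weight one part of the free operad of
parity `δ` on the linear dual of `E`. -/
noncomputable def perp (δ : Parity) (S : ∀ (v : F.V) (m : ℤ), Submodule k (((Ops.free E ε).obj v).X m))
    (v : F.V) (m' : ℤ) : Submodule k (((Ops.free (dualModule E) δ).obj v).X m') :=
  (⨅ m, ((S v m).comap (evalLin E ε v m)).dualAnnihilator.comap (weightPairLin E ε δ v m m')).map
    (evalLin (dualModule E) δ v m')

/-- The operad `F(E)/⟨S⟩`. -/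
noncomputable def quadraticOp (S : ∀ (v : F.V) (m : ℤ), Submodule k (((Ops.free E ε).obj v).X m)) :
    Ops F k ε :=
  (OpIdeal.span S).quot

/-- `S` is a sub-`V`-module (in complexes) of the weight one part of the free operad on `E`. -/
structure IsQuadraticDatum
    (S : ∀ (v : F.V) (m : ℤ), Submodule k (((Ops.free E ε).obj v).X m)) : Prop where
  le : ∀ v m, S v m ≤ weightOne E ε v m
  d_mem : ∀ v m m' x, x ∈ S v m → (((Ops.free E ε).obj v).d m m').hom x ∈ S v m'
  map_mem : ∀ (v w : F.Vert) (θ : v ⟶ w) m x, x ∈ S v.of m →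
    (Ops.free E ε).vmap θ m x ∈ S w.of m

variable (E) in
/-- `E` is of finite type: the vector spaces `E(v)_m` are finite-dimensional, and so are, in each
degree, the tensor products `E(v_1) ⊗ ⋯ ⊗ E(v_n)` for each source `(v_1, …, v_n)` of a generating morphism of
degree one; the latter means that only finitely many tuples of degrees contribute. -/
structure FiniteType : Prop where
  finite : ∀ (v : F.Vert) (m : ℤ), FiniteDimensional k ((E.obj v).X m)
  finite_degrees : ∀ {n : ℕ} {X : Fin n → F.V} {v : F.V} (a : F.Op X v), deg a = 1 →
    ∀ N : ℤ, {p : Fin n → ℤ | ∑ i, p i = N ∧ ∀ i, Nontrivial ((E.obj ⟨X i⟩).X (p i))}.Finite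

end Quadratic

variable {F₁ F₂ : CubicalFeynmanCat.{u}}

/-- `φ` is quadratic preserving: the natural transformation `F₁ r ⇒ R F₂` is surjective at each
vertex, and its kernel is generated, as an ideal, by its part of weight one. -/
structure QuadraticPreserving (k : Type u) [Field k] {φ : CubicalMorphism F₁ F₂}
    (hφ : φ.Admissible) : Prop where
  surjective : ∀ (ε : Parity) (E : VMod F₂ k) (v : F₁.V) (m : ℤ),
    Function.Surjective ((RawOp.Hom.app (Ops.beta hφ E ε) v).f m).hom
  ker : ∀ (ε : Parity) (E : VMod F₂ k), OpIdeal.ker (Ops.beta hφ E ε) =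
    OpIdeal.span fun v m => (OpIdeal.ker (Ops.beta hφ E ε)).carrier v m ⊓
      weightOne (Ops.resV φ E) ε v m

/-- The composite `F₁(rE) → R F₂(E) → R(F₂(E)/⟨T⟩)`. -/
noncomputable def projToRes {φ : CubicalMorphism F₁ F₂} (hφ : φ.Admissible) {E : VMod F₂ k}
    {δ : Parity} (T : ∀ (v : F₂.V) (m : ℤ), Submodule k (((Ops.free E δ).obj v).X m)) :
    Ops.free (Ops.resV φ E) δ ⟶ (Ops.res hφ).obj (quadraticOp T) :=
  Ops.beta hφ E δ ≫ (Ops.res hφ).map (OpIdeal.span T).π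

/-- The weight one part of the kernel of `F₁(rE) → R(F₂(E)/⟨T⟩)`; these are the relations of
`R(F₂(E)/⟨T⟩)`, as an operad with generators `rE`. -/
noncomputable def resRel {φ : CubicalMorphism F₁ F₂} (hφ : φ.Admissible) {E : VMod F₂ k}
    {δ : Parity} (T : ∀ (v : F₂.V) (m : ℤ), Submodule k (((Ops.free E δ).obj v).X m))
    (v : F₁.V) (m : ℤ) : Submodule k (((Ops.free (Ops.resV φ E) δ).obj v).X m) :=
  (OpIdeal.ker (projToRes hφ T)).carrier v m ⊓ weightOne (Ops.resV φ E) δ v m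

end Operads

/-! ### Morphisms of operads, induction on free operads, quotients by ideals -/

section OperadMaps

open CubicalFeynmanCat ColOperad

variable {k : Type u} [Field k] {F : CubicalFeynmanCat.{u}} {ε : Parity}

namespace Ops

/-! Write $\mathcal O = F_\epsilon(E)/\langle S\rangle$.

Computation of $R^!$. An element of $L^!(P)(v)$ is a family of components in $P$, indexed by the
classes of pairs $(w, \sigma\colon \phi(w)\cong v)$ (the cells), and its component at $(w,\sigma)$
is the component at $(w,\mathrm{id})$ of its translate along $\sigma^{-1}$. Hence morphisms $E\to
L^!(P)$ of $\mathbb V_2$-modules are the same as morphisms $rE\to P$ (`toShriek`, `ofShriek`), and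
morphisms of operads $F(E)\to L^!(P)$ are the same as morphisms $F(rE)\to P$. Such a morphism kills
$S$ exactly when the corresponding one kills all components of the images of $S$ in $L^!F(rE)$. If
$S'$ denotes the span of these components (`shriekRel`), then $F(rE)/\langle S'\rangle$ has the
universal property of $R^!(\mathcal O)$ (`universalArrowIsInitial`). As every operad is a quotient
of a free one, $R^!$ exists.

Part 1. Surjectivity of $\pi_1$ is inherited from $\beta$. For the kernel, surjectivity of $\beta$
forces every generating morphism of degree at most one with target $\phi(w)$ to be some $\phi(g)$ up
to an isomorphism of its source (`isLiftable`). So $S^\perp$ lifts at the vertices $\phi(w)$ to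
elements of $K$, and the elements that come from $\langle K\rangle$ form an ideal (`pushIdeal`)
which contains $\langle S^\perp\rangle$. An element of $\ker\pi_1$ is therefore congruent modulo
$\langle K\rangle$ to an element of $\ker\beta$, which is generated by its weight one part, and that
part lies in $K$ (`ker_projToRes`).

Part 2. The ideals $\langle S'\rangle$ and $\langle K^\perp\rangle$ have to be compared under
$rE\cong (rE^*)^*$. This rests on three properties of the pairing of weight one elements; the
pairing itself does not involve the parities, which enter only through degrees and through the signs
of the differentials. (a) Weight one elements of $\langle S^\perp\rangle$ pair to zero with $S$
(`weightPairLin_eq_zero`). As the free operad is given by generators and relations, this needs a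
model in which weight one elements can be detected: an operad in which composites of two operations
of degree one vanish and in which a weight one element is represented by its pairing function and
that of its differential (`truncSquareZero`). The same model proves `isLiftable`. (b) Every
functional on the weight one part of $F(E)$ in a given degree is the pairing with a weight one
element of the dual free operad (`exists_weightPairLin_eq`). This is an average over isomorphisms of
operations and uses characteristic zero, finite type, and the finiteness of the set of degree one
operations with given target. (c) Taking the component at a cell is adjoint to taking the image
under $\phi$ (`weightPairLin_shriekLin`); this is a bijection between sets of isomorphisms of
operations. By (c) and (a), $S'$ is orthogonal to $K$, so it lies in $K^\perp$. Conversely, if an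
element of $K^\perp$ were not in $\langle S'\rangle$, a functional vanishing on $\langle S'\rangle$
would separate it. By (b) this functional is the pairing with some $\xi$, and by (c) the image of
$\xi$ annihilates $S$, so $\xi\in K$, a contradiction. -/

/-- A morphism of operads on a homogeneous component. -/
abbrev hap {P Q : Ops F k ε} (f : P ⟶ Q) (v : F.V) (m : ℤ) :
    (P.obj v).X m →ₗ[k] (Q.obj v).X m :=
  ((RawOp.Hom.app f v).f m).hom

/-- The value of an operation on homogeneous elements, with the output degree computed. -/
theorem hap_act {P Q : Ops F k ε} (f : P ⟶ Q) {n : ℕ} {X : Fin n → F.V} {v : F.V} (a : F.Op X v)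
    (ha : deg a ≤ 1) (p : Fin n → ℤ) (m : ℤ) (h : ∑ i, p i + ε.shift (deg a) = m)
    (x : ∀ i, (P.obj (X i)).X (p i)) :
    hap f v m (P.act a ha p m h x) = Q.act a ha p m h (fun i => hap f (X i) (p i) (x i)) :=
  RawOp.Hom.map_act f a ha p m h x

theorem hap_vmap {P Q : Ops F k ε} (f : P ⟶ Q) {v w : F.Vert} (θ : v ⟶ w) (m : ℤ)
    (x : (P.obj v.of).X m) : hap f w.of m (P.vmap θ m x) = Q.vmap θ m (hap f v.of m x) :=
  hap_act f _ _ _ _ _ _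

theorem hap_d {P Q : Ops F k ε} (f : P ⟶ Q) (v : F.V) (m m' : ℤ) (x : (P.obj v).X m) :
    hap f v m' (((P.obj v).d m m').hom x) = ((Q.obj v).d m m').hom (hap f v m x) :=
  congrArg (fun g : (P.obj v).X m ⟶ (Q.obj v).X m' => g.hom x)
      ((RawOp.Hom.app f v).comm m m').symm

theorem hom_ext {P Q : Ops F k ε} {f g : P ⟶ Q} (h : ∀ v m x, hap f v m x = hap g v m x) : f = g :=
  RawOp.Hom.ext (funext fun v => HomologicalComplex.hom_ext _ _ fun m =>
    ModuleCat.hom_ext (LinearMap.ext fun x => h v m x))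

/-- A morphism of operads whose components are bijective is an isomorphism. -/
theorem isIso_of_bijective {P Q : Ops F k ε} (f : P ⟶ Q)
    (h : ∀ v m, Function.Bijective (hap f v m)) : IsIso f := by
  let e := fun v m => LinearEquiv.ofBijective (hap f v m) (h v m)
  have he : ∀ v m x, hap f v m ((e v m).symm x) = x := fun v m x => (e v m).apply_symm_apply x
  let g : Q ⟶ P :=
    { app := fun v =>
        { f := fun m => ModuleCat.ofHom ((e v m).symm : (Q.obj v).X m →ₗ[k] (P.obj v).X m)
          comm' := by
            intro m m' _
            ext x
            refine (h v m').1 ?_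
            refine (hap_d f v m m' _).trans ?_
            exact (congrArg ((Q.obj v).d m m').hom (he v m x)).trans (he v m' _).symm }
      map_act := by
        intro n X v a ha p m hm x
        refine (h v m).1 ((he v m _).trans ?_)
        refine Eq.trans ?_ (hap_act f a ha p m hm _).symm
        exact congrArg (Q.act a ha p m hm) (funext fun i => (he (X i) (p i) (x i)).symm) }
  exact ⟨g, hom_ext fun v m x => (e v m).symm_apply_apply x, hom_ext fun v m x => he v m x⟩

variable {E : VMod F k}

/-- A generator, as an element of the free operad. -/
noncomputable abbrev gen (E : VMod F k) (ε : Parity) {v : F.V} {m : ℤ} (x : (E.obj ⟨v⟩).X m) :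
    ((free E ε).obj v).X m :=
  (((unit (E := E) (ε := ε)).app ⟨v⟩).f m).hom x

/-- Induction on the elements of the free operad. -/
theorem free_induction {p : ∀ (v : F.V) (m : ℤ), ((free E ε).obj v).X m → Prop}
    (gen : ∀ v m x, p v m (gen E ε x)) (zero : ∀ v m, p v m 0)
    (add : ∀ v m x y, p v m x → p v m y → p v m (x + y))
    (smul : ∀ v m (c : k) x, p v m x → p v m (c • x))
    (d : ∀ v m m' x, m + 1 = m' → p v m x → p v m' ((((free E ε).obj v).d m m').hom x))
    (act : ∀ {n : ℕ} {X : Fin n → F.V} {v : F.V} (a : F.Op X v) (ha : deg a ≤ 1) (q : Fin n → ℤ)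
      (m : ℤ) (h : ∑ i, q i + ε.shift (deg a) = m) (x : ∀ i, ((free E ε).obj (X i)).X (q i)),
      (∀ i, p (X i) (q i) (x i)) → p v m ((free E ε).act a ha q m h x))
    (v : F.V) (m : ℤ) (x : ((free E ε).obj v).X m) : p v m x := by
  obtain ⟨t, rfl⟩ := FreeMod.mk_surjective x
  induction t with
  | gen x => exact gen _ _ x
  | zero => exact zero _ _
  | add s t hs ht => exact add _ _ _ _ hs ht
  | smul c t ht => exact smul _ _ c _ ht
  | @d v m m' h t ht =>
    have := d _ _ _ _ h ht
    have h2 := FreeMod.complex_d (E := E) (ε := ε) h t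
    exact h2 ▸ this
  | node a ha q m h x hx =>
    have := act a ha q m h _ hx
    exact (freeRaw_act a ha q m h x) ▸ this

/-- Generators exhaust the free operad under linear operations, differential and structure maps, and
morphisms commute with all of these. -/
theorem free_hom_ext {P : Ops F k ε} {f g : free E ε ⟶ P}
    (h : ∀ v m x, hap f v m (gen E ε x) = hap g v m (gen E ε x)) : f = g := by
  refine hom_ext fun v m x => ?_
  refine free_induction (p := fun v m x => hap f v m x = hap g v m x) h ?_ ?_ ?_ ?_ ?_ v m x
  · intro v m; rw [map_zero, map_zero]
  · intro v m x y hx hy; rw [map_add, map_add, hx, hy]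
  · intro v m c x hx; rw [map_smul, map_smul, hx]
  · intro v m m' x _ hx; rw [hap_d, hap_d, hx]
  · intro n X v a ha q m hm x hx
    rw [hap_act, hap_act]
    exact congrArg _ (funext hx)

/-- A morphism of operads as a morphism of the underlying `V`-modules. -/
noncomputable def underMap {P Q : Ops F k ε} (f : P ⟶ Q) : P.under ⟶ Q.under where
  app v := RawOp.Hom.app f v.of
  naturality v w θ := by
    ext m x
    exact hap_vmap f θ m x

theorem gen_map {v w : F.Vert} (θ : v ⟶ w) {m : ℤ} (x : (E.obj v).X m) :
    gen E ε (v := w.of) (((E.map θ).f m).hom x) = (free E ε).vmap θ m (gen E ε (v := v.of) x) :=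
  congrArg (fun g : E.obj v ⟶ (free E ε).under.obj w => (g.f m).hom x)
    ((unit (E := E) (ε := ε)).naturality θ)

theorem vmap_inv' (P : Ops F k ε) {v w : F.Vert} (θ : v ⟶ w) (m : ℤ) (x : (P.obj w.of).X m) :
    P.vmap θ m (P.vmap (Groupoid.inv θ) m x) = x := by
  rw [← vmap_comp, Groupoid.inv_comp, vmap_id]

end Ops

namespace OpIdeal

open Ops

variable {P Q : Ops F k ε}

theorem le_span (S : ∀ (v : F.V) (m : ℤ), Submodule k ((P.obj v).X m)) (v : F.V) (m : ℤ) :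
    S v m ≤ (span S).carrier v m := fun _ hx _ hI => hI v m hx

theorem span_le {S : ∀ (v : F.V) (m : ℤ), Submodule k ((P.obj v).X m)} {I : OpIdeal P}
    (h : ∀ v m, S v m ≤ I.carrier v m) (v : F.V) (m : ℤ) :
    (span S).carrier v m ≤ I.carrier v m := fun _ hx => hx I h

theorem vmap_mem (I : OpIdeal P) {v w : F.Vert} (θ : v ⟶ w) {m : ℤ} {x : (P.obj v.of).X m}
    (hx : x ∈ I.carrier v.of m) : P.vmap θ m x ∈ I.carrier w.of m :=
  I.act_mem _ _ _ _ _ (fun _ => x) (0 : Fin 1) hx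

/-- The preimage of an ideal. -/
def comap (f : P ⟶ Q) (I : OpIdeal Q) : OpIdeal P where
  carrier v m := (I.carrier v m).comap (hap f v m)
  d_mem {v m m' x} hx := by
    have := I.d_mem (m' := m') (show hap f v m x ∈ I.carrier v m from hx)
    exact Submodule.mem_comap.2 ((hap_d f v m m' x).symm ▸ this)
  act_mem a ha p m h x i hx := by
    have := I.act_mem a ha p m h (fun i => hap f _ _ (x i)) i hx
    exact Submodule.mem_comap.2 ((hap_act f a ha p m h x).symm ▸ this)

theorem mem_ker {f : P ⟶ Q} {v : F.V} {m : ℤ} {x : (P.obj v).X m} :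
    x ∈ (ker f).carrier v m ↔ hap f v m x = 0 := Iff.rfl

theorem ker_π (I : OpIdeal P) {v : F.V} {m : ℤ} {x : (P.obj v).X m} :
    hap I.π v m x = 0 ↔ x ∈ I.carrier v m :=
  Submodule.Quotient.mk_eq_zero (I.carrier v m)

theorem π_surjective (I : OpIdeal P) (v : F.V) (m : ℤ) : Function.Surjective (hap I.π v m) :=
  I.proj_surjective v m

/-- The morphism out of the quotient. -/
noncomputable def desc (I : OpIdeal P) (f : P ⟶ Q) (h : ∀ v m, I.carrier v m ≤ (ker f).carrier v m) :
    I.quot ⟶ Q where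
  app v :=
    { f := fun m => ModuleCat.ofHom (X := (I.complex v).X m)
        ((I.carrier v m).liftQ (hap f v m) (h v m))
      comm' := by
        intro m m' _
        refine ModuleCat.hom_ext (LinearMap.ext fun x => ?_)
        obtain ⟨x, rfl⟩ := I.proj_surjective v m x
        exact (hap_d f v m m' x).symm }
  map_act := by
    intro n X v a ha p m hm x
    obtain ⟨x, rfl⟩ := I.exists_rep x
    exact (congrArg ((I.carrier v m).liftQ (hap f v m) (h v m)) (I.quotRaw_act a ha p m hm x)).trans
      (hap_act f a ha p m hm x)

theorem quot_hom_ext (I : OpIdeal P) {f g : I.quot ⟶ Q} (h : I.π ≫ f = I.π ≫ g) : f = g := by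
  refine hom_ext fun v m x => ?_
  obtain ⟨x, rfl⟩ := I.π_surjective v m x
  exact congrArg (fun h : P ⟶ Q => hap h v m x) h

/-- An operad is the quotient of another one by the kernel of a surjection. -/
theorem nonempty_iso_quot (f : P ⟶ Q) (hf : ∀ v m, Function.Surjective (hap f v m)) :
    Nonempty ((ker f).quot ≅ Q) := by
  have : IsIso ((ker f).desc f fun _ _ => le_rfl) := by
    refine isIso_of_bijective _ fun v m => ⟨?_, fun y => ?_⟩
    · refine (injective_iff_map_eq_zero _).2 fun x hx => ?_
      obtain ⟨x, rfl⟩ := (ker f).π_surjective v m x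
      exact (ker_π _).2 hx
    · obtain ⟨x, rfl⟩ := hf v m y
      exact ⟨hap (ker f).π v m x, rfl⟩
  exact ⟨asIso ((ker f).desc f fun _ _ => le_rfl)⟩

/-- Allows any operad to be presented as a quotient of a free one by a span, with a whole kernel as
the family of relations. -/
theorem span_carrier (I : OpIdeal P) : span I.carrier = I := by
  refine OpIdeal.ext (funext fun v => funext fun m => le_antisymm ?_ ?_)
  · exact span_le (fun _ _ => le_rfl) v m
  · exact le_span _ v m

end OpIdeal

end OperadMaps

/-! ### The universal property of the push-forward and the existence of its left adjoint -/

section ExceptionalPushforward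

open CubicalFeynmanCat ColOperad CubicalMorphism

variable {k : Type u} [Field k] {F₁ F₂ : CubicalFeynmanCat.{u}} {φ : CubicalMorphism F₁ F₂}
  {ε : Parity}

namespace CubicalMorphism

theorem comp_comp_inv {C : Type*} [Groupoid C] {x y z t : C} (a : x ⟶ y) (b : y ⟶ z) (c : z ⟶ t) :
    (a ≫ b ≫ c) ≫ Groupoid.inv c = a ≫ b := by simp

theorem arrow_vop {F : CubicalFeynmanCat.{u}} {v w : F.Vert} (θ : v ⟶ w) :
    arrow (vop θ) = Iso.hom θ := arrow_toOp (X := fun _ : Fin 1 => v.of) (Iso.hom θ)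

theorem isOver_vop {v v' : F₂.Vert} {τ : v ⟶ v'} {c : φ.Cell v.of} {c' : φ.Cell v'.of}
    {g : (⟨c.w⟩ : F₁.Vert) ⟶ ⟨c'.w⟩} :
    IsOver (vop τ) (fun _ : Fin 1 => c) c' (vop g) ↔ φ.vert.map g ≫ c'.σ = c.σ ≫ τ := by
  unfold IsOver
  rw [arrow_vop, arrow_vop, Ops.cellIso_single]
  exact ⟨fun h => Iso.ext h, fun h => congrArg Iso.hom h⟩

variable (φ) in
/-- The cell of a vertex over its image. -/
noncomputable def baseCell (w : F₁.V) : φ.Cell (φ.obj w) :=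
  (Cell.exists_hom (φ := φ) ⟨w, 𝟙 _⟩).choose

variable (φ) in
/-- The comparison of a vertex with the representative of its cell. -/
noncomputable def baseHom (w : F₁.V) : (⟨w⟩ : F₁.Vert) ⟶ ⟨(baseCell φ w).w⟩ :=
  (Cell.exists_hom (φ := φ) ⟨w, 𝟙 _⟩).choose_spec.choose

theorem baseHom_spec (w : F₁.V) : φ.vert.map (baseHom φ w) ≫ (baseCell φ w).σ = 𝟙 _ :=
  (Cell.exists_hom (φ := φ) ⟨w, 𝟙 _⟩).choose_spec.choose_spec

theorem vert_map_inv {v w : F₁.Vert} (θ : v ⟶ w) :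
    φ.vert.map (Groupoid.inv θ) = Groupoid.inv (φ.vert.map θ) := rfl

/-- The isomorphism attached to this cell comes from `F₁`, so that transport along it can be carried
out inside `P`. -/
theorem baseCell_σ (w : F₁.V) :
    (baseCell φ w).σ = φ.vert.map (Groupoid.inv (baseHom φ w)) := by
  have := congrArg (Groupoid.inv (φ.vert.map (baseHom φ w)) ≫ ·) (baseHom_spec (φ := φ) w)
  refine Eq.trans ?_ (this.trans (Category.comp_id _))
  refine Eq.symm ((Category.assoc _ _ _).symm.trans ?_)
  exact (congrArg (· ≫ (baseCell φ w).σ) (Groupoid.inv_comp _)).trans (Category.id_comp _)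

end CubicalMorphism

namespace Ops

variable (hφ : φ.Admissible)

/-- The component of an element of `L^!(P)` at a cell. -/
noncomputable def lProj (P : Ops F₁ k ε) {v : F₂.V} (c : φ.Cell v) (m : ℤ) :
    (((lShriek hφ).obj P).obj v).X m →ₗ[k] (P.obj c.w).X m :=
  LinearMap.proj (φ := fun c : φ.Cell v => (P.obj c.w).X m) c

theorem lProj_ext {P : Ops F₁ k ε} {v : F₂.V} {m : ℤ} {x y : (((lShriek hφ).obj P).obj v).X m}
    (h : ∀ c : φ.Cell v, lProj hφ P c m x = lProj hφ P c m y) : x = y :=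
  funext (β := fun c : φ.Cell v => (P.obj c.w).X m) h

/-- Only one cell contributes to the sum that defines the action of `τ`: a cell with an isomorphism
over `τ` to `c'` is isomorphic, hence equal, to `c`. So on components `τ` is the action of `g` on
`P`. -/
theorem lProj_vmap {P : Ops F₁ k ε} {v v' : F₂.Vert} (τ : v ⟶ v') {c : φ.Cell v.of}
    {c' : φ.Cell v'.of} (g : (⟨c.w⟩ : F₁.Vert) ⟶ ⟨c'.w⟩)
    (h : φ.vert.map g ≫ c'.σ = c.σ ≫ τ) (m : ℤ) (x : (((lShriek hφ).obj P).obj v.of).X m) :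
    lProj hφ P c' m (((lShriek hφ).obj P).vmap τ m x) = P.vmap g m (lProj hφ P c m x) := by
  refine (lRaw_act P.toRawOp (vop τ) _ (fun _ => m) m _ (fun _ => x) c').trans ?_
  refine (Finset.sum_eq_single (fun _ => c) ?_ (fun h => (h (Finset.mem_univ _)).elim)).trans ?_
  · intro C _ hC
    obtain ⟨c₂, rfl⟩ : ∃ c₂, C = fun _ => c₂ :=
      ⟨C 0, funext fun i => congrArg C (Subsingleton.elim _ _)⟩
    rw [coef_zero]
    · rfl
    · rintro ⟨g₂, hg₂⟩
      obtain ⟨g₂, rfl⟩ := exists_vop (v := c₂.w) g₂ (hg₂.deg_eq.trans (deg_vop τ))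
      have h₂ := isOver_vop.1 hg₂
      refine hC (funext fun _ => Cell.eq_of_hom (g₂ ≫ Groupoid.inv g) ?_)
      rw [φ.vert.map_comp, vert_map_inv, Category.assoc]
      have h3 : Groupoid.inv (φ.vert.map g) ≫ c.σ = c'.σ ≫ Groupoid.inv τ := by
        rw [← cancel_epi (φ.vert.map g), ← Category.assoc, Groupoid.comp_inv, Category.id_comp,
          ← Category.assoc, h, Category.assoc, Groupoid.comp_inv, Category.comp_id]
      rw [h3, ← Category.assoc, h₂, Category.assoc, Groupoid.comp_inv, Category.comp_id]
  · have hd : deg (vop g) = 0 := deg_vop g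
    rw [coef_eq P.toRawOp hφ _ (fun _ => m) m _ (isOver_vop.2 h) (hd.le.trans (Nat.zero_le 1))
      (by rw [hd]; simp)]
    rfl

variable {E : VMod F₂ k} {P : Ops F₁ k ε}

/-- The morphism `E → L^!(P)` of `V`-modules adjoint to `rE → P`. -/
noncomputable def toShriek (g : resV φ E ⟶ P.under) : E ⟶ ((lShriek hφ).obj P).under where
  app v :=
    { f := fun m => ModuleCat.ofHom (X := (E.obj v).X m)
        (Y := (((lShriek hφ).obj P).obj v.of).X m)
        (LinearMap.pi (φ := fun c : φ.Cell v.of => (P.obj c.w).X m)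
          fun c => ((g.app ⟨c.w⟩).f m).hom ∘ₗ ((E.map (Groupoid.inv c.σ)).f m).hom)
      comm' := by
        intro m m' _
        refine ModuleCat.hom_ext (LinearMap.ext fun x => lProj_ext hφ fun c => ?_)
        exact congrArg (fun h : (E.obj v).X m ⟶ (P.obj c.w).X m' => h.hom x)
          (((E.map (Groupoid.inv c.σ)) ≫ g.app ⟨c.w⟩).comm m m') }
  naturality v v' τ := by
    refine HomologicalComplex.hom_ext _ _ fun m => ModuleCat.hom_ext (LinearMap.ext fun x =>
      lProj_ext hφ fun c' => ?_)
    -- The component at `c'` after applying `τ` comes from the cell of `c'.σ ≫ τ⁻¹`.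
    obtain ⟨c, θ, hθ⟩ := Cell.exists_hom (φ := φ) (⟨c'.w, c'.σ ≫ Groupoid.inv τ⟩ : φ.Lift v.of)
    have hθ' : φ.vert.map (Groupoid.inv θ) ≫ c'.σ = c.σ ≫ τ := by
      rw [vert_map_inv, ← cancel_epi (φ.vert.map θ), ← Category.assoc, Groupoid.comp_inv,
        Category.id_comp, ← Category.assoc, hθ]
      change _ = (c'.σ ≫ Groupoid.inv τ) ≫ τ
      rw [Category.assoc, Groupoid.inv_comp, Category.comp_id]
    refine Eq.trans ?_ (lProj_vmap hφ τ (Groupoid.inv θ) hθ' m _).symm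
    have h1 : E.map τ ≫ E.map (Groupoid.inv c'.σ) ≫ g.app ⟨c'.w⟩ =
        E.map (Groupoid.inv c.σ) ≫ g.app ⟨c.w⟩ ≫ P.under.map (Groupoid.inv θ) := by
      rw [← g.naturality]
      change _ = E.map (Groupoid.inv c.σ) ≫ E.map (φ.vert.map (Groupoid.inv θ)) ≫ _
      rw [← Category.assoc, ← Category.assoc, ← E.map_comp, ← E.map_comp]
      congr 2
      rw [← cancel_mono c'.σ, Category.assoc, Category.assoc, Groupoid.inv_comp, hθ',
        ← Category.assoc, Groupoid.inv_comp, Category.comp_id, Category.id_comp]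
    exact congrArg (fun h : E.obj v ⟶ P.obj c'.w => (h.f m).hom x) h1

/-- The component of an element of `L^!(P)` at a vertex. -/
noncomputable def lBase (P : Ops F₁ k ε) (w : F₁.V) (m : ℤ) :
    (((lShriek hφ).obj P).obj (φ.obj w)).X m →ₗ[k] (P.obj w).X m :=
  P.vmap (Groupoid.inv (baseHom φ w)) m ∘ₗ lProj hφ P (baseCell φ w) m

/-- Conjugation with the comparisons `baseHom` turns `θ` into an isomorphism between representatives
of cells, to which `lProj_vmap` applies. This gives the naturality of `ofShriek`. -/
theorem vmap_lBase {w w' : F₁.Vert} (θ : w ⟶ w') (m : ℤ)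
    (x : (((lShriek hφ).obj P).obj (φ.obj w.of)).X m) :
    P.vmap θ m (lBase hφ P w.of m x) =
      lBase hφ P w'.of m (((lShriek hφ).obj P).vmap (φ.vert.map θ) m x) := by
  have h : φ.vert.map (Groupoid.inv (baseHom φ w.of) ≫ θ ≫ baseHom φ w'.of) ≫
      (baseCell φ w'.of).σ = (baseCell φ w.of).σ ≫ φ.vert.map θ := by
    refine (congrArg (_ ≫ ·) (baseCell_σ w'.of)).trans ?_
    refine (φ.vert.map_comp _ _).symm.trans ?_
    refine Eq.trans (congrArg φ.vert.map ?_) ((φ.vert.map_comp _ _).trans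
      (congrArg (· ≫ φ.vert.map θ) (baseCell_σ w.of).symm))
    exact comp_comp_inv _ _ _
  refine Eq.symm ((congrArg (P.vmap (Groupoid.inv (baseHom φ w'.of)) m)
    (lProj_vmap hφ (φ.vert.map θ) _ h m x)).trans ?_)
  refine (P.vmap_comp _ _ m _).symm.trans (Eq.trans ?_ (P.vmap_comp _ _ m _))
  refine congrArg (fun z : (⟨(baseCell φ w.of).w⟩ : F₁.Vert) ⟶ w' =>
    P.vmap z m (lProj hφ P (baseCell φ w.of) m x)) ?_
  exact comp_comp_inv _ _ _

/-- Translation along `c.σ⁻¹` brings the cell `c` into the form of a vertex over its own image.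
Hence maps into `L^!(P)` are determined by their components at vertices. -/
theorem lProj_eq_lBase {v : F₂.V} (c : φ.Cell v) (m : ℤ)
    (x : (((lShriek hφ).obj P).obj v).X m) :
    lProj hφ P c m x = lBase hφ P c.w m (((lShriek hφ).obj P).vmap (Groupoid.inv c.σ) m x) := by
  have h : φ.vert.map (Groupoid.inv (baseHom φ c.w)) ≫ c.σ = (baseCell φ c.w).σ ≫ c.σ := by
    exact congrArg (· ≫ c.σ) (baseCell_σ c.w).symm
  refine Eq.trans (congrArg (lProj hφ P c m)
    (((lShriek hφ).obj P).vmap_inv' c.σ m x).symm) ?_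
  exact lProj_vmap hφ c.σ _ h m _

/-- The morphism `rE → P` of `V`-modules adjoint to `E → L^!(P)`. -/
noncomputable def ofShriek (f : E ⟶ ((lShriek hφ).obj P).under) : resV φ E ⟶ P.under where
  app w :=
    { f := fun m => ModuleCat.ofHom (X := (E.obj (φ.vert.obj w)).X m) (Y := (P.obj w.of).X m)
        (lBase hφ P w.of m ∘ₗ ((f.app (φ.vert.obj w)).f m).hom)
      comm' := by
        intro m m' hm
        refine ModuleCat.hom_ext (LinearMap.ext fun x => ?_)
        refine (P.vmap_d _ m m' hm _).trans (congrArg (P.vmap _ m') ?_)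
        refine congrArg (fun h : (E.obj (φ.vert.obj w)).X m ⟶
          (((lShriek hφ).obj P).obj (φ.obj w.of)).X m' =>
            lProj hφ P (baseCell φ w.of) m' (h.hom x)) ((f.app (φ.vert.obj w)).comm m m') }
  naturality w w' θ := by
    refine HomologicalComplex.hom_ext _ _ fun m => ModuleCat.hom_ext (LinearMap.ext fun x => ?_)
    refine Eq.trans ?_ (vmap_lBase hφ θ m _).symm
    exact congrArg (fun h : E.obj (φ.vert.obj w) ⟶ ((lShriek hφ).obj P).under.obj (φ.vert.obj w') =>
      lBase hφ P w'.of m ((h.f m).hom x)) (f.naturality (φ.vert.map θ))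

/-- One half of the bijection between morphisms `rE → P` and `E → L^!(P)`; the other half is
`lBase_toShriek`. -/
theorem toShriek_ofShriek (f : E ⟶ ((lShriek hφ).obj P).under) :
    toShriek hφ (ofShriek hφ f) = f := by
  refine NatTrans.ext (funext fun v => HomologicalComplex.hom_ext _ _ fun m =>
    ModuleCat.hom_ext (LinearMap.ext fun x => lProj_ext hφ fun c => ?_))
  refine Eq.trans ?_ (lProj_eq_lBase hφ c m _).symm
  exact congrArg (fun h : E.obj v ⟶ ((lShriek hφ).obj P).under.obj (φ.vert.obj ⟨c.w⟩) =>
      lBase hφ P c.w m ((h.f m).hom x)) (f.naturality (Groupoid.inv c.σ))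

/-- The transports along `(baseCell φ w).σ` in `E` and along `baseHom φ w` in `P` cancel by the
naturality of `g`. -/
theorem lBase_toShriek (g : resV φ E ⟶ P.under) {w : F₁.V} (m : ℤ)
    (x : (E.obj ⟨φ.obj w⟩).X m) : lBase hφ P w m ((((toShriek hφ g).app ⟨φ.obj w⟩).f m).hom x) =
      ((g.app ⟨w⟩).f m).hom x := by
  have h1 : E.map (Groupoid.inv (baseCell φ w).σ) ≫ g.app ⟨(baseCell φ w).w⟩ ≫
      P.under.map (Groupoid.inv (baseHom φ w)) = g.app ⟨w⟩ := by
    rw [← g.naturality]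
    change E.map _ ≫ E.map (φ.vert.map (Groupoid.inv (baseHom φ w))) ≫ _ = _
    rw [← Category.assoc, ← E.map_comp]
    have h2 : Groupoid.inv (baseCell φ w).σ ≫ φ.vert.map (Groupoid.inv (baseHom φ w)) = 𝟙 _ :=
      (congrArg (Groupoid.inv (baseCell φ w).σ ≫ ·) (baseCell_σ w).symm).trans
        (Groupoid.inv_comp _)
    exact (congrArg (fun z => E.map z ≫ g.app ⟨w⟩) h2).trans
      ((congrArg (· ≫ g.app ⟨w⟩) (E.map_id _)).trans (Category.id_comp _))
  exact congrArg (fun h : E.obj ⟨φ.obj w⟩ ⟶ P.obj w => (h.f m).hom x) h1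

/-- The morphism `F₂(E) → L^! F₁(rE)` given by the generators of `rE`. -/
noncomputable def freeToShriek (E : VMod F₂ k) (ε : Parity) : free E ε ⟶ (lShriek hφ).obj (free (resV φ E) ε) :=
  lift (toShriek hφ unit)

/-- The components in `F₁(rE)` of the images of the elements of `S ⊆ F₂(E)`. -/
noncomputable def shriekRel (S : ∀ (v : F₂.V) (m : ℤ), Submodule k (((free E ε).obj v).X m))
    (w : F₁.V) (m : ℤ) : Submodule k (((free (resV φ E) ε).obj w).X m) :=
  Submodule.span k {y | ∃ (v : F₂.V) (c : φ.Cell v) (h : c.w = w) (s : ((free E ε).obj v).X m),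
    s ∈ S v m ∧ h ▸ lProj hφ _ c m (hap (freeToShriek hφ E ε) v m s) = y}

/-- Removes the transport along `c.w = w` from the definition, so that later arguments only meet
components at cells. -/
theorem shriekRel_le {S : ∀ (v : F₂.V) (m : ℤ), Submodule k (((free E ε).obj v).X m)}
    {I : ∀ w m, Submodule k (((free (resV φ E) ε).obj w).X m)} :
    (∀ w m, shriekRel hφ S w m ≤ I w m) ↔ ∀ v m, ∀ s ∈ S v m, ∀ c : φ.Cell v,
      lProj hφ _ c m (hap (freeToShriek hφ E ε) v m s) ∈ I c.w m := by
  constructor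
  · intro h v m s hs c
    exact h _ _ (Submodule.subset_span ⟨v, c, rfl, s, hs, rfl⟩)
  · intro h w m
    refine Submodule.span_le.2 ?_
    rintro _ ⟨v, c, rfl, s, hs, rfl⟩
    exact h v m s hs c

/-- Together with `toShriek_ofShriek`, this factors every morphism from `F₂(E)` to an operad
`L^!(P)` through `freeToShriek`. -/
theorem freeToShriek_comp (g : resV φ E ⟶ P.under) :
    freeToShriek hφ E ε ≫ (lShriek hφ).map (lift g) = lift (toShriek hφ g) :=
  free_hom_ext fun _ _ _ => rfl

section universal

variable (S : ∀ (v : F₂.V) (m : ℤ), Submodule k (((free E ε).obj v).X m))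

/-- The universal morphism from a quotient of `F₂(E)` to an operad of the form `L^!(P)`. -/
noncomputable def universalArrow : (OpIdeal.span S).quot ⟶
    (lShriek hφ).obj (OpIdeal.span (shriekRel hφ S)).quot :=
  OpIdeal.desc _ (freeToShriek hφ E ε ≫ (lShriek hφ).map (OpIdeal.span (shriekRel hφ S)).π)
    -- `L^!` of the projection acts on each component separately, and each component of the image of
    -- `s` is a relation.
    (OpIdeal.span_le fun v m s hs => OpIdeal.mem_ker.2 (lProj_ext hφ fun c => by
      refine Eq.trans ?_ (map_zero _).symm
      refine (OpIdeal.ker_π _).2 (OpIdeal.le_span _ _ _ ?_)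
      exact (shriekRel_le hφ).1 (fun _ _ => le_rfl) v m s hs c))

/-- The universal morphism is initial. -/
noncomputable def universalArrowIsInitial :
    Limits.IsInitial (StructuredArrow.mk (universalArrow hφ S)) := by
  have hex : ∀ (A : StructuredArrow (OpIdeal.span S).quot (lShriek hφ)),
      Nonempty (StructuredArrow.mk (universalArrow hφ S) ⟶ A) := by
    intro A
    let f : (OpIdeal.span S).quot ⟶ (lShriek hφ).obj A.right := A.hom
    -- The adjoint of the restriction of `f` to the generators.
    let g := ofShriek hφ (unit ≫ underMap ((OpIdeal.span S).π ≫ f))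
    have hg : freeToShriek hφ E ε ≫ (lShriek hφ).map (lift g) = (OpIdeal.span S).π ≫ f := by
      rw [freeToShriek_comp, toShriek_ofShriek]
      exact free_hom_ext fun _ _ _ => rfl
    -- The value of `lift g` on a component of the image of `s` is the same component of the image
    -- of `s` under `f`, and `f` kills the class of `s`.
    have hk : ∀ w m, (OpIdeal.span (shriekRel hφ S)).carrier w m ≤
        (OpIdeal.ker (lift g)).carrier w m := by
      refine OpIdeal.span_le ((shriekRel_le hφ).2 fun v m s hs c => ?_)
      have h1 := congrArg (fun h : free E ε ⟶ (lShriek hφ).obj A.right =>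
        lProj hφ A.right c m (hap h v m s)) hg
      refine OpIdeal.mem_ker.2 (h1.trans ?_)
      have h2 : hap (OpIdeal.span S).π v m s = 0 :=
        (OpIdeal.ker_π _).2 (OpIdeal.le_span _ _ _ hs)
      exact (congrArg (fun z => lProj hφ A.right c m (hap f v m z)) h2).trans
        ((congrArg _ (map_zero _)).trans (map_zero _))
    refine ⟨StructuredArrow.homMk (OpIdeal.desc _ (lift g) hk) (OpIdeal.quot_hom_ext _ ?_)⟩
    exact (free_hom_ext fun _ _ _ => rfl :
      _ = freeToShriek hφ E ε ≫ (lShriek hφ).map (lift g)).trans hg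
  refine Limits.IsInitial.ofUniqueHom (fun A => (hex A).some) fun A h => ?_
  have huniq : ∀ h h' : StructuredArrow.mk (universalArrow hφ S) ⟶ A, h = h' := by
    intro h h'
    refine StructuredArrow.hom_ext _ _ (OpIdeal.quot_hom_ext _ (free_hom_ext fun w m x => ?_))
    -- A generator of `rE` at `w` is a generator of `E` at `φ(w)`, and the value of `h.right` on it
    -- is a component of the prescribed value of `A.hom`.
    have key : ∀ h : StructuredArrow.mk (universalArrow hφ S) ⟶ A,
        hap ((OpIdeal.span (shriekRel hφ S)).π ≫ h.right) w m (gen (resV φ E) ε x) =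
          lBase hφ A.right w m (hap ((OpIdeal.span S).π ≫ A.hom) (φ.obj w) m
            (gen E ε (v := φ.obj w) x)) := by
      intro h
      have h1 : universalArrow hφ S ≫ (lShriek hφ).map h.right = A.hom := StructuredArrow.w h
      refine Eq.trans ?_ (congrArg (fun z => lBase hφ A.right w m (hap ((OpIdeal.span S).π ≫ z)
        (φ.obj w) m (gen E ε (v := φ.obj w) x))) h1)
      exact (lBase_toShriek hφ
        (unit ≫ underMap ((OpIdeal.span (shriekRel hφ S)).π ≫ h.right)) m x).symm
    exact (key h).trans (key h').symm
  exact huniq _ _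

end universal

/-- Every operad is the quotient of the free operad on its underlying module by a kernel, so the
case of quotients of free operads provides an initial object of each comma category. -/
theorem lShriek_isRightAdjoint : (lShriek (k := k) (ε := ε) hφ).IsRightAdjoint := by
  refine isRightAdjoint_iff_hasInitial_structuredArrow.2 fun O => ?_
  let p : free O.under ε ⟶ O := lift (𝟙 _)
  obtain ⟨i⟩ : Nonempty ((OpIdeal.span (OpIdeal.ker p).carrier).quot ≅ O) := by
    rw [OpIdeal.span_carrier]
    exact OpIdeal.nonempty_iso_quot p fun v m x => ⟨gen O.under ε x, rfl⟩
  have := (universalArrowIsInitial hφ (OpIdeal.ker p).carrier).hasInitial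
  -- The initial object is transported along the equivalence of comma categories given by `i`.
  exact Adjunction.hasColimitsOfShape_of_equivalence (StructuredArrow.mapIso i).inverse

end Ops

end ExceptionalPushforward

/-! ### Koszul signs of permutations, and composition of operations with isomorphisms -/

section Matching

open CubicalFeynmanCat ColOperad

variable {k : Type u} [Field k]

section Signs

theorem sgn_add (m n : ℤ) : sgn k (m + n) = sgn k m * sgn k n := by
  simp [sgn, Int.negOnePow_add]

theorem sgn_eq_of_even_sub {m n : ℤ} (h : Even (m - n)) : sgn k m = sgn k n := by
  have : m = (m - n) + n := by ring
  rw [this, sgn_add, sgn, Int.negOnePow_even _ h]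
  simp

theorem sgn_mul_self (m : ℤ) : sgn k m * sgn k m = 1 := by
  rw [← sgn_add, ← sgn_zero]
  exact sgn_eq_of_even_sub ⟨m, by ring⟩

/-- Modulo two the terms off the diagonal cancel in pairs. -/
theorem even_sum_of_swap {n : ℕ} (h : Fin n → Fin n → ℤ) (hd : ∀ s, h s s = 0)
    (hs : ∀ s t, Even (h s t + h t s)) : Even (∑ s, ∑ t, h s t) := by
  rw [← ZMod.intCast_eq_zero_iff_even, ← Fintype.sum_prod_type' (f := h), Int.cast_sum]
  refine Finset.sum_involution (fun x _ => x.swap) ?_ ?_ (fun _ _ => Finset.mem_univ _)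
    (fun _ _ => Prod.swap_swap _)
  · rintro ⟨s, t⟩ _
    rw [← Int.cast_add, ZMod.intCast_eq_zero_iff_even]
    exact hs s t
  · rintro ⟨s, t⟩ _ h0 h1
    obtain rfl : t = s := congrArg Prod.fst h1
    exact h0 (by simp [hd])

/-- The exponent of the Koszul sign of a permutation. -/
def permKoszul {n N : ℕ} (π : Fin n ≃ Fin N) (p : Fin N → ℤ) : ℤ :=
  ∑ s, ∑ t, if s < t ∧ π t < π s then p (π s) * p (π t) else 0

/-- With one argument in each block and operations of degree zero, only the sign of sorting the
arguments is left. -/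
theorem koszul_sigmaOne {n N : ℕ} (π : Fin n ≃ Fin N) (p : Fin N → ℤ) (d : Fin n → ℤ)
    (hd : ∀ j, d j = 0) : koszul ((sigmaOne (Fin n)).trans π) p d = permKoszul π p := by
  unfold koszul permKoszul
  simp only [hd, zero_mul, ite_self, Finset.sum_const_zero, add_zero]
  rw [← Equiv.sum_comp (sigmaOne (Fin n))]
  refine Finset.sum_congr rfl fun s _ => ?_
  rw [← Equiv.sum_comp (sigmaOne (Fin n))]
  refine Finset.sum_congr rfl fun t _ => ?_
  refine if_congr (and_congr_left fun _ => ⟨?_, Or.inl⟩) rfl rfl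
  rintro (h | ⟨-, h⟩)
  · exact h
  · have := s.2.isLt; have := t.2.isLt; omega

/-- With a single block there are no previous arguments to move the operation past, whatever its
degree. -/
theorem koszul_one {n : Fin 1 → ℕ} {N : ℕ} (e : (Σ j, Fin (n j)) ≃ Fin N) (π : Fin (n 0) ≃ Fin N)
    (hπ : ∀ i, e ⟨0, i⟩ = π i) (p : Fin N → ℤ) (d : Fin 1 → ℤ) :
    koszul e p d = permKoszul π p := by
  have h2 : ∀ (s : (Σ j, Fin (n j))) (j : Fin 1), ¬ s.1 < j := by
    intro s j
    rw [Subsingleton.elim s.1 j]; exact lt_irrefl _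
  unfold koszul permKoszul
  simp only [h2, if_false, Finset.sum_const_zero, add_zero]
  rw [Fintype.sum_sigma, Fintype.sum_unique]
  refine Finset.sum_congr rfl fun s _ => ?_
  rw [Fintype.sum_sigma, Fintype.sum_unique]
  refine Finset.sum_congr rfl fun t _ => ?_
  have hs : e ⟨default, s⟩ = π s := hπ s
  have ht : e ⟨default, t⟩ = π t := hπ t
  simp only [hs, ht]
  refine if_congr (and_congr_left fun _ => ?_) rfl rfl
  exact ⟨fun h => h.elim False.elim And.right, fun h => Or.inr ⟨trivial, h⟩⟩

/-- A pair of inputs is inverted by the composite exactly when it is inverted by one of the factors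
but not by both; pairs inverted twice contribute an even number. -/
theorem permKoszul_trans {n m N : ℕ} (ρ : Fin n ≃ Fin m) (π : Fin m ≃ Fin N) (p : Fin N → ℤ) :
    sgn k (permKoszul (ρ.trans π) p) =
      sgn k (permKoszul ρ (fun j => p (π j))) * sgn k (permKoszul π p) := by
  rw [← sgn_add]
  refine sgn_eq_of_even_sub ?_
  -- The inversions of `π` are indexed by pairs in the source of `ρ`, so that the three exponents
  -- can be compared pair by pair.
  have h1 : permKoszul π p = ∑ s, ∑ t, if ρ s < ρ t ∧ π (ρ t) < π (ρ s) then
      p (π (ρ s)) * p (π (ρ t)) else 0 := by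
    unfold permKoszul
    rw [← Equiv.sum_comp ρ]
    exact Finset.sum_congr rfl fun s _ => (Equiv.sum_comp ρ _).symm
  rw [h1]
  unfold permKoszul
  rw [← Finset.sum_add_distrib, ← Finset.sum_sub_distrib]
  simp only [← Finset.sum_add_distrib, ← Finset.sum_sub_distrib, Equiv.trans_apply]
  refine even_sum_of_swap _ (fun s => by simp) fun s t => ?_
  rcases lt_trichotomy s t with h | rfl | h
  · have hρ : ρ s ≠ ρ t := fun h' => h.ne (ρ.injective h')
    have hπ : π (ρ s) ≠ π (ρ t) := fun h' => hρ (π.injective h')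
    rcases lt_or_gt_of_ne hρ with h1 | h1 <;> rcases lt_or_gt_of_ne hπ with h2 | h2 <;>
      simp [h, h1, h2, h.asymm, h1.asymm, h2.asymm, mul_comm, ← two_mul]
  · simp
  · have hρ : ρ s ≠ ρ t := fun h' => h.ne' (ρ.injective h')
    have hπ : π (ρ s) ≠ π (ρ t) := fun h' => hρ (π.injective h')
    rcases lt_or_gt_of_ne hρ with h1 | h1 <;> rcases lt_or_gt_of_ne hπ with h2 | h2 <;>
      simp [h, h1, h2, h.asymm, h1.asymm, h2.asymm, mul_comm, ← two_mul]

/-- A permutation and its inverse have the same inversions, read in the opposite order, and the two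
minus signs in each product of degrees cancel. -/
theorem permKoszul_symm {n N : ℕ} (π : Fin n ≃ Fin N) (p : Fin N → ℤ) (q : Fin n → ℤ)
    (h : ∀ j, q j = -p (π j)) : permKoszul π.symm q = permKoszul π p := by
  unfold permKoszul
  refine (Equiv.sum_comp π (fun s => ∑ t, if s < t ∧ π.symm t < π.symm s then
    q (π.symm s) * q (π.symm t) else 0)).symm.trans ?_
  refine Eq.trans ?_ Finset.sum_comm
  refine Finset.sum_congr rfl fun s _ => ?_
  refine (Equiv.sum_comp π (fun t => if π s < t ∧ π.symm t < π.symm (π s) then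
    q (π.symm (π s)) * q (π.symm t) else 0)).symm.trans ?_
  refine Finset.sum_congr rfl fun t _ => ?_
  simp only [Equiv.symm_apply_apply, h, neg_mul_neg, mul_comm (p (π t)), and_comm]

theorem permKoszul_neg {n N : ℕ} (π : Fin n ≃ Fin N) (p q : Fin N → ℤ) (h : ∀ j, q j = -p j) :
    permKoszul π q = permKoszul π p := by
  unfold permKoszul
  simp only [h, neg_mul_neg]

/-- Raising one degree by one changes the exponent by the degrees of the entries that form an
inversion with it. Modulo two this is the difference between the total degrees of the entries that
precede it in the two orders. So differentiating one input is compatible with permuting the inputs.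
-/
theorem permKoszul_bump {n N : ℕ} (π : Fin n ≃ Fin N) (p : Fin N → ℤ) (i : Fin n) :
    sgn k (permKoszul π (bump p (π i))) * sgn k (∑ j, if j < π i then p j else 0) =
      sgn k (∑ j, if j < i then p (π j) else 0) * sgn k (permKoszul π p) := by
  rw [← sgn_add, ← sgn_add]
  refine sgn_eq_of_even_sub ?_
  have h1 : permKoszul π (bump p (π i)) = permKoszul π p +
      ∑ t, ((if i < t ∧ π t < π i then p (π t) else 0) +
        if t < i ∧ π i < π t then p (π t) else 0) := by
    have h2 : ∑ t, (if i < t ∧ π t < π i then p (π t) else 0) =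
        ∑ s, ∑ t, if s = i then (if s < t ∧ π t < π s then p (π t) else 0) else 0 := by
      rw [Finset.sum_comm]
      exact Finset.sum_congr rfl fun t _ => by simp
    have h3 : ∑ t, (if t < i ∧ π i < π t then p (π t) else 0) =
        ∑ s, ∑ t, if t = i then (if s < t ∧ π t < π s then p (π s) else 0) else 0 :=
      Finset.sum_congr rfl fun t _ => by simp
    rw [Finset.sum_add_distrib, h2, h3]
    unfold permKoszul
    simp only [← Finset.sum_add_distrib]
    refine Finset.sum_congr rfl fun s _ => Finset.sum_congr rfl fun t _ => ?_
    by_cases hst : s < t ∧ π t < π s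
    · have : s ≠ t := hst.1.ne
      simp only [hst, and_self, if_true, bump, π.injective.eq_iff]
      by_cases hs : s = i
      · have ht : t ≠ i := fun h => this (hs.trans h.symm)
        simp only [hs, ht, if_true, if_false]; ring
      · by_cases ht : t = i
        · simp only [hs, ht, if_true, if_false]; ring
        · simp only [hs, ht, if_false]; ring
    · simp [hst]
  have h4 : (∑ j, if j < π i then p j else 0) = ∑ t, if π t < π i then p (π t) else 0 :=
    (Equiv.sum_comp π _).symm
  rw [h1, h4]
  have h5 : ∀ a b c d : ℤ, a + b + c - (d + a) = b + c - d := by intros; ring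
  rw [h5, ← Finset.sum_add_distrib, ← Finset.sum_sub_distrib]
  refine Finset.even_sum _ fun t _ => ?_
  rcases lt_trichotomy t i with h | rfl | h
  · rcases lt_or_gt_of_ne (fun h' => h.ne (π.injective h') : π t ≠ π i) with h' | h' <;>
      simp [h, h', h.asymm, h'.asymm]
  · simp
  · rcases lt_or_gt_of_ne (fun h' => h.ne' (π.injective h') : π t ≠ π i) with h' | h' <;>
      simp [h, h', h.asymm, h'.asymm, ← two_mul]

end Signs

namespace CubicalFeynmanCat

variable {F : CubicalFeynmanCat.{u}} {n n' : ℕ} {X : Fin n → F.V} {Y : Fin n' → F.V} {v w : F.V}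

/-- The composite of an operation with an isomorphism of its source, given by a bijection of the
inputs and isomorphisms of vertices. -/
abbrev pull (π : Fin n' ≃ Fin n) (u : ∀ j, (⟨X (π j)⟩ : F.Vert) ⟶ ⟨Y j⟩) (b : F.Op Y v) :
    F.Op X v :=
  compTo ((sigmaOne (Fin n')).trans π) b (fun j => vop (u j))

/-- The composite of an isomorphism of vertices with an operation. -/
abbrev push (θ : (⟨v⟩ : F.Vert) ⟶ ⟨w⟩) (a : F.Op X v) : F.Op X w :=
  compTo (m := 1) (n := fun _ => n) (oneSigma (Fin n)) (Y := fun _ => v) (vop θ) (fun _ => a)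

/-- The map `arrow` is injective and turns identities between composites of operations into
identities in a category, where most of them reduce to associativity. -/
theorem arrow_push (θ : (⟨v⟩ : F.Vert) ⟶ ⟨w⟩) (a : F.Op X v) :
    arrow (push θ a) = arrow a ≫ Iso.hom θ := by
  refine (arrow_compTo _ _ _).trans ?_
  have h : ofFin (m := 1) (n := fun _ => n) (oneSigma (Fin n)) (X := X)
      (Y := fun _ => v) (fun _ => a) = arrow a := by
    refine (arrow_toOp _).symm.trans (congrArg arrow (toOp_ofFin a))
  exact congrArg₂ (· ≫ ·) h (CubicalMorphism.arrow_vop θ)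

theorem arrow_pull (π : Fin n' ≃ Fin n) (u : ∀ j, (⟨X (π j)⟩ : F.Vert) ⟶ ⟨Y j⟩) (b : F.Op Y v) :
    arrow (pull π u b) = (ofFin ((sigmaOne (Fin n')).trans π) (fun j => vop (u j)) ≫ arrow b :
      fam X ⟶ single v) := arrow_compTo _ _ _

theorem deg_pull (π : Fin n' ≃ Fin n) (u : ∀ j, (⟨X (π j)⟩ : F.Vert) ⟶ ⟨Y j⟩) (b : F.Op Y v) :
    deg (pull π u b) = deg b := by
  refine (F.degree.deg_compTo _ _ _).trans ?_
  exact (congrArg (deg b + ·) (Finset.sum_eq_zero fun j _ => deg_vop (u j))).trans (add_zero _)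

theorem deg_push (θ : (⟨v⟩ : F.Vert) ⟶ ⟨w⟩) (a : F.Op X v) : deg (push θ a) = deg a := by
  refine (F.degree.deg_compTo _ _ _).trans ?_
  refine (congrArg₂ (· + ·) (deg_vop θ) (Fin.sum_univ_one _)).trans (zero_add _)

theorem push_pull (θ : (⟨v⟩ : F.Vert) ⟶ ⟨w⟩) (π : Fin n' ≃ Fin n)
    (u : ∀ j, (⟨X (π j)⟩ : F.Vert) ⟶ ⟨Y j⟩) (b : F.Op Y v) :
    push θ (pull π u b) = pull π u (push θ b) := by
  refine arrow_injective ?_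
  rw [arrow_push, arrow_pull, arrow_pull, arrow_push]
  exact Category.assoc _ _ _

theorem push_push {z : F.V} (θ : (⟨v⟩ : F.Vert) ⟶ ⟨w⟩) (θ' : (⟨w⟩ : F.Vert) ⟶ ⟨z⟩) (a : F.Op X v) :
    push θ' (push θ a) = push (θ ≫ θ') a := by
  refine arrow_injective ?_
  rw [arrow_push, arrow_push, arrow_push]
  exact Category.assoc _ _ _

theorem push_id (a : F.Op X v) : push (𝟙 _) a = a := by
  refine arrow_injective ?_
  rw [arrow_push]
  exact Category.comp_id _

theorem push_inv_push (θ : (⟨v⟩ : F.Vert) ⟶ ⟨w⟩) (a : F.Op X v) :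
    push (Groupoid.inv θ) (push θ a) = a := by
  rw [push_push, Groupoid.comp_inv, push_id]

theorem push_push_inv (θ : (⟨v⟩ : F.Vert) ⟶ ⟨w⟩) (a : F.Op X w) :
    push θ (push (Groupoid.inv θ) a) = a := by
  rw [push_push, Groupoid.inv_comp, push_id]

theorem push_injective (θ : (⟨v⟩ : F.Vert) ⟶ ⟨w⟩) :
    Function.Injective (push θ : F.Op X v → F.Op X w) := fun a b h => by
  rw [← push_inv_push θ a, h, push_inv_push]

/-- By the operad axioms both sides are relabellings of the same iterated composite, and the two
bijections of the inputs agree. -/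
theorem pull_pull {l : ℕ} {Z : Fin l → F.V} (π : Fin n' ≃ Fin n)
    (u : ∀ j, (⟨X (π j)⟩ : F.Vert) ⟶ ⟨Y j⟩) (ρ : Fin l ≃ Fin n')
    (t : ∀ j, (⟨Y (ρ j)⟩ : F.Vert) ⟶ ⟨Z j⟩) (c : F.Op Z v) :
    pull π u (pull ρ t c) = pull (ρ.trans π) (fun j => u (ρ j) ≫ t j) c := by
  have h1 := F.comp_reindex_left ((sigmaOne (Fin l)).trans ρ) (Y := Y)
    (X := fun j (_ : Fin 1) => X (π j)) (F.comp c (fun j => vop (t j))) (fun j => vop (u j))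
  refine Eq.trans (congrArg (F.reindex ((sigmaOne (Fin n')).trans π) (X := X)) h1) ?_
  refine (F.reindex_trans _ _ (X := X) _).trans ?_
  symm
  refine Eq.trans (congrArg (F.reindex ((sigmaOne (Fin l)).trans (ρ.trans π)) (X := X))
    (congrArg (F.comp c) (funext fun j => Ops.vop_comp (u (ρ j)) (t j)))) ?_
  refine Eq.trans (congrArg (F.reindex ((sigmaOne (Fin l)).trans (ρ.trans π)) (X := X))
    (F.comp_reindex_right (fun _ => oneSigma (Fin 1)) (X := fun j _ => X (π (ρ j))) c
      (fun j => F.comp (vop (t j)) (fun _ => vop (u (ρ j)))))) ?_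
  refine (F.reindex_trans _ _ (X := X) _).trans ?_
  refine Eq.trans (congrArg (F.reindex _ (X := X)) (F.assoc (K := Fin l) (J := fun _ => Fin 1)
    (I := fun _ _ => Fin 1) (X := fun j _ _ => X (π (ρ j))) c (fun j => vop (t j))
    (fun j _ => vop (u (ρ j)))).symm) ?_
  refine (F.reindex_trans _ _ (X := X) _).trans ?_
  exact reindex_congr (X := X)
    (ρ := (Equiv.sigmaAssoc fun (_ : Fin l) (_ : Fin 1) => Fin 1).trans
      ((Equiv.sigmaCongrRight fun _ : Fin l => oneSigma (Fin 1)).trans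
        ((sigmaOne (Fin l)).trans (ρ.trans π))))
    (ρ' := (Equiv.sigmaCongrLeft ((sigmaOne (Fin l)).trans ρ)).trans
      ((sigmaOne (Fin n')).trans π)) (fun i => rfl)
    (F.comp (F.comp c fun j => vop (t j)) (fun s : Σ _ : Fin l, Fin 1 => vop (u (ρ s.1)))) rfl rfl

theorem pull_refl (a : F.Op X v) : pull (Equiv.refl _) (fun j => 𝟙 (⟨X j⟩ : F.Vert)) a = a := by
  refine Eq.trans ?_ (F.comp_one a)
  exact congrArg (fun z => F.reindex (sigmaOne (Fin n)) (X := X) (F.comp a z))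
    (funext fun j => Ops.vop_id ⟨X j⟩)

end CubicalFeynmanCat

end Matching

/-! ### The pairing of operations of degree one, as a sum over isomorphisms -/

section Pairing

open CubicalFeynmanCat ColOperad

variable {k : Type u} [Field k]

/-- Homogeneous elements of a complex. -/
abbrev HomEl (C : CochainComplex (ModuleCat.{u} k) ℤ) := Σ p : ℤ, C.X p

namespace HomEl

variable {C D : CochainComplex (ModuleCat.{u} k) ℤ}

/-- The image under a chain map. -/
def map (f : C ⟶ D) (x : HomEl C) : HomEl D := ⟨x.1, (f.f x.1).hom x.2⟩

/-- The differential. -/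
def d (x : HomEl C) : HomEl C := ⟨x.1 + 1, (C.d x.1 (x.1 + 1)).hom x.2⟩

/-- The evaluation of homogeneous functionals. -/
noncomputable def pair (η : HomEl (dualComplex C)) (x : HomEl C) : k := dualEval C η.2 x.2

theorem map_id (x : HomEl C) : map (𝟙 C) x = x := rfl

theorem map_map {C' : CochainComplex (ModuleCat.{u} k) ℤ} (f : C ⟶ D) (g : D ⟶ C') (x : HomEl C) :
    map g (map f x) = map (f ≫ g) x := rfl

/-- The reason for working with pairs of a degree and an element: transports between equal degrees
become invisible. -/
theorem XIsoOfEq_eq {p q : ℤ} (h : p = q) (x : C.X p) :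
    (⟨q, (C.XIsoOfEq h).hom.hom x⟩ : HomEl C) = ⟨p, x⟩ := by
  subst h; simp [HomologicalComplex.XIsoOfEq]

theorem d_mk {p q : ℤ} (h : p + 1 = q) (x : C.X p) :
    (⟨q, (C.d p q).hom x⟩ : HomEl C) = d ⟨p, x⟩ := by
  subst h; rfl

theorem pair_mk (q : ℤ) (η : Module.Dual k (C.X (-q))) (x : C.X (-q)) :
    pair (C := C) ⟨q, η⟩ ⟨-q, x⟩ = η x := by
  simp [pair, dualEval, HomologicalComplex.XIsoOfEq]

theorem pair_of_ne {η : HomEl (dualComplex C)} {x : HomEl C} (h : x.1 ≠ -η.1) : pair η x = 0 :=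
  dif_neg h

theorem pair_dualMor (f : C ⟶ D) (η : HomEl (dualComplex D)) (x : HomEl C) :
    pair (map (dualMor f) η) x = pair η (map f x) := by
  by_cases h : x.1 = -η.1
  · obtain ⟨q, η⟩ := η
    obtain ⟨p, x⟩ := x
    obtain rfl : p = -q := h
    exact (pair_mk q _ x).trans (pair_mk (C := D) q η _).symm
  · rw [pair_of_ne h, pair_of_ne h]

/-- There is no sign because the differential of the dual complex is the plain transpose. When the
degrees do not fit, both sides take the default value zero. -/
theorem pair_d (η : HomEl (dualComplex C)) (x : HomEl C) : pair (d η) x = pair η (d x) := by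
  by_cases h : x.1 + 1 = -η.1
  · obtain ⟨q, η⟩ := η
    obtain ⟨p, x⟩ := x
    obtain rfl : p = -(q + 1) := by change p + 1 = -q at h; omega
    refine (pair_mk (q + 1) _ x).trans ?_
    have : d (C := C) ⟨-(q + 1), x⟩ = ⟨-q, (C.d (-(q + 1)) (-q)).hom x⟩ := (d_mk h x).symm
    rw [this]
    exact (pair_mk (C := C) q η _).symm
  · rw [pair_of_ne (η := η) (x := d x) h, pair_of_ne]
    intro h'
    change x.1 = -(η.1 + 1) at h'
    omega

theorem pair_add (p : ℤ) (η η' : (dualComplex C).X p) (x : HomEl C) :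
    pair (⟨p, η + η'⟩ : HomEl (dualComplex C)) x = pair ⟨p, η⟩ x + pair ⟨p, η'⟩ x := by
  unfold pair dualEval
  split_ifs
  · rfl
  · simp

theorem pair_smul (p : ℤ) (c : k) (η : (dualComplex C).X p) (x : HomEl C) :
    pair (⟨p, c • η⟩ : HomEl (dualComplex C)) x = c * pair ⟨p, η⟩ x := by
  unfold pair dualEval
  split_ifs
  · rfl
  · simp

theorem pair_zero_left (p : ℤ) (x : HomEl C) :
    pair (⟨p, 0⟩ : HomEl (dualComplex C)) x = 0 := by
  have := pair_smul p (0 : k) 0 x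
  rwa [zero_smul, zero_mul] at this

/-- Homogeneous elements as functionals on the dual. -/
noncomputable def bidual (x : HomEl C) : HomEl (dualComplex (dualComplex C)) :=
  ⟨x.1, (Module.Dual.eval k (C.X (- -x.1))
    ((C.XIsoOfEq (neg_neg x.1).symm).hom.hom x.2) : Module.Dual k (Module.Dual k (C.X (- -x.1))))⟩

theorem pair_bidual (x : HomEl C) (η : HomEl (dualComplex C)) : pair (bidual x) η = pair η x := by
  by_cases h : η.1 = -x.1
  · obtain ⟨p, x⟩ := x
    obtain ⟨q, η⟩ := η
    obtain rfl : q = -p := h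
    refine (pair_mk (C := dualComplex C) p _ η).trans ?_
    refine (pair_mk (C := C) (-p) η _).symm.trans ?_
    exact congrArg (pair (C := C) ⟨-p, η⟩) (XIsoOfEq_eq (neg_neg p).symm x)
  · rw [pair_of_ne h, pair_of_ne]
    intro h'; exact h (by omega)

end HomEl

namespace VMod

variable {F : CubicalFeynmanCat.{u}} (E : VMod F k)

/-- The homogeneous elements of a `V`-module at a vertex. -/
abbrev el (v : F.V) := HomEl (E.obj ⟨v⟩)

variable {E}

theorem map_inv_map {v w : F.Vert} (θ : v ⟶ w) (x : HomEl (E.obj v)) :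
    HomEl.map (E.map (Groupoid.inv θ)) (HomEl.map (E.map θ) x) = x := by
  rw [HomEl.map_map, ← E.map_comp, Groupoid.comp_inv, E.map_id, HomEl.map_id]

theorem pair_map {v w : F.Vert} (θ : v ⟶ w) (η : HomEl ((dualModule E).obj v))
    (x : HomEl (E.obj w)) : HomEl.pair (C := E.obj w) (HomEl.map ((dualModule E).map θ) η) x =
      HomEl.pair (C := E.obj v) η (HomEl.map (E.map (Groupoid.inv θ)) x) :=
  HomEl.pair_dualMor _ _ _

theorem pair_map_map {v w : F.Vert} (θ : v ⟶ w) (η : HomEl ((dualModule E).obj v))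
    (x : HomEl (E.obj v)) : HomEl.pair (C := E.obj w) (HomEl.map ((dualModule E).map θ) η)
      (HomEl.map (E.map θ) x) = HomEl.pair (C := E.obj v) η x := by
  rw [pair_map, map_inv_map]

end VMod

variable {F : CubicalFeynmanCat.{u}} {E : VMod F k} {n n' l : ℕ} {X : Fin n → F.V}
  {Y : Fin n' → F.V} {Z : Fin l → F.V} {v w : F.V}

theorem groupoid_inv_inv {C : Type*} [Groupoid C] {x y : C} (f : x ⟶ y) :
    Groupoid.inv (Groupoid.inv f) = f := by simp

theorem comp_inv_comp {C : Type*} [Groupoid C] {x y z : C} (a : x ⟶ y) (b : z ⟶ y) :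
    (a ≫ Groupoid.inv b) ≫ b = a := by simp

namespace IsoMatch

theorem mk_congr {b : F.Op Y v} {a : F.Op X v} {π : Fin n' ≃ Fin n}
    {u u' : ∀ j, (⟨X (π j)⟩ : F.Vert) ⟶ ⟨Y j⟩} (hu : u = u') (h : pull π u b = a)
    (h' : pull π u' b = a) : (⟨π, u, h⟩ : IsoMatch b a) = ⟨π, u', h'⟩ := by
  subst hu; rfl

/-- Distinct vertices are not isomorphic and automorphism groups are finite, so there are finitely
many isomorphisms between any two vertices. -/
instance finite (b : F.Op Y v) (a : F.Op X v) : Finite (IsoMatch b a) := by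
  have hf : ∀ v w : F.V, Finite ((⟨v⟩ : F.Vert) ⟶ ⟨w⟩) := by
    intro v w
    by_cases h : Nonempty ((⟨v⟩ : F.Vert) ⟶ ⟨w⟩)
    · obtain rfl := F.eq_of_iso h
      exact F.finite_aut v
    · rw [not_nonempty_iff] at h; infer_instance
  refine Finite.of_injective (β := Σ π : Fin n' ≃ Fin n, ∀ j, (⟨X (π j)⟩ : F.Vert) ⟶ ⟨Y j⟩)
    (fun l => ⟨l.π, l.u⟩) ?_
  rintro ⟨π, u, h⟩ ⟨π', u', h'⟩ hl
  obtain ⟨rfl, h2⟩ := Sigma.mk.inj hl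
  obtain rfl := eq_of_heq h2
  rfl

noncomputable instance (b : F.Op Y v) (a : F.Op X v) : Fintype (IsoMatch b a) := Fintype.ofFinite _

/-- Composition of matches. -/
def trans {c : F.Op Z v} {b : F.Op Y v} {a : F.Op X v} (s : IsoMatch c b) (t : IsoMatch b a) :
    IsoMatch c a where
  π := s.π.trans t.π
  u j := t.u (s.π j) ≫ s.u j
  comp := (pull_pull t.π t.u s.π s.u c).symm.trans ((congrArg (pull t.π t.u) s.comp).trans t.comp)

/-- The identity match. -/
def refl (a : F.Op X v) : IsoMatch a a where
  π := Equiv.refl _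
  u _ := 𝟙 _
  comp := pull_refl a

/-- Inverses of a family of isomorphisms over a bijection. -/
def invU (π : Fin n' ≃ Fin n) (u : ∀ j, (⟨X (π j)⟩ : F.Vert) ⟶ ⟨Y j⟩) (i : Fin n) (j : Fin n')
    (h : π j = i) : (⟨Y j⟩ : F.Vert) ⟶ ⟨X i⟩ := by
  subst h; exact Groupoid.inv (u j)

/-- The inverse match. -/
def symm {b : F.Op Y v} {a : F.Op X v} (s : IsoMatch b a) : IsoMatch a b where
  π := s.π.symm
  u i := invU s.π s.u i (s.π.symm i) (s.π.apply_symm_apply i)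
  comp := by
    obtain ⟨π, u, rfl⟩ := s
    refine (pull_pull π.symm _ π u b).trans ?_
    have hu : ∀ j j' (h : π j' = π j), invU π u (π j) j' h ≫ u j =
        eqToHom (by rw [π.injective h]) := by
      intro j j' h
      obtain rfl := π.injective h
      exact Groupoid.inv_comp _
    refine Eq.trans ?_ (pull_refl b)
    -- The composite bijection is the identity only propositionally; the isomorphisms over it are
    -- compared through `eqToHom`.
    have : ∀ (ρ : Fin n' ≃ Fin n') (hρ : ρ = Equiv.refl _)
        (t : ∀ j, (⟨Y (ρ j)⟩ : F.Vert) ⟶ ⟨Y j⟩)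
        (_ : ∀ j, t j = eqToHom (by rw [hρ]; rfl)), pull ρ t b =
          pull (Equiv.refl _) (fun j => 𝟙 (⟨Y j⟩ : F.Vert)) b := by
      rintro ρ rfl t ht
      exact congrArg (fun z => pull (Equiv.refl _) z b) (funext ht)
    exact this _ (by simp) _ fun j => hu j _ _

theorem symm_symm {b : F.Op Y v} {a : F.Op X v} (s : IsoMatch b a) : s.symm.symm = s := by
  obtain ⟨π, u, h⟩ := s
  -- The doubly inverted isomorphism with independent indices, so that the casts can be removed by
  -- substitution.
  let T : ∀ (i : Fin n) (j j' : Fin n') (_ : j' = j) (_ : π j' = i), (⟨X i⟩ : F.Vert) ⟶ ⟨Y j⟩ :=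
    fun i j j' h h2 => by subst h; exact Groupoid.inv (invU π u i j' h2)
  have key : ∀ (j j' : Fin n') (h : j' = j) (h2 : π j' = π j), T (π j) j j' h h2 = u j := by
    rintro j _ rfl h2
    exact groupoid_inv_inv (u _)
  exact mk_congr (funext fun j => key j _ (π.symm_apply_apply j) (π.apply_symm_apply _)) _ h

end IsoMatch

/-- One term of the pairing of two tuples of homogeneous elements. -/
noncomputable def matchTerm (η : ∀ j, (dualModule E).el (Y j)) (x : ∀ i, E.el (X i))
    (π : Fin n' ≃ Fin n) (u : ∀ j, (⟨X (π j)⟩ : F.Vert) ⟶ ⟨Y j⟩) : k :=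
  sgn k (permKoszul π fun i => (x i).1) *
    ∏ j, HomEl.pair (C := E.obj ⟨Y j⟩) (η j) (HomEl.map (E.map (u j)) (x (π j)))

/-- The pairing of two operations of degree one with homogeneous elements at their inputs. -/
noncomputable def opPair (b : F.Op Y v) (η : ∀ j, (dualModule E).el (Y j)) (a : F.Op X v)
    (x : ∀ i, E.el (X i)) : k :=
  ∑ s : IsoMatch b a, matchTerm η x s.π s.u

theorem weightPair_eq {ε δ : Parity} {m m' : ℤ} (s : WGen (dualModule E) δ v m')
    (t : WGen E ε v m) : weightPair s t =
      opPair s.op (fun j => ⟨s.p j, s.x j⟩) t.op (fun i => ⟨t.p i, t.x i⟩) := by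
  unfold weightPair opPair
  rw [finsum_eq_sum_of_fintype]
  refine Finset.sum_congr rfl fun l _ => ?_
  rw [koszul_sigmaOne _ _ _ fun _ => rfl]
  rfl

section

variable {η : ∀ j, (dualModule E).el (Y j)} {x : ∀ i, E.el (X i)}

theorem matchTerm_eq_zero {π : Fin n' ≃ Fin n} {u : ∀ j, (⟨X (π j)⟩ : F.Vert) ⟶ ⟨Y j⟩} (j : Fin n')
    (h : (x (π j)).1 ≠ -(η j).1) : matchTerm η x π u = 0 := by
  unfold matchTerm
  rw [Finset.prod_eq_zero (Finset.mem_univ j) (HomEl.pair_of_ne h), mul_zero]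

/-- In a non-zero term every functional meets an element of the opposite degree, which fixes the
total degrees. -/
theorem opPair_eq_zero (b : F.Op Y v) (a : F.Op X v) (h : ∑ i, (x i).1 ≠ -∑ j, (η j).1) :
    opPair b η a x = 0 := by
  refine Finset.sum_eq_zero fun s _ => ?_
  by_contra h0
  refine h ?_
  rw [← Equiv.sum_comp s.π, ← Finset.sum_neg_distrib]
  refine Finset.sum_congr rfl fun j _ => ?_
  by_contra h1
  exact h0 (matchTerm_eq_zero j h1)

/-- As `push θ` is injective and commutes with `pull`, it does not change the set of matches. -/
theorem opPair_push (θ : (⟨v⟩ : F.Vert) ⟶ ⟨w⟩) (b : F.Op Y v) (a : F.Op X v) :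
    opPair (push θ b) η (push θ a) x = opPair b η a x := by
  refine Finset.sum_bij' (fun s _ => ⟨s.π, s.u, push_injective θ ((push_pull θ s.π s.u b).trans
    s.comp)⟩) (fun s _ => ⟨s.π, s.u, (push_pull θ s.π s.u b).symm.trans
    (congrArg (push θ) s.comp)⟩) ?_ ?_ ?_ ?_ ?_ <;> simp

/-- Composition with the tautological match of `c` with `pull ρ t c` is a bijection between the
matches on the two sides. The signs agree by `permKoszul_trans` for the terms in which all degrees
are opposite, and the other terms vanish. -/
theorem opPair_pull (ρ : Fin l ≃ Fin n') (t : ∀ j, (⟨Y (ρ j)⟩ : F.Vert) ⟶ ⟨Z j⟩) (c : F.Op Z v)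
    (a : F.Op X v) : opPair (pull ρ t c) η a x = sgn k (permKoszul ρ fun j => (η j).1) *
      opPair c (fun j => HomEl.map ((dualModule E).map (t j)) (η (ρ j))) a x := by
  let s₀ : IsoMatch c (pull ρ t c) := ⟨ρ, t, rfl⟩
  unfold opPair
  rw [Finset.mul_sum]
  refine Finset.sum_bij (fun s _ => s₀.trans s) (fun _ _ => Finset.mem_univ _) ?_ ?_ ?_
  · rintro ⟨π, u, h⟩ - ⟨π', u', h'⟩ - hs
    have h1 : ρ.trans π = ρ.trans π' := congrArg IsoMatch.π hs
    obtain rfl : π = π' := by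
      ext i
      obtain ⟨j, rfl⟩ := ρ.surjective i
      exact congrArg Fin.val (congrArg (fun e => e j) h1)
    have h2 : (fun j => u (ρ j) ≫ t j) = fun j => u' (ρ j) ≫ t j :=
      eq_of_heq (IsoMatch.mk.inj hs).2
    obtain rfl : u = u' := by
      funext i
      obtain ⟨j, rfl⟩ := ρ.surjective i
      exact (cancel_mono (t j)).1 (congrFun h2 j)
    rfl
  · rintro ⟨π, u, h⟩ -
    -- A match of `c` with `a` is divided by the tautological one: first its bijection, then its
    -- isomorphisms at the inputs of the form `ρ j`.
    obtain ⟨π, rfl⟩ : ∃ π', π = ρ.trans π' := ⟨ρ.symm.trans π, by ext; simp⟩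
    obtain ⟨g, hg⟩ : ∃ g : ∀ i, (⟨X (π i)⟩ : F.Vert) ⟶ ⟨Y i⟩,
        ∀ j, g (ρ j) = u j ≫ Groupoid.inv (t j) :=
      ⟨Equiv.piCongrLeft (fun i => (⟨X (π i)⟩ : F.Vert) ⟶ ⟨Y i⟩) ρ
        (fun j => u j ≫ Groupoid.inv (t j)), fun j => Equiv.piCongrLeft_apply_apply _ _ _ _⟩
    have hu : (fun j => g (ρ j) ≫ t j) = u := funext fun j => by
      exact (congrArg (· ≫ t j) (hg j)).trans (comp_inv_comp _ _)
    subst hu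
    exact ⟨⟨π, g, (pull_pull π g ρ t c).trans h⟩, Finset.mem_univ _, rfl⟩
  · rintro ⟨π, u, h⟩ -
    change matchTerm η x π u = _ * matchTerm _ x (ρ.trans π) (fun j => u (ρ j) ≫ t j)
    by_cases h0 : ∀ j, (x (π j)).1 = -(η j).1
    · unfold matchTerm
      have h1 : permKoszul ρ (fun j => (x (π j)).1) = permKoszul ρ (fun j => (η j).1) :=
        permKoszul_neg ρ _ _ h0
      rw [permKoszul_trans, h1, ← mul_assoc, ← mul_assoc, sgn_mul_self, one_mul,
        ← Equiv.prod_comp ρ]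
      refine congrArg _ (Finset.prod_congr rfl fun j _ => ?_)
      refine Eq.trans (VMod.pair_map_map (t j) _ _).symm (congrArg (HomEl.pair _) ?_)
      exact congrArg (fun h => HomEl.map h (x (π (ρ j)))) (E.map_comp (u (ρ j)) (t j)).symm
    · push Not at h0
      obtain ⟨i, hi⟩ := h0
      obtain ⟨j, rfl⟩ := ρ.surjective i
      rw [matchTerm_eq_zero _ hi, matchTerm_eq_zero j, mul_zero]
      exact hi

/-- Inverse permutations have the same Koszul sign when the degrees on both sides are opposite, and
the dual module is defined with inverse transposes. -/
theorem matchTerm_symm {b : F.Op Y v} {a : F.Op X v} (s : IsoMatch b a) :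
    matchTerm (E := dualModule E) (fun i => HomEl.bidual (x i)) η s.symm.π s.symm.u =
      matchTerm η x s.π s.u := by
  obtain ⟨π, u, h⟩ := s
  by_cases h0 : ∀ j, (x (π j)).1 = -(η j).1
  · refine congrArg₂ (· * ·) (congrArg (sgn k)
      (permKoszul_symm π _ _ fun j => by rw [h0 j, neg_neg])) ?_
    refine (Equiv.prod_comp π _).symm.trans (Finset.prod_congr rfl fun j _ => ?_)
    have key : ∀ (j' : Fin n') (h : π j' = π j),
        HomEl.pair (HomEl.bidual (x (π j)))
          (HomEl.map ((dualModule E).map (IsoMatch.invU π u (π j) j' h)) (η j')) =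
        HomEl.pair (C := E.obj ⟨Y j⟩) (η j) (HomEl.map (E.map (u j)) (x (π j))) := by
      intro j' h
      obtain rfl := π.injective h
      rw [HomEl.pair_bidual, VMod.pair_map]
      exact congrArg (fun z => HomEl.pair (C := E.obj ⟨Y j'⟩) (η j') (HomEl.map (E.map z) (x (π j'))))
        (groupoid_inv_inv (u j'))
    exact key _ _
  · push Not at h0
    obtain ⟨j, hj⟩ := h0
    rw [matchTerm_eq_zero _ hj]
    refine matchTerm_eq_zero (π j) fun h' => hj ?_
    have h' : (η (π.symm (π j))).1 = -(x (π j)).1 := h'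
    rw [π.symm_apply_apply] at h'
    omega

/-- Inverting matches exchanges the two arguments of the pairing, at the cost of no sign. This makes
the outer dual, formed with the double dual of `rE`, comparable with `rE` itself. -/
theorem opPair_bidual (a : F.Op X v) (η : ∀ j, (dualModule E).el (Y j)) (b : F.Op Y v) :
    opPair (E := dualModule E) a (fun i => HomEl.bidual (x i)) b η = opPair b η a x :=
  (Finset.sum_bij' (fun s _ => s.symm) (fun s _ => s.symm) (fun _ _ => Finset.mem_univ _)
    (fun _ _ => Finset.mem_univ _) (fun s _ => s.symm_symm) (fun s _ => s.symm_symm)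
    fun s _ => (matchTerm_symm s).symm).symm

end

end Pairing

/-! ### Modules with operations of degree one whose composites vanish -/

section Truncated

open CubicalFeynmanCat ColOperad

variable {k : Type u} [Field k]

theorem HomEl.snd_eq {C : CochainComplex (ModuleCat.{u} k) ℤ} {m : ℤ} {x y : C.X m}
    (h : (⟨m, x⟩ : HomEl C) = ⟨m, y⟩) : x = y :=
  eq_of_heq (Sigma.mk.inj h).2

theorem HomEl.map_d {C D : CochainComplex (ModuleCat.{u} k) ℤ} (f : C ⟶ D) (x : HomEl C) :
    HomEl.map f x.d = (HomEl.map f x).d :=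
  Sigma.ext rfl (heq_of_eq (congrArg (fun g : C.X x.1 ⟶ D.X (x.1 + 1) => g.hom x.2)
    (f.comm x.1 (x.1 + 1)).symm))

/-- As pairs of a degree and an element, tuples are differentiated at one entry by a mere update;
the transports in `dAt` disappear. -/
theorem dAt_mk {n : ℕ} (C : Fin n → CochainComplex (ModuleCat.{u} k) ℤ) {p : Fin n → ℤ}
    (x : ∀ j, (C j).X (p j)) (i j : Fin n) :
    (⟨bump p i j, dAt C x i j⟩ : HomEl (C j)) =
      Function.update (fun j => (⟨p j, x j⟩ : HomEl (C j))) i (HomEl.d ⟨p i, x i⟩) j := by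
  unfold dAt
  split_ifs with h
  · subst h
    rw [Function.update_self]
    exact HomEl.d_mk (show p j + 1 = bump p j j by simp [bump]) _
  · rw [Function.update_of_ne h]
    exact HomEl.XIsoOfEq_eq _ _

namespace CubicalFeynmanCat

variable {F : CubicalFeynmanCat.{u}} {n n' : ℕ} {X : Fin n → F.V} {Y : Fin n' → F.V} {v w y : F.V}

theorem pull_one (u : (⟨y⟩ : F.Vert) ⟶ ⟨v⟩) :
    pull (X := fun _ => y) (Equiv.refl (Fin 1)) (fun _ => u) (F.one v) = vop u := by
  refine Eq.trans ?_ (F.one_comp (vop u))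
  exact reindex_congr (X := fun _ => y) (fun _ => Subsingleton.elim _ _)
    (F.comp (F.one v) fun _ => vop u) rfl rfl

/-- An operation of degree zero is an isomorphism onto a single vertex, so it has exactly one input.
-/
theorem exists_eq_pull_one (a : F.Op X v) (ha : deg a = 0) :
    ∃ (ρ : Fin 1 ≃ Fin n) (u : ∀ j, (⟨X (ρ j)⟩ : F.Vert) ⟶ ⟨v⟩), a = pull ρ u (F.one v) := by
  have := F.cubical.isIso_of_deg (arrow a) ((deg_arrow a).trans ha)
  let f : (⟨Fin n, X⟩ : F.Cat) ⟶ single v := arrow a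
  let g : single v ⟶ (⟨Fin n, X⟩ : F.Cat) := inv f
  have h1 : ∀ i, Mor.idx g (Mor.idx f i) = i := fun i => by
    refine (Mor.idx_comp f g i).symm.trans ?_
    rw [IsIso.hom_inv_id]
    exact Mor.idx_id i
  let ρ : Fin 1 ≃ Fin n :=
    ⟨Mor.idx g, Mor.idx f, fun _ => Subsingleton.elim _ _, h1⟩
  obtain rfl : n = 1 := by simpa using (Fintype.card_congr ρ).symm
  obtain ⟨y, rfl⟩ : ∃ y, X = fun _ => y := ⟨X 0, funext fun i => congrArg X (Subsingleton.elim _ _)⟩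
  obtain ⟨θ, rfl⟩ := exists_vop a ha
  exact ⟨Equiv.refl _, fun _ => θ, (pull_one θ).symm⟩

theorem pull_one_injective {ρ : Fin 1 ≃ Fin n} {u u' : ∀ j, (⟨X (ρ j)⟩ : F.Vert) ⟶ ⟨v⟩}
    (h : pull ρ u (F.one v) = pull ρ u' (F.one v)) : u = u' := by
  have h1 := congrArg arrow h
  rw [arrow_pull, arrow_pull, Ops.arrow_one] at h1
  have h2 : ofFin ((sigmaOne (Fin 1)).trans ρ) (fun j => vop (u j)) =
      ofFin ((sigmaOne (Fin 1)).trans ρ) (fun j => vop (u' j)) := by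
    exact (cancel_mono (𝟙 (single v : F.Cat))).1 h1
  have h3 := ofFin_injective _ h2
  exact funext fun j => vop_injective (congrFun h3 j)

theorem deg_pull_one (ρ : Fin 1 ≃ Fin n) (u : ∀ j, (⟨X (ρ j)⟩ : F.Vert) ⟶ ⟨v⟩) :
    deg (pull ρ u (F.one v)) = 0 := (deg_pull ρ u _).trans (F.degree.deg_one v)

theorem shift_deg_pull_one (ε : Parity) (ρ : Fin 1 ≃ Fin n) (u : ∀ j, (⟨X (ρ j)⟩ : F.Vert) ⟶ ⟨v⟩) :
    ε.shift (deg (pull ρ u (F.one v))) = 0 := by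
  rw [deg_pull_one, Parity.shift_zero]

theorem shift_deg_vop (ε : Parity) {v w : F.Vert} (θ : v ⟶ w) : ε.shift (deg (vop θ)) = 0 := by
  rw [deg_vop, Parity.shift_zero]

theorem push_one (u : (⟨y⟩ : F.Vert) ⟶ ⟨v⟩) :
    push u (F.one y) = pull (X := fun _ => y) (Equiv.refl (Fin 1)) (fun _ => u) (F.one v) := by
  refine Eq.trans ?_ (pull_one u).symm
  have h := congrArg vop (Category.id_comp u)
  refine Eq.trans ?_ h
  refine Eq.trans ?_ (Ops.vop_comp (𝟙 _) u).symm
  exact congrArg (fun a => compTo (n := fun _ : Fin 1 => 1) (X := fun _ : Fin 1 => y)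
      (Y := fun _ : Fin 1 => y) (oneSigma (Fin 1)) (vop u) (fun _ => a)) (Ops.vop_id ⟨y⟩).symm

theorem pull_id (π : Fin n' ≃ Fin n) (b : F.Op (fun j => X (π j)) v) :
    pull π (fun j => 𝟙 (⟨X (π j)⟩ : F.Vert)) b = F.reindex π (X := X) b := by
  refine (F.reindex_trans (sigmaOne (Fin n')) π (X := X) _).symm.trans ?_
  refine congrArg (F.reindex π (X := X)) ?_
  exact pull_refl b

theorem compTo_oneSigma (π : Fin n' ≃ Fin n) (θ : (⟨y⟩ : F.Vert) ⟶ ⟨v⟩)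
    (a : F.Op (fun i => X (π i)) y) :
    compTo (m := 1) (n := fun _ => n') ((oneSigma (Fin n')).trans π) (X := X) (Y := fun _ => y)
      (vop θ) (fun _ => a) = push θ (pull π (fun j => 𝟙 (⟨X (π j)⟩ : F.Vert)) a) := by
  rw [push_pull, pull_id]
  exact (F.reindex_trans (oneSigma (Fin n')) π (X := X) _).symm

end CubicalFeynmanCat

variable {F : CubicalFeynmanCat.{u}}

/-- A `V`-module with structure maps for the operations of degree one such that all composites of two
of them vanish. -/
structure SquareZero (C : VMod F k) (ε : Parity) where
  μ : ∀ {n : ℕ} {X : Fin n → F.V} {v : F.V} (a : F.Op X v) (_ : deg a = 1) (p : Fin n → ℤ) (m : ℤ)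
    (_ : ∑ i, p i + ε.shift 1 = m),
    MultilinearMap k (fun i => (C.obj ⟨X i⟩).X (p i)) ((C.obj ⟨v⟩).X m)
  push : ∀ {n : ℕ} {X : Fin n → F.V} {v w : F.V} (θ : (⟨v⟩ : F.Vert) ⟶ ⟨w⟩) (a : F.Op X v)
    (ha : deg a = 1) (ha' : deg (push θ a) = 1) (p : Fin n → ℤ) (m : ℤ)
    (h : ∑ i, p i + ε.shift 1 = m) (x : ∀ i, (C.obj ⟨X i⟩).X (p i)),
    μ (CubicalFeynmanCat.push θ a) ha' p m h x = ((C.map θ).f m).hom (μ a ha p m h x)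
  pull : ∀ {n n' : ℕ} {X : Fin n → F.V} {Y : Fin n' → F.V} {v : F.V} (π : Fin n' ≃ Fin n)
    (u : ∀ j, (⟨X (π j)⟩ : F.Vert) ⟶ ⟨Y j⟩) (b : F.Op Y v) (hb : deg b = 1)
    (hb' : deg (pull π u b) = 1) (p : Fin n → ℤ) (m : ℤ) (h : ∑ i, p i + ε.shift 1 = m)
    (h' : ∑ j, p (π j) + ε.shift 1 = m) (x : ∀ i, (C.obj ⟨X i⟩).X (p i)),
    μ (CubicalFeynmanCat.pull π u b) hb' p m h x = sgn k (permKoszul π p) •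
      μ b hb (fun j => p (π j)) m h' (fun j => ((C.map (u j)).f (p (π j))).hom (x (π j)))
  d : ∀ {n : ℕ} {X : Fin n → F.V} {v : F.V} (a : F.Op X v) (ha : deg a = 1)
    (p : Fin n → ℤ) (m m' : ℤ) (_ : m + 1 = m') (h : ∑ i, p i + ε.shift 1 = m)
    (h' : ∀ i, ∑ j, bump p i j + ε.shift 1 = m') (x : ∀ i, (C.obj ⟨X i⟩).X (p i)),
    ((C.obj ⟨v⟩).d m m').hom (μ a ha p m h x) = sgn k (ε.shift 1) •
      ∑ i, sgn k (∑ j, if j < i then p j else 0) •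
        μ a ha (bump p i) m' (h' i) (fun j => dAt (fun j => C.obj ⟨X j⟩) x i j)
  comp : ∀ {n n' : ℕ} {X : Fin n → F.V} {Y : Fin n' → F.V} {v : F.V} (b : F.Op Y v) (hb : deg b = 1)
    (q : Fin n' → ℤ) (r : ℤ) (hr : ∑ j, q j + ε.shift 1 = r) (y : ∀ j, (C.obj ⟨Y j⟩).X (q j))
    (j : Fin n') (a : F.Op X (Y j)) (ha : deg a = 1) (p : Fin n → ℤ)
    (h : ∑ i, p i + ε.shift 1 = q j) (x : ∀ i, (C.obj ⟨X i⟩).X (p i)),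
    y j = μ a ha p (q j) h x → μ b hb q r hr y = 0

namespace SquareZero

variable {C : VMod F k} {ε : Parity} (M : SquareZero C ε)

/-- The structure map of an operation of degree zero. -/
noncomputable def unary (C : VMod F k) {n : ℕ} {X : Fin n → F.V} {v : F.V} (ρ : Fin 1 ≃ Fin n)
    (u : ∀ j, (⟨X (ρ j)⟩ : F.Vert) ⟶ ⟨v⟩) (p : Fin n → ℤ) (m : ℤ) (h : p (ρ 0) = m) :
    MultilinearMap k (fun i => (C.obj ⟨X i⟩).X (p i)) ((C.obj ⟨v⟩).X m) where
  toFun x := ((C.map (u 0)).f m).hom (((C.obj ⟨X (ρ 0)⟩).XIsoOfEq h).hom.hom (x (ρ 0)))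
  map_update_add' := by
    intro _ x i s t
    obtain ⟨j, rfl⟩ := ρ.surjective i
    obtain rfl := Subsingleton.elim 0 j
    simp
  map_update_smul' := by
    intro _ x i c s
    obtain ⟨j, rfl⟩ := ρ.surjective i
    obtain rfl := Subsingleton.elim 0 j
    simp

theorem unary_mk {n : ℕ} {X : Fin n → F.V} {v : F.V} (ρ : Fin 1 ≃ Fin n)
    (u : ∀ j, (⟨X (ρ j)⟩ : F.Vert) ⟶ ⟨v⟩) (p : Fin n → ℤ) (m : ℤ) (h : p (ρ 0) = m)
    (x : ∀ i, (C.obj ⟨X i⟩).X (p i)) : (⟨m, unary C ρ u p m h x⟩ : HomEl (C.obj ⟨v⟩)) =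
      HomEl.map (C.map (u 0)) ⟨p (ρ 0), x (ρ 0)⟩ :=
  congrArg (HomEl.map (C.map (u 0))) (HomEl.XIsoOfEq_eq h (x (ρ 0)))

theorem sum_eq_of_perm {n : ℕ} (ρ : Fin 1 ≃ Fin n) (p : Fin n → ℤ) : ∑ i, p i = p (ρ 0) := by
  rw [← Equiv.sum_comp ρ, Fintype.sum_unique]; rfl

open Classical in
/-- The operad with the given structure maps in degree one. -/
noncomputable def raw : RawOp F k ε where
  obj v := C.obj ⟨v⟩
  act {n X v} a ha p m h :=
    if h1 : deg a = 1 then M.μ a h1 p m (h1 ▸ h) else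
      have h0 : deg a = 0 := by omega
      have hex := exists_eq_pull_one a h0
      unary C hex.choose hex.choose_spec.choose p m (by
        rw [← h, h0, Parity.shift_zero, add_zero]; exact (sum_eq_of_perm _ p).symm)

theorem raw_act_one {n : ℕ} {X : Fin n → F.V} {v : F.V} (a : F.Op X v) (ha : deg a ≤ 1)
    (h1 : deg a = 1) (p : Fin n → ℤ) (m : ℤ) (h : ∑ i, p i + ε.shift (deg a) = m)
    (x : ∀ i, (C.obj ⟨X i⟩).X (p i)) : M.raw.act a ha p m h x = M.μ a h1 p m (h1 ▸ h) x :=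
  congrArg (fun f : MultilinearMap k (fun i => (C.obj ⟨X i⟩).X (p i)) ((C.obj ⟨v⟩).X m) => f x)
    (dif_pos h1)

/-- The presentation picked by choice in `raw` is irrelevant: an operation of degree zero determines
its isomorphism of vertices. -/
theorem raw_act_zero {n : ℕ} {X : Fin n → F.V} {v : F.V} (a : F.Op X v) (ha : deg a ≤ 1)
    (ρ : Fin 1 ≃ Fin n) (u : ∀ j, (⟨X (ρ j)⟩ : F.Vert) ⟶ ⟨v⟩) (hu : a = CubicalFeynmanCat.pull ρ u (F.one v))
    (p : Fin n → ℤ) (m : ℤ) (h : ∑ i, p i + ε.shift (deg a) = m) (h' : p (ρ 0) = m)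
    (x : ∀ i, (C.obj ⟨X i⟩).X (p i)) : M.raw.act a ha p m h x = unary C ρ u p m h' x := by
  have h0 : deg a = 0 := by rw [hu]; exact deg_pull_one ρ u
  have h1 : deg a ≠ 1 := by omega
  refine congrArg (fun f : MultilinearMap k (fun i => (C.obj ⟨X i⟩).X (p i)) ((C.obj ⟨v⟩).X m) => f x)
    ((dif_neg h1).trans ?_)
  have key : ∀ (ρ' : Fin 1 ≃ Fin n) (u' : ∀ j, (⟨X (ρ' j)⟩ : F.Vert) ⟶ ⟨v⟩)
      (_ : a = CubicalFeynmanCat.pull ρ' u' (F.one v)) (h'' : p (ρ' 0) = m),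
      unary C ρ' u' p m h'' = unary C ρ u p m h' := by
    intro ρ' u' hu' h''
    obtain rfl : n = 1 := by simpa using (Fintype.card_congr ρ).symm
    obtain rfl : ρ' = ρ := Equiv.ext fun _ => Subsingleton.elim _ _
    obtain rfl := pull_one_injective (hu'.symm.trans hu)
    rfl
  exact key _ _ (exists_eq_pull_one a h0).choose_spec.choose_spec _

end SquareZero

end Truncated

/-! ### Such modules are operads, of either parity -/

section SquareZeroOp

open CubicalFeynmanCat ColOperad

variable {k : Type u} [Field k] {F : CubicalFeynmanCat.{u}}

namespace SquareZero

variable {C : VMod F k} {ε : Parity} (M : SquareZero C ε)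

theorem raw_act_vop {v w : F.V} (θ : (⟨v⟩ : F.Vert) ⟶ ⟨w⟩) (ha : deg (vop θ) ≤ 1)
    (q : ℤ) (h : ∑ _i : Fin 1, q + ε.shift (deg (vop θ)) = q) (x : (C.obj ⟨v⟩).X q) :
    M.raw.act (vop θ) ha (fun _ => q) q h (fun _ => x) = ((C.map θ).f q).hom x := by
  refine (M.raw_act_zero (vop θ) ha (Equiv.refl _) (fun _ => θ) (pull_one θ).symm (fun _ => q) _
    h rfl (fun _ => x)).trans ?_
  exact HomEl.snd_eq (unary_mk (C := C) (X := fun _ => v) (Equiv.refl _) (fun _ => θ) (fun _ => q) q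
    rfl (fun _ => x))

theorem raw_act_unary {v : F.V} {X : Fin 1 → F.V} (θ : ∀ j, (⟨X j⟩ : F.Vert) ⟶ ⟨v⟩) (a : F.Op X v)
    (hθ : a = CubicalFeynmanCat.pull (Equiv.refl _) θ (F.one v)) (ha : deg a ≤ 1)
    (p : Fin 1 → ℤ) (m : ℤ) (h : ∑ i, p i + ε.shift (deg a) = m) (x : ∀ i, (C.obj ⟨X i⟩).X (p i)) :
    (⟨m, M.raw.act a ha p m h x⟩ : HomEl (C.obj ⟨v⟩)) = HomEl.map (C.map (θ 0)) ⟨p 0, x 0⟩ := by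
  have h' : p 0 = m := by
    rw [← h, Fin.sum_univ_one, hθ]
    exact ((congrArg (p 0 + ·) (shift_deg_pull_one ε (Equiv.refl _) θ)).trans (add_zero _)).symm
  refine (congrArg (Sigma.mk m) (M.raw_act_zero a ha (Equiv.refl _) θ hθ _ _ h h' x)).trans ?_
  exact unary_mk (C := C) (Equiv.refl _) θ p m h' x

/-- The composition axiom for an outer isomorphism `θ`. If the inner operation has degree one, it is
the compatibility of the structure maps with `push` and `pull`; if it has degree zero, it is the
functoriality of the module. -/
theorem raw_comp_zero {N n₀ : ℕ} (π : Fin n₀ ≃ Fin N) {X : Fin N → F.V} {y v : F.V}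
    (θ : (⟨y⟩ : F.Vert) ⟶ ⟨v⟩) (a : F.Op (fun i => X (π i)) y) (ha : deg a ≤ 1)
    (c : F.Op X v) (hc' : c = CubicalFeynmanCat.push θ
      (CubicalFeynmanCat.pull π (fun j => 𝟙 (⟨X (π j)⟩ : F.Vert)) a))
    (hc : deg c ≤ 1) (p : Fin N → ℤ) (r : ℤ) (hq : ∑ i, p (π i) + ε.shift (deg a) = r)
    (hp : ∑ t, p t + ε.shift (deg c) = r) (x : ∀ t, (C.obj ⟨X t⟩).X (p t)) :
    M.raw.act c hc p r hp x = sgn k (permKoszul π p) • ((C.map θ).f r).hom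
      (M.raw.act a ha (fun i => p (π i)) r hq (fun i => x (π i))) := by
  by_cases h1 : deg a = 1
  · have h2 : deg (CubicalFeynmanCat.pull π (fun j => 𝟙 (⟨X (π j)⟩ : F.Vert)) a) = 1 :=
      (deg_pull _ _ _).trans h1
    have h3 : deg c = 1 := by rw [hc']; exact (deg_push _ _).trans h2
    subst hc'
    refine (M.raw_act_one _ hc h3 p r hp x).trans ((M.push θ _ h2 h3 p r (h3 ▸ hp) x).trans ?_)
    refine (congrArg ((C.map θ).f r).hom (M.pull π (fun _ => 𝟙 _) a h1 h2 p r (h3 ▸ hp) (h1 ▸ hq) x)).trans ?_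
    refine (map_smul _ _ _).trans (congrArg (fun z => sgn k (permKoszul π p) • ((C.map θ).f r).hom z) ?_)
    refine Eq.trans ?_ (M.raw_act_one a ha h1 _ r hq _).symm
    refine congrArg (M.μ a h1 _ r _) (funext fun j => ?_)
    exact HomEl.snd_eq (congrArg (fun z => HomEl.map z (⟨p (π j), x (π j)⟩ : HomEl (C.obj ⟨X (π j)⟩)))
      (C.map_id _))
  · obtain ⟨ρ, u, rfl⟩ := exists_eq_pull_one a (by omega)
    obtain rfl : n₀ = 1 := by simpa using (Fintype.card_congr ρ).symm
    obtain rfl : ρ = Equiv.refl _ := Equiv.ext fun _ => Subsingleton.elim _ _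
    have hc'' : c = CubicalFeynmanCat.pull π (fun j => u j ≫ θ) (F.one v) := by
      have h2 : CubicalFeynmanCat.push θ (CubicalFeynmanCat.pull (Equiv.refl _) u (F.one y)) =
          CubicalFeynmanCat.pull (X := fun i => X (π i)) (Equiv.refl _) (fun j => u j ≫ θ) (F.one v) := by
        refine (push_pull _ _ _ _).trans ((congrArg (CubicalFeynmanCat.pull (X := fun i => X (π i))
          (Equiv.refl _) u) (push_one θ)).trans ?_)
        exact pull_pull (X := fun i => X (π i)) (Y := fun _ => y) (Equiv.refl (Fin 1)) u (Z := fun _ => v) (Equiv.refl (Fin 1)) (fun _ => θ) (F.one v)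
      refine hc'.trans ((push_pull _ _ _ _).trans
        ((congrArg (CubicalFeynmanCat.pull π _) h2).trans ?_))
      refine (pull_pull (Y := fun i => X (π i)) (Z := fun _ => v) π _ (Equiv.refl (Fin 1)) (fun j => u j ≫ θ) (F.one v)).trans ?_
      refine congrArg (fun z => CubicalFeynmanCat.pull π z (F.one v)) (funext fun j => ?_)
      exact Category.id_comp (u j ≫ θ)
    have hr : p (π 0) = r := by
      rw [← hq, Fin.sum_univ_one]
      exact ((congrArg (p (π 0) + ·) (shift_deg_pull_one (X := fun i => X (π i)) ε (Equiv.refl _) u)).trans (add_zero _)).symm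
    have hs : permKoszul π p = 0 :=
      Finset.sum_eq_zero fun s _ => Finset.sum_eq_zero fun t _ => if_neg fun h =>
        h.1.ne (Subsingleton.elim _ _)
    rw [hs, sgn_zero, one_smul]
    refine (M.raw_act_zero c hc π _ hc'' p r hp hr x).trans ?_
    refine HomEl.snd_eq ((unary_mk (C := C) π _ p r hr x).trans ?_)
    refine Eq.trans ?_ (congrArg (HomEl.map (C.map θ))
      (M.raw_act_unary u _ rfl ha (fun i => p (π i)) r hq (fun i => x (π i))).symm)
    exact congrArg (fun z => HomEl.map z (⟨p (π 0), x (π 0)⟩ : HomEl (C.obj ⟨X (π 0)⟩)))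
      (C.map_comp (u 0) θ)

theorem raw_isOp : M.raw.IsOp where
  act_one v h1 m h x := by
    refine HomEl.snd_eq ((M.raw_act_unary (X := fun _ => v) (fun _ => 𝟙 _) (F.one v)
      ((Ops.vop_id ⟨v⟩).symm.trans (pull_one (𝟙 _)).symm) h1 (fun _ => m) m h x).trans ?_)
    exact congrArg (fun z => HomEl.map z (⟨m, x 0⟩ : HomEl (C.obj ⟨v⟩))) (C.map_id _)
  act_comp := by
    intro m N n e X Y v b a hb ha hc p q r hq hr hp x
    -- As the total degree is at most one, either the outer operation has degree one and all inner
    -- ones are isomorphisms, or the outer one is an isomorphism with a single input.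
    by_cases hb1 : deg b = 1
    · have hs : ∀ j, deg (a j) = 0 := by
        have := F.degree.deg_compTo e b a
        have h2 : ∑ j, deg (a j) = 0 := by
          have h3 : deg (compTo e b a) ≤ 1 := hc
          have h4 : deg b = 1 := hb1
          have h5 : deg (compTo e b a) = deg b + ∑ j, deg (a j) := this
          omega
        exact fun j => (Finset.sum_eq_zero_iff.1 h2) j (Finset.mem_univ j)
      obtain rfl : n = fun _ => 1 := funext fun j => by
        obtain ⟨ρ, -⟩ := exists_eq_pull_one (a j) (hs j)
        simpa using (Fintype.card_congr ρ).symm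
      obtain ⟨π, rfl⟩ : ∃ π, e = (sigmaOne (Fin m)).trans π :=
        ⟨(sigmaOne (Fin m)).symm.trans e, by ext; simp⟩
      have hex : ∀ j, ∃ u : (⟨X (π j)⟩ : F.Vert) ⟶ ⟨Y j⟩, a j = vop u := fun j =>
        exists_vop (v := X (π j)) (a j) (hs j)
      choose u hu using hex
      obtain rfl : a = fun j => vop (u j) := funext hu
      obtain rfl : q = fun j => p (π j) := funext fun j => by
        rw [← hq j]
        rw [Fin.sum_univ_one]
        exact (congrArg (p (π j) + ·) (shift_deg_vop ε (u j))).trans (add_zero _)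
      have hc1 : deg (CubicalFeynmanCat.pull π u b) = 1 := (deg_pull π u b).trans hb1
      refine (M.raw_act_one _ hc hc1 p r hp x).trans ?_
      refine (M.pull π u b hb1 hc1 p r _ (hb1 ▸ hr) x).trans ?_
      refine congrArg₂ (· • ·) (congrArg (sgn k) (koszul_sigmaOne π p _ fun j =>
        shift_deg_vop ε (u j)).symm) ?_
      refine Eq.trans ?_ (M.raw_act_one b hb hb1 _ r hr _).symm
      refine congrArg (M.μ b hb1 _ r _) (funext fun j => ?_)
      exact (M.raw_act_vop (u j) _ (p (π j)) _ (x (π j))).symm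
    · obtain ⟨ρ, θ, rfl⟩ := exists_eq_pull_one b (by omega)
      obtain rfl : m = 1 := by simpa using (Fintype.card_congr ρ).symm
      obtain rfl : ρ = Equiv.refl _ := Equiv.ext fun _ => Subsingleton.elim _ _
      obtain ⟨y, rfl⟩ : ∃ y, Y = fun _ => y := ⟨Y 0, funext fun i => congrArg Y (Subsingleton.elim _ _)⟩
      obtain ⟨θ, rfl⟩ : ∃ θ' : (⟨y⟩ : F.Vert) ⟶ ⟨v⟩, θ = fun _ => θ' :=
        ⟨θ 0, funext fun i => congrArg θ (Subsingleton.elim _ _)⟩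
      obtain ⟨n₀, rfl⟩ : ∃ n₀, n = fun _ => n₀ := ⟨n 0, funext fun i => congrArg n (Subsingleton.elim _ _)⟩
      obtain ⟨π, rfl⟩ : ∃ π, e = (oneSigma (Fin n₀)).trans π :=
        ⟨(oneSigma (Fin n₀)).symm.trans e, by ext; simp⟩
      obtain ⟨a, rfl⟩ : ∃ a₀ : F.Op (fun i => X (π i)) y, a = fun _ => a₀ :=
        ⟨a 0, funext fun i => by rw [Subsingleton.elim i 0]⟩
      have hr' : q 0 = r := by
        rw [← hr, deg_pull_one, Parity.shift_zero, Fin.sum_univ_one, add_zero]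
      obtain ⟨q, rfl⟩ : ∃ q₀, q = fun _ => q₀ := ⟨q 0, funext fun i => congrArg q (Subsingleton.elim _ _)⟩
      obtain rfl : q = r := hr'
      have hpo : CubicalFeynmanCat.pull (X := fun _ => y) (Equiv.refl _) (fun _ => θ) (F.one v) = vop θ :=
        pull_one θ
      refine (M.raw_comp_zero π θ a (ha 0) _ ((congrArg (fun b => compTo (m := 1)
        (n := fun _ => n₀) ((oneSigma (Fin n₀)).trans π) (X := X) (Y := fun _ => y) b (fun _ => a))
          hpo).trans (compTo_oneSigma π θ a)) hc p q (hq 0) hp x).trans ?_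
      refine congrArg₂ (· • ·) (congrArg (sgn k)
        (koszul_one (n := fun _ => n₀) _ π (fun i => rfl) p _).symm) ?_
      refine HomEl.snd_eq ?_
      refine Eq.trans ?_ (M.raw_act_unary (X := fun _ => y) (fun _ => θ) _ rfl hb (fun _ => q) q hr _).symm
      rfl
  act_swap := by
    -- In both factorizations an operation of degree one is applied to the value of another one, so
    -- both sides are zero and the sign of the parity plays no role.
    have key : ∀ {N m : ℕ} {n : Fin m → ℕ} {X : Fin N → F.V} {Y : Fin m → F.V} {v : F.V}
        (e : (Σ j, Fin (n j)) ≃ Fin N) (b : F.Op Y v) (a : ∀ j, F.Op (fun i => X (e ⟨j, i⟩)) (Y j))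
        (hb : deg b = 1) (_ : ∑ j, deg (a j) = 1) (ha₁ : ∀ j, deg (a j) ≤ 1)
        (p : Fin N → ℤ) (q : Fin m → ℤ) (r : ℤ)
        (hq : ∀ j, ∑ i, p (e ⟨j, i⟩) + ε.shift (deg (a j)) = q j)
        (hr : ∑ j, q j + ε.shift (deg b) = r) (x : ∀ t, (M.raw.obj (X t)).X (p t)),
        M.raw.act₂ e b a hb.le ha₁ p q r hq hr x = 0 := by
      intro N m n X Y v e b a hb ha ha₁ p q r hq hr x
      obtain ⟨j, -, hj⟩ := Finset.exists_ne_zero_of_sum_ne_zero (ha ▸ one_ne_zero : ∑ j, deg (a j) ≠ 0)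
      have hj1 : deg (a j) = 1 := le_antisymm (ha₁ j) (Nat.one_le_iff_ne_zero.2 hj)
      refine (congrArg (sgn k _ • ·) ?_).trans (smul_zero _)
      refine (M.raw_act_one b hb.le hb _ r hr _).trans ?_
      refine M.comp b hb q r _ _ j (a j) hj1 (fun i => p (e ⟨j, i⟩)) (hj1 ▸ hq j)
        (fun i => x (e ⟨j, i⟩)) ?_
      exact M.raw_act_one (a j) (ha₁ j) hj1 _ _ (hq j) _
    intro N m m' n n' X Y Y' v e b a e' b' a' hb ha hb' ha' ha₁ ha₁' hc hs p q q' r hq hr hq' hr' x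
    rw [key e b a hb ha ha₁ p q r hq hr x, key e' b' a' hb' ha' ha₁' p q' r hq' hr' x, smul_zero]
  d_act := by
    intro n X v a ha p m m' hm h h' x
    by_cases h1 : deg a = 1
    · refine (congrArg ((C.obj ⟨v⟩).d m m').hom (M.raw_act_one a ha h1 p m h x)).trans ?_
      refine (M.d a h1 p m m' hm _ (fun i => h1 ▸ h' i) x).trans ?_
      refine congrArg₂ (· • ·) (by rw [h1]) (Finset.sum_congr rfl fun i _ => ?_)
      refine congrArg (sgn k _ • ·) ?_
      exact (M.raw_act_one a ha h1 _ m' (h' i) _).symm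
    · obtain ⟨ρ, θ, rfl⟩ := exists_eq_pull_one a (by omega)
      obtain rfl : n = 1 := by simpa using (Fintype.card_congr ρ).symm
      obtain rfl : ρ = Equiv.refl _ := Equiv.ext fun _ => Subsingleton.elim _ _
      rw [deg_pull_one, Parity.shift_zero, sgn_zero, one_smul, Fin.sum_univ_one,
        Finset.sum_eq_zero (fun (j : Fin 1) _ => if_neg (by rw [Subsingleton.elim j 0]; exact lt_irrefl _)),
        sgn_zero, one_smul]
      refine HomEl.snd_eq ((HomEl.d_mk hm _).trans ?_)
      refine (congrArg HomEl.d (M.raw_act_unary θ _ rfl ha p m h x)).trans ?_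
      refine Eq.trans ?_ (M.raw_act_unary θ _ rfl ha (bump p 0) m' (h' 0) _).symm
      refine (HomEl.map_d _ _).symm.trans (congrArg (HomEl.map (C.map (θ 0))) ?_)
      refine Eq.trans ?_ (dAt_mk (fun j => C.obj ⟨X j⟩) x 0 0).symm
      rw [Function.update_self]
      rfl

/-- The operad with the given structure maps in degree one. -/
noncomputable def op : Ops F k ε := ⟨M.raw, M.raw_isOp⟩

end SquareZero

end SquareZeroOp

/-! ### Weight one elements, isomorphisms and the differential -/

section WeightOneTerms

open CubicalFeynmanCat ColOperad

variable {k : Type u} [Field k] {F : CubicalFeynmanCat.{u}} {ε : Parity}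

namespace Ops

variable (P : Ops F k ε) {n n' : ℕ} {X : Fin n → F.V} {Y : Fin n' → F.V} {v w : F.V}

theorem act_push (θ : (⟨v⟩ : F.Vert) ⟶ ⟨w⟩) (a : F.Op X v) (ha : deg a ≤ 1)
    (ha' : deg (push θ a) ≤ 1) (p : Fin n → ℤ) (m : ℤ) (h : ∑ i, p i + ε.shift (deg a) = m)
    (h' : ∑ i, p i + ε.shift (deg (push θ a)) = m) (x : ∀ i, (P.obj (X i)).X (p i)) :
    P.act (push θ a) ha' p m h' x = P.vmap θ m (P.act a ha p m h x) := by
  refine (P.isOp.act_comp (m := 1) (n := fun _ => n) (oneSigma (Fin n)) (Y := fun _ => v) (vop θ)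
    (fun _ => a) (by rw [deg_vop]; exact Nat.zero_le 1) (fun _ => ha) ha' p (fun _ => m) m
    (fun _ => h) (by rw [shift_deg_vop]; simp) h' x).trans ?_
  refine (congrArg (fun c => sgn k c • P.vmap θ m (P.act a ha p m h x)) (koszul_oneSigma p _)).trans ?_
  rw [sgn_zero, one_smul]

/-- The inner operations have degree zero and one input each, so the sign of the composition axiom
is that of the permutation. -/
theorem act_pull (π : Fin n' ≃ Fin n) (u : ∀ j, (⟨X (π j)⟩ : F.Vert) ⟶ ⟨Y j⟩) (b : F.Op Y v)
    (hb : deg b ≤ 1) (hb' : deg (pull π u b) ≤ 1) (p : Fin n → ℤ) (m : ℤ)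
    (h : ∑ i, p i + ε.shift (deg (pull π u b)) = m) (h' : ∑ j, p (π j) + ε.shift (deg b) = m)
    (x : ∀ i, (P.obj (X i)).X (p i)) :
    P.act (pull π u b) hb' p m h x = sgn k (permKoszul π p) •
      P.act b hb (fun j => p (π j)) m h' (fun j => P.vmap (u j) (p (π j)) (x (π j))) := by
  refine (P.isOp.act_comp ((sigmaOne (Fin n')).trans π) b (fun j => vop (u j)) hb
    (fun j => (deg_vop (u j)).le.trans (Nat.zero_le 1)) hb' p (fun j => p (π j)) m
    (fun j => (congrArg₂ (· + ·) (Fin.sum_univ_one _) (shift_deg_vop ε (u j))).trans (add_zero _))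
    h' h x).trans ?_
  exact congrArg₂ (· • ·) (congrArg (sgn k) (koszul_sigmaOne π p _ fun j => shift_deg_vop ε (u j))) rfl

end Ops

variable {E : VMod F k}

/-- Operations of degree one with homogeneous elements at their inputs. -/
structure OpTest (E : VMod F k) (v : F.V) where
  n : ℕ
  X : Fin n → F.V
  op : F.Op X v
  deg_op : deg op = 1
  x : ∀ i, E.el (X i)

namespace OpTest

variable {v w : F.V}

/-- Composition with an isomorphism of vertices. -/
def push (θ : (⟨v⟩ : F.Vert) ⟶ ⟨w⟩) (t : OpTest E v) : OpTest E w where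
  n := t.n
  X := t.X
  op := CubicalFeynmanCat.push θ t.op
  deg_op := (deg_push θ t.op).trans t.deg_op
  x := t.x

theorem push_push {z : F.V} (θ : (⟨v⟩ : F.Vert) ⟶ ⟨w⟩) (θ' : (⟨w⟩ : F.Vert) ⟶ ⟨z⟩) (t : OpTest E v) :
    (t.push θ).push θ' = t.push (θ ≫ θ') := by
  unfold push
  congr 1
  exact CubicalFeynmanCat.push_push θ θ' t.op

theorem push_id (t : OpTest E v) : t.push (𝟙 _) = t := by
  obtain ⟨n, X, a, ha, x⟩ := t
  unfold push
  congr 1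
  exact CubicalFeynmanCat.push_id a

/-- Differentiation at an input. -/
noncomputable def dAt (t : OpTest E v) (i : Fin t.n) : OpTest E v where
  n := t.n
  X := t.X
  op := t.op
  deg_op := t.deg_op
  x := Function.update t.x i (t.x i).d

end OpTest

namespace WGen

variable {v w : F.V} {m : ℤ}

/-- The underlying operation with homogeneous elements at its inputs. -/
def test (t : WGen E ε v m) : OpTest E v := ⟨t.n, t.X, t.op, t.deg_op, fun i => ⟨t.p i, t.x i⟩⟩

/-- Composition with an isomorphism of vertices. -/
def push (θ : (⟨v⟩ : F.Vert) ⟶ ⟨w⟩) (t : WGen E ε v m) : WGen E ε w m where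
  n := t.n
  X := t.X
  op := CubicalFeynmanCat.push θ t.op
  deg_op := (deg_push θ t.op).trans t.deg_op
  p := t.p
  h := (congrArg (fun d => ∑ i, t.p i + ε.shift d) (deg_push θ t.op)).trans t.h
  x := t.x

theorem eval_push (θ : (⟨v⟩ : F.Vert) ⟶ ⟨w⟩) (t : WGen E ε v m) :
    (t.push θ).eval = (Ops.free E ε).vmap θ m t.eval :=
  (Ops.free E ε).act_push θ t.op _ _ t.p m t.h _ _

theorem sum_bump {n : ℕ} (p : Fin n → ℤ) (i : Fin n) : ∑ j, bump p i j = ∑ j, p j + 1 := by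
  unfold bump
  have : ∀ j, (if j = i then p j + 1 else p j) = p j + if j = i then 1 else 0 := fun j => by
    split_ifs <;> simp
  simp [this, Finset.sum_add_distrib]

/-- Differentiation at an input. -/
noncomputable def dAt (t : WGen E ε v m) (i : Fin t.n) : WGen E ε v (m + 1) where
  n := t.n
  X := t.X
  op := t.op
  deg_op := t.deg_op
  p := bump t.p i
  h := by rw [sum_bump, add_right_comm, t.h]
  x j := _root_.dAt (fun j => E.obj ⟨t.X j⟩) t.x i j

theorem test_dAt (t : WGen E ε v m) (i : Fin t.n) : (t.dAt i).test = t.test.dAt i :=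
  congrArg (fun x => (⟨t.n, t.X, t.op, t.deg_op, x⟩ : OpTest E v))
    (funext fun j => dAt_mk (fun j => E.obj ⟨t.X j⟩) t.x i j)

/-- The differential of a generator of weight one, as a linear combination of such. -/
noncomputable def d (t : WGen E ε v m) : WGen E ε v (m + 1) →₀ k :=
  ∑ i, Finsupp.single (t.dAt i) (sgn k (ε.shift 1) * sgn k (∑ j, if j < i then t.p j else 0))

theorem gen_dAt {n : ℕ} {X : Fin n → F.V} {p : Fin n → ℤ} (x : ∀ j, (E.obj ⟨X j⟩).X (p j))
    (i j : Fin n) : Ops.gen E ε (v := X j) (_root_.dAt (fun j => E.obj ⟨X j⟩) x i j) =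
      _root_.dAt (fun j => (Ops.free E ε).obj (X j)) (fun j => Ops.gen E ε (x j)) i j := by
  have h1 := dAt_mk (fun j => E.obj ⟨X j⟩) x i j
  have h2 := dAt_mk (fun j => (Ops.free E ε).obj (X j)) (fun j => Ops.gen E ε (x j)) i j
  refine HomEl.snd_eq (C := (Ops.free E ε).obj (X j)) (Eq.trans ?_ h2.symm)
  refine (congrArg (HomEl.map (Ops.unit.app ⟨X j⟩)) h1).trans ?_
  by_cases hj : j = i
  · subst hj
    rw [Function.update_self, Function.update_self]
    exact HomEl.map_d _ _
  · rw [Function.update_of_ne hj, Function.update_of_ne hj]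
    rfl

/-- The Leibniz rule keeps the differential of a weight one element in weight one, and provides an
explicit lift of it to formal linear combinations. -/
theorem evalLin_d (t : WGen E ε v m) :
    evalLin E ε v (m + 1) t.d = (((Ops.free E ε).obj v).d m (m + 1)).hom t.eval := by
  have h1 : ε.shift (deg t.op) = ε.shift 1 := congrArg ε.shift t.deg_op
  refine Eq.trans ?_ ((Ops.free E ε).isOp.d_act t.op t.deg_op.le t.p m (m + 1) rfl t.h
    (fun i => (t.dAt i).h) _).symm
  rw [h1, Finset.smul_sum]
  unfold d
  rw [map_sum]
  refine Finset.sum_congr rfl fun i _ => ?_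
  refine (Finsupp.linearCombination_single k _ _).trans ((mul_smul _ _ _).trans ?_)
  refine congrArg (fun z : ((Ops.free E ε).obj v).X (m + 1) => sgn k (ε.shift 1) •
    sgn k (∑ j, if j < i then t.p j else 0) • z) ?_
  exact congrArg ((Ops.free E ε).act t.op t.deg_op.le (bump t.p i) (m + 1) (t.dAt i).h)
    (funext fun j => gen_dAt t.x i j)

end WGen

end WeightOneTerms

/-! ### The pairing and the differential -/

section PairingDerivation

open CubicalFeynmanCat ColOperad

variable {k : Type u} [Field k] {F : CubicalFeynmanCat.{u}} {ε : Parity} {E : VMod F k}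
  {n n' l : ℕ} {X : Fin n → F.V} {Y : Fin n' → F.V} {Z : Fin l → F.V} {v w : F.V}

theorem sgn_neg (m : ℤ) : sgn k (-m) = sgn k m := sgn_eq_of_even_sub ⟨-m, by ring⟩

theorem sgn_add_one (m : ℤ) : sgn k (m + 1) = -sgn k m := by
  rw [sgn_add]; simp [sgn]

namespace HomEl

variable {C : CochainComplex (ModuleCat.{u} k) ℤ}

theorem d_d (x : HomEl C) : x.d.d = ⟨x.1 + 1 + 1, 0⟩ :=
  Sigma.ext rfl (heq_of_eq (congrArg (fun g : C.X x.1 ⟶ C.X (x.1 + 1 + 1) => g.hom x.2)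
    (C.d_comp_d x.1 (x.1 + 1) (x.1 + 1 + 1))))

theorem pair_d_d (η : HomEl (dualComplex C)) (x : HomEl C) : pair η.d.d x = 0 := by
  rw [d_d, pair_zero_left]

variable (C) in
/-- The evaluation of functionals of a fixed degree on a homogeneous element. -/
noncomputable def pairLin (p : ℤ) (x : HomEl C) : (dualComplex C).X p →ₗ[k] k where
  toFun η := pair ⟨p, η⟩ x
  map_add' η η' := pair_add p η η' x
  map_smul' c η := pair_smul p c η x

end HomEl

theorem update_fst {C : Fin n → CochainComplex (ModuleCat.{u} k) ℤ} (x : ∀ j, HomEl (C j)) (i : Fin n) :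
    (fun j => (Function.update x i (x i).d j).1) = bump (fun j => (x j).1) i := by
  funext j
  by_cases h : j = i
  · subst h; simp [bump, HomEl.d]
  · simp [bump, h]

/-- The differential moves across the pairing of the two matched entries without a sign, and
`permKoszul_bump` compares the signs of moving it past the preceding entries. If the degrees do not
fit, both sides vanish. -/
theorem matchTerm_d (η : ∀ j, (dualModule E).el (Y j)) (x : ∀ i, E.el (X i)) (π : Fin n' ≃ Fin n)
    (u : ∀ j, (⟨X (π j)⟩ : F.Vert) ⟶ ⟨Y j⟩) (i : Fin n') :
    sgn k (∑ j, if j < i then (η j).1 else 0) * matchTerm (Function.update η i (η i).d) x π u =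
      sgn k (∑ j, if j < π i then (x j).1 else 0) *
        matchTerm η (Function.update x (π i) (x (π i)).d) π u := by
  by_cases h0 : ∀ j, (x (π j)).1 = -(Function.update η i (η i).d j).1
  · have h1 : sgn k (∑ j, if j < i then (η j).1 else 0) =
        sgn k (∑ j, if j < i then (x (π j)).1 else 0) := by
      rw [← sgn_neg, ← Finset.sum_neg_distrib]
      refine congrArg (sgn k) (Finset.sum_congr rfl fun j _ => ?_)
      split_ifs with hj
      · rw [h0 j, Function.update_of_ne hj.ne]
      · exact neg_zero
    have h2 : ∀ j, HomEl.pair (C := E.obj ⟨Y j⟩) (Function.update η i (η i).d j)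
        (HomEl.map (E.map (u j)) (x (π j))) = HomEl.pair (C := E.obj ⟨Y j⟩) (η j)
        (HomEl.map (E.map (u j)) (Function.update x (π i) (x (π i)).d (π j))) := by
      intro j
      by_cases hj : j = i
      · subst hj
        rw [Function.update_self, Function.update_self, HomEl.map_d]
        exact HomEl.pair_d _ _
      · rw [Function.update_of_ne hj, Function.update_of_ne (fun h => hj (π.injective h))]
    unfold matchTerm
    rw [Finset.prod_congr rfl fun j _ => h2 j, h1, ← mul_assoc, ← mul_assoc,
      update_fst (C := fun j => E.obj ⟨X j⟩) x (π i)]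
    exact congrArg (· * _) ((permKoszul_bump π (fun j => (x j).1) i).symm.trans (mul_comm _ _))
  · have h1 : ¬ ∀ j, (Function.update x (π i) (x (π i)).d (π j)).1 = -(η j).1 := by
      intro h
      refine h0 fun j => ?_
      have := h j
      by_cases hj : j = i
      · subst hj
        rw [Function.update_self] at this ⊢
        change (x (π j)).1 + 1 = -(η j).1 at this
        change (x (π j)).1 = -((η j).1 + 1)
        omega
      · rw [Function.update_of_ne (fun h => hj (π.injective h))] at this
        rwa [Function.update_of_ne hj]
    push Not at h0 h1
    obtain ⟨j, hj⟩ := h0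
    obtain ⟨j', hj'⟩ := h1
    rw [matchTerm_eq_zero j hj, matchTerm_eq_zero j' hj', mul_zero, mul_zero]

/-- The differential is self-adjoint up to sign for the pairing of operations of degree one. -/
theorem sum_opPair_d (b : F.Op Y v) (η : ∀ j, (dualModule E).el (Y j)) (a : F.Op X v)
    (x : ∀ i, E.el (X i)) :
    ∑ i, sgn k (∑ j, if j < i then (η j).1 else 0) * opPair b (Function.update η i (η i).d) a x =
      ∑ i, sgn k (∑ j, if j < i then (x j).1 else 0) * opPair b η a (Function.update x i (x i).d) := by
  unfold opPair
  simp only [Finset.mul_sum]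
  rw [Finset.sum_comm, Finset.sum_comm (s := (Finset.univ : Finset (Fin n)))]
  refine Finset.sum_congr rfl fun s _ => ?_
  rw [← Equiv.sum_comp s.π]
  exact Finset.sum_congr rfl fun i _ => matchTerm_d η x s.π s.u i

theorem matchTerm_eq_zero_of_pair {η : ∀ j, (dualModule E).el (Y j)} {x : ∀ i, E.el (X i)}
    {π : Fin n' ≃ Fin n} {u : ∀ j, (⟨X (π j)⟩ : F.Vert) ⟶ ⟨Y j⟩} (j : Fin n')
    (h : ∀ y, HomEl.pair (C := E.obj ⟨Y j⟩) (η j) y = 0) : matchTerm η x π u = 0 := by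
  unfold matchTerm
  rw [Finset.prod_eq_zero (Finset.mem_univ j) (h _), mul_zero]

/-- A second differentiation at the same input gives zero. At two distinct inputs the two orders
cancel: the first differentiation raises by one the degree that the second has to pass in exactly
one of the orders. -/
theorem sum_sum_opPair_d (b : F.Op Y v) (η : ∀ j, (dualModule E).el (Y j)) (a : F.Op X v)
    (x : ∀ i, E.el (X i)) :
    ∑ i, sgn k (∑ j, if j < i then (η j).1 else 0) *
      ∑ i', sgn k (∑ j, if j < i' then (Function.update η i (η i).d j).1 else 0) *
        opPair b (Function.update (Function.update η i (η i).d) i'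
          (Function.update η i (η i).d i').d) a x = 0 := by
  simp only [Finset.mul_sum]
  rw [← Finset.sum_product']
  have hs : ∀ i i' : Fin n', (∑ j, if j < i' then (Function.update η i (η i).d j).1 else 0) =
      (∑ j, if j < i' then (η j).1 else 0) + if i < i' then 1 else 0 := by
    intro i i'
    have : (if i < i' then (1 : ℤ) else 0) = ∑ j, if j = i then (if j < i' then 1 else 0) else 0 := by
      simp
    rw [this, ← Finset.sum_add_distrib]
    refine Finset.sum_congr rfl fun j _ => ?_
    by_cases h : j = i
    · subst h
      rw [Function.update_self, if_pos rfl]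
      change (if j < i' then (η j).1 + 1 else 0) = _
      split_ifs <;> simp
    · rw [Function.update_of_ne h, if_neg h, add_zero]
  have hz : ∀ i, opPair b (Function.update (Function.update η i (η i).d) i
          (Function.update η i (η i).d i).d) a x = 0 := fun i =>
    Finset.sum_eq_zero fun s _ => matchTerm_eq_zero_of_pair i fun y => by
      rw [Function.update_self, Function.update_self]
      exact HomEl.pair_d_d _ _
  refine Finset.sum_involution (fun q _ => q.swap) ?_ ?_ (fun _ _ => by simp) fun _ _ => Prod.swap_swap _
  · rintro ⟨i, i'⟩ -
    by_cases h : i = i'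
    · subst h
      simp only [Prod.swap_prod_mk]
      rw [hz]; simp
    · have h2 : Function.update (Function.update η i (η i).d) i' (Function.update η i (η i).d i').d =
          Function.update (Function.update η i' (η i').d) i (Function.update η i' (η i').d i).d := by
        rw [Function.update_of_ne (Ne.symm h), Function.update_of_ne h, Function.update_comm h]
      simp only [Prod.swap_prod_mk]
      rw [h2, ← mul_assoc, ← mul_assoc, ← add_mul, hs, hs]
      rcases lt_or_gt_of_ne h with h3 | h3
      · rw [if_pos h3, if_neg h3.asymm, add_zero, sgn_add_one]; ring
      · rw [if_pos h3, if_neg h3.asymm, add_zero, sgn_add_one]; ring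
  · rintro ⟨i, i'⟩ - h0 h1
    obtain rfl : i' = i := congrArg Prod.fst h1
    exact h0 (by simp only []; rw [hz]; simp)

/-- The differentiated form of `opPair_pull`: by `permKoszul_bump` the sign of the permutation is a
common factor of all summands. -/
theorem sum_opPair_d_pull (ρ : Fin l ≃ Fin n') (t : ∀ j, (⟨Y (ρ j)⟩ : F.Vert) ⟶ ⟨Z j⟩) (c : F.Op Z v)
    (η : ∀ j, (dualModule E).el (Y j)) (ζ : ∀ j, (dualModule E).el (Z j))
    (hζ : ∀ j, ζ j = HomEl.map ((dualModule E).map (t j)) (η (ρ j))) (a : F.Op X v)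
    (x : ∀ i, E.el (X i)) :
    ∑ i, sgn k (∑ j, if j < i then (η j).1 else 0) *
        opPair (pull ρ t c) (Function.update η i (η i).d) a x =
      sgn k (permKoszul ρ fun j => (η j).1) * ∑ i, sgn k (∑ j, if j < i then (ζ j).1 else 0) *
        opPair c (Function.update ζ i (ζ i).d) a x := by
  rw [← Equiv.sum_comp ρ, Finset.mul_sum]
  refine Finset.sum_congr rfl fun i _ => ?_
  rw [opPair_pull, update_fst (C := fun j => (dualModule E).obj ⟨Y j⟩) η (ρ i)]
  have h1 : (fun j => HomEl.map ((dualModule E).map (t j))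
      (Function.update η (ρ i) (η (ρ i)).d (ρ j))) = Function.update ζ i (ζ i).d := by
    funext j
    by_cases h : j = i
    · subst h
      rw [Function.update_self, Function.update_self, hζ, HomEl.map_d]
    · rw [Function.update_of_ne h, Function.update_of_ne (fun h' => h (ρ.injective h')), hζ]
  have h2 : (∑ j, if j < i then (ζ j).1 else 0) = ∑ j, if j < i then (η (ρ j)).1 else 0 :=
    Finset.sum_congr rfl fun j _ => by rw [hζ]; rfl
  rw [h1, h2, ← mul_assoc, ← mul_assoc]
  exact congrArg (· * _) ((mul_comm _ _).trans ((permKoszul_bump ρ (fun j => (η j).1) i).trans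
    (mul_comm _ _)))

/-- The pairing as a multilinear function of its first argument. -/
noncomputable def opPairMulti (b : F.Op Y v) (p : Fin n' → ℤ) (t : OpTest E v) :
    MultilinearMap k (fun j => ((dualModule E).obj ⟨Y j⟩).X (p j)) k :=
  ∑ s : IsoMatch b t.op, sgn k (permKoszul s.π fun i => (t.x i).1) •
    (MultilinearMap.mkPiAlgebra k (Fin n') k).compLinearMap fun j =>
      HomEl.pairLin (E.obj ⟨Y j⟩) (p j) (HomEl.map (E.map (s.u j)) (t.x (s.π j)))

theorem opPairMulti_apply (b : F.Op Y v) (p : Fin n' → ℤ) (t : OpTest E v)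
    (η : ∀ j, ((dualModule E).obj ⟨Y j⟩).X (p j)) :
    opPairMulti b p t η = opPair b (fun j => ⟨p j, η j⟩) t.op t.x := by
  exact sum_apply (F := MultilinearMap k (fun j => ((dualModule E).obj ⟨Y j⟩).X (p j)) k)
    Finset.univ _ η

/-- The differential at an input as a linear map. -/
noncomputable def dAtLin (C : Fin n → CochainComplex (ModuleCat.{u} k) ℤ) (p : Fin n → ℤ)
    (i j : Fin n) : (C j).X (p j) →ₗ[k] (C j).X (bump p i j) :=
  if h : j = i then ((C j).d (p j) (bump p i j)).hom
  else ((C j).XIsoOfEq (show p j = bump p i j by simp [bump, h])).hom.hom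

theorem dAtLin_apply (C : Fin n → CochainComplex (ModuleCat.{u} k) ℤ) (p : Fin n → ℤ)
    (x : ∀ j, (C j).X (p j)) (i j : Fin n) : dAtLin C p i j (x j) = dAt C x i j := by
  unfold dAtLin dAt
  split_ifs <;> rfl

/-- The pairing with the differential of the first argument. -/
noncomputable def opPairDMulti (ε : Parity) (b : F.Op Y v) (p : Fin n' → ℤ) (t : OpTest E v) :
    MultilinearMap k (fun j => ((dualModule E).obj ⟨Y j⟩).X (p j)) k :=
  sgn k (ε.shift 1) • ∑ i, sgn k (∑ j, if j < i then p j else 0) •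
    (opPairMulti b (bump p i) t).compLinearMap (dAtLin (fun j => (dualModule E).obj ⟨Y j⟩) p i)

theorem opPairDMulti_apply (b : F.Op Y v) (p : Fin n' → ℤ) (t : OpTest E v)
    (η : ∀ j, ((dualModule E).obj ⟨Y j⟩).X (p j)) :
    opPairDMulti ε b p t η = sgn k (ε.shift 1) * ∑ i, sgn k (∑ j, if j < i then p j else 0) *
      opPair b (Function.update (fun j => (⟨p j, η j⟩ : (dualModule E).el (Y j))) i
        (HomEl.d ⟨p i, η i⟩)) t.op t.x := by
  refine congrArg (sgn k (ε.shift 1) * ·) ((sum_apply (F := MultilinearMap k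
    (fun j => ((dualModule E).obj ⟨Y j⟩).X (p j)) k) Finset.univ _ η).trans ?_)
  refine (Finset.sum_congr rfl fun i _ => ?_)
  refine congrArg (sgn k (∑ j, if j < i then p j else 0) * ·) ((opPairMulti_apply _ _ _ _).trans ?_)
  refine congrArg (fun z => opPair b z t.op t.x) (funext fun j => ?_)
  rw [dAtLin_apply]
  exact dAt_mk _ η i j

end PairingDerivation

/-! ### The truncated operad, in which pairing functions can be read off -/

section TruncatedOp

open CubicalFeynmanCat ColOperad

variable {k : Type u} [Field k] {F : CubicalFeynmanCat.{u}}

/-- The sum of a complex and of a contractible complex with the same space in each degree. -/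
noncomputable def truncComplex (A : CochainComplex (ModuleCat.{u} k) ℤ) (W : Type u)
    [AddCommGroup W] [Module k W] : CochainComplex (ModuleCat.{u} k) ℤ where
  X m := ModuleCat.of k (A.X m × W × W)
  d m m' := ModuleCat.ofHom (((A.d m m').hom ∘ₗ LinearMap.fst k _ _).prod
    ((if m + 1 = m' then LinearMap.snd k W W ∘ₗ LinearMap.snd k (A.X m) (W × W) else 0).prod 0))
  shape m m' h := by
    have h' : ¬ m + 1 = m' := h
    rw [if_neg h', A.shape m m' h]
    rfl
  d_comp_d' i j l hi hj := by
    have hi' : i + 1 = j := hi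
    have hj' : j + 1 = l := hj
    rw [if_pos hi', if_pos hj']
    refine ModuleCat.hom_ext (LinearMap.ext fun x => ?_)
    exact Prod.ext (congrArg (fun g : A.X i ⟶ A.X l => g.hom x.1) (A.d_comp_d i j l)) rfl

/-- In a pair of functions the second one is stored as the differential of the first, so no
differential has to be constructed on functions of tests. -/
theorem truncComplex_d {A : CochainComplex (ModuleCat.{u} k) ℤ} {W : Type u}
    [AddCommGroup W] [Module k W] {m m' : ℤ} (h : m + 1 = m') (x : A.X m) (f g : W) :
    ((truncComplex A W).d m m').hom (x, f, g) = ((A.d m m').hom x, g, 0) := by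
  have : ((truncComplex A W).d m m').hom (x, f, g) = ((A.d m m').hom x,
    (if m + 1 = m' then LinearMap.snd k W W ∘ₗ LinearMap.snd k (A.X m) (W × W) else 0) (x, f, g), 0) := rfl
  rw [this, if_pos h]
  rfl

/-- Functoriality of `truncComplex`. -/
noncomputable def truncComplexMap {A B : CochainComplex (ModuleCat.{u} k) ℤ} {W W' : Type u}
    [AddCommGroup W] [Module k W] [AddCommGroup W'] [Module k W'] (f : A ⟶ B) (g : W →ₗ[k] W') :
    truncComplex A W ⟶ truncComplex B W' where
  f m := ModuleCat.ofHom (X := (truncComplex A W).X m) (Y := (truncComplex B W').X m)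
    ((f.f m).hom.prodMap (g.prodMap g))
  comm' m m' h := by
    have h' : m + 1 = m' := h
    refine ModuleCat.hom_ext (LinearMap.ext fun ⟨x, y, z⟩ => ?_)
    refine (truncComplex_d h' _ _ _).trans (Eq.trans ?_
      (congrArg ((f.f m').hom.prodMap (g.prodMap g)) (truncComplex_d h' x y z)).symm)
    refine Prod.ext (congrArg (fun g : A.X m ⟶ B.X m' => g.hom x) (f.comm m m')) (Prod.ext rfl ?_)
    exact (map_zero g).symm

variable (E : VMod F k) (ε : Parity)

/-- Functionals on `E` together with pairs of functions on the operations of degree one with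
homogeneous elements of `E` at their inputs. -/
noncomputable def truncModule : VMod F k where
  obj v := truncComplex ((dualModule E).obj v) (OpTest E v.of → k)
  map {v w} θ := truncComplexMap ((dualModule E).map θ)
    (LinearMap.funLeft k k (OpTest.push (Groupoid.inv θ : (⟨w.of⟩ : F.Vert) ⟶ ⟨v.of⟩)))
  map_id v := by
    refine HomologicalComplex.hom_ext _ _ fun m => ModuleCat.hom_ext (LinearMap.ext fun ⟨x, y, z⟩ => ?_)
    have h : Groupoid.inv (𝟙 v) = 𝟙 v := by simp
    have h1 : ∀ y : OpTest E v.of → k, LinearMap.funLeft k k (OpTest.push (Groupoid.inv (𝟙 v))) y = y := by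
      intro y
      rw [h]
      exact funext fun t => congrArg y t.push_id
    refine Prod.ext ?_ (Prod.ext (h1 y) (h1 z))
    exact congrArg (fun g : (dualModule E).obj v ⟶ (dualModule E).obj v => (g.f m).hom x)
      ((dualModule E).map_id v)
  map_comp {v w z} θ θ' := by
    refine HomologicalComplex.hom_ext _ _ fun m => ModuleCat.hom_ext (LinearMap.ext fun ⟨x, f, g⟩ => ?_)
    have h : Groupoid.inv (θ ≫ θ') = Groupoid.inv θ' ≫ Groupoid.inv θ := by simp
    have h1 : ∀ y : OpTest E v.of → k, LinearMap.funLeft k k (OpTest.push (Groupoid.inv (θ ≫ θ'))) y =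
        LinearMap.funLeft k k (OpTest.push (Groupoid.inv θ'))
          (LinearMap.funLeft k k (OpTest.push (Groupoid.inv θ)) y) := by
      intro y
      rw [h]
      exact funext fun t => congrArg y (t.push_push _ _).symm
    refine Prod.ext ?_ (Prod.ext (h1 f) (h1 g))
    exact congrArg (fun g : (dualModule E).obj v ⟶ (dualModule E).obj z => (g.f m).hom x)
      ((dualModule E).map_comp θ θ')

/-- The projection of `truncModule` to the functionals. -/
noncomputable def truncFst (v : F.Vert) (m : ℤ) :
    ((truncModule E).obj v).X m →ₗ[k] ((dualModule E).obj v).X m := LinearMap.fst k _ _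

variable {E} in
/-- The pair of functions given by an operation of degree one and functionals at its inputs. -/
noncomputable def pairFun {n : ℕ} {X : Fin n → F.V} {v : F.V} (a : F.Op X v)
    (η : ∀ j, (dualModule E).el (X j)) : (OpTest E v → k) × (OpTest E v → k) :=
  (fun t => opPair a η t.op t.x, fun t => sgn k (ε.shift 1) *
    ∑ i, sgn k (∑ j, if j < i then (η j).1 else 0) * opPair a (Function.update η i (η i).d) t.op t.x)

/-- `pairFun` as a multilinear map. -/
noncomputable def pairFunMulti {n : ℕ} {X : Fin n → F.V} {v : F.V} (a : F.Op X v) (p : Fin n → ℤ) :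
    MultilinearMap k (fun i => ((dualModule E).obj ⟨X i⟩).X (p i))
      ((OpTest E v → k) × (OpTest E v → k)) :=
  (MultilinearMap.pi fun t => opPairMulti a p t).prod (MultilinearMap.pi fun t => opPairDMulti ε a p t)

theorem pairFunMulti_apply {n : ℕ} {X : Fin n → F.V} {v : F.V} (a : F.Op X v) (p : Fin n → ℤ)
    (η : ∀ i, ((dualModule E).obj ⟨X i⟩).X (p i)) :
    pairFunMulti E ε a p η = pairFun ε a (fun i => ⟨p i, η i⟩) :=
  Prod.ext (funext fun t => opPairMulti_apply a p t η) (funext fun t => opPairDMulti_apply a p t η)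

/-- The inclusion of the pairs of functions. -/
noncomputable def truncSnd (v : F.Vert) (m : ℤ) :
    (OpTest E v.of → k) × (OpTest E v.of → k) →ₗ[k] ((truncModule E).obj v).X m := LinearMap.inr k _ _

theorem pairFun_push {n : ℕ} {X : Fin n → F.V} {v w : F.V} (θ : (⟨v⟩ : F.Vert) ⟶ ⟨w⟩) (a : F.Op X v)
    (η : ∀ j, (dualModule E).el (X j)) (m : ℤ) :
    truncSnd E ⟨w⟩ m (pairFun ε (push θ a) η) =
      (((truncModule E).map θ).f m).hom (truncSnd E ⟨v⟩ m (pairFun ε a η)) := by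
  have h : ∀ (η : ∀ j, (dualModule E).el (X j)) (t : OpTest E w),
      opPair (push θ a) η t.op t.x = opPair a η (t.push (Groupoid.inv θ)).op (t.push (Groupoid.inv θ)).x := by
    intro η t
    refine Eq.trans ?_ (opPair_push θ a (push (Groupoid.inv θ) t.op))
    rw [push_push_inv]
    rfl
  refine Prod.ext (map_zero (((dualModule E).map θ).f m).hom).symm (Prod.ext (funext fun t => h η t) (funext fun t => ?_))
  exact congrArg (sgn k (ε.shift 1) * ·) (Finset.sum_congr rfl fun i _ => congrArg (_ * ·) (h _ t))

theorem pairFun_pull {n n' : ℕ} {X : Fin n → F.V} {Y : Fin n' → F.V} {v : F.V} (π : Fin n' ≃ Fin n)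
    (u : ∀ j, (⟨X (π j)⟩ : F.Vert) ⟶ ⟨Y j⟩) (b : F.Op Y v) (η : ∀ j, (dualModule E).el (X j)) :
    pairFun ε (pull π u b) η = sgn k (permKoszul π fun i => (η i).1) •
      pairFun ε b (fun j => HomEl.map ((dualModule E).map (u j)) (η (π j))) := by
  refine Prod.ext (funext fun t => opPair_pull π u b t.op) (funext fun t => ?_)
  refine (congrArg (sgn k (ε.shift 1) * ·) (sum_opPair_d_pull π u b η _ (fun _ => rfl) t.op t.x)).trans ?_
  exact mul_left_comm _ _ _

/-- The square zero structure on `truncModule`. -/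
noncomputable def truncSquareZero : SquareZero (truncModule E) ε where
  μ {n X v} a _ p m _ := (truncSnd E ⟨v⟩ m).compMultilinearMap
    ((pairFunMulti E ε a p).compLinearMap fun i => truncFst E ⟨X i⟩ (p i))
  push {n X v w} θ a ha ha' p m h x := by
    refine (congrArg (truncSnd E ⟨w⟩ m) (pairFunMulti_apply E ε _ p _)).trans ?_
    refine (pairFun_push E ε θ a _ m).trans ?_
    exact congrArg (fun z => (((truncModule E).map θ).f m).hom (truncSnd E ⟨v⟩ m z))
      (pairFunMulti_apply E ε _ p _).symm
  pull {n n' X Y v} π u b hb hb' p m h h' x := by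
    refine (congrArg (truncSnd E ⟨v⟩ m) (pairFunMulti_apply E ε _ p _)).trans ?_
    refine (congrArg (truncSnd E ⟨v⟩ m) (pairFun_pull E ε π u b _)).trans ?_
    refine (map_smul _ _ _).trans (congrArg (sgn k (permKoszul π p) • ·) ?_)
    exact congrArg (truncSnd E ⟨v⟩ m) (pairFunMulti_apply E ε _ _ _).symm
  d {n X v} a ha p m m' hm h h' x := by
    -- The pairs of functions do not contribute to the functional part of a differential, so the
    -- projection to functionals commutes with differentiating one entry.
    have h1 : ∀ i, (fun j => (⟨bump p i j, truncFst E ⟨X j⟩ _ (dAt (fun j => (truncModule E).obj ⟨X j⟩) x i j)⟩ :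
        (dualModule E).el (X j))) = Function.update (fun j => (⟨p j, truncFst E ⟨X j⟩ _ (x j)⟩ :
          (dualModule E).el (X j))) i (HomEl.d ⟨p i, truncFst E ⟨X i⟩ _ (x i)⟩) := by
      intro i
      funext j
      have h2 := congrArg (fun z : HomEl ((truncModule E).obj ⟨X j⟩) =>
        (⟨z.1, truncFst E ⟨X j⟩ _ z.2⟩ : (dualModule E).el (X j)))
        (dAt_mk (fun j => (truncModule E).obj ⟨X j⟩) x i j)
      refine h2.trans ?_
      by_cases hj : j = i
      · subst hj
        rw [Function.update_self, Function.update_self]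
        rfl
      · rw [Function.update_of_ne hj, Function.update_of_ne hj]
    have h2 : ∀ i, (truncSnd E ⟨v⟩ m').compMultilinearMap
        ((pairFunMulti E ε a (bump p i)).compLinearMap fun j => truncFst E ⟨X j⟩ (bump p i j))
          (fun j => dAt (fun j => (truncModule E).obj ⟨X j⟩) x i j) =
        truncSnd E ⟨v⟩ m' (pairFun ε a (Function.update (fun j => (⟨p j, truncFst E ⟨X j⟩ _ (x j)⟩ :
          (dualModule E).el (X j))) i (HomEl.d ⟨p i, truncFst E ⟨X i⟩ _ (x i)⟩))) := fun i =>
      congrArg (truncSnd E ⟨v⟩ m') ((pairFunMulti_apply E ε _ _ _).trans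
        (congrArg (pairFun ε a) (h1 i)))
    refine (congrArg (((truncModule E).obj ⟨v⟩).d m m').hom
      (congrArg (truncSnd E ⟨v⟩ m) (pairFunMulti_apply E ε a p _))).trans ?_
    refine (truncComplex_d hm _ _ _).trans ?_
    rw [Finset.sum_congr rfl fun i _ => congrArg (_ • ·) (h2 i)]
    simp only [← map_smul, ← map_sum]
    set η : ∀ j, (dualModule E).el (X j) := fun j => ⟨p j, truncFst E ⟨X j⟩ _ (x j)⟩ with hη
    -- The differential of the first function is the second by construction; that the second has
    -- differential zero is `sum_sum_opPair_d`.
    refine Prod.ext (map_zero _) (Prod.ext ?_ ?_)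
    · funext t
      refine Eq.trans ?_ (congrFun (congrArg Prod.fst (show (sgn k (ε.shift 1) • ∑ i,
        sgn k (∑ j, if j < i then p j else 0) • pairFun ε a (Function.update η i (η i).d)) = _ from rfl)) t)
      rw [Prod.smul_fst, Prod.fst_sum, Pi.smul_apply, Finset.sum_apply]
      rfl
    · funext t
      refine Eq.trans ?_ (congrFun (congrArg Prod.snd (show (sgn k (ε.shift 1) • ∑ i,
        sgn k (∑ j, if j < i then p j else 0) • pairFun ε a (Function.update η i (η i).d)) = _ from rfl)) t)
      rw [Prod.smul_snd, Prod.snd_sum, Pi.smul_apply, Finset.sum_apply]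
      have h3 := sum_sum_opPair_d a η t.op t.x
      have h4 : ∑ i, (sgn k (∑ j, if j < i then p j else 0) •
          pairFun ε a (Function.update η i (η i).d)).2 t = sgn k (ε.shift 1) * 0 := by
        rw [← h3, Finset.mul_sum]
        exact Finset.sum_congr rfl fun i _ => mul_left_comm _ _ _
      rw [h4, mul_zero, smul_zero]
      rfl
  comp {n n' X Y v} b hb q r hr y j a ha p h x hy := by
    -- A structure map only depends on the functional parts of its arguments, and its values have
    -- functional part zero.
    refine (congrArg (truncSnd E ⟨v⟩ r) ((pairFunMulti E ε b q).map_coord_zero j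
      (m := fun i => truncFst E ⟨Y i⟩ (q i) (y i)) ?_)).trans (map_zero _)
    rw [hy]
    rfl

end TruncatedOp

/-! ### Orthogonality of weight one elements of the ideal of functionals -/

section Annihilator

open CubicalFeynmanCat ColOperad

variable {k : Type u} [Field k] {F : CubicalFeynmanCat.{u}} {E : VMod F k} {ε δ : Parity}

namespace WGen

variable {v w : F.V} {m m' : ℤ}

theorem evalLin_single (t : WGen E ε v m) (c : k) :
    evalLin E ε v m (Finsupp.single t c) = c • t.eval := Finsupp.linearCombination_single k c t

/-- The differential of linear combinations of generators of weight one. -/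
noncomputable def dLin (E : VMod F k) (ε : Parity) (v : F.V) (m : ℤ) :
    (WGen E ε v m →₀ k) →ₗ[k] (WGen E ε v (m + 1) →₀ k) := Finsupp.linearCombination k d

theorem evalLin_dLin (ζ : WGen E ε v m →₀ k) : evalLin E ε v (m + 1) (dLin E ε v m ζ) =
    (((Ops.free E ε).obj v).d m (m + 1)).hom (evalLin E ε v m ζ) := by
  have : evalLin E ε v (m + 1) ∘ₗ dLin E ε v m =
      (((Ops.free E ε).obj v).d m (m + 1)).hom ∘ₗ evalLin E ε v m := by
    refine Finsupp.lhom_ext fun t c => ?_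
    refine (congrArg (evalLin E ε v (m + 1)) (Finsupp.linearCombination_single k c t)).trans ?_
    refine (map_smul _ _ _).trans ?_
    refine Eq.trans ?_ (congrArg _ (evalLin_single t c)).symm
    exact (congrArg (c • ·) (evalLin_d t)).trans (map_smul _ _ _).symm
  exact LinearMap.congr_fun this ζ

theorem evalLin_mapDomain_push (θ : (⟨v⟩ : F.Vert) ⟶ ⟨w⟩) (ζ : WGen E ε v m →₀ k) :
    evalLin E ε w m (ζ.mapDomain (push θ)) = (Ops.free E ε).vmap θ m (evalLin E ε v m ζ) := by
  have : evalLin E ε w m ∘ₗ Finsupp.lmapDomain k k (push θ) =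
      (Ops.free E ε).vmap θ m ∘ₗ evalLin E ε v m := by
    refine Finsupp.lhom_ext fun t c => ?_
    refine (congrArg (evalLin E ε w m) (Finsupp.mapDomain_single)).trans ?_
    refine (evalLin_single _ c).trans ?_
    refine Eq.trans ?_ (congrArg ((Ops.free E ε).vmap θ m) (evalLin_single t c)).symm
    exact (congrArg (c • ·) (eval_push θ t)).trans (map_smul _ _ _).symm
  exact LinearMap.congr_fun this ζ

end WGen

/-- The extension of a function on tests to linear combinations of generators of weight one. -/
noncomputable def testLin (ε : Parity) {v : F.V} (m : ℤ) :
    (OpTest E v → k) →ₗ[k] (WGen E ε v m →₀ k) →ₗ[k] k where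
  toFun f := Finsupp.linearCombination k fun t => f t.test
  map_add' f g := Finsupp.lhom_ext fun t c => by simp [mul_add]
  map_smul' a f := Finsupp.lhom_ext fun t c => by simp [mul_left_comm]

theorem testLin_single {v : F.V} (m : ℤ) (f : OpTest E v → k) (t : WGen E ε v m) (c : k) :
    testLin ε m f (Finsupp.single t c) = c * f t.test :=
  Finsupp.linearCombination_single k c t

theorem testLin_push {v w : F.V} (m : ℤ) (θ : (⟨v⟩ : F.Vert) ⟶ ⟨w⟩) (f : OpTest E w → k)
    (ζ : WGen E ε v m →₀ k) : testLin ε m f (ζ.mapDomain (WGen.push θ)) =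
      testLin ε m (fun t => f (t.push θ)) ζ := by
  have : testLin ε m f ∘ₗ Finsupp.lmapDomain k k (WGen.push θ) =
      testLin ε m (fun t => f (t.push θ)) := by
    refine Finsupp.lhom_ext fun t c => ?_
    refine (congrArg (testLin ε m f) (Finsupp.mapDomain_single)).trans ?_
    exact (testLin_single _ _ _ _).trans
      (testLin_single m (fun t => f (t.push θ)) t c).symm
  exact LinearMap.congr_fun this ζ

theorem weightPair_eq_pairFun {v : F.V} {m m' : ℤ} (s : WGen (dualModule E) δ v m')
    (t : WGen E ε v m) : weightPair s t = (pairFun δ s.op s.test.x).1 t.test :=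
  weightPair_eq s t

/-- Expresses the pairing with `ξ` by the single function on tests that the truncated operad
attaches to `ξ`. -/
theorem weightPairLin_eq {v : F.V} {m m' : ℤ} (ξ : WGen (dualModule E) δ v m' →₀ k)
    (ζ : WGen E ε v m →₀ k) : weightPairLin E ε δ v m m' ξ ζ =
      testLin ε m (∑ s ∈ ξ.support, ξ s • (pairFun δ s.op s.test.x).1) ζ := by
  have h1 : weightPairLin E ε δ v m m' ξ =
      ∑ s ∈ ξ.support, ξ s • Finsupp.linearCombination k fun t : WGen E ε v m => weightPair s t :=
    Finsupp.linearCombination_apply k ξ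
  rw [h1, map_sum]
  refine congrArg (fun f : (WGen E ε v m →₀ k) →ₗ[k] k => f ζ) (Finset.sum_congr rfl fun s _ => ?_)
  rw [map_smul]
  refine congrArg (ξ s • ·) (Finsupp.lhom_ext fun t c => ?_)
  refine (Finsupp.linearCombination_single k c t).trans
    (Eq.trans ?_ (testLin_single m _ t c).symm)
  exact congrArg (c * ·) (weightPair_eq_pairFun s t)

/-- The self-adjointness `sum_opPair_d`, with the signs that the two parities put into the Leibniz
rules on the two sides. -/
theorem testLin_pairFun_snd {v : F.V} {m m' : ℤ} (s : WGen (dualModule E) δ v m')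
    (ζ : WGen E ε v m →₀ k) : testLin ε m (pairFun δ s.op s.test.x).2 ζ =
      sgn k (δ.shift 1) * sgn k (ε.shift 1) *
        testLin ε (m + 1) (pairFun δ s.op s.test.x).1 (WGen.dLin E ε v m ζ) := by
  have : testLin ε m (pairFun δ s.op s.test.x).2 = (sgn k (δ.shift 1) * sgn k (ε.shift 1)) •
      (testLin ε (m + 1) (pairFun δ s.op s.test.x).1 ∘ₗ WGen.dLin E ε v m) := by
    refine Finsupp.lhom_ext fun t c => ?_
    refine (testLin_single _ _ _ _).trans ?_
    refine Eq.trans ?_ (congrArg (fun z => sgn k (δ.shift 1) * sgn k (ε.shift 1) *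
      testLin ε (m + 1) (pairFun δ s.op s.test.x).1 z)
      (Finsupp.linearCombination_single k c t : WGen.dLin E ε v m _ = _)).symm
    rw [map_smul, smul_eq_mul]
    have h1 : testLin ε (m + 1) (pairFun δ s.op s.test.x).1 t.d = sgn k (ε.shift 1) *
        ∑ i, sgn k (∑ j, if j < i then t.p j else 0) *
          opPair s.op s.test.x t.op (Function.update t.test.x i (t.test.x i).d) := by
      unfold WGen.d
      rw [map_sum, Finset.mul_sum]
      refine Finset.sum_congr rfl fun i _ => ?_
      refine (testLin_single _ _ _ _).trans ((mul_assoc _ _ _).trans ?_)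
      rw [WGen.test_dAt]
      rfl
    have h2 : (pairFun δ s.op s.test.x).2 t.test = sgn k (δ.shift 1) *
        ∑ i, sgn k (∑ j, if j < i then t.p j else 0) *
          opPair s.op s.test.x t.op (Function.update t.test.x i (t.test.x i).d) :=
      congrArg (_ * ·) (sum_opPair_d s.op s.test.x t.op t.test.x)
    rw [h1, h2]
    have h3 := sgn_mul_self (k := k) (ε.shift 1)
    calc _ = c * (sgn k (δ.shift 1) * (1 * _)) := by rw [one_mul]
      _ = _ := by rw [← h3]; ring
  exact LinearMap.congr_fun this ζ

variable (E δ) in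
/-- The projection of the free operad on the dual module to its truncation. -/
noncomputable def toTrunc : Ops.free (dualModule E) δ ⟶ (truncSquareZero E δ).op :=
  Ops.lift (P := (truncSquareZero E δ).op)
    { app := fun v =>
        { f := fun m => ModuleCat.ofHom (X := ((dualModule E).obj v).X m)
            (Y := ((truncModule E).obj v).X m) (LinearMap.inl k _ _)
          comm' := fun m m' h => ModuleCat.hom_ext (LinearMap.ext fun x => truncComplex_d h x 0 0) }
      naturality := fun v w θ => HomologicalComplex.hom_ext _ _ fun m =>
        ModuleCat.hom_ext (LinearMap.ext fun x => by
          refine Eq.trans ?_ ((truncSquareZero E δ).raw_act_vop θ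
            (by rw [deg_vop]; exact Nat.zero_le 1) m (by simp [deg_vop]) _).symm
          exact Prod.ext rfl (Prod.ext rfl rfl)) }

theorem toTrunc_eval {v : F.V} {m : ℤ} (s : WGen (dualModule E) δ v m) :
    Ops.hap (toTrunc E δ) v m s.eval = truncSnd E ⟨v⟩ m (pairFun δ s.op s.test.x) := by
  refine (Ops.hap_act (toTrunc E δ) s.op _ _ _ _ _).trans ?_
  refine ((truncSquareZero E δ).raw_act_one s.op s.deg_op.le s.deg_op s.p m s.h _).trans ?_
  exact congrArg (truncSnd E ⟨v⟩ m) (pairFunMulti_apply E δ s.op s.p _)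

/-- The truncated operad sees a weight one element as its pairing function. In particular this
function depends only on the element of the free operad and not on the formal combination that
represents it. -/
theorem toTrunc_evalLin {v : F.V} {m : ℤ} (ξ : WGen (dualModule E) δ v m →₀ k) :
    Ops.hap (toTrunc E δ) v m (evalLin _ _ v m ξ) =
      truncSnd E ⟨v⟩ m (∑ s ∈ ξ.support, ξ s • pairFun δ s.op s.test.x) := by
  have h1 : evalLin _ _ v m ξ = ∑ s ∈ ξ.support, ξ s • s.eval := Finsupp.linearCombination_apply k ξ
  rw [h1, map_sum, map_sum]
  refine Finset.sum_congr rfl fun s _ => (map_smul _ _ _).trans ?_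
  exact (congrArg (ξ s • ·) (toTrunc_eval s)).trans (map_smul _ _ _).symm

/-- An operation of degree zero preserves every family of subspaces that is preserved by the isomorphisms of
vertices. -/
theorem Ops.act_mem_of_deg_zero (P : Ops F k ε) (I : ∀ (v : F.V) (m : ℤ), Submodule k ((P.obj v).X m))
    (hI : ∀ (v w : F.Vert) (θ : v ⟶ w) m x, x ∈ I v.of m → P.vmap θ m x ∈ I w.of m)
    {n : ℕ} {X : Fin n → F.V} {v : F.V} (a : F.Op X v) (h0 : deg a = 0) (ha : deg a ≤ 1)
    (p : Fin n → ℤ) (m : ℤ) (h : ∑ i, p i + ε.shift (deg a) = m)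
    (x : ∀ i, (P.obj (X i)).X (p i)) (i : Fin n) (hx : x i ∈ I (X i) (p i)) :
    P.act a ha p m h x ∈ I v m := by
  obtain ⟨ρ, -⟩ := exists_eq_pull_one a h0
  obtain rfl : n = 1 := by simpa using (Fintype.card_congr ρ).symm
  obtain rfl : i = 0 := Subsingleton.elim _ _
  obtain ⟨y, rfl⟩ : ∃ y, X = fun _ => y := ⟨X 0, funext fun i => by rw [Subsingleton.elim i 0]⟩
  obtain ⟨q, rfl⟩ : ∃ q, p = fun _ => q := ⟨p 0, funext fun i => by rw [Subsingleton.elim i 0]⟩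
  obtain ⟨θ, rfl⟩ := exists_vop a h0
  obtain ⟨x, rfl⟩ : ∃ z, x = fun _ => z := ⟨x 0, funext fun i => by rw [Subsingleton.elim i 0]⟩
  obtain rfl : q = m := by
    rw [← h, shift_deg_vop]
    simp
  exact hI _ _ θ q x hx

/-- The functions on tests that vanish on `S`. -/
def annFun (S : ∀ (v : F.V) (m : ℤ), Submodule k (((Ops.free E ε).obj v).X m)) (v : F.V) :
    Submodule k (OpTest E v → k) where
  carrier := {f | ∀ m ζ, evalLin E ε v m ζ ∈ S v m → testLin ε m f ζ = 0}
  zero_mem' m ζ _ := by rw [map_zero]; rfl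
  add_mem' hf hg m ζ h := by
    rw [map_add, LinearMap.add_apply, hf m ζ h, hg m ζ h, add_zero]
  smul_mem' c f hf m ζ h := by
    rw [map_smul, LinearMap.smul_apply, hf m ζ h, smul_zero]

variable {S : ∀ (v : F.V) (m : ℤ), Submodule k (((Ops.free E ε).obj v).X m)}

theorem annFun_push (hS : IsQuadraticDatum S) {v w : F.V} (θ : (⟨w⟩ : F.Vert) ⟶ ⟨v⟩)
    {f : OpTest E v → k} (hf : f ∈ annFun S v) : (fun t => f (t.push θ)) ∈ annFun S w := by
  intro m ζ hζ
  refine (testLin_push m θ f ζ).symm.trans (hf m _ ?_)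
  rw [WGen.evalLin_mapDomain_push]
  exact hS.map_mem _ _ θ m _ hζ

/-- The ideal of the pairs of functions that vanish on `S`. -/
noncomputable def annIdeal (δ : Parity) (hS : IsQuadraticDatum S) :
    OpIdeal (truncSquareZero E δ).op where
  carrier v _ := Submodule.prod ⊥ (Submodule.prod (annFun S v) (annFun S v))
  d_mem {v m m' x} hx := by
    obtain ⟨x, f, g⟩ := x
    obtain ⟨h1, h2, h3⟩ := hx
    obtain rfl : x = 0 := h1
    by_cases hm : m + 1 = m'
    · refine (congrArg (· ∈ Submodule.prod ⊥ (Submodule.prod (annFun S v) (annFun S v)))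
        ((truncComplex_d hm (0 : ((dualModule E).obj ⟨v⟩).X m) f g).trans
          (congrArg (fun z => (z, g, 0)) (map_zero _)))).mpr ?_
      exact ⟨zero_mem _, h3, zero_mem _⟩
    · have := ((truncComplex ((dualModule E).obj ⟨v⟩) (OpTest E v → k))).shape m m' hm
      refine (congrArg (fun z : _ ⟶ (truncComplex ((dualModule E).obj ⟨v⟩) (OpTest E v → k)).X m' =>
        z.hom (0, f, g) ∈ Submodule.prod ⊥ (Submodule.prod (annFun S v) (annFun S v))) this).mpr ?_
      exact zero_mem (Submodule.prod ⊥ (Submodule.prod (annFun S v) (annFun S v)))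
  act_mem {n X v} a ha p m h x i hi := by
    by_cases h1 : deg a = 1
    -- Elements of the ideal have functional part zero, so they are annihilated by all operations of
    -- degree one.
    · have h2 : (truncSquareZero E δ).raw.act a ha p m h x = 0 := by
        refine ((truncSquareZero E δ).raw_act_one a ha h1 p m h x).trans ?_
        refine (congrArg (truncSnd E ⟨v⟩ m) ((pairFunMulti E δ a p).map_coord_zero i
          (m := fun i => truncFst E ⟨X i⟩ (p i) (x i)) ?_)).trans (map_zero _)
        exact hi.1
      exact (congrArg (· ∈ Submodule.prod ⊥ (Submodule.prod (annFun S v) (annFun S v))) h2).mpr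
        (zero_mem _)
    · refine Ops.act_mem_of_deg_zero (truncSquareZero E δ).op
        (fun v _ => Submodule.prod ⊥ (Submodule.prod (annFun S v) (annFun S v)))
        (fun v w θ m x hx => ?_) a (by omega) ha p m h x i hi
      have h2 : (truncSquareZero E δ).op.vmap θ m x = (((truncModule E).map θ).f m).hom x :=
        (truncSquareZero E δ).raw_act_vop θ _ m _ x
      refine (congrArg (· ∈ Submodule.prod ⊥ (Submodule.prod (annFun S w.of) (annFun S w.of)))
        h2).mpr ⟨?_, annFun_push hS _ hx.2.1, annFun_push hS _ hx.2.2⟩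
      have h3 : x.1 = 0 := hx.1
      exact (congrArg (((dualModule E).map θ).f m).hom h3).trans (map_zero _)

theorem mem_perp {v : F.V} {m' : ℤ} {z : ((Ops.free (dualModule E) δ).obj v).X m'} :
    z ∈ perp δ S v m' ↔ ∃ ξ, evalLin (dualModule E) δ v m' ξ = z ∧ ∀ m ζ, evalLin E ε v m ζ ∈ S v m →
      weightPairLin E ε δ v m m' ξ ζ = 0 := by
  unfold perp
  rw [Submodule.mem_map]
  simp only [Submodule.mem_iInf, Submodule.mem_comap, Submodule.mem_dualAnnihilator]
  constructor
  · rintro ⟨ξ, h, rfl⟩; exact ⟨ξ, rfl, h⟩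
  · rintro ⟨ξ, rfl, h⟩; exact ⟨ξ, h, rfl⟩

/-- The functionals in the ideal generated by the functionals vanishing on `S` vanish on `S`. -/
theorem weightPairLin_eq_zero (hS : IsQuadraticDatum S) {v : F.V} {m' : ℤ}
    {ξ : WGen (dualModule E) δ v m' →₀ k}
    (hξ : evalLin (dualModule E) δ v m' ξ ∈ (OpIdeal.span (perp δ S)).carrier v m') (m : ℤ)
    {ζ : WGen E ε v m →₀ k} (hζ : evalLin E ε v m ζ ∈ S v m) :
    weightPairLin E ε δ v m m' ξ ζ = 0 := by
  -- The preimage of `annIdeal` in the free operad is an ideal that contains the functionals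
  -- vanishing on `S`, hence the ideal generated by them. A weight one element of this preimage has
  -- a pairing function that vanishes on `S`.
  have h1 := OpIdeal.span_le (I := OpIdeal.comap (toTrunc E δ) (annIdeal δ hS)) (fun w n z hz => by
    obtain ⟨ξ, rfl, h⟩ := mem_perp.1 hz
    refine (congrArg (· ∈ Submodule.prod ⊥ (Submodule.prod (annFun S w) (annFun S w)))
      (toTrunc_evalLin ξ)).mpr ⟨rfl, ?_, ?_⟩
    · intro m ζ hζ
      refine Eq.trans ?_ ((weightPairLin_eq ξ ζ).symm.trans (h m ζ hζ))
      exact congrArg (fun f => testLin ε m f ζ) (Prod.fst_sum.trans rfl)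
    · intro m ζ hζ
      -- The second function at `ζ` is, up to sign, the first one at the differential of `ζ`, and
      -- `S` is closed under the differential.
      have h2 := h (m + 1) (WGen.dLin E ε w m ζ) (by
        rw [WGen.evalLin_dLin]
        exact hS.d_mem _ _ _ _ hζ)
      rw [weightPairLin_eq, map_sum, LinearMap.sum_apply] at h2
      refine (congrArg (fun f => testLin ε m f ζ) (Prod.snd_sum)).trans ?_
      rw [map_sum, LinearMap.sum_apply]
      refine Eq.trans (Finset.sum_congr rfl fun s _ => ?_)
        ((Finset.mul_sum _ _ (sgn k (δ.shift 1) * sgn k (ε.shift 1))).symm.trans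
          ((congrArg (_ * ·) h2).trans (mul_zero _)))
      rw [map_smul, LinearMap.smul_apply, smul_eq_mul]
      refine Eq.trans ?_ (mul_left_comm _ _ _)
      refine (congrArg (fun f => testLin ε m f ζ) (Prod.smul_snd (ξ s) _)).trans ?_
      rw [map_smul, LinearMap.smul_apply, smul_eq_mul]
      exact congrArg (ξ s * ·) (testLin_pairFun_snd s ζ)) v m' hξ
  have h2 := ((congrArg (· ∈ Submodule.prod ⊥ (Submodule.prod (annFun S v) (annFun S v)))
      (toTrunc_evalLin ξ)).mp h1).2.1 m ζ hζ
  refine (weightPairLin_eq ξ ζ).trans (Eq.trans ?_ h2)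
  exact congrArg (fun f => testLin ε m f ζ)
    (Prod.fst_sum (s := ξ.support) (f := fun s => ξ s • pairFun δ s.op s.test.x)).symm

end Annihilator

/-! ### Operations into vertices of the image come from the source category -/

section LiftingOperations

open CubicalFeynmanCat ColOperad

variable {k : Type u} [Field k] {F₁ F₂ : CubicalFeynmanCat.{u}} {φ : CubicalMorphism F₁ F₂}

namespace CubicalMorphism

variable (φ) in
/-- The operation is the image of an operation under `φ`, up to an isomorphism of its source. -/
def IsLiftable {n : ℕ} {X : Fin n → F₂.V} {w : F₁.V} (f : F₂.Op X (φ.obj w)) : Prop :=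
  ∃ (n' : ℕ) (π : Fin n' ≃ Fin n) (W : Fin n' → F₁.V)
    (u : ∀ j, (⟨X (π j)⟩ : F₂.Vert) ⟶ ⟨φ.obj (W j)⟩) (g : F₁.Op W w),
    f = pull (Y := fun j => φ.obj (W j)) π u (φ.map g)

theorem map_push {n : ℕ} {X : Fin n → F₁.V} {v w : F₁.V} (θ : (⟨v⟩ : F₁.Vert) ⟶ ⟨w⟩)
    (a : F₁.Op X v) : φ.map (push θ a) = push (X := fun i => φ.obj (X i)) (v := φ.obj v)
      (w := φ.obj w) (φ.vert.map θ) (φ.map a) := by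
  refine (φ.map_compTo _ _ _).trans ?_
  exact congrArg (fun z => compTo (F := F₂.toColOperad) (m := 1) (n := fun _ => n) (oneSigma (Fin n))
    (X := fun i => φ.obj (X i)) (Y := fun _ => φ.obj v) z (fun _ => φ.map a)) (φ.map_vop θ)

theorem map_pull {n n' : ℕ} {X : Fin n → F₁.V} {Y : Fin n' → F₁.V} {v : F₁.V} (π : Fin n' ≃ Fin n)
    (u : ∀ j, (⟨X (π j)⟩ : F₁.Vert) ⟶ ⟨Y j⟩) (b : F₁.Op Y v) : φ.map (pull π u b) =
      pull (X := fun i => φ.obj (X i)) (Y := fun j => φ.obj (Y j)) π (fun j => φ.vert.map (u j))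
        (φ.map b) := by
  refine (φ.map_compTo _ _ _).trans ?_
  exact congrArg (compTo (F := F₂.toColOperad) (X := fun i => φ.obj (X i)) (Y := fun j => φ.obj (Y j))
    ((sigmaOne (Fin n')).trans π) (φ.map b)) (funext fun j => φ.map_vop (u j))

theorem IsLiftable.push {n : ℕ} {X : Fin n → F₂.V} {w w' : F₁.V} {f : F₂.Op X (φ.obj w)}
    (h : φ.IsLiftable f) (θ : (⟨w⟩ : F₁.Vert) ⟶ ⟨w'⟩) :
    φ.IsLiftable (push (v := φ.obj w) (w := φ.obj w') (φ.vert.map θ) f) := by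
  obtain ⟨n', π, W, u, g, rfl⟩ := h
  refine ⟨n', π, W, u, CubicalFeynmanCat.push θ g, (push_pull _ _ _ _).trans ?_⟩
  exact congrArg (pull π u) (map_push θ g).symm

/-- An isomorphism onto `φ(w)` is the identity operation of `w` after an isomorphism of the source.
-/
theorem isLiftable_of_deg_zero {n : ℕ} {X : Fin n → F₂.V} {w : F₁.V} (f : F₂.Op X (φ.obj w))
    (hf : deg f = 0) : φ.IsLiftable f := by
  obtain ⟨ρ, u, rfl⟩ := exists_eq_pull_one f hf
  exact ⟨1, ρ, fun _ => w, u, F₁.one w, congrArg (pull (Y := fun _ => φ.obj w) ρ u) (φ.map_one w).symm⟩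

end CubicalMorphism

/-- The complex with a one-dimensional space in each degree and zero differential. -/
noncomputable def unitComplex (k : Type u) [Field k] : CochainComplex (ModuleCat.{u} k) ℤ where
  X _ := ModuleCat.of k k
  d _ _ := 0

/-- The constant `V`-module. -/
noncomputable def unitModule (F : CubicalFeynmanCat.{u}) (k : Type u) [Field k] : VMod F k :=
  (Functor.const _).obj (unitComplex k)

/-- All degrees are zero and all isomorphisms act trivially, so each match contributes one. -/
theorem opPair_unitModule_self {F : CubicalFeynmanCat.{u}} {n : ℕ} {X : Fin n → F.V} {v : F.V}
    (f : F.Op X v) : opPair (E := unitModule F k) f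
      (fun _ => ⟨0, (LinearMap.id : Module.Dual k k)⟩) f (fun _ => ⟨-0, (1 : k)⟩) =
        Fintype.card (IsoMatch f f) := by
  unfold opPair
  rw [← Finset.card_univ, Finset.cast_card]
  refine Finset.sum_congr rfl fun s _ => ?_
  unfold matchTerm
  have h1 : permKoszul s.π (fun _ => (-0 : ℤ)) = 0 := by simp [permKoszul]
  refine (congrArg₂ (· * ·) ((congrArg (sgn k) h1).trans sgn_zero)
    (Finset.prod_eq_one fun j _ => ?_)).trans (one_mul 1)
  exact HomEl.pair_mk (C := unitComplex k) 0 (LinearMap.id : Module.Dual k k) (1 : k)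

/-- The pairs of functions that vanish on the operations which cannot be lifted. -/
noncomputable def liftableFun (hφ : φ.Admissible) (C : VMod F₂ k) (ε : Parity) (w : F₁.V) (m : ℤ) :
    Submodule k ((((Ops.res hφ).obj (truncSquareZero C ε).op).obj w).X m) :=
  let N : Submodule k (OpTest C (φ.obj w) → k) :=
    { carrier := {f | ∀ t, ¬ φ.IsLiftable t.op → f t = 0}
      zero_mem' := fun _ _ => rfl
      add_mem' := fun hf hg t h => by rw [Pi.add_apply, hf t h, hg t h, add_zero]
      smul_mem' := fun c f hf t h => by rw [Pi.smul_apply, hf t h, smul_zero] }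
  Submodule.prod (⊤ : Submodule k (((dualModule C).obj ⟨φ.obj w⟩).X m)) (N.prod N)

theorem Ops.res_vmap (hφ : φ.Admissible) {ε : Parity} (P : Ops F₂ k ε) {v w : F₁.Vert} (θ : v ⟶ w)
    (m : ℤ) (x : (P.obj (φ.obj v.of)).X m) :
    ((Ops.res hφ).obj P).vmap θ m x = P.vmap (φ.vert.map θ) m x :=
  (congrArg (fun f : (Ops.resV φ P.under).obj v ⟶ ((Ops.res hφ).obj P).under.obj w => (f.f m).hom x)
    ((Ops.resUnder hφ P).naturality θ)).symm

/-- In `F₁(rG)` only operations of `F₁` occur. So, after passing to the truncated operad, the image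
of `β` consists of elements whose functions vanish on all tests whose operation cannot be lifted. A
non-liftable `f`, with coordinate functionals at its inputs, pairs with itself to the number of its
self-matches. This number is positive, hence non-zero in characteristic zero, which contradicts the
surjectivity of `β`. The constant module and even parity are enough for the test. -/
theorem isLiftable (hφ : φ.Admissible) [CharZero k] (hq : QuadraticPreserving k hφ) {n : ℕ}
    {X : Fin n → F₂.V} {w : F₁.V} (f : F₂.Op X (φ.obj w)) (hf : deg f ≤ 1) : φ.IsLiftable f := by
  by_cases h0 : deg f = 0
  · exact φ.isLiftable_of_deg_zero f h0
  have h1 : deg f = 1 := by omega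
  by_contra hn
  let C := unitModule F₂ k
  let h := Ops.beta hφ (dualModule C) .even ≫ (Ops.res hφ).map (toTrunc C .even)
  have key : ∀ w m (y : ((Ops.free (Ops.resV φ (dualModule C)) .even).obj w).X m),
      Ops.hap h w m y ∈ liftableFun hφ C .even w m := by
    refine Ops.free_induction (p := fun w m y => Ops.hap h w m y ∈ liftableFun hφ C .even w m)
      ?_ ?_ ?_ ?_ ?_ ?_
    · intro w m x
      exact ⟨trivial, fun t _ => rfl, fun t _ => rfl⟩
    · intro w m
      rw [map_zero]
      exact zero_mem _
    · intro w m x y hx hy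
      rw [map_add]
      exact add_mem hx hy
    · intro w m c x hx
      rw [map_smul]
      exact Submodule.smul_mem _ c hx
    · intro w m m' x hm hx
      rw [Ops.hap_d]
      have h2 := truncComplex_d hm (Ops.hap h w m x).1 (Ops.hap h w m x).2.1 (Ops.hap h w m x).2.2
      refine (congrArg (· ∈ liftableFun hφ C .even w m') h2).mpr ⟨trivial, hx.2.2, fun t _ => rfl⟩
    · intro l Z w a ha q m hm x hx
      rw [Ops.hap_act]
      by_cases ha1 : deg a = 1
      · have h2 : ((Ops.res hφ).obj (truncSquareZero C .even).op).act a ha q m hm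
            (fun i => Ops.hap h _ _ (x i)) = truncSnd C ⟨φ.obj w⟩ m (pairFun .even (φ.map a)
              fun i => ⟨q i, truncFst C ⟨φ.obj (Z i)⟩ (q i) (Ops.hap h _ _ (x i))⟩) := by
          refine ((truncSquareZero C .even).raw_act_one (φ.map a)
            ((φ.deg_map a).le.trans ha) ((φ.deg_map a).trans ha1) q m
            (by rw [φ.deg_map a]; exact hm) _).trans ?_
          exact congrArg (truncSnd C ⟨φ.obj w⟩ m) (pairFunMulti_apply C .even _ q _)
        rw [h2]
        have h3 : ∀ (t : OpTest C (φ.obj w)) (_ : ¬ φ.IsLiftable t.op)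
            (η : ∀ i, (dualModule C).el (φ.obj (Z i))),
            opPair (Y := fun i => φ.obj (Z i)) (φ.map a) η t.op t.x = 0 := by
          intro t ht η
          -- A match of `φ.map a` with the operation of the test would be a lifting of the latter.
          refine Finset.sum_eq_zero fun s _ => (ht ?_).elim
          exact ⟨l, s.π, Z, s.u, a, s.comp.symm⟩
        refine ⟨trivial, fun t ht => h3 t ht _, fun t ht => ?_⟩
        refine (congrArg (_ * ·) (Finset.sum_eq_zero fun i _ => ?_)).trans (mul_zero _)
        rw [h3 t ht, mul_zero]
      · obtain ⟨ρ, -⟩ := exists_eq_pull_one a (by omega)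
        refine Ops.act_mem_of_deg_zero _ (liftableFun hφ C .even) ?_ a (by omega) ha q m hm _ (ρ 0)
          (hx _)
        intro v w θ m x hx
        have h2 : ((Ops.res hφ).obj (truncSquareZero C .even).op).vmap θ m x =
            (((truncModule C).map (φ.vert.map θ)).f m).hom x :=
          (Ops.res_vmap hφ (truncSquareZero C .even).op θ m x).trans
            ((truncSquareZero C .even).raw_act_vop (φ.vert.map θ) _ m _ x)
        have h3 : ∀ t : OpTest C (φ.obj w.of), ¬ φ.IsLiftable t.op → ¬ φ.IsLiftable
            (t.push (Groupoid.inv (φ.vert.map θ) : (⟨φ.obj w.of⟩ : F₂.Vert) ⟶ ⟨φ.obj v.of⟩)).op := by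
          intro t ht h4
          refine ht ?_
          have h5 := CubicalMorphism.IsLiftable.push (φ := φ) h4 θ
          exact (congrArg φ.IsLiftable (push_push_inv (v := φ.obj v.of) (w := φ.obj w.of)
            (φ.vert.map θ) t.op)).mp h5
        rw [h2]
        exact ⟨trivial, fun t ht => hx.2.1 _ (h3 t ht), fun t ht => hx.2.2 _ (h3 t ht)⟩
  -- The operation `f` with the identity functional of `k`, in degree zero, at each input.
  let s : WGen (dualModule C) .even (φ.obj w) 0 :=
    ⟨n, X, f, h1, fun _ => 0, by simp [Parity.shift], fun _ => (LinearMap.id : Module.Dual k k)⟩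
  obtain ⟨y, hy⟩ := hq.surjective .even (dualModule C) w 0 s.eval
  have h2 := key w 0 y
  have h3 : Ops.hap h w 0 y = truncSnd C ⟨φ.obj w⟩ 0 (pairFun .even s.op s.test.x) :=
    (congrArg (Ops.hap (toTrunc C .even) (φ.obj w) 0) hy).trans (toTrunc_eval s)
  rw [h3] at h2
  -- The test is `f` with the unit of `k` at each input; the degree is written `-0` because
  -- functionals of degree `q` live on the component of degree `-q`.
  have h4 := h2.2.1 ⟨n, X, f, h1, fun _ => ⟨-0, (1 : k)⟩⟩ hn
  have h5 := (opPair_unitModule_self (k := k) f).symm.trans h4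
  have : Nonempty (IsoMatch f f) := ⟨IsoMatch.refl f⟩
  exact Fintype.card_ne_zero (Nat.cast_eq_zero.1 h5)

end LiftingOperations

/-! ### The kernel of the projection to the restricted dual is generated in weight one -/

section Restriction

open CubicalFeynmanCat ColOperad

variable {k : Type u} [Field k] {F₁ F₂ : CubicalFeynmanCat.{u}} {φ : CubicalMorphism F₁ F₂}
  {G : VMod F₂ k} {δ : Parity}

variable (φ) in
/-- The image of a generator of weight one under `φ`. -/
def WGen.image {w : F₁.V} {m : ℤ} (s : WGen (Ops.resV φ G) δ w m) : WGen G δ (φ.obj w) m where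
  n := s.n
  X i := φ.obj (s.X i)
  op := φ.map s.op
  deg_op := (φ.deg_map s.op).trans s.deg_op
  p := s.p
  h := (congrArg (fun d => ∑ i, s.p i + δ.shift d) (φ.deg_map s.op)).trans s.h
  x := s.x

theorem WGen.eval_image (hφ : φ.Admissible) {w : F₁.V} {m : ℤ} (s : WGen (Ops.resV φ G) δ w m) :
    (s.image φ).eval = Ops.hap (Ops.beta hφ G δ) w m s.eval :=
  (Ops.hap_act (Ops.beta hφ G δ) s.op s.deg_op.le s.p m s.h
    fun i => Ops.gen (Ops.resV φ G) δ (s.x i)).symm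

theorem WGen.evalLin_image (hφ : φ.Admissible) {w : F₁.V} {m : ℤ}
    (ξ : WGen (Ops.resV φ G) δ w m →₀ k) :
    evalLin G δ (φ.obj w) m (ξ.mapDomain (WGen.image φ)) =
      Ops.hap (Ops.beta hφ G δ) w m (evalLin _ _ w m ξ) := by
  have : evalLin G δ (φ.obj w) m ∘ₗ Finsupp.lmapDomain k k (WGen.image φ) =
      Ops.hap (Ops.beta hφ G δ) w m ∘ₗ evalLin _ _ w m := by
    refine Finsupp.lhom_ext fun t c => ?_
    refine (congrArg (evalLin G δ (φ.obj w) m) (Finsupp.mapDomain_single)).trans ?_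
    refine (WGen.evalLin_single _ c).trans ?_
    refine Eq.trans ?_ (congrArg (Ops.hap (Ops.beta hφ G δ) w m) (WGen.evalLin_single t c)).symm
    exact (congrArg (c • ·) (WGen.eval_image hφ t)).trans (map_smul _ _ _).symm
  exact LinearMap.congr_fun this ξ

/-- The operation of a generator is `φ.map g` composed with an isomorphism of its source, and the
isomorphism can be absorbed into the elements of `G` at the inputs. -/
theorem exists_weightOne_lift (hφ : φ.Admissible)
    (hl : ∀ {n : ℕ} {X : Fin n → F₂.V} {w : F₁.V} (f : F₂.Op X (φ.obj w)), deg f ≤ 1 → φ.IsLiftable f)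
    {w : F₁.V} {m : ℤ} {z : ((Ops.free G δ).obj (φ.obj w)).X m} (hz : z ∈ weightOne G δ (φ.obj w) m) :
    ∃ y ∈ weightOne (Ops.resV φ G) δ w m, Ops.hap (Ops.beta hφ G δ) w m y = z := by
  obtain ⟨ζ, rfl⟩ := hz
  induction ζ using Finsupp.induction_linear with
  | zero => exact ⟨0, zero_mem _, (map_zero _).trans (map_zero _).symm⟩
  | add ζ ζ' h h' =>
    obtain ⟨y, hy, h⟩ := h
    obtain ⟨y', hy', h'⟩ := h'
    exact ⟨y + y', add_mem hy hy', (map_add _ _ _).trans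
      ((congrArg₂ (· + ·) h h').trans (map_add _ _ _).symm)⟩
  | single t c =>
    obtain ⟨n', π, W, u, g, hg⟩ := hl t.op t.deg_op.le
    have hd : deg (pull (Y := fun j => φ.obj (W j)) π u (φ.map g)) = 1 := hg ▸ t.deg_op
    have hd2 : deg (φ.map g) = 1 := (deg_pull (Y := fun j => φ.obj (W j)) π u (φ.map g)).symm.trans hd
    have hd1 : deg g = 1 := (φ.deg_map g).symm.trans hd2
    have ht : ∑ i, t.p i + δ.shift 1 = m := t.deg_op ▸ t.h
    have hp : ∑ j, t.p (π j) + δ.shift 1 = m := (congrArg (· + _) (Equiv.sum_comp π t.p)).trans ht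
    let s : WGen (Ops.resV φ G) δ w m :=
      { n := n', X := W, op := g, deg_op := hd1, p := fun j => t.p (π j)
        h := by rw [hd1]; exact hp
        x := fun j => ((G.map (u j)).f (t.p (π j))).hom (t.x (π j)) }
    -- The additional factor is the sign of permuting the inputs by `π`.
    refine ⟨evalLin _ _ w m (Finsupp.single s (c * sgn k (permKoszul π t.p))), ⟨_, rfl⟩, ?_⟩
    refine (congrArg (Ops.hap (Ops.beta hφ G δ) w m) (WGen.evalLin_single s _)).trans ?_
    refine (map_smul _ _ _).trans ?_
    refine ((congrArg (_ • ·) (WGen.eval_image hφ s).symm).trans ?_).trans (WGen.evalLin_single t c).symm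
    refine (mul_smul _ _ _).trans (congrArg (c • ·) ?_)
    have h1 : t.eval = (Ops.free G δ).act (pull (Y := fun j => φ.obj (W j)) π u (φ.map g)) hd.le t.p m
        (by rw [hd]; exact ht) (fun i => Ops.gen G δ (t.x i)) :=
      (Ops.free G δ).act_congr hg _ _ _ _ _ _ _
    refine Eq.trans ?_ h1.symm
    refine Eq.trans ?_ ((Ops.free G δ).act_pull (Y := fun j => φ.obj (W j)) π u (φ.map g) hd2.le hd.le
      t.p m _ (by rw [hd2]; exact hp) _).symm
    refine congrArg (sgn k (permKoszul π t.p) • ·) ?_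
    exact congrArg ((Ops.free G δ).act (φ.map g) hd2.le (fun j => t.p (π j)) m _)
      (funext fun j => Ops.gen_map (u j) (t.x (π j)))

/-- The elements of `F₂(G)` whose images at all vertices `φ(w)` come from an ideal of `F₁(rG)`. -/
noncomputable def pushIdeal (hφ : φ.Admissible)
    (hβ : ∀ w m, Function.Surjective (Ops.hap (Ops.beta hφ G δ) w m))
    (hl : ∀ {n : ℕ} {X : Fin n → F₂.V} {w : F₁.V} (f : F₂.Op X (φ.obj w)), deg f ≤ 1 → φ.IsLiftable f)
    (I : OpIdeal (Ops.free (Ops.resV φ G) δ)) : OpIdeal (Ops.free G δ) where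
  carrier v m := ⨅ (w : F₁.V) (θ : (⟨v⟩ : F₂.Vert) ⟶ ⟨φ.obj w⟩),
    ((I.carrier w m).map (Ops.hap (Ops.beta hφ G δ) w m)).comap ((Ops.free G δ).vmap θ m)
  d_mem {v m m' x} hx := by
    by_cases hm : m + 1 = m'
    · rw [Submodule.mem_iInf] at hx ⊢
      intro w
      have hx := hx w
      rw [Submodule.mem_iInf] at hx ⊢
      intro θ
      obtain ⟨y, hy, hyx⟩ := hx θ
      refine ⟨_, I.d_mem hy, ?_⟩
      refine (Ops.hap_d _ _ _ _ _).trans ?_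
      have h1 := (Ops.free G δ).vmap_d θ m m' hm x
      exact (congrArg (((Ops.free G δ).obj (φ.obj w)).d m m').hom hyx).trans h1
    · have h0 := ((Ops.free G δ).obj v).shape m m' hm
      rw [h0]
      exact zero_mem _
  act_mem {n X v} a ha p m h x i hi := by
    rw [Submodule.mem_iInf] at hi ⊢
    intro w
    rw [Submodule.mem_iInf]
    intro θ
    have ha' : deg (push θ a) ≤ 1 := (deg_push θ a).le.trans ha
    have h1 := (Ops.free G δ).act_push θ a ha ha' p m h (by rw [deg_push]; exact h) x
    refine (congrArg (· ∈ (I.carrier w m).map (Ops.hap (Ops.beta hφ G δ) w m)) h1).mp ?_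
    -- With a lift `g` of the operation the value can be computed in `F₁(rG)`: all arguments lift
    -- because `β` is surjective, and the argument at `i` lifts to an element of `I`, so the value
    -- is the image of an element of `I`.
    obtain ⟨n', π, W, u, g, hg⟩ := hl (push θ a) ha'
    have hd : deg (pull (Y := fun j => φ.obj (W j)) π u (φ.map g)) ≤ 1 := hg ▸ ha'
    have hd' : deg (φ.map g) = deg a := (deg_pull (Y := fun j => φ.obj (W j)) π u (φ.map g)).symm.trans
      ((congrArg deg hg).symm.trans (deg_push θ a))
    have hp : ∑ j, p (π j) + δ.shift (deg a) = m := by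
      rw [Equiv.sum_comp π p, h]
    refine (congrArg (· ∈ (I.carrier w m).map (Ops.hap (Ops.beta hφ G δ) w m))
      (((Ops.free G δ).act_congr hg _ hd p m _ (by rw [← hg, deg_push]; exact h) x).trans
        ((Ops.free G δ).act_pull (Y := fun j => φ.obj (W j)) π u (φ.map g) (hd'.le.trans ha) hd
          p m _ (by rw [hd']; exact hp) x))).mpr ?_
    refine Submodule.smul_mem _ _ ?_
    have hex : ∀ j, ∃ y : ((Ops.free (Ops.resV φ G) δ).obj (W j)).X (p (π j)),
        Ops.hap (Ops.beta hφ G δ) (W j) _ y = (Ops.free G δ).vmap (u j) (p (π j)) (x (π j)) ∧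
          (π j = i → y ∈ I.carrier (W j) (p (π j))) := by
      intro j
      by_cases hj : π j = i
      · subst hj
        have h2 := hi (W j)
        rw [Submodule.mem_iInf] at h2
        obtain ⟨y, hy, hyx⟩ := h2 (u j)
        exact ⟨y, hyx, fun _ => hy⟩
      · obtain ⟨y, hy⟩ := hβ (W j) (p (π j)) ((Ops.free G δ).vmap (u j) (p (π j)) (x (π j)))
        exact ⟨y, hy, fun h => (hj h).elim⟩
    choose y hy hyI using hex
    have hdg : deg g = deg a := (φ.deg_map g).symm.trans hd'
    refine ⟨(Ops.free (Ops.resV φ G) δ).act g (hdg.le.trans ha) (fun j => p (π j)) m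
      (by rw [hdg]; exact hp) y, I.act_mem _ _ _ _ _ _ (π.symm i) (hyI _ (π.apply_symm_apply i)), ?_⟩
    refine (Ops.hap_act _ _ _ _ _ _ _).trans ?_
    exact congrArg ((Ops.free G δ).act (φ.map g) _ (fun j => p (π j)) m _) (funext hy)

variable {T : ∀ (v : F₂.V) (m : ℤ), Submodule k (((Ops.free G δ).obj v).X m)}

theorem mem_ker_projToRes (hφ : φ.Admissible) {w : F₁.V} {m : ℤ}
    {y : ((Ops.free (Ops.resV φ G) δ).obj w).X m} :
    y ∈ (OpIdeal.ker (projToRes hφ T)).carrier w m ↔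
      Ops.hap (Ops.beta hφ G δ) w m y ∈ (OpIdeal.span T).carrier (φ.obj w) m :=
  OpIdeal.ker_π (OpIdeal.span T)

/-- The kernel of the projection to a restricted quadratic operad is generated in weight one. -/
theorem ker_projToRes [CharZero k] (hφ : φ.Admissible) (hq : QuadraticPreserving k hφ)
    (hT : ∀ v m, T v m ≤ weightOne G δ v m)
    (hT' : ∀ (v w : F₂.Vert) (θ : v ⟶ w) m x, x ∈ T v.of m → (Ops.free G δ).vmap θ m x ∈ T w.of m) :
    OpIdeal.ker (projToRes hφ T) = OpIdeal.span (resRel hφ T) := by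
  have h1 : ∀ w m, (OpIdeal.span (resRel hφ T)).carrier w m ≤
      (OpIdeal.ker (projToRes hφ T)).carrier w m := OpIdeal.span_le fun w m => inf_le_left
  have h2 : ∀ w m, (OpIdeal.ker (projToRes hφ T)).carrier w m ≤
      (OpIdeal.span (resRel hφ T)).carrier w m := by
    intro w m y hy
    have hl : ∀ {n : ℕ} {X : Fin n → F₂.V} {w : F₁.V} (f : F₂.Op X (φ.obj w)), deg f ≤ 1 →
      φ.IsLiftable f := fun f hf => isLiftable hφ hq f hf
    -- At the vertices `φ(w)` the elements of `T` lift to weight one elements of the kernel. So `T`,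
    -- and with it the ideal it generates, consists of elements coming from the ideal generated by
    -- `resRel`.
    have h3 := OpIdeal.span_le (I := pushIdeal hφ (hq.surjective δ G) hl (OpIdeal.span (resRel hφ T)))
      (S := T) (fun v m z hz => by
        refine (Submodule.mem_iInf _).2 fun w => (Submodule.mem_iInf _).2 fun θ => ?_
        have hz' := hT' ⟨v⟩ ⟨φ.obj w⟩ θ m z hz
        obtain ⟨y, hy, hyz⟩ := exists_weightOne_lift hφ hl (hT _ _ hz')
        refine ⟨y, OpIdeal.le_span _ _ _ ⟨(mem_ker_projToRes hφ).2 ?_, hy⟩, hyz⟩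
        exact OpIdeal.le_span _ _ _ (hyz ▸ hz')) _ _ ((mem_ker_projToRes hφ).1 hy)
    -- For the identity of `φ(w)` this yields `y'` in the ideal generated by `resRel` with the same
    -- image as `y`. The difference lies in the kernel of `β`, which by hypothesis is generated by
    -- its weight one part, and this part is contained in `resRel`.
    have h4 := (Submodule.mem_iInf _).1 ((Submodule.mem_iInf _).1 h3 w) (𝟙 _)
    obtain ⟨y', hy', h5⟩ := h4
    have h5 := h5.trans ((Ops.free G δ).vmap_id ⟨φ.obj w⟩ m _)
    have h6 : y - y' ∈ (OpIdeal.ker (Ops.beta hφ G δ)).carrier w m :=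
      OpIdeal.mem_ker.2 ((map_sub _ _ _).trans (sub_eq_zero.2 h5.symm))
    rw [hq.ker] at h6
    have h7 := OpIdeal.span_le (S := fun v m => (OpIdeal.ker (Ops.beta hφ G δ)).carrier v m ⊓
      weightOne (Ops.resV φ G) δ v m) (I := OpIdeal.span (resRel hφ T)) (fun w m z hz =>
      OpIdeal.le_span _ _ _ ⟨(mem_ker_projToRes hφ).2 (by
        have h8 : Ops.hap (Ops.beta hφ G δ) w m z = 0 := hz.1
        exact h8 ▸ zero_mem _), hz.2⟩) w m h6
    have h9 := add_mem h7 hy'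
    rwa [sub_add_cancel] at h9
  have h3 : (OpIdeal.ker (projToRes hφ T)).carrier = (OpIdeal.span (resRel hφ T)).carrier :=
    funext fun w => funext fun m => le_antisymm (h2 w m) (h1 w m)
  exact (OpIdeal.span_carrier _).symm.trans ((congrArg OpIdeal.span h3).trans (OpIdeal.span_carrier _))

theorem projToRes_surjective (hφ : φ.Admissible) (hq : QuadraticPreserving k hφ) (v : F₁.V) (m : ℤ) :
    Function.Surjective (Ops.hap (projToRes hφ T) v m) := fun z => by
  obtain ⟨z, rfl⟩ := (OpIdeal.span T).π_surjective (φ.obj v) m z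
  obtain ⟨y, rfl⟩ := hq.surjective δ G v m z
  exact ⟨y, rfl⟩

end Restriction

/-! ### Orthogonal complements are stable under isomorphisms of vertices -/

section PerpStable

open CubicalFeynmanCat ColOperad

variable {k : Type u} [Field k] {F : CubicalFeynmanCat.{u}} {E : VMod F k} {ε δ : Parity}

theorem perp_le_weightOne {S : ∀ (v : F.V) (m : ℤ), Submodule k (((Ops.free E ε).obj v).X m)}
    (v : F.V) (m : ℤ) : perp δ S v m ≤ weightOne (dualModule E) δ v m := by
  rintro z hz
  obtain ⟨ξ, rfl, -⟩ := mem_perp.1 hz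
  exact ⟨ξ, rfl⟩

theorem weightPair_push {v w : F.V} (θ : (⟨v⟩ : F.Vert) ⟶ ⟨w⟩) {m m' : ℤ}
    (s : WGen (dualModule E) δ v m') (t : WGen E ε v m) :
    weightPair (s.push θ) (t.push θ) = weightPair s t :=
  (weightPair_eq _ _).trans ((opPair_push θ s.op t.op).trans (weightPair_eq _ _).symm)

theorem weightPairLin_single {v : F.V} {m m' : ℤ} (s : WGen (dualModule E) δ v m')
    (t : WGen E ε v m) (a b : k) : weightPairLin E ε δ v m m' (Finsupp.single s a)
      (Finsupp.single t b) = a * (b * weightPair s t) := by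
  unfold weightPairLin
  rw [Finsupp.linearCombination_single, LinearMap.smul_apply, Finsupp.linearCombination_single]
  rfl

theorem weightPairLin_push {v w : F.V} (θ : (⟨v⟩ : F.Vert) ⟶ ⟨w⟩) {m m' : ℤ}
    (ξ : WGen (dualModule E) δ v m' →₀ k) (ζ : WGen E ε v m →₀ k) :
    weightPairLin E ε δ w m m' (ξ.mapDomain (WGen.push θ)) (ζ.mapDomain (WGen.push θ)) =
      weightPairLin E ε δ v m m' ξ ζ := by
  induction ξ using Finsupp.induction_linear with
  | zero => rw [Finsupp.mapDomain_zero, map_zero, map_zero]; rfl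
  | add ξ ξ' h h' => rw [Finsupp.mapDomain_add, map_add, map_add, LinearMap.add_apply, h, h']; rfl
  | single s a =>
    induction ζ using Finsupp.induction_linear with
    | zero => rw [Finsupp.mapDomain_zero, map_zero, map_zero]
    | add ζ ζ' h h' => rw [Finsupp.mapDomain_add, map_add, map_add, h, h']
    | single t b =>
      rw [Finsupp.mapDomain_single, Finsupp.mapDomain_single, weightPairLin_single,
        weightPairLin_single, weightPair_push]

theorem WGen.mapDomain_push_push {v w : F.V} (θ : (⟨v⟩ : F.Vert) ⟶ ⟨w⟩) {m : ℤ}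
    (ζ : WGen E ε w m →₀ k) :
    (ζ.mapDomain (WGen.push (Groupoid.inv θ))).mapDomain (WGen.push θ) = ζ := by
  rw [← Finsupp.mapDomain_comp]
  have : WGen.push θ ∘ WGen.push (Groupoid.inv θ) = (id : WGen E ε w m → WGen E ε w m) := by
    funext t
    obtain ⟨n, X, a, ha, p, h, x⟩ := t
    have h1 := push_push_inv θ a
    unfold WGen.push
    simp only [Function.comp_apply, id]
    congr 1
  rw [this, Finsupp.mapDomain_id]

/-- The pairing is invariant under simultaneous transport of both arguments along `θ`, and `S` is
preserved by the inverse of `θ`. -/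
theorem perp_vmap {S : ∀ (v : F.V) (m : ℤ), Submodule k (((Ops.free E ε).obj v).X m)}
    (hS : IsQuadraticDatum S) (v w : F.Vert) (θ : v ⟶ w) (m : ℤ)
    (x : ((Ops.free (dualModule E) δ).obj v.of).X m) (hx : x ∈ perp δ S v.of m) :
    (Ops.free (dualModule E) δ).vmap θ m x ∈ perp δ S w.of m := by
  obtain ⟨ξ, rfl, h⟩ := mem_perp.1 hx
  refine mem_perp.2 ⟨ξ.mapDomain (WGen.push θ), WGen.evalLin_mapDomain_push θ ξ, fun n ζ hζ => ?_⟩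
  rw [← WGen.mapDomain_push_push θ ζ]
  refine (weightPairLin_push θ ξ _).trans (h n _ ?_)
  rw [WGen.evalLin_mapDomain_push]
  exact hS.map_mem _ _ _ n _ hζ

end PerpStable

/-! ### Functionals on the weight one part are represented by the pairing -/

section Nondegeneracy

open CubicalFeynmanCat ColOperad

variable {k : Type u} [Field k] {F : CubicalFeynmanCat.{u}}

section

variable (E : VMod F k) {n : ℕ} (X : Fin n → F.V) (N : ℤ)

/-- The functions on tuples of homogeneous elements that are linear combinations of products of homogeneous
functionals with the given sum of degrees. -/
def productFun : Submodule k ((∀ i, E.el (X i)) → k) :=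
  Submodule.span k {f | ∃ η : ∀ i, (dualModule E).el (X i), ∑ i, (η i).1 = N ∧
    f = fun y => ∏ i, HomEl.pair (C := E.obj ⟨X i⟩) (η i) (y i)}

variable {E X N}

/-- The function on tuples of homogeneous elements given by multilinear maps for all tuples of degrees with
the given sum. -/
def multiFun (f : ∀ p : Fin n → ℤ, ∑ i, p i = N →
    MultilinearMap k (fun i => (E.obj ⟨X i⟩).X (p i)) k) (y : ∀ i, E.el (X i)) : k :=
  if h : ∑ i, (y i).1 = N then f _ h (fun i => (y i).2) else 0

-- In one tuple of degrees, a multilinear form on finite-dimensional spaces is expanded in bases: it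
-- is a finite linear combination of products of coordinate functionals.
open Classical in
theorem multiFun_part_mem (hE : ∀ (v : F.Vert) (m : ℤ), FiniteDimensional k ((E.obj v).X m))
    (f : ∀ p : Fin n → ℤ, ∑ i, p i = N → MultilinearMap k (fun i => (E.obj ⟨X i⟩).X (p i)) k)
    (q : Fin n → ℤ) (hq : ∑ i, -q i = N) :
    (fun y => if ∀ i, (y i).1 = -q i then multiFun f y else 0) ∈ productFun E X (-N) := by
  have := hE
  let b := fun i => Module.finBasis k ((E.obj ⟨X i⟩).X (-q i))
  have h1 : (fun y => if ∀ i, (y i).1 = -q i then multiFun f y else 0) =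
      ∑ I : ∀ i, Fin (Module.finrank k ((E.obj ⟨X i⟩).X (-q i))),
        f _ hq (fun i => b i (I i)) • fun y : ∀ i, E.el (X i) =>
          ∏ i, HomEl.pair (C := E.obj ⟨X i⟩) ⟨q i, ((b i).coord (I i) : Module.Dual k _)⟩ (y i) := by
    funext y
    rw [Finset.sum_apply]
    by_cases hy : ∀ i, (y i).1 = -q i
    · obtain ⟨z, rfl⟩ : ∃ z : ∀ i, (E.obj ⟨X i⟩).X (-q i), y = fun i => ⟨-q i, z i⟩ := by
        have : ∀ i, ∃ z : (E.obj ⟨X i⟩).X (-q i), y i = ⟨-q i, z⟩ := fun i => by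
          have h := hy i
          revert h
          generalize y i = t
          rintro h
          obtain ⟨p, x⟩ := t
          obtain rfl : p = -q i := h
          exact ⟨x, rfl⟩
        choose z hz using this
        exact ⟨z, funext hz⟩
      rw [if_pos hy]
      refine (dif_pos hq).trans ?_
      have h2 : (fun i => z i) = fun i => ∑ j, (b i).coord j (z i) • b i j :=
        funext fun i => ((b i).sum_repr (z i)).symm
      refine (congrArg (f _ hq) h2).trans ((MultilinearMap.map_sum _ _).trans ?_)
      refine Finset.sum_congr rfl fun I _ => ?_
      refine (MultilinearMap.map_smul_univ _ _ _).trans ((mul_comm _ _).trans ?_)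
      refine congrArg (_ * ·) (Finset.prod_congr rfl fun i _ => ?_)
      exact (HomEl.pair_mk (C := E.obj ⟨X i⟩) (q i) _ (z i)).symm
    · rw [if_neg hy]
      push Not at hy
      obtain ⟨i, hi⟩ := hy
      refine (Finset.sum_eq_zero fun I _ => ?_).symm
      refine (congrArg (_ * ·) (Finset.prod_eq_zero (Finset.mem_univ i) ?_)).trans (mul_zero _)
      exact HomEl.pair_of_ne hi
  rw [h1]
  refine Submodule.sum_mem _ fun I _ => Submodule.smul_mem _ _ (Submodule.subset_span ⟨_, ?_, rfl⟩)
  rw [← hq, Finset.sum_neg_distrib, neg_neg]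

/-- Only tuples of degrees in which all components are non-zero contribute, and there are finitely
many of them with the given sum. -/
theorem multiFun_mem (hE : ∀ (v : F.Vert) (m : ℤ), FiniteDimensional k ((E.obj v).X m))
    (hN : {p : Fin n → ℤ | ∑ i, p i = N ∧ ∀ i, Nontrivial ((E.obj ⟨X i⟩).X (p i))}.Finite)
    (f : ∀ p : Fin n → ℤ, ∑ i, p i = N → MultilinearMap k (fun i => (E.obj ⟨X i⟩).X (p i)) k) :
    multiFun f ∈ productFun E X (-N) := by
  classical
  have h1 : multiFun f = ∑ p ∈ hN.toFinset, fun y => if ∀ i, (y i).1 = p i then multiFun f y else 0 := by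
    funext y
    rw [Finset.sum_apply]
    by_cases hy : (fun i => (y i).1) ∈ hN.toFinset
    · rw [Finset.sum_eq_single_of_mem _ hy fun p _ hp => if_neg fun h =>
        hp (funext fun i => (h i).symm), if_pos fun _ => rfl]
    · rw [Finset.sum_eq_zero fun p hp => if_neg fun h => hy (by
        rwa [show (fun i => (y i).1) = p from funext h])]
      unfold multiFun
      split_ifs with h
      · rw [Set.Finite.mem_toFinset, Set.mem_ofPred_eq, not_and] at hy
        have h2 := hy h
        push Not at h2
        obtain ⟨i, hi⟩ := h2
        exact MultilinearMap.map_coord_zero _ i (hi.elim _ _)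
      · rfl
  rw [h1]
  refine Submodule.sum_mem _ fun p hp => ?_
  obtain ⟨q, rfl⟩ : ∃ q : Fin n → ℤ, p = fun i => -q i := ⟨fun i => -p i, by simp⟩
  exact multiFun_part_mem hE f q ((Set.Finite.mem_toFinset _).1 hp).1

end

variable {E : VMod F k} {ε δ : Parity} {v : F.V} {m m' : ℤ}

/-- The function on the inputs of an operation of degree one given by a functional on the free operad. -/
noncomputable def functionalFun (l : ((Ops.free E ε).obj v).X m →ₗ[k] k) {n : ℕ} {X : Fin n → F.V}
    (a : F.Op X v) (ha : deg a = 1) : (∀ i, E.el (X i)) → k :=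
  multiFun (N := m - ε.shift 1) fun p hp => (l.compMultilinearMap
    ((Ops.free E ε).act a ha.le p m (by rw [ha, hp, sub_add_cancel]))).compLinearMap fun i =>
      (((Ops.unit (E := E) (ε := ε)).app ⟨X i⟩).f (p i)).hom

/-- Both conditions of finite type enter: finite-dimensional components allow expansion in dual
bases, and finitely many tuples of degrees make the resulting sum finite. -/
theorem functionalFun_mem (hE : FiniteType E) (l : ((Ops.free E ε).obj v).X m →ₗ[k] k) {n : ℕ}
    {X : Fin n → F.V} (a : F.Op X v) (ha : deg a = 1) :
    functionalFun l a ha ∈ productFun E X (-(m - ε.shift 1)) :=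
  multiFun_mem hE.finite (hE.finite_degrees a ha _) _

theorem functionalFun_mk (l : ((Ops.free E ε).obj v).X m →ₗ[k] k) {n : ℕ} {X : Fin n → F.V}
    (a : F.Op X v) (ha : deg a = 1) (p : Fin n → ℤ) (hp : ∑ i, p i + ε.shift (deg a) = m)
    (x : ∀ i, (E.obj ⟨X i⟩).X (p i)) : functionalFun l a ha (fun i => ⟨p i, x i⟩) =
      l ((Ops.free E ε).act a ha.le p m hp fun i => Ops.gen E ε (x i)) :=
  dif_pos (by rw [← hp, ha, add_sub_cancel_right])

/-- A match rewrites the element given by `t` as `a` applied to the transported arguments, up to the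
sign of the permutation. So every match contributes the same value of `l`. -/
theorem functional_eval (l : ((Ops.free E ε).obj v).X m →ₗ[k] k) (t : WGen E ε v m) {n : ℕ}
    {X : Fin n → F.V} (a : F.Op X v) (ha : deg a = 1) (s : IsoMatch a t.op) :
    sgn k (permKoszul s.π t.p) * functionalFun l a ha
      (fun j => HomEl.map (E.map (s.u j)) (t.test.x (s.π j))) = l t.eval := by
  have hd : deg (pull s.π s.u a) = 1 := (congrArg deg s.comp).trans t.deg_op
  have ht : ∑ i, t.p i + ε.shift 1 = m := t.deg_op ▸ t.h
  have hp : ∑ j, t.p (s.π j) + ε.shift (deg a) = m := by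
    rw [ha]
    exact (congrArg (· + _) (Equiv.sum_comp s.π t.p)).trans ht
  refine (congrArg (_ * ·) (functionalFun_mk l a ha (fun j => t.p (s.π j)) hp _)).trans ?_
  refine (map_smul l _ _).symm.trans (congrArg l ?_)
  have h1 : t.eval = (Ops.free E ε).act (pull s.π s.u a) hd.le t.p m (by rw [hd]; exact ht)
      (fun i => Ops.gen E ε (t.x i)) := (Ops.free E ε).act_congr s.comp.symm _ _ _ _ _ _ _
  refine Eq.trans ?_ h1.symm
  refine Eq.trans ?_ ((Ops.free E ε).act_pull s.π s.u a ha.le hd.le t.p m _ hp _).symm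
  exact congrArg (fun z => sgn k (permKoszul s.π t.p) • (Ops.free E ε).act a ha.le
    (fun j => t.p (s.π j)) m hp z) (funext fun j => Ops.gen_map (s.u j) (t.x (s.π j)))

/-- For a product of functionals, `ξ` is the operation `a` with these functionals at its inputs;
both sides are linear in `f`. The relation between `m` and `m'` gives this generator the degree
`m'`. -/
theorem exists_weightPair_product (hm : m + m' = ε.shift 1 + δ.shift 1) {n : ℕ} {X : Fin n → F.V}
    (a : F.Op X v) (ha : deg a = 1) {f : (∀ i, E.el (X i)) → k}
    (hf : f ∈ productFun E X (-(m - ε.shift 1))) :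
    ∃ ξ : WGen (dualModule E) δ v m' →₀ k, ∀ t : WGen E ε v m,
      weightPairLin E ε δ v m m' ξ (Finsupp.single t 1) = ∑ s : IsoMatch a t.op,
        sgn k (permKoszul s.π t.p) * f (fun j => HomEl.map (E.map (s.u j)) (t.test.x (s.π j))) := by
  induction hf using Submodule.span_induction with
  | mem f hf =>
    obtain ⟨η, hη, rfl⟩ := hf
    refine ⟨Finsupp.single ⟨n, X, a, ha, fun i => (η i).1, by rw [hη, ha]; omega,
      fun i => (η i).2⟩ 1, fun t => ?_⟩
    rw [weightPairLin_single, one_mul, one_mul]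
    exact weightPair_eq _ t
  | zero =>
    refine ⟨0, fun t => ?_⟩
    rw [map_zero]
    exact (Finset.sum_eq_zero fun s _ => mul_zero _).symm
  | add f g _ _ hf hg =>
    obtain ⟨ξ, hξ⟩ := hf
    obtain ⟨ξ', hξ'⟩ := hg
    refine ⟨ξ + ξ', fun t => ?_⟩
    rw [map_add, LinearMap.add_apply, hξ, hξ', ← Finset.sum_add_distrib]
    exact Finset.sum_congr rfl fun s _ => (mul_add _ _ _).symm
  | smul c f _ hf =>
    obtain ⟨ξ, hξ⟩ := hf
    refine ⟨c • ξ, fun t => ?_⟩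
    rw [map_smul, LinearMap.smul_apply, hξ, Finset.smul_sum]
    exact Finset.sum_congr rfl fun s _ => mul_left_comm _ _ _

variable (F) in
/-- The operations of degree one with a given target. -/
abbrev DegOneOp (v : F.V) := Σ n : ℕ, Σ X : Fin n → F.V, {a : F.Op X v // deg a = 1}

noncomputable instance (v : F.V) : Fintype (DegOneOp F v) :=
  have : Finite (DegOneOp F v) := F.cubical.finite_deg_one v
  Fintype.ofFinite _

/-- The number of isomorphisms from operations of degree one to a given one. -/
noncomputable def matchCount {n : ℕ} {X : Fin n → F.V} (a : F.Op X v) : ℕ :=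
  ∑ b : DegOneOp F v, Fintype.card (IsoMatch b.2.2.1 a)

/-- Composition with `s` is injective; applied also to the inverse of `s`, this makes `matchCount`
an invariant of isomorphism classes. -/
theorem IsoMatch.card_eq {n n' l : ℕ} {X : Fin n → F.V} {Y : Fin n' → F.V} {Z : Fin l → F.V}
    {a : F.Op X v} {b : F.Op Y v} (c : F.Op Z v) (s : IsoMatch b a) :
    Fintype.card (IsoMatch c b) ≤ Fintype.card (IsoMatch c a) := by
  refine Fintype.card_le_of_injective (fun t => t.trans s) ?_
  rintro ⟨π, u, h⟩ ⟨π', u', h'⟩ hs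
  obtain ⟨ρ, t, ht⟩ := s
  have h1 : π.trans ρ = π'.trans ρ := congrArg IsoMatch.π hs
  obtain rfl : π = π' := by
    ext i
    exact congrArg Fin.val (ρ.injective (congrArg (fun e => e i) h1))
  have h2 : (fun j => t (π j) ≫ u j) = fun j => t (π j) ≫ u' j := eq_of_heq (IsoMatch.mk.inj hs).2
  obtain rfl : u = u' := funext fun j => (cancel_epi (t (π j))).1 (congrFun h2 j)
  rfl

theorem matchCount_eq {n n' : ℕ} {X : Fin n → F.V} {Y : Fin n' → F.V} {a : F.Op X v} {b : F.Op Y v}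
    (s : IsoMatch b a) : matchCount b = matchCount a :=
  Finset.sum_congr rfl fun c _ => le_antisymm (IsoMatch.card_eq c.2.2.1 s)
    (IsoMatch.card_eq c.2.2.1 s.symm)

theorem matchCount_pos {n : ℕ} {X : Fin n → F.V} (a : F.Op X v) (ha : deg a = 1) :
    0 < matchCount a :=
  Finset.sum_pos' (fun _ _ => Nat.zero_le _) ⟨⟨n, X, a, ha⟩, Finset.mem_univ _,
    Fintype.card_pos_iff.2 ⟨IsoMatch.refl a⟩⟩

/-- Every functional on the weight one part of the free operad is given by the pairing. -/
theorem exists_weightPairLin_eq [CharZero k] (hE : FiniteType E)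
    (hm : m + m' = ε.shift 1 + δ.shift 1) (l : ((Ops.free E ε).obj v).X m →ₗ[k] k) :
    ∃ ξ : WGen (dualModule E) δ v m' →₀ k, ∀ ζ : WGen E ε v m →₀ k,
      weightPairLin E ε δ v m m' ξ ζ = l (evalLin E ε v m ζ) := by
  have h1 : ∀ b : DegOneOp F v, ∃ ξ : WGen (dualModule E) δ v m' →₀ k, ∀ t : WGen E ε v m,
      weightPairLin E ε δ v m m' ξ (Finsupp.single t 1) =
        Fintype.card (IsoMatch b.2.2.1 t.op) * l t.eval := by
    intro b
    obtain ⟨ξ, hξ⟩ := exists_weightPair_product hm b.2.2.1 b.2.2.2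
      (functionalFun_mem hE l b.2.2.1 b.2.2.2)
    refine ⟨ξ, fun t => (hξ t).trans ?_⟩
    refine (Finset.sum_congr rfl fun s _ => functional_eval l t b.2.2.1 b.2.2.2 s).trans ?_
    rw [Finset.sum_const, Finset.card_univ, nsmul_eq_mul]
  choose ξ hξ using h1
  -- Each `ξ b` represents `l` multiplied by the number of matches with `b`. If there is a match of
  -- `b` with the operation of `t`, the two have the same `matchCount`, and this is the sum of the
  -- numbers of matches over all `b`; so the weighted sum represents `l`.
  refine ⟨∑ b, (matchCount b.2.2.1 : k)⁻¹ • ξ b, fun ζ => ?_⟩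
  have : weightPairLin E ε δ v m m' (∑ b, (matchCount b.2.2.1 : k)⁻¹ • ξ b) =
      l ∘ₗ evalLin E ε v m := by
    refine Finsupp.lhom_ext' fun t => LinearMap.ext_ring ?_
    have h2 : (l ∘ₗ evalLin E ε v m) (Finsupp.single t 1) = l t.eval :=
      congrArg l ((WGen.evalLin_single t 1).trans (one_smul _ _))
    refine Eq.trans ?_ h2.symm
    change weightPairLin E ε δ v m m' _ (Finsupp.single t 1) = _
    rw [map_sum, LinearMap.sum_apply]
    have h3 : (matchCount t.op : k) ≠ 0 := Nat.cast_ne_zero.2 (matchCount_pos t.op t.deg_op).ne'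
    have h4 : ∀ b : DegOneOp F v, weightPairLin E ε δ v m m' ((matchCount b.2.2.1 : k)⁻¹ • ξ b)
        (Finsupp.single t 1) = (matchCount t.op : k)⁻¹ * (Fintype.card (IsoMatch b.2.2.1 t.op) *
          l t.eval) := by
      intro b
      rw [map_smul, LinearMap.smul_apply, hξ, smul_eq_mul]
      by_cases hb : Nonempty (IsoMatch b.2.2.1 t.op)
      · rw [matchCount_eq hb.some]
      · rw [not_nonempty_iff] at hb
        rw [Fintype.card_eq_zero, Nat.cast_zero, zero_mul, mul_zero, mul_zero]
    rw [Finset.sum_congr rfl fun b _ => h4 b, ← Finset.mul_sum, ← Finset.sum_mul, ← Nat.cast_sum]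
    exact inv_mul_cancel_left₀ h3 _
  exact LinearMap.congr_fun this ζ

end Nondegeneracy

/-! ### Operations over a given one, and a bijection between isomorphisms in the two categories -/

section Adjunction

open CubicalFeynmanCat ColOperad CubicalMorphism

variable {k : Type u} [Field k] {F₁ F₂ : CubicalFeynmanCat.{u}} {φ : CubicalMorphism F₁ F₂}

theorem arrow_pull_refl {F : CubicalFeynmanCat.{u}} {n : ℕ} {X Y : Fin n → F.V} {v : F.V}
    (u : ∀ j, (⟨X j⟩ : F.Vert) ⟶ ⟨Y j⟩) (b : F.Op Y v) :
    arrow (pull (Equiv.refl (Fin n)) u b) = (vhom u ≫ arrow b : fam X ⟶ single v) := by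
  refine (arrow_pull (Equiv.refl (Fin n)) u b).trans (congrArg (· ≫ arrow b) ?_)
  refine Mor.ext rfl (heq_of_eq (funext fun j => ?_))
  exact reindex_congr (X := fun i : {i : Fin n // i = j} => X i.1)
    (fun i => Subtype.ext ((fiberEquiv (n := fun _ => 1) ((sigmaOne (Fin n)).trans (Equiv.refl _)) j i).2.trans
      (fiberOne j i).2.symm)) (vop (u j)) rfl rfl

/-- The families of classes over the inputs of an operation such that there is an operation over it. -/
abbrev OverCell {n : ℕ} {X : Fin n → F₂.V} {v : F₂.V} (a : F₂.Op X v) (c₀ : φ.Cell v) :=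
  {c : ∀ i, φ.Cell (X i) // ∃ g, IsOver a c c₀ g}

namespace OverCell

variable {n : ℕ} {X : Fin n → F₂.V} {v : F₂.V} {a : F₂.Op X v} {c₀ : φ.Cell v}

/-- The operation that lies over the given one. -/
noncomputable def op (c : OverCell a c₀) : F₁.Op (fun i => (c.1 i).w) c₀.w := c.2.choose

theorem isOver (c : OverCell a c₀) : IsOver a c.1 c₀ c.op := c.2.choose_spec

noncomputable instance : Fintype (OverCell a c₀) := Fintype.ofFinite _

end OverCell

/-- Translates the commutative square of `IsOver` into the language of `push` and `pull` in which
matches are expressed. -/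
theorem isOver_iff_push {n : ℕ} {X : Fin n → F₂.V} {v : F₂.V} {a : F₂.Op X v} {c₀ : φ.Cell v}
    {c : ∀ i, φ.Cell (X i)} {g : F₁.Op (fun i => (c i).w) c₀.w} : IsOver a c c₀ g ↔
      push (v := φ.obj c₀.w) c₀.σ (φ.map g) =
        pull (X := fun i => φ.obj (c i).w) (Equiv.refl (Fin n)) (fun i => (c i).σ) a := by
  unfold IsOver
  have h1 := arrow_push (v := φ.obj c₀.w) c₀.σ (φ.map g)
  have h2 := arrow_pull_refl (X := fun i => φ.obj (c i).w) (fun i => (c i).σ) a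
  rw [map_arrow]
  constructor
  · intro h
    exact arrow_injective (h1.trans (h.trans h2.symm))
  · intro h
    exact h1.symm.trans ((congrArg arrow h).trans h2)

section Matches

variable {n n' : ℕ} {X : Fin n → F₂.V} {Y : Fin n' → F₁.V} {v : F₂.V} {c₀ : φ.Cell v}
  {a : F₂.Op X v} {b : F₁.Op Y c₀.w}

/-- The isomorphisms of the cells at the inputs are invertible and can be moved to the other side of
the equation, where they combine with the images of `u`. -/
theorem pull_eq_of_isOver {c : ∀ i, φ.Cell (X i)} {π : Fin n' ≃ Fin n}
    {u : ∀ j, (⟨(c (π j)).w⟩ : F₁.Vert) ⟶ ⟨Y j⟩} :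
    IsOver a c c₀ (pull (X := fun i => (c i).w) π u b) ↔
      pull (Y := fun j => φ.obj (Y j)) π
        (fun j => (Groupoid.inv (c (π j)).σ : _ ⟶ (⟨φ.obj (c (π j)).w⟩ : F₂.Vert)) ≫ φ.vert.map (u j))
          (push (v := φ.obj c₀.w) c₀.σ (φ.map b)) = a := by
  rw [isOver_iff_push]
  have h1 : push (v := φ.obj c₀.w) c₀.σ (φ.map (pull (X := fun i => (c i).w) π u b)) =
      pull (X := fun i => φ.obj (c i).w) (Y := fun j => φ.obj (Y j)) π (fun j => φ.vert.map (u j))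
        (push (v := φ.obj c₀.w) c₀.σ (φ.map b)) :=
    (congrArg (push (v := φ.obj c₀.w) c₀.σ) (map_pull (X := fun i => (c i).w) π u b)).trans
      (push_pull _ _ _ _)
  have h2 : ∀ z : F₂.Op X v, pull (X := X) (Y := fun i => φ.obj (c i).w) (Equiv.refl (Fin n))
      (fun i => (Groupoid.inv (c i).σ : _ ⟶ (⟨φ.obj (c i).w⟩ : F₂.Vert)))
      (pull (X := fun i => φ.obj (c i).w) (Equiv.refl (Fin n)) (fun i => (c i).σ) z) = z := by
    intro z
    refine (pull_pull (X := X) (Y := fun i => φ.obj (c i).w) (Z := X) (Equiv.refl (Fin n)) _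
      (Equiv.refl (Fin n)) (fun i => (c i).σ) z).trans ?_
    refine Eq.trans ?_ (pull_refl z)
    exact congrArg (fun t => pull (X := X) (Y := X) (Equiv.refl (Fin n)) t z)
      (funext fun i => Groupoid.inv_comp _)
  have h3 : ∀ z : F₂.Op (fun i => φ.obj (c i).w) v, pull (X := fun i => φ.obj (c i).w) (Y := X)
      (Equiv.refl (Fin n)) (fun i => (c i).σ)
      (pull (X := X) (Y := fun i => φ.obj (c i).w) (Equiv.refl (Fin n))
        (fun i => (Groupoid.inv (c i).σ : _ ⟶ (⟨φ.obj (c i).w⟩ : F₂.Vert))) z) = z := by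
    intro z
    refine (pull_pull (X := fun i => φ.obj (c i).w) (Y := X) (Z := fun i => φ.obj (c i).w)
      (Equiv.refl (Fin n)) (fun i => (c i).σ) (Equiv.refl (Fin n)) _ z).trans ?_
    refine Eq.trans ?_ (pull_refl z)
    exact congrArg (fun t => pull (X := fun i => φ.obj (c i).w) (Y := fun i => φ.obj (c i).w)
      (Equiv.refl (Fin n)) t z) (funext fun i => Groupoid.comp_inv _)
  have h4 : pull (X := X) (Y := fun i => φ.obj (c i).w) (Equiv.refl (Fin n))
      (fun i => (Groupoid.inv (c i).σ : _ ⟶ (⟨φ.obj (c i).w⟩ : F₂.Vert)))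
      (pull (X := fun i => φ.obj (c i).w) (Y := fun j => φ.obj (Y j)) π (fun j => φ.vert.map (u j))
        (push (v := φ.obj c₀.w) c₀.σ (φ.map b))) = pull (Y := fun j => φ.obj (Y j)) π
        (fun j => (Groupoid.inv (c (π j)).σ : _ ⟶ (⟨φ.obj (c (π j)).w⟩ : F₂.Vert)) ≫ φ.vert.map (u j))
          (push (v := φ.obj c₀.w) c₀.σ (φ.map b)) :=
    pull_pull (X := X) (Y := fun i => φ.obj (c i).w) (Z := fun j => φ.obj (Y j)) (Equiv.refl (Fin n))
      _ π _ _
  constructor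
  · intro h
    refine h4.symm.trans (Eq.trans ?_ (h2 a))
    exact congrArg (pull (X := X) (Y := fun i => φ.obj (c i).w) (Equiv.refl (Fin n)) _)
      (h1.symm.trans h)
  · intro h
    refine h1.trans ((h3 _).symm.trans ?_)
    exact congrArg (pull (X := fun i => φ.obj (c i).w) (Y := X) (Equiv.refl (Fin n)) _) (h4.trans h)

/-- The match of operations of `F₂` given by a match of operations of `F₁`. -/
noncomputable def OverCell.match (s : Σ c : OverCell a c₀, IsoMatch b c.op) :
    IsoMatch (Y := fun j => φ.obj (Y j)) (push (v := φ.obj c₀.w) c₀.σ (φ.map b)) a where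
  π := s.2.π
  u j := (Groupoid.inv (s.1.1 (s.2.π j)).σ : _ ⟶ (⟨φ.obj (s.1.1 (s.2.π j)).w⟩ : F₂.Vert)) ≫
    φ.vert.map (s.2.u j)
  comp := pull_eq_of_isOver.1 ((congrArg (IsOver a s.1.1 c₀) s.2.comp).mpr s.1.isOver)

/-- Equality of the two matches makes `u j ≫ (u' j)⁻¹` an isomorphism of pairs, so the cells agree;
then `u` and `u'` have the same image and agree because `φ` is faithful. -/
theorem OverCell.match_injective (hφ : φ.Admissible) :
    Function.Injective (OverCell.match (a := a) (c₀ := c₀) (b := b)) := by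
  rintro ⟨c, π, u, h⟩ ⟨d, π', u', h'⟩ hs
  obtain rfl : π = π' := congrArg IsoMatch.π hs
  have h2 : (fun j => (Groupoid.inv (c.1 (π j)).σ : _ ⟶ (⟨φ.obj (c.1 (π j)).w⟩ : F₂.Vert)) ≫
      φ.vert.map (u j)) = fun j => (Groupoid.inv (d.1 (π j)).σ : _ ⟶
        (⟨φ.obj (d.1 (π j)).w⟩ : F₂.Vert)) ≫ φ.vert.map (u' j) := eq_of_heq (IsoMatch.mk.inj hs).2
  obtain rfl : c = d := by
    refine Subtype.ext (funext fun i => ?_)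
    obtain ⟨j, rfl⟩ := π.surjective i
    refine Cell.eq_of_hom (u j ≫ Groupoid.inv (u' j)) ?_
    have h3 := congrFun h2 j
    have key : ∀ {C : Type _} [Groupoid C] {x y z t : C} (σ : x ⟶ y) (τ : z ⟶ y) (f : x ⟶ t)
        (g : z ⟶ t), Groupoid.inv σ ≫ f = Groupoid.inv τ ≫ g → (f ≫ Groupoid.inv g) ≫ τ = σ := by
      intro C _ x y z t σ τ f g h
      simp only [Groupoid.inv_eq_inv] at h ⊢
      have h5 : f = σ ≫ inv τ ≫ g := by rw [← h]; simp
      rw [h5]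
      simp
    exact (congrArg (· ≫ (d.1 (π j)).σ) (φ.vert.map_comp _ _)).trans (key _ _ _ _ h3)
  obtain rfl : u = u' := by
    funext j
    have h3 := (cancel_epi (Groupoid.inv (c.1 (π j)).σ)).1 (congrFun h2 j)
    have := hφ.faithful
    exact Iso.ext (φ.functor.map_injective (congrArg Iso.hom h3))
  rfl

/-- The cells are forced: at the input `π j` it has to be the class of `Y j` with the inverse of `u
j`. -/
theorem OverCell.match_surjective (hφ : φ.Admissible) :
    Function.Surjective (OverCell.match (a := a) (c₀ := c₀) (b := b)) := by
  rintro ⟨π, u, h⟩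
  have h1 : ∀ i, ∃ c : φ.Cell (X i), ∀ (j : Fin n') (hj : π j = i),
      ∃ θ : (⟨Y j⟩ : F₁.Vert) ⟶ ⟨c.w⟩, φ.vert.map θ ≫ c.σ =
        IsoMatch.invU (Y := fun j => φ.obj (Y j)) π u i j hj := by
    intro i
    obtain ⟨j, rfl⟩ := π.surjective i
    obtain ⟨c, θ, hθ⟩ := Cell.exists_hom (φ := φ) (⟨Y j, Groupoid.inv (u j)⟩ : φ.Lift (X (π j)))
    refine ⟨c, fun j' hj => ?_⟩
    obtain rfl := π.injective hj
    exact ⟨θ, hθ⟩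
  choose c hc using h1
  choose θ hθ using fun j => hc (π j) j rfl
  obtain rfl : (fun j => (Groupoid.inv (c (π j)).σ : _ ⟶ (⟨φ.obj (c (π j)).w⟩ : F₂.Vert)) ≫
      φ.vert.map (Groupoid.inv (θ j))) = u := by
    funext j
    have h2 : φ.vert.map (θ j) ≫ (c (π j)).σ = Groupoid.inv (u j) := hθ j
    have key : ∀ {C : Type _} [Groupoid C] {x y z : C} (σ : x ⟶ y) (f : z ⟶ x) (g : y ⟶ z),
        f ≫ σ = Groupoid.inv g → Groupoid.inv σ ≫ Groupoid.inv f = g := by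
      intro C _ x y z σ f g h
      have h' : (f ≫ σ) ≫ g = 𝟙 _ := by rw [h, Groupoid.inv_comp]
      rw [← Category.comp_id (Groupoid.inv f), ← h']
      simp
    exact key _ _ _ h2
  have h2 := (pull_eq_of_isOver (c := c) (u := fun j => Groupoid.inv (θ j))).2 h
  -- The operation chosen over `a` for this family of cells is the one pulled back from `b`, as
  -- there is at most one.
  have h3 : OverCell.op (⟨c, _, h2⟩ : OverCell a c₀) = _ := (OverCell.isOver _).unique hφ h2
  exact ⟨⟨⟨c, _, h2⟩, π, fun j => Groupoid.inv (θ j), h3.symm⟩, rfl⟩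

variable {E : VMod F₂ k}

/-- The core of the adjointness of components and images. The sum over operations above `a` and over
their matches with `b` becomes, under `OverCell.match`, the sum over matches in `F₂`; the bijections
of inputs are unchanged and the factors agree by the functoriality of `E`. -/
theorem sum_opPair_overCell (hφ : φ.Admissible) (η : ∀ j, (dualModule (Ops.resV φ E)).el (Y j))
    (x : ∀ i, E.el (X i)) :
    ∑ c : OverCell a c₀, opPair (E := Ops.resV φ E) b η c.op
      (fun i => HomEl.map (E.map (Groupoid.inv (c.1 i).σ)) (x i)) =
    opPair (E := E) (Y := fun j => φ.obj (Y j)) (push (v := φ.obj c₀.w) c₀.σ (φ.map b)) η a x := by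
  unfold opPair
  rw [Finset.sum_sigma']
  refine Fintype.sum_bijective OverCell.match
    ⟨OverCell.match_injective hφ, OverCell.match_surjective hφ⟩ _ _ fun s => ?_
  refine congrArg (_ * ·) (Finset.prod_congr rfl fun j _ => ?_)
  refine congrArg (HomEl.pair (C := E.obj ⟨φ.obj (Y j)⟩) (η j)) ?_
  exact congrArg (fun f => HomEl.map f (x (s.2.π j))) (E.map_comp _ _).symm

end Matches

end Adjunction

/-! ### Taking components in the push-forward is adjoint to taking images -/

section ShriekPairing

open CubicalFeynmanCat ColOperad CubicalMorphism

variable {k : Type u} [Field k] {F₁ F₂ : CubicalFeynmanCat.{u}} {φ : CubicalMorphism F₁ F₂}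
  {E : VMod F₂ k} {ε δ : Parity} {v : F₂.V} {m m' : ℤ}

namespace WGen

/-- The part over a family of classes of the image in `L^! F₁(rE)` of a generator of weight one. -/
noncomputable def overAt {c₀ : φ.Cell v} (t : WGen E ε v m) (c : OverCell t.op c₀) :
    WGen (Ops.resV φ E) ε c₀.w m where
  n := t.n
  X i := (c.1 i).w
  op := c.op
  deg_op := c.isOver.deg_eq.trans t.deg_op
  p := t.p
  h := (congrArg (fun d => ∑ i, t.p i + ε.shift d) c.isOver.deg_eq).trans t.h
  x i := ((E.map (Groupoid.inv (c.1 i).σ)).f (t.p i)).hom (t.x i)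

/-- The component at a class of the image in `L^! F₁(rE)` of a generator of weight one. -/
noncomputable def shriek (c₀ : φ.Cell v) (t : WGen E ε v m) : WGen (Ops.resV φ E) ε c₀.w m →₀ k :=
  ∑ c : OverCell t.op c₀, Finsupp.single (t.overAt c) 1

/-- The same for linear combinations. -/
noncomputable def shriekLin (c₀ : φ.Cell v) :
    (WGen E ε v m →₀ k) →ₗ[k] (WGen (Ops.resV φ E) ε c₀.w m →₀ k) :=
  Finsupp.linearCombination k (shriek c₀)

/-- The structure map of the push-forward is a sum over families of cells at the inputs. The
components of a generator of `E` at these cells are its transports along the inverse isomorphisms,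
which are the entries of `overAt`. -/
theorem lProj_eval (hφ : φ.Admissible) (c₀ : φ.Cell v) (t : WGen E ε v m) :
    Ops.lProj hφ _ c₀ m (Ops.hap (Ops.freeToShriek hφ E ε) v m t.eval) =
      evalLin _ _ _ m (t.shriek c₀) := by
  classical
  unfold shriek
  rw [map_sum]
  refine (congrArg (Ops.lProj hφ _ c₀ m) (Ops.hap_act (Ops.freeToShriek hφ E ε) t.op t.deg_op.le
    t.p m t.h fun i => Ops.gen E ε (t.x i))).trans ?_
  refine (Ops.lRaw_act (Ops.free (Ops.resV φ E) ε).toRawOp t.op t.deg_op.le t.p m t.h _ c₀).trans ?_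
  -- Families of cells without an operation over `t.op` have coefficient zero.
  refine (Finset.sum_filter_of_ne (p := fun c => ∃ g, IsOver t.op c c₀ g) ?_).symm.trans ?_
  · intro c _ hc
    by_contra hg
    exact hc (congrArg (fun f : MultilinearMap k _ (((Ops.free (Ops.resV φ E) ε).obj c₀.w).X m) => f _)
      (Ops.coef_zero (Ops.free (Ops.resV φ E) ε).toRawOp t.deg_op.le t.p m t.h hg))
  refine (Finset.sum_subtype (M := ((Ops.free (Ops.resV φ E) ε).obj c₀.w).X m) (F := inferInstanceAs (Fintype (OverCell t.op c₀)))
    (p := fun c => ∃ g, IsOver t.op c c₀ g)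
    (Finset.univ.filter fun c => ∃ g, IsOver t.op c c₀ g)
    (fun c => ⟨fun h => (Finset.mem_filter.1 h).2,
      fun h => Finset.mem_filter.2 ⟨Finset.mem_univ _, h⟩⟩) _ :).trans ?_
  refine Finset.sum_congr rfl fun c _ => ?_
  refine Eq.trans ?_ ((evalLin_single (t.overAt c) 1).trans (one_smul k _)).symm
  exact congrArg (fun f : MultilinearMap k _ (((Ops.free (Ops.resV φ E) ε).obj c₀.w).X m) => f _)
    (Ops.coef_eq (Ops.free (Ops.resV φ E) ε).toRawOp hφ t.deg_op.le t.p m t.h (OverCell.isOver c)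
      (t.overAt c).deg_op.le (t.overAt c).h)

theorem lProj_evalLin (hφ : φ.Admissible) (c₀ : φ.Cell v) (ζ : WGen E ε v m →₀ k) :
    Ops.lProj hφ _ c₀ m (Ops.hap (Ops.freeToShriek hφ E ε) v m (evalLin E ε v m ζ)) =
      evalLin _ _ _ m (shriekLin c₀ ζ) := by
  have : Ops.lProj hφ _ c₀ m ∘ₗ Ops.hap (Ops.freeToShriek hφ E ε) v m ∘ₗ evalLin E ε v m =
      evalLin _ _ _ m ∘ₗ shriekLin c₀ := by
    refine Finsupp.lhom_ext' fun t => LinearMap.ext_ring ?_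
    refine (congrArg (fun z => Ops.lProj hφ _ c₀ m (Ops.hap (Ops.freeToShriek hφ E ε) v m z))
      ((evalLin_single t 1).trans (one_smul k _))).trans ((lProj_eval hφ c₀ t).trans ?_)
    exact congrArg (evalLin _ _ _ m)
      ((Finsupp.linearCombination_single k (1 : k) t).trans (one_smul k _)).symm
  exact LinearMap.congr_fun this ζ

end WGen

/-- The generator of weight one of `F₂(E^*)` given by one of `F₁(rE^*)` at a class. -/
noncomputable def WGen.imageAt (c₀ : φ.Cell v) (s : WGen (dualModule (Ops.resV φ E)) δ c₀.w m') :
    WGen (dualModule E) δ v m' :=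
  (WGen.image (G := dualModule E) φ s).push (v := φ.obj c₀.w) c₀.σ

/-- The same for linear combinations. -/
noncomputable def WGen.imageLin (c₀ : φ.Cell v) :
    (WGen (dualModule (Ops.resV φ E)) δ c₀.w m' →₀ k) →ₗ[k] (WGen (dualModule E) δ v m' →₀ k) :=
  Finsupp.lmapDomain k k (WGen.imageAt c₀)

theorem WGen.imageLin_single (c₀ : φ.Cell v) (s : WGen (dualModule (Ops.resV φ E)) δ c₀.w m') (a : k) :
    imageLin c₀ (Finsupp.single s a) = Finsupp.single (s.imageAt c₀) a := Finsupp.mapDomain_single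

theorem WGen.evalLin_imageLin (hφ : φ.Admissible) (c₀ : φ.Cell v)
    (ξ : WGen (dualModule (Ops.resV φ E)) δ c₀.w m' →₀ k) :
    evalLin (dualModule E) δ v m' (imageLin c₀ ξ) = (Ops.free (dualModule E) δ).vmap c₀.σ m'
      (Ops.hap (Ops.beta hφ (dualModule E) δ) c₀.w m' (evalLin _ _ _ m' ξ)) := by
  have : evalLin (dualModule E) δ v m' ∘ₗ imageLin c₀ = (Ops.free (dualModule E) δ).vmap c₀.σ m' ∘ₗ
      Ops.hap (Ops.beta hφ (dualModule E) δ) c₀.w m' ∘ₗ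
        evalLin (dualModule (Ops.resV φ E)) δ c₀.w m' := by
    refine Finsupp.lhom_ext' fun s => LinearMap.ext_ring ?_
    refine (congrArg (evalLin (dualModule E) δ v m') (imageLin_single c₀ s 1)).trans ?_
    refine ((evalLin_single _ _).trans (one_smul _ _)).trans ?_
    refine (eval_push (v := φ.obj c₀.w) c₀.σ (WGen.image (G := dualModule E) φ s)).trans ?_
    refine congrArg ((Ops.free (dualModule E) δ).vmap c₀.σ m') ?_
    refine (eval_image (G := dualModule E) hφ s).trans ?_
    exact congrArg (Ops.hap (Ops.beta hφ (dualModule E) δ) c₀.w m')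
      ((evalLin_single s 1).trans (one_smul _ _)).symm
  exact LinearMap.congr_fun this ξ

/-- Pairing with the component at a class of the image in `L^! F₁(rE)`. -/
theorem weightPairLin_shriekLin (hφ : φ.Admissible) (c₀ : φ.Cell v)
    (ξ : WGen (dualModule (Ops.resV φ E)) δ c₀.w m' →₀ k) (ζ : WGen E ε v m →₀ k) :
    weightPairLin (Ops.resV φ E) ε δ c₀.w m m' ξ (WGen.shriekLin c₀ ζ) =
      weightPairLin E ε δ v m m' (WGen.imageLin c₀ ξ) ζ := by
  induction ξ using Finsupp.induction_linear with
  | zero => rw [map_zero, map_zero, map_zero]; rfl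
  | add ξ ξ' h h' =>
    rw [map_add, map_add, map_add, LinearMap.add_apply, h, h']
    rfl
  | single s a =>
    induction ζ using Finsupp.induction_linear with
    | zero => rw [map_zero, map_zero, map_zero]
    | add ζ ζ' h h' => rw [map_add, map_add, map_add, h, h']
    | single t b =>
      rw [WGen.imageLin_single, weightPairLin_single]
      refine (congrArg _ (Finsupp.linearCombination_single k b t)).trans ?_
      rw [map_smul, smul_eq_mul]
      unfold WGen.shriek
      rw [map_sum]
      refine Eq.trans ?_ (mul_left_comm _ _ _)
      refine congrArg (b * ·) ?_
      rw [weightPair_eq]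
      refine Eq.trans ?_ (congrArg (a * ·) (sum_opPair_overCell hφ _ _))
      rw [Finset.mul_sum]
      refine Finset.sum_congr rfl fun c _ => ?_
      rw [weightPairLin_single, one_mul, weightPair_eq]
      rfl

end ShriekPairing

/-! ### Comparison with the double dual -/

section Bidual

open CubicalFeynmanCat ColOperad

variable {k : Type u} [Field k] {F : CubicalFeynmanCat.{u}}

variable (E : VMod F k)

/-- The map to the bidual. -/
noncomputable def toBidual : E ⟶ dualModule (dualModule E) where
  app v :=
    { f := fun m => ModuleCat.ofHom (X := (E.obj v).X m)
        (Y := ((dualModule (dualModule E)).obj v).X m)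
        ((Module.Dual.eval k ((E.obj v).X (- -m)) :
          (E.obj v).X (- -m) →ₗ[k] Module.Dual k (Module.Dual k ((E.obj v).X (- -m)))) ∘ₗ
          ((E.obj v).XIsoOfEq (neg_neg m).symm).hom.hom)
      comm' := by
        intro m m' h
        refine ModuleCat.hom_ext (LinearMap.ext fun x => LinearMap.ext fun η => ?_)
        -- Transposing twice without signs returns the differential of `E`, up to the identification
        -- of the degrees `m` and `- -m`.
        have hd : ((E.obj v).XIsoOfEq (neg_neg m).symm).hom ≫ (E.obj v).d (- -m) (- -m') =
            (E.obj v).d m m' ≫ ((E.obj v).XIsoOfEq (neg_neg m').symm).hom :=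
          (HomologicalComplex.XIsoOfEq_hom_comp_d _ _ _).trans
            (HomologicalComplex.d_comp_XIsoOfEq_hom _ _ _).symm
        exact congrArg (fun g : (E.obj v).X m ⟶ (E.obj v).X (- -m') =>
          (show Module.Dual k ((E.obj v).X (- -m')) from η) (g.hom x)) hd }
  naturality v w θ := by
    refine HomologicalComplex.hom_ext _ _ fun m => ModuleCat.hom_ext (LinearMap.ext fun x => LinearMap.ext fun η => ?_)
    have h : (E.map θ).f m ≫ ((E.obj w).XIsoOfEq (neg_neg m).symm).hom =
        ((E.obj v).XIsoOfEq (neg_neg m).symm).hom ≫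
          (E.map (Groupoid.inv (Groupoid.inv θ))).f (- -m) :=
      (HomologicalComplex.XIsoOfEq_hom_naturality (E.map θ) (neg_neg m).symm).trans
        (congrArg (fun f => ((E.obj v).XIsoOfEq (neg_neg m).symm).hom ≫ (E.map f).f (- -m))
          (groupoid_inv_inv θ).symm)
    exact congrArg (fun g : (E.obj v).X m ⟶ (E.obj w).X (- -m) =>
      (show Module.Dual k ((E.obj w).X (- -m)) from η) (g.hom x)) h

theorem toBidual_mk {v : F.Vert} (x : HomEl (E.obj v)) :
    HomEl.map ((toBidual E).app v) x = HomEl.bidual x := rfl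

-- Evaluation is an isomorphism onto the double dual of a finite-dimensional space, in each degree
-- and at each vertex.
variable {E} in
theorem isIso_toBidual (hE : ∀ (v : F.Vert) (m : ℤ), FiniteDimensional k ((E.obj v).X m)) :
    IsIso (toBidual E) := by
  have : ∀ v, IsIso ((toBidual E).app v) := fun v => by
    have : ∀ m, IsIso (((toBidual E).app v).f m) := fun m => by
      have := hE v (- -m)
      exact ((((E.obj v).XIsoOfEq (neg_neg m).symm).toLinearEquiv.trans
        (Module.evalEquiv k ((E.obj v).X (- -m)))).toModuleIso (X₁ := (E.obj v).X m)
          (X₂ := ((dualModule (dualModule E)).obj v).X m)).isIso_hom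
    exact HomologicalComplex.Hom.isIso_of_components _
  exact NatIso.isIso_of_isIso_app _

end Bidual

/-! ### Functoriality of free operads, symmetry of the pairing, isomorphic quotients -/

section FreeMap

open CubicalFeynmanCat ColOperad

variable {k : Type u} [Field k] {F : CubicalFeynmanCat.{u}} {E E' E'' : VMod F k} {ε δ : Parity}

variable (ε) in
/-- The functoriality of the free operad. -/
noncomputable def Ops.freeMap (f : E ⟶ E') : Ops.free E ε ⟶ Ops.free E' ε :=
  Ops.lift (f ≫ Ops.unit)

theorem Ops.freeMap_comp (f : E ⟶ E') (g : E' ⟶ E'') :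
    Ops.freeMap ε f ≫ Ops.freeMap ε g = Ops.freeMap ε (f ≫ g) :=
  Ops.free_hom_ext fun _ _ _ => rfl

theorem Ops.freeMap_id : Ops.freeMap ε (𝟙 E) = 𝟙 _ := Ops.free_hom_ext fun _ _ _ => rfl

/-- The functoriality of the generators of weight one. -/
def WGen.map (f : E ⟶ E') {v : F.V} {m : ℤ} (t : WGen E ε v m) : WGen E' ε v m where
  n := t.n
  X := t.X
  op := t.op
  deg_op := t.deg_op
  p := t.p
  h := t.h
  x i := ((f.app ⟨t.X i⟩).f (t.p i)).hom (t.x i)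

theorem WGen.evalLin_map (f : E ⟶ E') {v : F.V} {m : ℤ} (ζ : WGen E ε v m →₀ k) :
    evalLin E' ε v m (ζ.mapDomain (WGen.map f)) =
      Ops.hap (Ops.freeMap ε f) v m (evalLin E ε v m ζ) := by
  have : evalLin E' ε v m ∘ₗ Finsupp.lmapDomain k k (WGen.map f) =
      Ops.hap (Ops.freeMap ε f) v m ∘ₗ evalLin E ε v m := by
    refine Finsupp.lhom_ext' fun t => LinearMap.ext_ring ?_
    refine (congrArg (evalLin E' ε v m) Finsupp.mapDomain_single).trans ?_
    refine ((evalLin_single _ _).trans (one_smul _ _)).trans ?_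
    refine Eq.trans ?_ (congrArg (Ops.hap (Ops.freeMap ε f) v m)
      ((evalLin_single t 1).trans (one_smul _ _))).symm
    exact (Ops.hap_act (Ops.freeMap ε f) t.op t.deg_op.le t.p m t.h
      fun i => Ops.gen E ε (t.x i)).symm
  exact LinearMap.congr_fun this ζ

/-- The symmetry `opPair_bidual`, extended linearly: orthogonality in the free operad on a double
dual can be tested with the pairing of the dual with the original module. -/
theorem weightPairLin_bidual {v : F.V} {m m' : ℤ} (ζ : WGen E ε v m →₀ k)
    (ξ : WGen (dualModule E) δ v m' →₀ k) :
    weightPairLin (dualModule E) δ ε v m' m (ζ.mapDomain (WGen.map (toBidual E))) ξ =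
      weightPairLin E ε δ v m m' ξ ζ := by
  induction ξ using Finsupp.induction_linear with
  | zero => rw [map_zero, map_zero]; rfl
  | add ξ ξ' h h' => rw [map_add, map_add, LinearMap.add_apply, h, h']
  | single s a =>
    induction ζ using Finsupp.induction_linear with
    | zero => rw [Finsupp.mapDomain_zero, map_zero, map_zero]; rfl
    | add ζ ζ' h h' => rw [Finsupp.mapDomain_add, map_add, map_add, LinearMap.add_apply, h, h']
    | single t b =>
      refine (congrArg (fun z => weightPairLin (dualModule E) δ ε v m' m z (Finsupp.single s a))
        Finsupp.mapDomain_single).trans ?_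
      refine (weightPairLin_single _ _ _ _).trans (Eq.trans ?_ (weightPairLin_single _ _ _ _).symm)
      refine (mul_left_comm _ _ _).trans (congrArg (fun z => a * (b * z)) ?_)
      refine (weightPair_eq _ _).trans (Eq.trans ?_ (weightPair_eq _ _).symm)
      refine Eq.trans ?_ (opPair_bidual (E := E) (x := fun i => ⟨t.p i, t.x i⟩) t.op
        (fun j => ⟨s.p j, s.x j⟩) s.op)
      exact congrArg (fun y : ∀ i, (dualModule (dualModule E)).el (t.X i) =>
        opPair (E := dualModule E) t.op y s.op fun j => ⟨s.p j, s.x j⟩)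
        (funext fun i => toBidual_mk E ⟨t.p i, t.x i⟩)

/-- The degrees of the inputs on the two sides add up to `m - ε.shift 1` and `m' - δ.shift 1`, and
these have to be opposite for a non-zero pairing. -/
theorem weightPairLin_of_ne {v : F.V} {m m' : ℤ} (hm : m + m' ≠ ε.shift 1 + δ.shift 1)
    (ξ : WGen (dualModule E) δ v m' →₀ k) (ζ : WGen E ε v m →₀ k) :
    weightPairLin E ε δ v m m' ξ ζ = 0 := by
  have : weightPairLin E ε δ v m m' = 0 := by
    refine Finsupp.lhom_ext' fun s => LinearMap.ext_ring (Finsupp.lhom_ext' fun t =>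
      LinearMap.ext_ring ?_)
    change weightPairLin E ε δ v m m' (Finsupp.single s 1) (Finsupp.single t 1) = 0
    rw [weightPairLin_single, weightPair_eq, opPair_eq_zero, mul_zero, mul_zero]
    have h1 : ∑ i, s.p i + δ.shift 1 = m' := s.deg_op ▸ s.h
    have h2 : ∑ i, t.p i + ε.shift 1 = m := t.deg_op ▸ t.h
    intro h
    have h' : ∑ i, t.p i = -∑ j, s.p j := h
    omega
  rw [this]
  rfl

/-- Isomorphic operads have isomorphic quotients by corresponding ideals. -/
theorem OpIdeal.nonempty_quot_iso {P Q : Ops F k ε} (f : P ⟶ Q) (g : Q ⟶ P) (hfg : f ≫ g = 𝟙 _)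
    (hgf : g ≫ f = 𝟙 _) (I : OpIdeal P) (J : OpIdeal Q)
    (hf : ∀ v m, I.carrier v m ≤ (OpIdeal.comap f J).carrier v m)
    (hg : ∀ v m, J.carrier v m ≤ (OpIdeal.comap g I).carrier v m) : Nonempty (I.quot ≅ J.quot) := by
  let f' : I.quot ⟶ J.quot := I.desc (f ≫ J.π) fun v m x hx => J.ker_π.2 (hf v m hx)
  let g' : J.quot ⟶ I.quot := J.desc (g ≫ I.π) fun v m x hx => I.ker_π.2 (hg v m hx)
  refine ⟨⟨f', g', I.quot_hom_ext ?_, J.quot_hom_ext ?_⟩⟩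
  · exact (show I.π ≫ f' ≫ g' = (f ≫ g) ≫ I.π from rfl).trans
      ((congrArg (· ≫ I.π) hfg).trans ((Category.id_comp _).trans (Category.comp_id _).symm))
  · exact (show J.π ≫ g' ≫ f' = (g ≫ f) ≫ J.π from rfl).trans
      ((congrArg (· ≫ J.π) hgf).trans ((Category.id_comp _).trans (Category.comp_id _).symm))

end FreeMap

/-! ### The relations of the left adjoint are the orthogonal complement of the restricted relations
-/

section DualOfRestriction

open CubicalFeynmanCat ColOperad CubicalMorphism

variable {k : Type u} [Field k] {F₁ F₂ : CubicalFeynmanCat.{u}} {φ : CubicalMorphism F₁ F₂}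
  {E : VMod F₂ k} {ε δ : Parity}

variable (φ E) in
/-- The map from a restriction to the dual of the restriction of the dual. -/
noncomputable def toResBidual : Ops.resV φ E ⟶ dualModule (Ops.resV φ (dualModule E)) :=
  toBidual (Ops.resV φ E)

variable {S : ∀ (v : F₂.V) (m : ℤ), Submodule k (((Ops.free E ε).obj v).X m)}

/-- Let `ξ` represent an element of `resRel` and `ζ` an element of `S`. By adjointness, the pairing
of `ξ` with a component of `ζ` is the pairing of the image of `ξ` with `ζ`. By the definition of
`resRel` this image lies in the ideal generated by the functionals vanishing on `S`, so the pairing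
is zero by `weightPairLin_eq_zero`. -/
theorem span_shriekRel_le (hφ : φ.Admissible) (hS : IsQuadraticDatum S) (w : F₁.V) (m : ℤ) :
    (OpIdeal.span (Ops.shriekRel hφ S)).carrier w m ≤
      (OpIdeal.comap (Ops.freeMap ε (toResBidual φ E))
        (OpIdeal.span (perp ε (resRel hφ (perp δ S))))).carrier w m := by
  refine OpIdeal.span_le (fun w m => (Ops.shriekRel_le hφ).2 (fun v m s hs c => ?_) w m) w m
  obtain ⟨ζ, rfl⟩ := hS.le v m hs
  refine (congrArg (· ∈ (OpIdeal.comap (Ops.freeMap ε (toResBidual φ E))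
    (OpIdeal.span (perp ε (resRel hφ (perp δ S))))).carrier c.w m)
      (WGen.lProj_evalLin hφ c ζ)).mpr ?_
  refine OpIdeal.le_span _ _ _ (mem_perp.2
    ⟨(WGen.shriekLin c ζ).mapDomain (WGen.map (toResBidual φ E)), WGen.evalLin_map _ _,
      fun m' ξ hξ => ?_⟩)
  refine (weightPairLin_bidual (E := Ops.resV φ E) _ ξ).trans
    ((weightPairLin_shriekLin hφ c ξ ζ).trans (weightPairLin_eq_zero hS ?_ m hs))
  refine (congrArg (· ∈ (OpIdeal.span (perp δ S)).carrier v m')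
    (WGen.evalLin_imageLin hφ c ξ)).mpr ?_
  exact OpIdeal.vmap_mem _ c.σ ((mem_ker_projToRes hφ).1 hξ.1)

/-- Passing to the representative of the cell of `w` and returning along the isomorphism of this
cell cancel by `baseHom_spec`. -/
theorem imageLin_baseCell {w : F₁.V} {m' : ℤ}
    (ξ : WGen (dualModule (Ops.resV φ E)) δ w m' →₀ k) :
    WGen.imageLin (baseCell φ w) (ξ.mapDomain (WGen.push (baseHom φ w))) =
      ξ.mapDomain (WGen.image (G := dualModule E) φ) := by
  refine (Finsupp.mapDomain_comp (f := WGen.push (baseHom φ w))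
    (g := WGen.imageAt (baseCell φ w))).symm.trans
    (congrArg (fun f => Finsupp.mapDomain f ξ) (funext fun s => ?_))
  obtain ⟨n, X, b, hb, p, h, x⟩ := s
  have h1 : push (v := φ.obj (baseCell φ w).w) (X := fun i => φ.obj (X i)) (baseCell φ w).σ
      (φ.map (push (baseHom φ w) b)) = φ.map b :=
    (congrArg (push (v := φ.obj (baseCell φ w).w) (X := fun i => φ.obj (X i)) (baseCell φ w).σ)
      (map_push (baseHom φ w) b)).trans ((push_push (v := φ.obj w) (w := φ.obj (baseCell φ w).w)
        (X := fun i => φ.obj (X i)) _ _ _).trans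
        ((congrArg (fun θ => push (v := φ.obj w) (w := φ.obj w) (X := fun i => φ.obj (X i)) θ
          (φ.map b)) (baseHom_spec w)).trans (push_id _)))
  simp only [Function.comp_apply, WGen.imageAt, WGen.push, WGen.image]
  congr 1

/-- Pairing with an image in `F₂(E^*)` in terms of the image in `L^! F₁(rE)`. -/
theorem weightPairLin_image (hφ : φ.Admissible) {w : F₁.V} {m m' : ℤ}
    (ξ : WGen (dualModule (Ops.resV φ E)) δ w m' →₀ k) (ζ : WGen E ε (φ.obj w) m →₀ k) :
    weightPairLin E ε δ (φ.obj w) m m' (ξ.mapDomain (WGen.image (G := dualModule E) φ)) ζ =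
      weightPairLin (Ops.resV φ E) ε δ w m m' ξ
        ((WGen.shriekLin (baseCell φ w) ζ).mapDomain (WGen.push (Groupoid.inv (baseHom φ w)))) := by
  refine (congrArg (fun η => weightPairLin E ε δ (φ.obj w) m m' η ζ)
    (imageLin_baseCell ξ)).symm.trans ?_
  refine (weightPairLin_shriekLin hφ (baseCell φ w) _ ζ).symm.trans ?_
  refine Eq.trans ?_ (weightPairLin_push (baseHom φ w) ξ _)
  exact congrArg _ (WGen.mapDomain_push_push (baseHom φ w) _).symm

theorem FiniteType.resV (hE : FiniteType E) : FiniteType (Ops.resV φ E) where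
  finite w m := hE.finite (φ.vert.obj w) m
  finite_degrees a ha N := hE.finite_degrees (φ.map a) ((φ.deg_map a).trans ha) N

theorem WGen.mapDomain_map_map {F : CubicalFeynmanCat.{u}} {E E' : VMod F k} {f : E ⟶ E'}
    {g : E' ⟶ E} (h : f ≫ g = 𝟙 _) {v : F.V} {m : ℤ} (ζ : WGen E ε v m →₀ k) :
    (ζ.mapDomain (WGen.map f)).mapDomain (WGen.map g) = ζ := by
  refine (Finsupp.mapDomain_comp (f := WGen.map f) (g := WGen.map g)).symm.trans
    (Eq.trans (congrArg (fun f => Finsupp.mapDomain f ζ) (funext fun t => ?_)) Finsupp.mapDomain_id)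
  obtain ⟨n, X, a, ha, p, hp, x⟩ := t
  have h1 : ∀ i, ((g.app ⟨X i⟩).f (p i)).hom (((f.app ⟨X i⟩).f (p i)).hom (x i)) = x i :=
    fun i => congrArg (fun f : E ⟶ E => ((f.app ⟨X i⟩).f (p i)).hom (x i)) h
  simp only [Function.comp_apply, WGen.map, id]
  congr 1
  exact funext h1

/-- The inclusion that needs the perfectness of the pairing. An element of the orthogonal complement
outside the ideal of `shriekRel` would be separated from it by a functional. This functional is the
pairing with some `ξ`, and since it kills the components of `S`, the image of `ξ` annihilates `S`.
So `ξ` belongs to `resRel`, and the functional vanishes on the given element after all. -/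
theorem span_perp_resRel_le [CharZero k] (hφ : φ.Admissible) (hE : FiniteType E)
    (κ : dualModule (Ops.resV φ (dualModule E)) ⟶ Ops.resV φ E) (hκ : κ ≫ toResBidual φ E = 𝟙 _)
    (w : F₁.V) (m : ℤ) :
    (OpIdeal.span (perp ε (resRel hφ (perp δ S)))).carrier w m ≤
      (OpIdeal.comap (Ops.freeMap ε κ) (OpIdeal.span (Ops.shriekRel hφ S))).carrier w m := by
  refine OpIdeal.span_le (fun w m z hz => ?_) w m
  obtain ⟨ω, rfl, hω⟩ := mem_perp.1 hz
  refine (congrArg (· ∈ (OpIdeal.span (Ops.shriekRel hφ S)).carrier w m)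
    (WGen.evalLin_map κ ω)).mp ?_
  by_contra hmem
  obtain ⟨l, hl, hl'⟩ := Submodule.exists_le_ker_of_notMem hmem
  -- The degree `m'` is the only one that can pair with degree `m` to a non-zero value.
  obtain ⟨ξ, hξ⟩ := exists_weightPairLin_eq (δ := δ) (hE.resV (φ := φ))
    (m := m) (m' := ε.shift 1 + δ.shift 1 - m) (by omega) l
  refine hl ((hξ _).symm.trans ?_)
  refine (weightPairLin_bidual (E := Ops.resV φ E) _ ξ).symm.trans ?_
  -- As `ω` is orthogonal to `resRel`, it suffices that `ξ` represents an element of `resRel`.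
  refine (congrArg (fun η => weightPairLin (dualModule (Ops.resV φ E)) δ ε w _ m η ξ)
    (WGen.mapDomain_map_map hκ ω)).trans (hω _ ξ ⟨(mem_ker_projToRes hφ).2 ?_, ξ, rfl⟩)
  refine OpIdeal.le_span _ _ _ (mem_perp.2 ⟨ξ.mapDomain (WGen.image (G := dualModule E) φ),
    WGen.evalLin_image (G := dualModule E) hφ ξ, fun m₁ ζ hζ => ?_⟩)
  -- In degree `m` the pairing is the value of `l` at a component of an element of `S`, carried back
  -- to `w`, and `l` vanishes on such components; in all other degrees it is zero by counting
  -- degrees.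
  by_cases hm : m₁ = m
  · subst hm
    refine (weightPairLin_image hφ ξ ζ).trans ((hξ _).trans (hl' ?_))
    refine (congrArg (· ∈ (OpIdeal.span (Ops.shriekRel hφ S)).carrier w m₁)
      (WGen.evalLin_mapDomain_push _ _)).mpr (OpIdeal.vmap_mem _ _ ?_)
    refine (congrArg (· ∈ (OpIdeal.span (Ops.shriekRel hφ S)).carrier _ m₁)
      (WGen.lProj_evalLin hφ (baseCell φ w) ζ)).mp (OpIdeal.le_span _ _ _ ?_)
    exact (Ops.shriekRel_le hφ).1 (fun _ _ => le_rfl) _ _ _ hζ _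
  · exact weightPairLin_of_ne (by omega) _ _

/-- The candidate for `R^!(F(E)/⟨S⟩)` is the dual of the restricted dual. -/
theorem nonempty_shriekRel_iso [CharZero k] (hφ : φ.Admissible) (hE : FiniteType E)
    (hS : IsQuadraticDatum S) : Nonempty ((OpIdeal.span (Ops.shriekRel hφ S)).quot ≅
      quadraticOp (perp ε (resRel hφ (perp δ S)))) := by
  have : IsIso (toResBidual φ E) := isIso_toBidual hE.resV.finite
  have h1 : Ops.freeMap ε (toResBidual φ E) ≫ Ops.freeMap ε (inv (toResBidual φ E)) = 𝟙 _ :=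
    (Ops.freeMap_comp _ _).trans ((congrArg _ (IsIso.hom_inv_id _)).trans Ops.freeMap_id)
  have h2 : Ops.freeMap ε (inv (toResBidual φ E)) ≫ Ops.freeMap ε (toResBidual φ E) = 𝟙 _ :=
    (Ops.freeMap_comp _ _).trans ((congrArg _ (IsIso.inv_hom_id _)).trans Ops.freeMap_id)
  exact OpIdeal.nonempty_quot_iso _ _ h1 h2 _ _ (span_shriekRel_le hφ hS)
    (span_perp_resRel_le hφ hE _ (IsIso.inv_hom_id _))

/-- The values of a left adjoint of `L^!` at quadratic operads. -/
theorem nonempty_leftAdjoint_iso (hφ : φ.Admissible) {Rsh : Ops F₂ k ε ⥤ Ops F₁ k ε}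
    (adj : Rsh ⊣ Ops.lShriek hφ) :
    Nonempty (Rsh.obj (quadraticOp S) ≅ (OpIdeal.span (Ops.shriekRel hφ S)).quot) :=
  ⟨(StructuredArrow.proj (quadraticOp S) (Ops.lShriek hφ)).mapIso
    ((mkInitialOfLeftAdjoint _ adj (quadraticOp S)).uniqueUpToIso
      (Ops.universalArrowIsInitial hφ S))⟩

end DualOfRestriction

theorem theorem5p21 {k : Type u} [Field k] [CharZero k] {F₁ F₂ : CubicalFeynmanCat.{u}}
    (φ : CubicalMorphism F₁ F₂) (hφ : φ.Admissible) (hq : QuadraticPreserving k hφ) :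
    (∀ ε : Parity, (Ops.lShriek (k := k) (ε := ε) hφ).IsRightAdjoint) ∧
    ∀ (ε : Parity) (E : VMod F₂ k) (_ : FiniteType E)
      (S : ∀ (v : F₂.V) (m : ℤ), Submodule k (((Ops.free E ε).obj v).X m))
      (_ : IsQuadraticDatum S) (O : Ops F₂ k ε) (_ : Nonempty (O ≅ quadraticOp S)),
      ((∀ v m, Function.Surjective
          ((RawOp.Hom.app (projToRes hφ (perp ε.flip S)) v).f m).hom) ∧
        OpIdeal.ker (projToRes hφ (perp ε.flip S)) =
          OpIdeal.span (resRel hφ (perp ε.flip S))) ∧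
      ∀ (Rsh : Ops F₂ k ε ⥤ Ops F₁ k ε) (_ : Rsh ⊣ Ops.lShriek hφ),
        Nonempty (Rsh.obj O ≅ quadraticOp (perp ε (resRel hφ (perp ε.flip S)))) := by
  refine ⟨fun ε => Ops.lShriek_isRightAdjoint hφ, fun ε E hE S hS O ⟨i⟩ =>
    ⟨⟨fun v m => projToRes_surjective hφ hq v m,
      ker_projToRes hφ hq perp_le_weightOne (perp_vmap hS)⟩, fun Rsh adj => ?_⟩⟩
  -- The value of the left adjoint is first identified with the quotient of `F₁(rE)` by the
  -- components of `S`, and this quotient with the dual of the restricted dual.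
  obtain ⟨j⟩ := nonempty_leftAdjoint_iso (S := S) hφ adj
  obtain ⟨l⟩ := nonempty_shriekRel_iso (δ := ε.flip) hφ hE hS
  exact ⟨Rsh.mapIso i ≪≫ j ≪≫ l⟩
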